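/- **Setting.** Let $(\Omega,\mathcal F,(\mathcal F_s)_{s\ge 0},\mathbb P)$ be a filtered probability space satisfying the usual conditions and $W$ a Brownian motion relative to $(\mathcal F_s)$. Let $\gamma_1,\alpha,\beta,\rho,\lambda\ge 0$ and $\gamma_2>0$ be constants with $\beta-\alpha>0$, $a:=\gamma_2\rho-\gamma_1\alpha+\lambda>0$, and put $\tilde a:=\gamma_2\rho+\lambda$. Let $0\le t<T$, let $x_0$ be a square integrable random variable, and let $\sigma$ be progressively measurable with $\mathbb E\int_0^T\sigma_s^2\,ds<\infty$. Put $$\mathcal H=\begin{pmatrix}0&0&0\\0&-\rho&-\gamma_1(\beta-\alpha)\\0&0&-(\beta-\alpha)\end{pmatrix},\quad \overline{\mathcal H}=\begin{pmatrix}0&0&0\\-\alpha\gamma_1&0&0\\-\alpha&0&0\end{pmatrix},\quad \mathcal G=\begin{pmatrix}0\\\alpha\gamma_1\mathbb E[x_0]\\\alpha\mathbb E[x_0]\end{pmatrix},\quad \mathcal D_s=\begin{pmatrix}0\\\sigma_s\\0\end{pmatrix},\quad \mathcal K=\begin{pmatrix}-1\\\gamma_2\\0\end{pmatrix}.$$ **Control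 problem.** The initial state $\mathcal X_{t-}=\xi$ is an $\mathcal F_t$-measurable, square integrable $\mathbb R^3$-valued random vector. A strategy $Z$ (with $Z_{t-}=0$) drives the state $\mathcal X=(X,Y,C)$, an adapted càdlàg process with integrable $\mathcal X_s$ and integrable $s\mapsto\mathbb E[\mathcal X_s]$, via $$d\mathcal X_s=(\mathcal H\mathcal X_s+\overline{\mathcal H}\,\mathbb E[\mathcal X_s]+\mathcal G)\,ds+\mathcal D_s\,dW_s+\mathcal K\,dZ_s ,\qquad \mathcal X_{t-}=\xi .$$ $\mathscr A_t$ is the set of càdlàg semimartingales $Z$ started at $t$ with $\mathbb E[[Z]_T]<\infty$ and $\mathbb E[\sup_{t\le s\le T}Z_s^2]<\infty$. The cost is $$J(t,Z)=\mathbb E\Big[\int_t^T\Big(Y_{s-}\,dZ_s+\frac{\gamma_2}{2}\,d[Z]_s+\sigma_s\,d[Z,W]_s\Big)+\int_t^T\lambda X_s^2\,ds\Big],$$ where the integrals include a jump at time $t$. It is to be minimised over all $Z\in\mathscr A_t$ with $X_T=0$. **Coefficients.** Let $A,B:[0,T]\to\mathbb R^{3\times3}$ be symmetric and $D:[0,T]\to\mathbb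 R^3$ with $A_{11}=\gamma_2A_{21}$, $A_{12}=\gamma_2A_{22}+\frac12$, $A_{13}=\gamma_2A_{23}$, the same relations for $B$, and $D_2=\gamma_2^{-1}D_1$. Let them solve on $[0,T]$ the following equations, with $A_{11,T}=B_{11,T}=\frac{\gamma_2}{2}$ and $A_{13,T}=A_{33,T}=B_{13,T}=B_{33,T}=D_{1,T}=D_{3,T}=0$: $$\dot A_{11}=-\lambda+\tfrac{(\rho A_{11}+\lambda)^2}{\tilde a},\quad \dot A_{13}=\tfrac{\gamma_1(\beta-\alpha)}{\gamma_2}A_{11}+(\beta-\alpha)A_{13}-\tfrac{(\rho A_{11}+\lambda)(\gamma_1(\beta-\alpha)-2\rho A_{13})}{2\tilde a},$$ $$\dot A_{33}=2(\beta-\alpha)A_{33}+2\tfrac{\gamma_1(\beta-\alpha)}{\gamma_2}A_{13}+\tfrac{(\gamma_1(\beta-\alpha)-2\rho A_{13})^2}{4\tilde a},$$ and, writing $u=2(\gamma_1\alpha-\gamma_2\rho)B_{11}+\gamma_1\gamma_2\alpha+2\alpha\gamma_2B_{13}-2\gamma_2\lambda$, $v=2(\gamma_1\alpha-\gamma_2\rho)B_{13}+2\gamma_2\alpha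 B_{33}+\gamma_1\gamma_2(\beta-\alpha)$, $w=-\gamma_1\gamma_2\alpha\mathbb E[x_0]+(\gamma_1\alpha-\gamma_2\rho)D_1+\alpha\gamma_2D_3$, $$\dot B_{11}=2\tfrac{\gamma_1\alpha}{\gamma_2}B_{11}+2\alpha B_{13}-\lambda+\tfrac{u^2}{4\gamma_2^2a},\qquad \dot B_{33}=2(\beta-\alpha)B_{33}+2\tfrac{\gamma_1(\beta-\alpha)}{\gamma_2}B_{13}+\tfrac{v^2}{4\gamma_2^2a},$$ $$\dot B_{13}=\tfrac{\gamma_1(\beta-\alpha)}{\gamma_2}B_{11}+\alpha B_{33}+\big(\beta-\alpha+\tfrac{\gamma_1\alpha}{\gamma_2}\big)B_{13}+\tfrac{uv}{4\gamma_2^2a},$$ $$\dot D_1=-\tfrac{2\gamma_1\alpha\mathbb E[x_0]}{\gamma_2}B_{11}-2\alpha\mathbb E[x_0]B_{13}+\tfrac{\gamma_1\alpha}{\gamma_2}D_1+\alpha D_3+\tfrac{uw}{2\gamma_2^2a},$$ $$\dot D_3=-2\alpha\mathbb E[x_0]B_{33}-\tfrac{2\gamma_1\alpha\mathbb E[x_0]}{\gamma_2}B_{13}+\tfrac{\gamma_1(\beta-\alpha)}{\gamma_2}D_1+(\beta-\alpha)D_3+\tfrac{vw}{2\gamma_2^2a}.$$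 Define the row vectors and the scalar $$I^A=\Big(-\rho A_{11}-\lambda,\ -\rho\tfrac{A_{11}}{\gamma_2}+\rho,\ \tfrac{\gamma_1(\beta-\alpha)}{2}-\rho A_{13}\Big),$$ $$I^B=\Big(\tfrac{\alpha\gamma_1-\gamma_2\rho}{\gamma_2}B_{11}+\alpha B_{13}-\lambda+\tfrac{\alpha\gamma_1}{2},\ \tfrac{\alpha\gamma_1-\gamma_2\rho}{\gamma_2^2}B_{11}+\alpha\tfrac{B_{13}}{\gamma_2}+\rho-\tfrac{\alpha\gamma_1}{2\gamma_2},\ \tfrac{\gamma_1(\beta-\alpha)}{2}+(\gamma_1\alpha-\gamma_2\rho)\tfrac{B_{13}}{\gamma_2}+\alpha B_{33}\Big),$$ $$I^D=-\tfrac{\alpha\gamma_1}{2}\mathbb E[x_0]+(\gamma_1\alpha-\gamma_2\rho)\tfrac{D_1}{2\gamma_2}+\tfrac{\alpha}{2}D_3 .$$ **Candidate.** Let $\widetilde Z$ be an adapted càdlàg process started at $t$ (with $\widetilde Z_{t-}=0$), and let $\widetilde{\mathcal X}=(\widetilde X,\widetilde Y,\widetilde C)$ be the state process driven by it, such that $$\Delta\widetilde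 Z_t=-\frac{I^A_t}{\tilde a}(\xi-\mathbb E[\xi])-\frac{I^B_t}{a}\mathbb E[\xi]-\frac{I^D_t}{a},\qquad \Delta\widetilde Z_T=\widetilde X_{T-},$$ and on $(t,T)$ $$d\widetilde Z_s=\Big(-\frac{\dot I^A_s}{\tilde a}(\widetilde{\mathcal X}_s-\mathbb E[\widetilde{\mathcal X}_s])-\frac{\dot I^B_s}{a}\mathbb E[\widetilde{\mathcal X}_s]-\frac{\dot I^D_s}{a}-\frac{I^A_s}{\tilde a}\mathcal H(\widetilde{\mathcal X}_s-\mathbb E[\widetilde{\mathcal X}_s])-\frac{I^B_s}{a}\big((\mathcal H+\overline{\mathcal H})\mathbb E[\widetilde{\mathcal X}_s]+\mathcal G\big)\Big)ds-\frac{I^A_s}{\tilde a}\mathcal D_s\,dW_s .$$ **Theorem.** Almost surely, for all $s\in[t,T)$, $$I^A_s(\widetilde{\mathcal X}_s-\mathbb E[\widetilde{\mathcal X}_s])=0,\qquad\text{and}\qquad I^B_s\,\mathbb E[\widetilde{\mathcal X}_s]+I^D_s=0\ \text{ for all } s\in[t,T).$$ Hence $\int_t^T\big(I^A_s(\widetilde{\mathcal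 X}_s-\mathbb E[\widetilde{\mathcal X}_s])\big)^2ds=0$ almost surely and $\int_t^T\big(I^B_s\mathbb E[\widetilde{\mathcal X}_s]+I^D_s\big)^2ds=0$. Moreover $\widetilde Z\in\mathscr A_t$, $\widetilde X_T=0$ almost surely, and $\widetilde Z$ is optimal: $J(t,\widetilde Z)=\min\{J(t,Z): Z\in\mathscr A_t,\ X_T=0\}$. -/

import Mathlib

open MeasureTheory ProbabilityTheory Filter Topology
open scoped NNReal ENNReal Matrix

noncomputable section

namespace Liquidation

/-! ### Model parameters, coefficient matrices and coefficient equations -/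

/-- The constants `γ₁, γ₂, α, β, ρ, λ` of the liquidation model. -/
structure Params where
  γ₁ : ℝ
  γ₂ : ℝ
  α : ℝ
  β : ℝ
  ρ : ℝ
  lam : ℝ

/-- Standing assumption on the constants (`γ₂ > 0` because all formulas divide by `γ₂`). -/
structure Params.Standing (p : Params) : Prop where
  γ₁_nonneg : 0 ≤ p.γ₁
  γ₂_pos : 0 < p.γ₂
  α_nonneg : 0 ≤ p.α
  β_nonneg : 0 ≤ p.β
  ρ_nonneg : 0 ≤ p.ρ
  lam_nonneg : 0 ≤ p.lam
  α_lt_β : 0 < p.β - p.α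
  a_pos : 0 < p.γ₂ * p.ρ - p.γ₁ * p.α + p.lam

/-- `ã = γ₂ρ + λ`. -/
def Params.aTilde (p : Params) : ℝ := p.γ₂ * p.ρ + p.lam

/-- `a = γ₂ρ - γ₁α + λ`. -/
def Params.a (p : Params) : ℝ := p.γ₂ * p.ρ - p.γ₁ * p.α + p.lam

/-- The matrix `𝓗`. -/
def Params.H (p : Params) : Matrix (Fin 3) (Fin 3) ℝ :=
  !![0, 0, 0;
     0, -p.ρ, -(p.γ₁ * (p.β - p.α));
     0, 0, -(p.β - p.α)]

/-- The matrix `𝓗̄` in front of the expected state. -/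
def Params.Hbar (p : Params) : Matrix (Fin 3) (Fin 3) ℝ :=
  !![0, 0, 0;
     -(p.α * p.γ₁), 0, 0;
     -p.α, 0, 0]

/-- The vector `𝓖`; `e₀` stands for `E[x₀]`. -/
def Params.G (p : Params) (e₀ : ℝ) : Fin 3 → ℝ := ![0, p.α * p.γ₁ * e₀, p.α * e₀]

/-- The vector `𝓚`. -/
def Params.K (p : Params) : Fin 3 → ℝ := ![-1, p.γ₂, 0]

/-- `A` is symmetric with the stated linear relations between its entries and `A₁₁, A₁₃, A₃₃`
solve their terminal value problem on `[0, T]`. -/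
structure SolvesA (p : Params) (T : ℝ) (A : ℝ → Matrix (Fin 3) (Fin 3) ℝ) : Prop where
  symm : ∀ s ∈ Set.Icc 0 T, (A s).IsSymm
  rel₁ : ∀ s ∈ Set.Icc 0 T, A s 0 0 = p.γ₂ * A s 1 0
  rel₂ : ∀ s ∈ Set.Icc 0 T, A s 0 1 = p.γ₂ * A s 1 1 + 1 / 2
  rel₃ : ∀ s ∈ Set.Icc 0 T, A s 0 2 = p.γ₂ * A s 1 2
  ode₁₁ : ∀ s ∈ Set.Icc 0 T, HasDerivWithinAt (fun r => A r 0 0)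
    (-p.lam + (p.ρ * A s 0 0 + p.lam) ^ 2 / (p.γ₂ * p.ρ + p.lam)) (Set.Icc 0 T) s
  ode₁₃ : ∀ s ∈ Set.Icc 0 T, HasDerivWithinAt (fun r => A r 0 2)
    (p.γ₁ * (p.β - p.α) / p.γ₂ * A s 0 0 + (p.β - p.α) * A s 0 2
      - (p.ρ * A s 0 0 + p.lam) * (p.γ₁ * (p.β - p.α) - 2 * p.ρ * A s 0 2)
        / (2 * (p.γ₂ * p.ρ + p.lam))) (Set.Icc 0 T) s
  ode₃₃ : ∀ s ∈ Set.Icc 0 T, HasDerivWithinAt (fun r => A r 2 2)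
    (2 * (p.β - p.α) * A s 2 2 + 2 * (p.γ₁ * (p.β - p.α) / p.γ₂) * A s 0 2
      + (p.γ₁ * (p.β - p.α) - 2 * p.ρ * A s 0 2) ^ 2
        / (4 * (p.γ₂ * p.ρ + p.lam))) (Set.Icc 0 T) s
  term₁₁ : A T 0 0 = p.γ₂ / 2
  term₁₃ : A T 0 2 = 0
  term₃₃ : A T 2 2 = 0

/-- `B` is symmetric with the stated linear relations between its entries and `B₁₁, B₁₃, B₃₃`
solve the coupled Riccati terminal value problem on `[0, T]`. -/
structure SolvesB (p : Params) (T : ℝ) (B : ℝ → Matrix (Fin 3) (Fin 3) ℝ) : Prop where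
  symm : ∀ s ∈ Set.Icc 0 T, (B s).IsSymm
  rel₁ : ∀ s ∈ Set.Icc 0 T, B s 0 0 = p.γ₂ * B s 1 0
  rel₂ : ∀ s ∈ Set.Icc 0 T, B s 0 1 = p.γ₂ * B s 1 1 + 1 / 2
  rel₃ : ∀ s ∈ Set.Icc 0 T, B s 0 2 = p.γ₂ * B s 1 2
  ode₁₁ : ∀ s ∈ Set.Icc 0 T, HasDerivWithinAt (fun r => B r 0 0)
    (2 * (p.γ₁ * p.α / p.γ₂) * B s 0 0 + 2 * p.α * B s 0 2 - p.lam
      + (2 * (p.γ₁ * p.α - p.γ₂ * p.ρ) * B s 0 0 + p.γ₁ * p.γ₂ * p.α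
          + 2 * p.α * p.γ₂ * B s 0 2 - 2 * p.γ₂ * p.lam) ^ 2
        / (4 * p.γ₂ ^ 2 * (p.γ₂ * p.ρ - p.γ₁ * p.α + p.lam))) (Set.Icc 0 T) s
  ode₃₃ : ∀ s ∈ Set.Icc 0 T, HasDerivWithinAt (fun r => B r 2 2)
    (2 * (p.β - p.α) * B s 2 2 + 2 * (p.γ₁ * (p.β - p.α) / p.γ₂) * B s 0 2
      + (2 * (p.γ₁ * p.α - p.γ₂ * p.ρ) * B s 0 2 + 2 * p.γ₂ * p.α * B s 2 2
          + p.γ₁ * p.γ₂ * (p.β - p.α)) ^ 2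
        / (4 * p.γ₂ ^ 2 * (p.γ₂ * p.ρ - p.γ₁ * p.α + p.lam))) (Set.Icc 0 T) s
  ode₁₃ : ∀ s ∈ Set.Icc 0 T, HasDerivWithinAt (fun r => B r 0 2)
    (p.γ₁ * (p.β - p.α) / p.γ₂ * B s 0 0 + p.α * B s 2 2
      + (p.β - p.α + p.γ₁ * p.α / p.γ₂) * B s 0 2
      + (2 * (p.γ₁ * p.α - p.γ₂ * p.ρ) * B s 0 0 + p.γ₁ * p.γ₂ * p.α
          + 2 * p.α * p.γ₂ * B s 0 2 - 2 * p.γ₂ * p.lam)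
        * ((2 * (p.γ₁ * p.α - p.γ₂ * p.ρ) * B s 0 2 + 2 * p.γ₂ * p.α * B s 2 2
            + p.γ₁ * p.γ₂ * (p.β - p.α))
          / (4 * p.γ₂ ^ 2 * (p.γ₂ * p.ρ - p.γ₁ * p.α + p.lam)))) (Set.Icc 0 T) s
  term₁₁ : B T 0 0 = p.γ₂ / 2
  term₁₃ : B T 0 2 = 0
  term₃₃ : B T 2 2 = 0

/-- `D₂ = D₁ / γ₂` and `D₁, D₃` solve the linear terminal value problem on `[0, T]`;
`e₀` stands for `E[x₀]`. -/
structure SolvesD (p : Params) (e₀ T : ℝ) (B : ℝ → Matrix (Fin 3) (Fin 3) ℝ)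
    (D : ℝ → Fin 3 → ℝ) : Prop where
  rel : ∀ s ∈ Set.Icc 0 T, D s 1 = p.γ₂⁻¹ * D s 0
  ode₁ : ∀ s ∈ Set.Icc 0 T, HasDerivWithinAt (fun r => D r 0)
    (-(2 * p.γ₁ * p.α * e₀ / p.γ₂) * B s 0 0 - 2 * p.α * e₀ * B s 0 2
      + p.γ₁ * p.α / p.γ₂ * D s 0 + p.α * D s 2
      + (-(2 * p.lam * p.γ₂) + 2 * (p.γ₁ * p.α - p.γ₂ * p.ρ) * B s 0 0 + p.γ₁ * p.γ₂ * p.α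
          + 2 * p.α * p.γ₂ * B s 0 2)
        * ((-(p.γ₁ * p.γ₂ * p.α * e₀) + (p.γ₁ * p.α - p.γ₂ * p.ρ) * D s 0
            + p.α * p.γ₂ * D s 2)
          / (2 * p.γ₂ ^ 2 * (p.γ₂ * p.ρ - p.γ₁ * p.α + p.lam)))) (Set.Icc 0 T) s
  ode₃ : ∀ s ∈ Set.Icc 0 T, HasDerivWithinAt (fun r => D r 2)
    (-(2 * p.α * e₀ * B s 2 2) - 2 * p.γ₁ * p.α * e₀ / p.γ₂ * B s 0 2
      + p.γ₁ * (p.β - p.α) / p.γ₂ * D s 0 + (p.β - p.α) * D s 2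
      + (2 * (p.γ₁ * p.α - p.γ₂ * p.ρ) * B s 0 2 + 2 * p.γ₂ * p.α * B s 2 2
          + p.γ₁ * p.γ₂ * (p.β - p.α))
        * ((-(p.γ₁ * p.γ₂ * p.α * e₀) + (p.γ₁ * p.α - p.γ₂ * p.ρ) * D s 0
            + p.α * p.γ₂ * D s 2)
          / (2 * p.γ₂ ^ 2 * (p.γ₂ * p.ρ - p.γ₁ * p.α + p.lam)))) (Set.Icc 0 T) s
  term₁ : D T 0 = 0
  term₃ : D T 2 = 0

/-- The row vector `I^A`. -/
def IA (p : Params) (A : ℝ → Matrix (Fin 3) (Fin 3) ℝ) (s : ℝ) : Fin 3 → ℝ :=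
  ![-(p.ρ * A s 0 0) - p.lam,
    -(p.ρ * (A s 0 0 / p.γ₂)) + p.ρ,
    p.γ₁ * (p.β - p.α) / 2 - p.ρ * A s 0 2]

/-- The row vector `I^B`. -/
def IB (p : Params) (B : ℝ → Matrix (Fin 3) (Fin 3) ℝ) (s : ℝ) : Fin 3 → ℝ :=
  ![(p.α * p.γ₁ - p.γ₂ * p.ρ) / p.γ₂ * B s 0 0 + p.α * B s 0 2 - p.lam + p.α * p.γ₁ / 2,
    (p.α * p.γ₁ - p.γ₂ * p.ρ) / p.γ₂ ^ 2 * B s 0 0 + p.α * (B s 0 2 / p.γ₂) + p.ρ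
      - p.α * p.γ₁ / (2 * p.γ₂),
    p.γ₁ * (p.β - p.α) / 2 + (p.γ₁ * p.α - p.γ₂ * p.ρ) * (B s 0 2 / p.γ₂) + p.α * B s 2 2]

/-- The scalar function `I^D`; `e₀` stands for `E[x₀]`. -/
def ID (p : Params) (e₀ : ℝ) (D : ℝ → Fin 3 → ℝ) (s : ℝ) : ℝ :=
  -(p.α * p.γ₁ / 2 * e₀) + (p.γ₁ * p.α - p.γ₂ * p.ρ) * (D s 0 / (2 * p.γ₂)) + p.α / 2 * D s 2

/-! ### Stochastic calculus -/

section Stochastic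

variable {Ω : Type*} {mΩ : MeasurableSpace Ω}

/-- The filtration satisfies the usual conditions and `W` is a Brownian motion relative to it. -/
structure IsBrownianBasis (P : Measure Ω) (𝓕 : Filtration ℝ≥0 mΩ) (W : ℝ≥0 → Ω → ℝ) : Prop where
  complete : ∀ S : Set Ω, P S = 0 → MeasurableSet[𝓕 0] S
  rightCont : 𝓕.IsRightContinuous
  brownian : IsBrownianReal W P
  adapted : StronglyAdapted 𝓕 W
  indep : ∀ s u : ℝ≥0, s ≤ u →
    Indep (MeasurableSpace.comap (fun ω => W u ω - W s ω) inferInstance) (𝓕 s) P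

/-- The Lebesgue integral `∫_t^s f(r) dr` of a function of time. -/
def timeIntegral (t s : ℝ≥0) (f : ℝ≥0 → ℝ) : ℝ := ∫ r in (t : ℝ)..(s : ℝ), f r.toNNReal

/-- Right-continuous on `[t, T)` with left limits on `(t, T]`. -/
def IsCadlagOn (f : ℝ≥0 → ℝ) (t T : ℝ≥0) : Prop :=
  (∀ s ∈ Set.Ico t T, ContinuousWithinAt f (Set.Ici s) s) ∧
  (∀ s ∈ Set.Ioc t T, ∃ l : ℝ, Tendsto f (𝓝[<] s) (𝓝 l))

/-- Simple predictable processes `∑_{i<n} ξ_i 1_{(p_i, p_{i+1}]}` with `ξ_i` bounded and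
`𝓕_{p_i}`-measurable. -/
structure SimpleProcess (𝓕 : Filtration ℝ≥0 mΩ) where
  n : ℕ
  pt : ℕ → ℝ≥0
  mono : Monotone pt
  coef : ℕ → Ω → ℝ
  meas : ∀ i, StronglyMeasurable[𝓕 (pt i)] (coef i)
  bdd : ∃ c : ℝ, ∀ i ω, |coef i ω| ≤ c

/-- The value at `(s, ω)` of a simple process. -/
def SimpleProcess.val {𝓕 : Filtration ℝ≥0 mΩ} (S : SimpleProcess 𝓕) (s : ℝ≥0) (ω : Ω) : ℝ :=
  ∑ i ∈ Finset.range S.n,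
    (Set.Ioc (S.pt i) (S.pt (i + 1))).indicator (fun _ => S.coef i ω) s

/-- The elementary stochastic integral `∫_0^s S dW` of a simple process. -/
def SimpleProcess.integral {𝓕 : Filtration ℝ≥0 mΩ} (S : SimpleProcess 𝓕) (W : ℝ≥0 → Ω → ℝ)
    (s : ℝ≥0) (ω : Ω) : ℝ :=
  ∑ i ∈ Finset.range S.n,
    S.coef i ω * (W (min (S.pt (i + 1)) s) ω - W (min (S.pt i) s) ω)

/-- A process regarded as a function of `(s, ω)`. -/
def onProd (h : ℝ≥0 → Ω → ℝ) : ℝ × Ω → ℝ := fun q => h q.1.toNNReal q.2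

/-- The product measure `ds ⊗ P` on `[0, T] × Ω`. -/
def prodMeasure (P : Measure Ω) (T : ℝ≥0) : Measure (ℝ × Ω) :=
  (volume.restrict (Set.Ioc 0 (T : ℝ))).prod P

/-- `N` is (a continuous adapted version of) the Itô integral process `∫_0^· h dW` on `[0, T]`:
the `L²`-limit of the elementary integrals of simple processes that converge to `h` in
`L²(ds ⊗ P)`. -/
structure IsItoIntegral (P : Measure Ω) (𝓕 : Filtration ℝ≥0 mΩ) (W : ℝ≥0 → Ω → ℝ) (T : ℝ≥0)
    (h N : ℝ≥0 → Ω → ℝ) : Prop where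
  adapted : ∀ s ≤ T, StronglyMeasurable[𝓕 s] (N s)
  cont : ∀ᵐ ω ∂P, ContinuousOn (fun s => N s ω) (Set.Icc 0 T)
  approx : ∃ S : ℕ → SimpleProcess 𝓕,
    Tendsto (fun k => eLpNorm (fun q => onProd (S k).val q - onProd h q) 2 (prodMeasure P T))
      atTop (𝓝 0) ∧
    ∀ s ≤ T, Tendsto (fun k => eLpNorm (fun ω => (S k).integral W s ω - N s ω) 2 P) atTop (𝓝 0)

/-- Finite partitions `t = p_0 ≤ p_1 ≤ … ≤ p_n = s`. -/
structure TimePartition (t s : ℝ≥0) where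
  n : ℕ
  pt : ℕ → ℝ≥0
  mono : Monotone pt
  first : pt 0 = t
  last : pt n = s

/-- `S_π → L` in probability as the mesh of the partition `π` of `[t, s]` tends to `0`. -/
def ConvergesAlongPartitions (P : Measure Ω) {t s : ℝ≥0} (S : TimePartition t s → Ω → ℝ)
    (L : Ω → ℝ) : Prop :=
  ∀ ε : ℝ, 0 < ε → ∀ δ : ℝ, 0 < δ → ∃ η : ℝ, 0 < η ∧ ∀ π : TimePartition t s,
    (∀ i < π.n, (π.pt (i + 1) : ℝ) - π.pt i < η) →
      P {ω | ε ≤ |S π ω - L ω|} ≤ ENNReal.ofReal δ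

/-- `I = ∫_{[t,T]} Y_{s-} dZ_s`, where `y = Y_{t-}` and `Z_{t-} = 0`: the limit in probability of
the left-point Riemann sums, including the contribution `Y_{t-} ΔZ_t` of the jump at `t`. -/
def IsStochIntegral (P : Measure Ω) (t T : ℝ≥0) (Y : ℝ≥0 → Ω → ℝ) (y : Ω → ℝ)
    (Z : ℝ≥0 → Ω → ℝ) (I : Ω → ℝ) : Prop :=
  ConvergesAlongPartitions P (t := t) (s := T)
    (fun π ω => y ω * Z t ω +
      ∑ i ∈ Finset.range π.n, Y (π.pt i) ω * (Z (π.pt (i + 1)) ω - Z (π.pt i) ω)) I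

/-- `L = [Z, U]_s` for processes started at `t` with `Z_{t-} = z` and `U_{t-} = u`: the limit in
probability of the sums of products of increments, including the product of the jumps at `t`. -/
def IsCovariation (P : Measure Ω) (t s : ℝ≥0) (Z : ℝ≥0 → Ω → ℝ) (z : Ω → ℝ)
    (U : ℝ≥0 → Ω → ℝ) (u : Ω → ℝ) (L : Ω → ℝ) : Prop :=
  ConvergesAlongPartitions P (t := t) (s := s)
    (fun π ω => (Z t ω - z ω) * (U t ω - u ω) +
      ∑ i ∈ Finset.range π.n,
        (Z (π.pt (i + 1)) ω - Z (π.pt i) ω) * (U (π.pt (i + 1)) ω - U (π.pt i) ω)) L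

/-- `L = [Z]_T` for a process with `Z_{t-} = 0`. -/
def IsQuadVar (P : Measure Ω) (t T : ℝ≥0) (Z : ℝ≥0 → Ω → ℝ) (L : Ω → ℝ) : Prop :=
  IsCovariation P t T Z (fun _ => 0) Z (fun _ => 0) L

/-- `R = ∫_{(t,T]} h dv` as a Lebesgue–Stieltjes integral: on `[t, T]`, up to a constant, `v` is
the difference of two non-decreasing right-continuous functions, and `h` is integrable with
respect to both associated measures. -/
def IsStieltjesIntegral (t T : ℝ≥0) (h v : ℝ≥0 → ℝ) (R : ℝ) : Prop :=
  ∃ f g : StieltjesFunction ℝ,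
    (∀ s ∈ Set.Icc t T, v s - v t = (f s - f t) - (g s - g t)) ∧
    IntegrableOn (fun r : ℝ => h r.toNNReal) (Set.Ioc (t : ℝ) T) f.measure ∧
    IntegrableOn (fun r : ℝ => h r.toNNReal) (Set.Ioc (t : ℝ) T) g.measure ∧
    R = (∫ r in Set.Ioc (t : ℝ) T, h r.toNNReal ∂f.measure)
      - ∫ r in Set.Ioc (t : ℝ) T, h r.toNNReal ∂g.measure

/-- `R = ∫_t^T h_s d[Z, W]_s`, where `W` has continuous paths (so that `[Z, W]` does not charge
the time `t`). -/
def IsCovariationIntegral (P : Measure Ω) (t T : ℝ≥0) (h Z W : ℝ≥0 → Ω → ℝ) (R : Ω → ℝ) : Prop :=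
  ∃ v : ℝ≥0 → Ω → ℝ,
    (∀ s ∈ Set.Icc t T, IsCovariation P t s Z (fun _ => 0) W (W t) (v s)) ∧
    ∀ᵐ ω ∂P, IsStieltjesIntegral t T (fun s => h s ω) (fun s => v s ω) (R ω)

/-- `Z` is on `[0, T]` the sum of a càdlàg local martingale and an adapted càdlàg process of
finite variation. -/
def IsSemimartingaleOn (P : Measure Ω) (𝓕 : Filtration ℝ≥0 mΩ) (T : ℝ≥0)
    (Z : ℝ≥0 → Ω → ℝ) : Prop :=
  ∃ M V : ℝ≥0 → Ω → ℝ,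
    Locally (fun X => Martingale X 𝓕 P) 𝓕 M P ∧
    (∀ᵐ ω ∂P, IsCadlagOn (fun s => M s ω) 0 T) ∧
    (∀ s ≤ T, StronglyMeasurable[𝓕 s] (V s)) ∧
    (∀ᵐ ω ∂P, IsCadlagOn (fun s => V s ω) 0 T) ∧
    (∀ᵐ ω ∂P, BoundedVariationOn (fun s => V s ω) (Set.Icc 0 T)) ∧
    ∀ᵐ ω ∂P, ∀ s ≤ T, Z s ω = M s ω + V s ω

/-! ### The control problem -/

/-- The class `𝒜_t` of admissible strategies: càdlàg semimartingales started at time `t`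
(that is, `Z_{t-} = 0`) with `E[[Z]_T] < ∞` and `E[sup_{t ≤ s ≤ T} |Z_s|²] < ∞`. -/
structure IsAdmissible (P : Measure Ω) (𝓕 : Filtration ℝ≥0 mΩ) (t T : ℝ≥0)
    (Z : ℝ≥0 → Ω → ℝ) : Prop where
  start : ∀ s < t, ∀ ω, Z s ω = 0
  adapted : ∀ s ≤ T, StronglyMeasurable[𝓕 s] (Z s)
  cadlag : ∀ ω, IsCadlagOn (fun s => Z s ω) t T
  semimartingale : IsSemimartingaleOn P 𝓕 T Z
  quadVar : ∃ Q : Ω → ℝ, IsQuadVar P t T Z Q ∧ Integrable Q P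
  sup_sq : ∫⁻ ω, ⨆ s ∈ Set.Icc t T, ENNReal.ofReal ((Z s ω) ^ 2) ∂P < ∞

/-- The expected state `E[𝒳_s]`. -/
def mean (P : Measure Ω) (𝒳 : ℝ≥0 → Ω → Fin 3 → ℝ) (s : ℝ≥0) : Fin 3 → ℝ :=
  fun i => ∫ ω, 𝒳 s ω i ∂P

/-- The diffusion vector `𝓓_s = (0, σ_s, 0)`. -/
def diffusion (σ : ℝ≥0 → Ω → ℝ) (s : ℝ≥0) (ω : Ω) : Fin 3 → ℝ := ![0, σ s ω, 0]

/-- `𝒳 = (X, Y, C)` is the state process driven by the strategy `Z` (with `Z_{t-} = 0`) and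
started from `𝒳_{t-} = ξ`: it is adapted and càdlàg on `[t, T]`, its mean exists, and
`d𝒳_s = (𝓗𝒳_s + 𝓗̄ E[𝒳_s] + 𝓖) ds + 𝓓_s dW_s + 𝓚 dZ_s`. -/
structure IsState (P : Measure Ω) (𝓕 : Filtration ℝ≥0 mΩ) (W : ℝ≥0 → Ω → ℝ) (p : Params)
    (e₀ : ℝ) (σ : ℝ≥0 → Ω → ℝ) (t T : ℝ≥0) (ξ : Ω → Fin 3 → ℝ) (Z : ℝ≥0 → Ω → ℝ)
    (𝒳 : ℝ≥0 → Ω → Fin 3 → ℝ) : Prop where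
  adapted : ∀ s ∈ Set.Icc t T, ∀ i, StronglyMeasurable[𝓕 s] (fun ω => 𝒳 s ω i)
  cadlag : ∀ ω i, IsCadlagOn (fun s => 𝒳 s ω i) t T
  integrable : ∀ s ∈ Set.Icc t T, ∀ i, Integrable (fun ω => 𝒳 s ω i) P
  integrable_mean : ∀ i,
    IntervalIntegrable (fun r : ℝ => mean P 𝒳 r.toNNReal i) volume (t : ℝ) (T : ℝ)
  sde : ∃ N : Fin 3 → ℝ≥0 → Ω → ℝ,
    (∀ i, IsItoIntegral P 𝓕 W T (fun s ω => diffusion σ s ω i) (N i)) ∧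
    ∀ᵐ ω ∂P, ∀ s ∈ Set.Icc t T, ∀ i,
      𝒳 s ω i = ξ ω i
        + timeIntegral t s (fun r => (p.H *ᵥ 𝒳 r ω + p.Hbar *ᵥ mean P 𝒳 r + p.G e₀) i)
        + (N i s ω - N i t ω) + p.K i * Z s ω

/-- `c = J(t, Z)`, the expectation of
`∫_t^T (Y_{s-} dZ_s + (γ₂/2) d[Z]_s + σ_s d[Z, W]_s) + ∫_t^T λ X_s² ds`. -/
def IsCost (P : Measure Ω) (W : ℝ≥0 → Ω → ℝ) (p : Params) (σ : ℝ≥0 → Ω → ℝ) (t T : ℝ≥0)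
    (ξ : Ω → Fin 3 → ℝ) (Z : ℝ≥0 → Ω → ℝ) (𝒳 : ℝ≥0 → Ω → Fin 3 → ℝ) (c : ℝ) : Prop :=
  ∃ I Q R : Ω → ℝ,
    IsStochIntegral P t T (fun s ω => 𝒳 s ω 1) (fun ω => ξ ω 1) Z I ∧
    IsQuadVar P t T Z Q ∧
    IsCovariationIntegral P t T σ Z W R ∧
    Integrable (fun ω => I ω + p.γ₂ / 2 * Q ω + R ω
      + timeIntegral t T (fun s => p.lam * (𝒳 s ω 0) ^ 2)) P ∧
    c = ∫ ω, (I ω + p.γ₂ / 2 * Q ω + R ω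
      + timeIntegral t T (fun s => p.lam * (𝒳 s ω 0) ^ 2)) ∂P

/-- The set of costs `J(t, Z)` of all `Z ∈ 𝒜_t` that satisfy the liquidation constraint
`X_T = 0`; the value function is the infimum of this set. -/
def attainableCosts (P : Measure Ω) (𝓕 : Filtration ℝ≥0 mΩ) (W : ℝ≥0 → Ω → ℝ) (p : Params)
    (e₀ : ℝ) (σ : ℝ≥0 → Ω → ℝ) (t T : ℝ≥0) (ξ : Ω → Fin 3 → ℝ) : Set ℝ :=
  {c | ∃ (Z : ℝ≥0 → Ω → ℝ) (𝒳 : ℝ≥0 → Ω → Fin 3 → ℝ),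
    IsAdmissible P 𝓕 t T Z ∧ IsState P 𝓕 W p e₀ σ t T ξ Z 𝒳 ∧
    (∀ᵐ ω ∂P, 𝒳 T ω 0 = 0) ∧ IsCost P W p σ t T ξ Z 𝒳 c}

/-- The drift of the candidate strategy at time `s`, when the state is `x` and its mean `m`. -/
def candidateDrift (p : Params) (e₀ : ℝ) (A B : ℝ → Matrix (Fin 3) (Fin 3) ℝ)
    (D : ℝ → Fin 3 → ℝ) (s : ℝ) (x m : Fin 3 → ℝ) : ℝ :=
  -((deriv (IA p A) s ⬝ᵥ (x - m)) / p.aTilde) - (deriv (IB p B) s ⬝ᵥ m) / p.a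
    - deriv (ID p e₀ D) s / p.a
    - (IA p A s ⬝ᵥ (p.H *ᵥ (x - m))) / p.aTilde
    - (IB p B s ⬝ᵥ ((p.H + p.Hbar) *ᵥ m + p.G e₀)) / p.a

/-- `Z` is the candidate strategy and `𝒳` the state process driven by it: `Z` is adapted and
càdlàg with `Z_{t-} = 0`, has the prescribed jumps at `t` and `T`, and on `(t, T)` follows
the candidate dynamics, in feedback form. -/
structure IsCandidate (P : Measure Ω) (𝓕 : Filtration ℝ≥0 mΩ) (W : ℝ≥0 → Ω → ℝ) (p : Params)
    (e₀ : ℝ) (σ : ℝ≥0 → Ω → ℝ) (A B : ℝ → Matrix (Fin 3) (Fin 3) ℝ) (D : ℝ → Fin 3 → ℝ)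
    (t T : ℝ≥0) (ξ : Ω → Fin 3 → ℝ) (Z : ℝ≥0 → Ω → ℝ) (𝒳 : ℝ≥0 → Ω → Fin 3 → ℝ) : Prop where
  state : IsState P 𝓕 W p e₀ σ t T ξ Z 𝒳
  start : ∀ s < t, ∀ ω, Z s ω = 0
  adapted : ∀ s ≤ T, StronglyMeasurable[𝓕 s] (Z s)
  cadlag : ∀ ω, IsCadlagOn (fun s => Z s ω) t T
  initial_jump : ∀ᵐ ω ∂P,
    Z t ω = -((IA p A t ⬝ᵥ (ξ ω - fun i => ∫ ω', ξ ω' i ∂P)) / p.aTilde)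
      - (IB p B t ⬝ᵥ fun i => ∫ ω', ξ ω' i ∂P) / p.a - ID p e₀ D t / p.a
  dynamics : ∃ N : ℝ≥0 → Ω → ℝ,
    IsItoIntegral P 𝓕 W T (fun s ω => (IA p A s ⬝ᵥ diffusion σ s ω) / p.aTilde) N ∧
    ∀ᵐ ω ∂P, ∀ s ∈ Set.Ico t T,
      Z s ω = Z t ω
        + timeIntegral t s (fun r => candidateDrift p e₀ A B D r (𝒳 r ω) (mean P 𝒳 r))
        - (N s ω - N t ω)
  terminal_jump : ∀ᵐ ω ∂P,
    Z T ω - Function.leftLim (fun s => Z s ω) T = Function.leftLim (fun s => 𝒳 s ω 0) T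

end Stochastic

end Liquidation

end

open Liquidation

set_option linter.unusedSectionVars false

open Set (Icc Ico Ioc Ioo Ioi Iio Ici Iic)
open Finset (range sum_congr mem_range sum_range_succ sum_le_sum mul_sum sum_add_distrib
  sum_sub_distrib sum_mul sum_nonneg abs_sum_le_sum_abs)

namespace Liquidation

/-! ### Primitives of integrable functions -/

/-- On `[a, b]`, `u` is a primitive of the integrable function `u'`. -/
structure IsPrimitiveOn (u u' : ℝ → ℝ) (a b : ℝ) : Prop where
  integrable : IntervalIntegrable u' volume a b
  eq : ∀ s ∈ Icc a b, u s = u a + ∫ r in a..s, u' r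

namespace IsPrimitiveOn

variable {u u' v v' : ℝ → ℝ} {a b : ℝ}

lemma integrable_sub (h : IsPrimitiveOn u u' a b) {r s : ℝ} (hr : r ∈ Icc a b)
    (hs : s ∈ Icc a b) : IntervalIntegrable u' volume r s :=
  h.integrable.mono_set (by
    rw [Set.uIcc_of_le (hr.1.trans hr.2)]
    exact Set.uIcc_subset_Icc hr hs)

lemma sub_eq (h : IsPrimitiveOn u u' a b) {r s : ℝ} (hr : r ∈ Icc a b)
    (hs : s ∈ Icc a b) : u s - u r = ∫ x in r..s, u' x := by
  have ha : a ∈ Icc a b := ⟨le_rfl, hr.1.trans hr.2⟩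
  rw [h.eq s hs, h.eq r hr, ← intervalIntegral.integral_interval_sub_left
    (h.integrable_sub ha hs) (h.integrable_sub ha hr)]
  ring

lemma continuousOn (h : IsPrimitiveOn u u' a b) : ContinuousOn u (Icc a b) := by
  rcases le_or_gt a b with hab | hab
  · have := intervalIntegral.continuousOn_primitive_interval (a := a) (b := b) (f := u')
      (μ := volume) (by
        rw [Set.uIcc_of_le hab, integrableOn_Icc_iff_integrableOn_Ioc,
          ← intervalIntegrable_iff_integrableOn_Ioc_of_le hab]
        exact h.integrable)
    rw [Set.uIcc_of_le hab] at this
    exact (this.const_add (u a)).congr fun s hs => h.eq s hs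
  · rw [Set.Icc_eq_empty (not_le.2 hab)]
    exact continuousOn_empty _

lemma congr (h : IsPrimitiveOn u u' a b) (hab : a ≤ b) (hv : ∀ s ∈ Icc a b, v s = u s)
    (hv' : ∀ s ∈ Ioo a b, v' s = u' s) : IsPrimitiveOn v v' a b := by
  have hae : ∀ᵐ s, s ∈ Set.uIoc a b → u' s = v' s := by
    have : ∀ᵐ s : ℝ, s ≠ b := by simp [ae_iff]
    filter_upwards [this] with s hs hsm
    rw [Set.uIoc_of_le hab] at hsm
    exact (hv' s ⟨hsm.1, lt_of_le_of_ne hsm.2 hs⟩).symm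
  refine ⟨h.integrable.congr_ae ((ae_restrict_iff' measurableSet_uIoc).2 hae), fun s hs => ?_⟩
  rw [hv s hs, h.eq s hs, hv a ⟨le_rfl, hab⟩]
  congr 1
  refine intervalIntegral.integral_congr_ae ?_
  filter_upwards [hae] with r hr hrm
  refine hr ?_
  rw [Set.uIoc_of_le hs.1] at hrm
  rw [Set.uIoc_of_le hab]
  exact ⟨hrm.1, hrm.2.trans hs.2⟩

lemma mono (h : IsPrimitiveOn u u' a b) {c d : ℝ} (hc : c ∈ Icc a b) (hd : d ∈ Icc a b) :
    IsPrimitiveOn u u' c d :=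
  ⟨h.integrable_sub hc hd, fun s hs => by
    rw [← h.sub_eq hc ⟨hc.1.trans hs.1, hs.2.trans hd.2⟩]; ring⟩

lemma const (c a b : ℝ) : IsPrimitiveOn (fun _ => c) (fun _ => 0) a b := ⟨by simp, by simp⟩

lemma add (h : IsPrimitiveOn u u' a b) (k : IsPrimitiveOn v v' a b) :
    IsPrimitiveOn (fun s => u s + v s) (fun s => u' s + v' s) a b := by
  refine ⟨h.integrable.add k.integrable, fun s hs => ?_⟩
  have ha : a ∈ Icc a b := ⟨le_rfl, hs.1.trans hs.2⟩
  rw [intervalIntegral.integral_add (h.integrable_sub ha hs) (k.integrable_sub ha hs), h.eq s hs,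
    k.eq s hs]
  ring

lemma const_mul (h : IsPrimitiveOn u u' a b) (c : ℝ) :
    IsPrimitiveOn (fun s => c * u s) (fun s => c * u' s) a b := by
  refine ⟨h.integrable.const_mul c, fun s hs => ?_⟩
  rw [intervalIntegral.integral_const_mul, h.eq s hs]
  ring

lemma sub (h : IsPrimitiveOn u u' a b) (k : IsPrimitiveOn v v' a b) :
    IsPrimitiveOn (fun s => u s - v s) (fun s => u' s - v' s) a b := by
  have := h.add (k.const_mul (-1))
  simpa [sub_eq_add_neg] using this

lemma of_intervalIntegrable (h : IntervalIntegrable u' volume a b) (c : ℝ) :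
    IsPrimitiveOn (fun s => c + ∫ r in a..s, u' r) u' a b :=
  ⟨h, fun s _ => by simp⟩

lemma mul (h : IsPrimitiveOn u u' a b) (k : IsPrimitiveOn v v' a b) (hab : a ≤ b) :
    IsPrimitiveOn (fun s => u s * v s) (fun s => u' s * v s + u s * v' s) a b := by
  have hcu : ContinuousOn u (Set.uIcc a b) := by rw [Set.uIcc_of_le hab]; exact h.continuousOn
  have hcv : ContinuousOn v (Set.uIcc a b) := by rw [Set.uIcc_of_le hab]; exact k.continuousOn
  refine ⟨(h.integrable.mul_continuousOn hcv).add (k.integrable.continuousOn_mul hcu),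
    fun s hs => ?_⟩
  have key : ∀ {w w' : ℝ → ℝ}, IsPrimitiveOn w w' a b →
      AbsolutelyContinuousOnInterval (fun x => w a + ∫ r in a..x, w' r) a s := by
    intro w w' hw
    have h1 := hw.integrable.absolutelyContinuousOnInterval_intervalIntegral
      (c := a) Set.left_mem_uIcc
    have h2 : AbsolutelyContinuousOnInterval (fun _ : ℝ => w a) a b :=
      ((LipschitzWith.const (w a)).lipschitzOnWith).absolutelyContinuousOnInterval
    refine (h2.add h1).mono ?_
    rw [Set.uIcc_of_le hs.1, Set.uIcc_of_le hab]
    exact Set.Icc_subset_Icc_right hs.2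
  have kd : ∀ {w w' : ℝ → ℝ}, IsPrimitiveOn w w' a b → ∀ᵐ x, x ∈ Set.uIoc a s →
      deriv (fun x => w a + ∫ r in a..x, w' r) x = w' x := by
    intro w w' hw
    filter_upwards [hw.integrable.ae_hasDerivAt_integral] with x hx hxm
    rw [Set.uIoc_of_le hs.1] at hxm
    have hxm' : x ∈ Set.uIcc a b := by
      rw [Set.uIcc_of_le hab]; exact ⟨hxm.1.le, hxm.2.trans hs.2⟩
    exact ((hx hxm' a Set.left_mem_uIcc).const_add (w a)).deriv
  have hint := AbsolutelyContinuousOnInterval.integral_deriv_mul_eq_sub (key h) (key k)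
  simp only [intervalIntegral.integral_same, add_zero, ← h.eq s hs, ← k.eq s hs] at hint
  have : u s * v s = u a * v a + (u s * v s - u a * v a) := by ring
  rw [this, ← hint]
  congr 1
  refine intervalIntegral.integral_congr_ae ?_
  filter_upwards [kd h, kd k] with x hx hx' hxm
  rw [hx hxm, hx' hxm]
  rw [Set.uIoc_of_le hs.1] at hxm
  have hxm' : x ∈ Icc a b := ⟨hxm.1.le, hxm.2.trans hs.2⟩
  rw [← h.eq x hxm', ← k.eq x hxm']

lemma of_hasDerivWithinAt (hab : a ≤ b)
    (hd : ∀ s ∈ Icc a b, HasDerivWithinAt u (u' s) (Icc a b) s)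
    (hc : ContinuousOn u' (Icc a b)) : IsPrimitiveOn u u' a b := by
  have hi : IntervalIntegrable u' volume a b :=
    ContinuousOn.intervalIntegrable (by rwa [Set.uIcc_of_le hab])
  refine ⟨hi, fun s hs => ?_⟩
  rw [intervalIntegral.integral_eq_sub_of_hasDerivAt_of_le hs.1 (f := u)]
  · ring
  · exact fun x hx => ((hd x ⟨hx.1, hx.2.trans hs.2⟩).continuousWithinAt).mono
      (Set.Icc_subset_Icc_right hs.2)
  · exact fun x hx => (hd x ⟨hx.1.le, hx.2.le.trans hs.2⟩).hasDerivAt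
      (Icc_mem_nhds hx.1 (hx.2.trans_le hs.2))
  · exact hi.mono_set (by
      rw [Set.uIcc_of_le hs.1, Set.uIcc_of_le hab]; exact Set.Icc_subset_Icc_right hs.2)

end IsPrimitiveOn

/-- Grönwall's inequality in integral form. -/
lemma le_mul_exp_of_le_add_integral {φ : ℝ → ℝ} {a b K L : ℝ} (hab : a ≤ b) (hL : 0 ≤ L)
    (hφ : ContinuousOn φ (Icc a b))
    (h : ∀ s ∈ Icc a b, φ s ≤ K + L * ∫ r in a..s, φ r) :
    ∀ s ∈ Icc a b, φ s ≤ K * Real.exp (L * (s - a)) := by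
  have hi : IntervalIntegrable φ volume a b :=
    ContinuousOn.intervalIntegrable (by rwa [Set.uIcc_of_le hab])
  have hprim := IsPrimitiveOn.of_intervalIntegrable hi 0
  simp only [zero_add] at hprim
  have hd : ∀ x ∈ Ioo a b, HasDerivAt
      (fun s => Real.exp (-(L * (s - a))) * (K + L * ∫ r in a..s, φ r))
      (Real.exp (-(L * (x - a))) * (-(L * 1)) * (K + L * ∫ r in a..x, φ r)
        + Real.exp (-(L * (x - a))) * (L * φ x)) x := by
    intro x hx
    have h1 : HasDerivAt (fun s => ∫ r in a..s, φ r) (φ x) x := by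
      refine intervalIntegral.integral_hasDerivAt_right (hi.mono_set ?_) ?_ ?_
      · rw [Set.uIcc_of_le hx.1.le, Set.uIcc_of_le hab]
        exact Set.Icc_subset_Icc_right hx.2.le
      · exact (hφ.mono Set.Ioo_subset_Icc_self).stronglyMeasurableAtFilter isOpen_Ioo x hx
      · exact hφ.continuousAt (Icc_mem_nhds hx.1 hx.2)
    exact ((((hasDerivAt_id x).sub_const a).const_mul L).neg.exp).mul
      ((h1.const_mul L).const_add K)
  have hanti : AntitoneOn (fun s => Real.exp (-(L * (s - a))) * (K + L * ∫ r in a..s, φ r))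
      (Icc a b) := by
    refine antitoneOn_of_deriv_nonpos (convex_Icc a b) ?_ ?_ ?_
    · exact (Continuous.continuousOn (by fun_prop)).mul
        (continuousOn_const.add (continuousOn_const.mul hprim.continuousOn))
    · rw [interior_Icc]
      exact fun x hx => (hd x hx).differentiableAt.differentiableWithinAt
    · rw [interior_Icc]
      intro x hx
      rw [(hd x hx).deriv]
      have h2 := h x ⟨hx.1.le, hx.2.le⟩
      have h3 : 0 ≤ Real.exp (-(L * (x - a))) * L := by positivity
      nlinarith [mul_le_mul_of_nonneg_left h2 h3]
  intro s hs
  have h4 := hanti ⟨le_rfl, hab⟩ hs hs.1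
  simp only [sub_self, mul_zero, neg_zero, Real.exp_zero, intervalIntegral.integral_same, add_zero,
    one_mul] at h4
  refine (h s hs).trans ?_
  have h5 : Real.exp (-(L * (s - a))) * Real.exp (L * (s - a)) = 1 := by
    rw [← Real.exp_add]; simp
  have h6 := mul_le_mul_of_nonneg_right h4 (Real.exp_pos (L * (s - a))).le
  calc K + L * ∫ r in a..s, φ r
      = (Real.exp (-(L * (s - a))) * Real.exp (L * (s - a))) * (K + L * ∫ r in a..s, φ r) := by
        rw [h5, one_mul]
    _ ≤ _ := by linarith

/-! ### Riemann sums along partitions -/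

namespace TimePartition

variable {t s : ℝ≥0}

lemma le_pt (π : TimePartition t s) (i : ℕ) : t ≤ π.pt i := by
  exact π.first.ge.trans (π.mono (Nat.zero_le i))

lemma pt_le (π : TimePartition t s) {i : ℕ} (hi : i ≤ π.n) : π.pt i ≤ s := by
  exact (π.mono hi).trans π.last.le

lemma le (π : TimePartition t s) : t ≤ s := π.le_pt π.n |>.trans (π.pt_le le_rfl)

lemma mem_Icc (π : TimePartition t s) {i : ℕ} (hi : i ≤ π.n) :
    (π.pt i : ℝ) ∈ Icc (t : ℝ) s :=
  ⟨by exact_mod_cast π.le_pt i, by exact_mod_cast π.pt_le hi⟩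

lemma pt_le_succ (π : TimePartition t s) (i : ℕ) : (π.pt i : ℝ) ≤ π.pt (i + 1) := by
  exact_mod_cast π.mono (Nat.le_succ i)

lemma sum_sub (π : TimePartition t s) (f : ℝ≥0 → ℝ) :
    ∑ i ∈ range π.n, (f (π.pt (i + 1)) - f (π.pt i)) = f s - f t := by
  rw [Finset.sum_range_sub (fun i => f (π.pt i)), π.first, π.last]

lemma sum_sub_real (π : TimePartition t s) (f : ℝ → ℝ) :
    ∑ i ∈ range π.n, (f (π.pt (i + 1)) - f (π.pt i)) = f s - f t :=
  π.sum_sub fun r => f r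

lemma exists_cell (π : TimePartition t s) {r : ℝ} (hr : r ∈ Ioc (t : ℝ) s) :
    ∃ i < π.n, r ∈ Ioc (π.pt i : ℝ) (π.pt (i + 1)) ∧
      ∀ j, j ≠ i → r ∉ Ioc (π.pt j : ℝ) (π.pt (j + 1)) := by
  have hex : ∃ i, r ≤ π.pt i := ⟨π.n, by rw [π.last]; exact hr.2⟩
  classical
  have h0 : Nat.find hex ≠ 0 := by
    intro h
    have := Nat.find_spec hex
    rw [h, π.first] at this
    exact absurd hr.1 (not_lt.2 this)
  obtain ⟨i, hi⟩ := Nat.exists_eq_succ_of_ne_zero h0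
  have hlt : (π.pt i : ℝ) < r := not_le.1 (Nat.find_min hex (m := i) (by omega))
  have hle : r ≤ π.pt (i + 1) := by
    have := Nat.find_spec hex
    rwa [hi] at this
  refine ⟨i, ?_, ⟨hlt, hle⟩, fun j hj hrj => ?_⟩
  · by_contra hn
    have h2 : (s : ℝ) ≤ π.pt i := by
      exact_mod_cast π.last.ge.trans (π.mono (not_lt.1 hn))
    exact absurd (hr.2.trans h2) (not_le.2 hlt)
  · rcases lt_or_gt_of_ne hj with h | h
    · have : (π.pt (j + 1) : ℝ) ≤ π.pt i := by exact_mod_cast π.mono h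
      exact absurd (hrj.2.trans this) (not_le.2 hlt)
    · have : (π.pt (i + 1) : ℝ) ≤ π.pt j := by exact_mod_cast π.mono h
      exact absurd (hle.trans this) (not_le.2 hrj.1)

/-- The partition stopped at a time `u`. -/
def stopAt (π : TimePartition t s) (u : ℝ≥0) (htu : t ≤ u) (hus : u ≤ s) : TimePartition t u where
  n := π.n
  pt i := min (π.pt i) u
  mono _ _ h := min_le_min_right u (π.mono h)
  first := by simp [π.first, htu]
  last := by simp [π.last, hus]

lemma sum_integral (π : TimePartition t s) {f : ℝ → ℝ} (hf : IntervalIntegrable f volume t s) :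
    ∑ i ∈ range π.n, ∫ r in (π.pt i : ℝ)..π.pt (i + 1), f r = ∫ r in (t : ℝ)..s, f r := by
  rw [intervalIntegral.sum_integral_adjacent_intervals (a := fun i => (π.pt i : ℝ)),
    π.first, π.last]
  intro k hk
  refine hf.mono_set ?_
  rw [Set.uIcc_of_le (a := (t : ℝ)) (b := s) (by exact_mod_cast π.le)]
  exact Set.uIcc_subset_Icc (π.mem_Icc hk.le) (π.mem_Icc hk)

/-- The equidistant partition with `n + 1` cells. -/
noncomputable def uniform (t s : ℝ≥0) (hts : t ≤ s) (n : ℕ) : TimePartition t s where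
  n := n + 1
  pt i := t + min (i : ℝ≥0) (n + 1) / (n + 1) * (s - t)
  mono i j h := by
    have : (i : ℝ≥0) ≤ j := by exact_mod_cast h
    dsimp only
    gcongr
  first := by simp
  last := by
    have : ((n : ℝ≥0) + 1) ≠ 0 := by positivity
    simp [this, hts]

end TimePartition

variable {t T : ℝ≥0}

/-- The mesh of the partitions `π k` tends to `0`. -/
def MeshTendsto (π : ℕ → TimePartition t T) : Prop :=
  ∀ η : ℝ, 0 < η → ∀ᶠ k in atTop, ∀ i < (π k).n, ((π k).pt (i + 1) : ℝ) - (π k).pt i < η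

lemma MeshTendsto.comp {π : ℕ → TimePartition t T} (h : MeshTendsto π) {ns : ℕ → ℕ}
    (hns : Tendsto ns atTop atTop) : MeshTendsto fun k => π (ns k) :=
  fun η hη => hns.eventually (h η hη)

lemma MeshTendsto.stopAt {π : ℕ → TimePartition t T} (h : MeshTendsto π) {u : ℝ≥0} (htu : t ≤ u)
    (hu : u ≤ T) : MeshTendsto fun k => (π k).stopAt u htu hu := by
  intro η hη
  filter_upwards [h η hη] with k hk i hi
  refine lt_of_le_of_lt ?_ (hk i hi)
  have := (π k).pt_le_succ i
  simp only [TimePartition.stopAt, NNReal.coe_min]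
  rcases le_total ((π k).pt i : ℝ) u with h1 | h1
  · rw [min_eq_left h1]; linarith [min_le_left ((π k).pt (i + 1) : ℝ) u]
  · rw [min_eq_right h1, min_eq_right (h1.trans this)]; linarith

lemma meshTendsto_uniform (h : t ≤ T) : MeshTendsto fun n => TimePartition.uniform t T h n := by
  intro η hη
  have h1 : Tendsto (fun n : ℕ => ((T : ℝ) - t) * (1 / ((n : ℝ) + 1))) atTop (𝓝 0) := by
    simpa using tendsto_one_div_add_atTop_nhds_zero_nat.const_mul ((T : ℝ) - t)
  filter_upwards [h1.eventually (gt_mem_nhds hη)] with n hn i hi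
  refine lt_of_le_of_lt (le_of_eq ?_) hn
  simp only [TimePartition.uniform] at hi ⊢
  have hi' : ((i + 1 : ℕ) : ℝ≥0) ≤ n + 1 := by exact_mod_cast hi
  have hi'' : (i : ℝ≥0) ≤ n + 1 := by exact_mod_cast hi.le
  rw [min_eq_left hi', min_eq_left hi'']
  push_cast [NNReal.coe_sub h]
  field_simp
  ring

/-- Oscillation of a continuous function along fine partitions. -/
lemma MeshTendsto.eventually_abs_sub_lt {π : ℕ → TimePartition t T} (h : MeshTendsto π)
    {f : ℝ → ℝ} (hf : ContinuousOn f (Icc (t : ℝ) T)) {ε : ℝ} (hε : 0 < ε) :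
    ∀ᶠ k in atTop, ∀ i < (π k).n, |f ((π k).pt (i + 1)) - f ((π k).pt i)| < ε := by
  have huc := isCompact_Icc.uniformContinuousOn_of_continuous hf
  rw [Metric.uniformContinuousOn_iff] at huc
  obtain ⟨δ, hδ, hd⟩ := huc ε hε
  filter_upwards [h δ hδ] with k hk i hi
  have := hd _ ((π k).mem_Icc (Nat.succ_le_of_lt hi)) _ ((π k).mem_Icc hi.le) (by
    rw [Real.dist_eq, abs_of_nonneg (sub_nonneg.2 ((π k).pt_le_succ i))]
    exact hk i hi)
  rwa [Real.dist_eq] at this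

lemma IsPrimitiveOn.sum_abs_sub_le {u u' : ℝ → ℝ} (h : IsPrimitiveOn u u' t T)
    (π : TimePartition t T) :
    ∑ i ∈ range π.n, |u (π.pt (i + 1)) - u (π.pt i)| ≤ ∫ r in (t : ℝ)..T, |u' r| := by
  rw [← π.sum_integral h.integrable.abs]
  refine sum_le_sum fun i hi => ?_
  have hi := Finset.mem_range.1 hi
  rw [h.sub_eq (π.mem_Icc hi.le) (π.mem_Icc hi)]
  exact intervalIntegral.abs_integral_le_integral_abs (π.pt_le_succ i)

lemma abs_sum_mul_le_of_sum_abs_le {n : ℕ} {x y : ℕ → ℝ} {ε C : ℝ} (hε : 0 ≤ ε)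
    (hx : ∀ i < n, |x i| ≤ ε) (hy : ∑ i ∈ range n, |y i| ≤ C) :
    |∑ i ∈ range n, x i * y i| ≤ ε * C := by
  calc |∑ i ∈ range n, x i * y i| ≤ ∑ i ∈ range n, |x i * y i| :=
        abs_sum_le_sum_abs _ _
    _ ≤ ∑ i ∈ range n, ε * |y i| := by
        refine sum_le_sum fun i hi => ?_
        rw [abs_mul]
        exact mul_le_mul_of_nonneg_right (hx i (Finset.mem_range.1 hi)) (abs_nonneg _)
    _ = ε * ∑ i ∈ range n, |y i| := by rw [mul_sum]
    _ ≤ ε * C := mul_le_mul_of_nonneg_left hy hε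

/-- Sums of small quantities against the increments of a primitive vanish. -/
lemma tendsto_sum_mul_sub_zero {π : ℕ → TimePartition t T} {u u' : ℝ → ℝ}
    (hu : IsPrimitiveOn u u' t T) {x : ℕ → ℕ → ℝ}
    (hx : ∀ ε : ℝ, 0 < ε → ∀ᶠ k in atTop, ∀ i < (π k).n, |x k i| < ε) :
    Tendsto (fun k => ∑ i ∈ range (π k).n,
      x k i * (u ((π k).pt (i + 1)) - u ((π k).pt i))) atTop (𝓝 0) := by
  rw [Metric.tendsto_atTop']
  intro ε hε
  set C := ∫ r in (t : ℝ)..T, |u' r|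
  have hC : 0 ≤ C := (sum_nonneg fun _ _ => abs_nonneg _).trans (hu.sum_abs_sub_le (π 0))
  obtain ⟨N, hN⟩ := eventually_atTop.1 (hx (ε / (2 * (C + 1))) (by positivity))
  refine ⟨N, fun k hk => ?_⟩
  rw [Real.dist_eq, sub_zero]
  refine lt_of_le_of_lt (abs_sum_mul_le_of_sum_abs_le (by positivity)
    (fun i hi => (hN k hk.le i hi).le) (hu.sum_abs_sub_le (π k))) ?_
  rw [div_mul_eq_mul_div, div_lt_iff₀ (by positivity)]
  nlinarith

/-- Riemann–Stieltjes sums with right end points, for right-continuous integrands. -/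
lemma tendsto_sum_right {π : ℕ → TimePartition t T} (hπ : MeshTendsto π) {f u u' : ℝ → ℝ}
    (hu : IsPrimitiveOn u u' t T) {K : ℝ} (hK : ∀ r ∈ Icc (t : ℝ) T, |f r| ≤ K)
    (hf : ∀ r ∈ Ico (t : ℝ) T, ContinuousWithinAt f (Ici r) r) :
    Tendsto (fun k => ∑ i ∈ range (π k).n,
        f ((π k).pt (i + 1)) * (u ((π k).pt (i + 1)) - u ((π k).pt i))) atTop
      (𝓝 (∫ r in (t : ℝ)..T, f r * u' r)) := by
  have htT : (t : ℝ) ≤ T := by exact_mod_cast (π 0).le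
  set F : ℕ → ℝ → ℝ := fun k r => ∑ i ∈ range (π k).n,
    (Ioc ((π k).pt i : ℝ) ((π k).pt (i + 1))).indicator
      (fun r => f ((π k).pt (i + 1)) * u' r) r with hF
  have hint : ∀ k, ∑ i ∈ range (π k).n,
      f ((π k).pt (i + 1)) * (u ((π k).pt (i + 1)) - u ((π k).pt i))
        = ∫ r in (t : ℝ)..T, F k r := by
    intro k
    rw [intervalIntegral.integral_of_le htT, integral_finsetSum]
    · refine sum_congr rfl fun i hi => ?_
      have hi := Finset.mem_range.1 hi
      rw [hu.sub_eq ((π k).mem_Icc hi.le) ((π k).mem_Icc hi), integral_indicator measurableSet_Ioc,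
        Measure.restrict_restrict measurableSet_Ioc, Set.inter_eq_left.2,
        intervalIntegral.integral_of_le ((π k).pt_le_succ i), integral_const_mul]
      exact Set.Ioc_subset_Ioc ((π k).mem_Icc hi.le).1 ((π k).mem_Icc hi).2
    · intro i hi
      refine Integrable.indicator ?_ measurableSet_Ioc
      exact (((intervalIntegrable_iff_integrableOn_Ioc_of_le htT).1 hu.integrable).const_mul _)
  have hcell : ∀ k, ∀ r ∈ Ioc (t : ℝ) T, ∃ i < (π k).n,
      r ∈ Ioc ((π k).pt i : ℝ) ((π k).pt (i + 1)) ∧ F k r = f ((π k).pt (i + 1)) * u' r := by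
    intro k r hr
    obtain ⟨i, hi, hri, hne⟩ := (π k).exists_cell hr
    refine ⟨i, hi, hri, ?_⟩
    rw [hF]
    simp only
    rw [Finset.sum_eq_single i]
    · rw [Set.indicator_of_mem hri]
    · exact fun j _ hj => Set.indicator_of_notMem (hne j hj) _
    · exact fun h => absurd (Finset.mem_range.2 hi) h
  simp only [hint]
  refine intervalIntegral.tendsto_integral_filter_of_dominated_convergence
    (fun r => K * |u' r|) ?_ ?_ (hu.integrable.abs.const_mul K) ?_
  · refine Eventually.of_forall fun k => ?_
    rw [Set.uIoc_of_le htT]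
    refine Finset.aestronglyMeasurable_fun_sum _ fun i _ => ?_
    exact (((intervalIntegrable_iff_integrableOn_Ioc_of_le htT).1
      hu.integrable).aestronglyMeasurable.const_mul _).indicator measurableSet_Ioc
  · refine Eventually.of_forall fun k => Eventually.of_forall fun r hr => ?_
    rw [Set.uIoc_of_le htT] at hr
    obtain ⟨i, hi, -, h⟩ := hcell k r hr
    rw [h, Real.norm_eq_abs, abs_mul]
    exact mul_le_mul_of_nonneg_right (hK _ ((π k).mem_Icc hi)) (abs_nonneg _)
  · have : ∀ᵐ r : ℝ, r ≠ T := by simp [ae_iff]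
    filter_upwards [this] with r hrT hr
    rw [Set.uIoc_of_le htT] at hr
    have hr' : r ∈ Ico (t : ℝ) T := ⟨hr.1.le, lt_of_le_of_ne hr.2 hrT⟩
    rw [Metric.tendsto_atTop']
    intro ε hε
    have hc := Metric.continuousWithinAt_iff.1 (hf r hr') (ε / (|u' r| + 1)) (by positivity)
    obtain ⟨δ, hδ, hd⟩ := hc
    obtain ⟨N, hN⟩ := eventually_atTop.1 (hπ δ hδ)
    refine ⟨N, fun k hk => ?_⟩
    obtain ⟨i, hi, hri, h⟩ := hcell k r hr
    have hdist := hd (x := ((π k).pt (i + 1) : ℝ)) hri.2 (by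
      rw [Real.dist_eq, abs_of_nonneg (sub_nonneg.2 hri.2)]
      linarith [hN k hk.le i hi, hri.1])
    rw [h, Real.dist_eq, ← sub_mul, abs_mul]
    rw [Real.dist_eq, lt_div_iff₀ (by positivity)] at hdist
    refine lt_of_le_of_lt ?_ hdist
    exact mul_le_mul_of_nonneg_left (by linarith) (abs_nonneg _)

lemma exists_bound_of_continuousOn {f : ℝ → ℝ} (hf : ContinuousOn f (Icc (t : ℝ) T)) :
    ∃ K, ∀ r ∈ Icc (t : ℝ) T, |f r| ≤ K :=
  isCompact_Icc.exists_bound_of_continuousOn hf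

lemma tendsto_sum_right_of_continuousOn {π : ℕ → TimePartition t T} (hπ : MeshTendsto π)
    {f u u' : ℝ → ℝ} (hu : IsPrimitiveOn u u' t T) (hf : ContinuousOn f (Icc (t : ℝ) T)) :
    Tendsto (fun k => ∑ i ∈ range (π k).n,
        f ((π k).pt (i + 1)) * (u ((π k).pt (i + 1)) - u ((π k).pt i))) atTop
      (𝓝 (∫ r in (t : ℝ)..T, f r * u' r)) := by
  obtain ⟨K, hK⟩ := exists_bound_of_continuousOn hf
  refine tendsto_sum_right hπ hu hK fun r hr => ?_
  have h1 := hf r ⟨hr.1, hr.2.le⟩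
  rw [← continuousWithinAt_inter (Iic_mem_nhds hr.2)]
  exact h1.mono fun x hx => ⟨hr.1.trans hx.1, hx.2⟩

/-- Riemann–Stieltjes sums with left end points, for continuous integrands. -/
lemma tendsto_sum_left {π : ℕ → TimePartition t T} (hπ : MeshTendsto π)
    {f u u' : ℝ → ℝ} (hu : IsPrimitiveOn u u' t T) (hf : ContinuousOn f (Icc (t : ℝ) T)) :
    Tendsto (fun k => ∑ i ∈ range (π k).n,
        f ((π k).pt i) * (u ((π k).pt (i + 1)) - u ((π k).pt i))) atTop
      (𝓝 (∫ r in (t : ℝ)..T, f r * u' r)) := by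
  have h1 := tendsto_sum_right_of_continuousOn hπ hu hf
  have h2 := tendsto_sum_mul_sub_zero (π := π) hu
    (x := fun k i => f ((π k).pt (i + 1)) - f ((π k).pt i))
    fun ε hε => hπ.eventually_abs_sub_lt hf hε
  have h3 := h1.sub h2
  rw [sub_zero] at h3
  refine h3.congr fun k => ?_
  rw [← sum_sub_distrib]
  exact sum_congr rfl fun i _ => by ring

/-- Riemann sums of a primitive against a continuous function. -/
lemma tendsto_sum_primitive_mul_sub {π : ℕ → TimePartition t T} (hπ : MeshTendsto π)
    {N g g' : ℝ → ℝ} (hg : IsPrimitiveOn g g' t T) (hN : ContinuousOn N (Icc (t : ℝ) T)) :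
    Tendsto (fun k => ∑ i ∈ range (π k).n,
        g ((π k).pt i) * (N ((π k).pt (i + 1)) - N ((π k).pt i))) atTop
      (𝓝 (g T * N T - g t * N t - ∫ r in (t : ℝ)..T, N r * g' r)) := by
  refine ((tendsto_sum_right_of_continuousOn hπ hg hN).const_sub (g T * N T - g t * N t)).congr
    fun k => ?_
  rw [← (π k).sum_sub_real (fun r => g r * N r), ← sum_sub_distrib]
  exact sum_congr rfl fun i _ => by ring

/-- An integrand together with its stochastic integral. -/
abbrev ProcPair (Ω : Type*) := (ℝ≥0 → Ω → ℝ) × (ℝ≥0 → Ω → ℝ)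

variable {Ω : Type*} {mΩ : MeasurableSpace Ω} {P : Measure Ω} [IsProbabilityMeasure P]
  {𝓕 : Filtration ℝ≥0 mΩ} {W : ℝ≥0 → Ω → ℝ} {x y : ProcPair Ω}

/-! ### Square integrable martingale differences -/

/-- The integrals of `Q` over the sets of the sub-σ-algebra `m` vanish. -/
def HasZeroMeanOn (P : Measure Ω) (m : MeasurableSpace Ω) (Q : Ω → ℝ) : Prop :=
  ∀ F : Set Ω, MeasurableSet[m] F → ∫ ω in F, Q ω ∂P = 0

lemma _root_.MeasureTheory.MemLp.integrable_mul_two {μ : Measure Ω} {f g : Ω → ℝ} (hf : MemLp f 2 μ)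
    (hg : MemLp g 2 μ) : Integrable (fun ω => f ω * g ω) μ :=
  hf.integrable_mul hg

lemma HasZeroMeanOn.integral_eq_zero {m : MeasurableSpace Ω} {Q : Ω → ℝ}
    (h : HasZeroMeanOn P m Q) : ∫ ω, Q ω ∂P = 0 := by
  simpa using h Set.univ MeasurableSet.univ

lemma HasZeroMeanOn.condExp_eq_zero {m : MeasurableSpace Ω} (hm : m ≤ mΩ) {Q : Ω → ℝ}
    (hQ : Integrable Q P) (h : HasZeroMeanOn P m Q) : P[Q|m] =ᵐ[P] 0 := by
  refine (ae_eq_condExp_of_forall_setIntegral_eq hm hQ (fun s _ _ => ?_) (fun s hs _ => ?_)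
    ?_).symm
  · exact integrableOn_zero
  · rw [h s hs]; simp
  · exact stronglyMeasurable_zero.aestronglyMeasurable

lemma HasZeroMeanOn.integral_mul_eq_zero {m : MeasurableSpace Ω} (hm : m ≤ mΩ) {Q ζ : Ω → ℝ}
    (h : HasZeroMeanOn P m Q) (hQ : Integrable Q P) (hζ : StronglyMeasurable[m] ζ)
    (hi : Integrable (fun ω => ζ ω * Q ω) P) : ∫ ω, ζ ω * Q ω ∂P = 0 := by
  have h1 : P[ζ * Q|m] =ᵐ[P] 0 := by
    refine (condExp_mul_of_stronglyMeasurable_left hζ hi hQ).trans ?_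
    filter_upwards [h.condExp_eq_zero hm hQ] with ω hω
    simp [hω]
  have h2 := integral_condExp hm (μ := P) (f := ζ * Q)
  rw [integral_congr_ae h1] at h2
  simpa using h2.symm

lemma HasZeroMeanOn.mul {m : MeasurableSpace Ω} (hm : m ≤ mΩ) {Q ζ : Ω → ℝ}
    (h : HasZeroMeanOn P m Q) (hQ : Integrable Q P) (hζ : StronglyMeasurable[m] ζ)
    (hi : Integrable (fun ω => ζ ω * Q ω) P) : HasZeroMeanOn P m (fun ω => ζ ω * Q ω) := by
  intro F hF
  have h1 := h.integral_mul_eq_zero hm hQ (ζ := F.indicator ζ) (hζ.indicator hF) (by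
    refine (hi.indicator (hm F hF)).congr (Eventually.of_forall fun ω => ?_)
    by_cases hω : ω ∈ F <;> simp [hω])
  rw [← integral_indicator (hm F hF), ← h1]
  congr 1
  ext ω
  by_cases hω : ω ∈ F <;> simp [hω]

lemma HasZeroMeanOn.add {m : MeasurableSpace Ω} {Q R : Ω → ℝ}
    (h : HasZeroMeanOn P m Q) (hQ : Integrable Q P) (k : HasZeroMeanOn P m R)
    (hR : Integrable R P) : HasZeroMeanOn P m (fun ω => Q ω + R ω) := by
  intro F hF
  rw [integral_add hQ.integrableOn hR.integrableOn, h F hF, k F hF, add_zero]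

lemma HasZeroMeanOn.const_mul {m : MeasurableSpace Ω} {Q : Ω → ℝ}
    (h : HasZeroMeanOn P m Q) (c : ℝ) : HasZeroMeanOn P m (fun ω => c * Q ω) := by
  intro F hF
  rw [integral_const_mul, h F hF, mul_zero]

/-- Martingale differences are orthogonal. -/
lemma integral_sum_sq_eq {p : ℕ → ℝ≥0} (hp : Monotone p)
    {Q : ℕ → Ω → ℝ} {n : ℕ} (hQ : ∀ i < n, MemLp (Q i) 2 P)
    (hm : ∀ i < n, StronglyMeasurable[𝓕 (p (i + 1))] (Q i))
    (hz : ∀ i < n, HasZeroMeanOn P (𝓕 (p i)) (Q i)) :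
    ∫ ω, (∑ i ∈ range n, Q i ω) ^ 2 ∂P = ∑ i ∈ range n, ∫ ω, Q i ω ^ 2 ∂P := by
  induction n with
  | zero => simp
  | succ n ih =>
    have hS : MemLp (fun ω => ∑ i ∈ range n, Q i ω) 2 P :=
      memLp_finsetSum _ fun i hi => hQ i ((Finset.mem_range.1 hi).trans (Nat.lt_succ_self n))
    have hSm : StronglyMeasurable[𝓕 (p n)] (fun ω => ∑ i ∈ range n, Q i ω) := by
      refine Finset.stronglyMeasurable_fun_sum _ fun i hi => ?_
      have hi := Finset.mem_range.1 hi
      exact (hm i (hi.trans (Nat.lt_succ_self n))).mono (𝓕.mono (hp hi))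
    have hn := hQ n (Nat.lt_succ_self n)
    have hcross := (hz n (Nat.lt_succ_self n)).integral_mul_eq_zero (𝓕.le _)
      (hn.integrable one_le_two) hSm (hS.integrable_mul_two hn)
    simp only [sum_range_succ]
    rw [← ih (fun i hi => hQ i (hi.trans (Nat.lt_succ_self n)))
      (fun i hi => hm i (hi.trans (Nat.lt_succ_self n)))
      (fun i hi => hz i (hi.trans (Nat.lt_succ_self n)))]
    have : ∀ ω, (∑ i ∈ range n, Q i ω + Q n ω) ^ 2
        = (∑ i ∈ range n, Q i ω) ^ 2
          + (2 * ((∑ i ∈ range n, Q i ω) * Q n ω) + Q n ω ^ 2) := fun ω => by ring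
    simp only [this]
    rw [integral_add hS.integrable_sq
      (((hS.integrable_mul_two hn).const_mul 2).fun_add hn.integrable_sq),
      integral_add ((hS.integrable_mul_two hn).const_mul 2) hn.integrable_sq, integral_const_mul,
      hcross]
    ring

/-! ### Increments of Brownian motion -/

lemma exists_integral_pow_four_gaussianReal :
    ∃ C : ℝ, 0 ≤ C ∧ ∀ v : ℝ≥0, ∫ x, x ^ 4 ∂(gaussianReal 0 v) = C * (v : ℝ) ^ 2 := by
  refine ⟨∫ x, x ^ 4 ∂(gaussianReal 0 1), integral_nonneg fun x => by positivity, fun v => ?_⟩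
  have h := gaussianReal_map_const_mul (μ := 0) (v := 1) (Real.sqrt v)
  have h2 : gaussianReal 0 v = (gaussianReal 0 1).map (fun x => Real.sqrt v * x) := by
    rw [h]
    congr 1
    · simp
    · ext; simp
  rw [h2, integral_map (by fun_prop) (by fun_prop), ← integral_mul_const]
  congr 1
  ext x
  have : Real.sqrt v ^ 4 = (v : ℝ) ^ 2 := by
    rw [show Real.sqrt v ^ 4 = (Real.sqrt v ^ 2) ^ 2 by ring, Real.sq_sqrt v.coe_nonneg]
  rw [mul_pow, this, mul_comm]

namespace IsBrownianBasis

variable (hW : IsBrownianBasis P 𝓕 W)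
include hW

lemma stronglyMeasurable {s u : ℝ≥0} (h : s ≤ u) : StronglyMeasurable[𝓕 u] (W s) :=
  (hW.adapted s).mono (𝓕.mono h)

lemma hasLaw_sub {s u : ℝ≥0} (h : s ≤ u) :
    HasLaw (fun ω => W u ω - W s ω) (gaussianReal 0 (u - s)) P := by
  have h1 := hW.brownian.hasLaw_sub u s
  have : nndist u.1 s.1 = u - s := by
    ext
    rw [coe_nndist, Real.dist_eq, NNReal.coe_sub h]
    exact abs_of_nonneg (sub_nonneg.2 (by exact_mod_cast h))
  rw [this] at h1
  exact h1

lemma memLp_sub (s u : ℝ≥0) (p : ℝ≥0∞) (hp : p ≠ ∞) : MemLp (fun ω => W u ω - W s ω) p P := by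
  wlog h : s ≤ u generalizing s u
  · have := (this u s (not_le.1 h).le).neg
    refine this.ae_eq (Eventually.of_forall fun ω => ?_)
    simp
  have hl := hW.hasLaw_sub h
  have h2 := memLp_id_gaussianReal' (μ := 0) (v := u - s) p hp
  rw [← hl.map_eq] at h2
  exact (memLp_map_measure_iff (by fun_prop) hl.aemeasurable).1 h2

lemma integral_sub_sq {s u : ℝ≥0} (h : s ≤ u) :
    ∫ ω, (W u ω - W s ω) ^ 2 ∂P = (u : ℝ) - s := by
  have hl := hW.hasLaw_sub h
  have h1 : ∫ ω, (W u ω - W s ω) ^ 2 ∂P = ∫ x, x ^ 2 ∂(gaussianReal 0 (u - s)) := by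
    rw [← hl.map_eq, integral_map hl.aemeasurable (by fun_prop)]
  have h2 := variance_fun_id_gaussianReal (μ := 0) (v := u - s)
  rw [variance_eq_integral (by fun_prop)] at h2
  simp only [integral_id_gaussianReal, sub_zero] at h2
  rw [h1, h2, NNReal.coe_sub h]

lemma integral_sub_eq {s u : ℝ≥0} (h : s ≤ u) : ∫ ω, (W u ω - W s ω) ∂P = 0 := by
  have hl := hW.hasLaw_sub h
  rw [hl.integral_eq, integral_id_gaussianReal]

lemma integral_sub_pow_four :
    ∃ C : ℝ, 0 ≤ C ∧ ∀ s u : ℝ≥0, s ≤ u →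
      ∫ ω, (W u ω - W s ω) ^ 4 ∂P = C * ((u : ℝ) - s) ^ 2 := by
  obtain ⟨C, hC, h⟩ := exists_integral_pow_four_gaussianReal
  refine ⟨C, hC, fun s u hsu => ?_⟩
  have hl := hW.hasLaw_sub hsu
  rw [← NNReal.coe_sub hsu, ← h, ← hl.map_eq, integral_map hl.aemeasurable (by fun_prop)]

lemma indepFun_sub {s u : ℝ≥0} (h : s ≤ u) {ξ : Ω → ℝ} (hξ : StronglyMeasurable[𝓕 s] ξ) :
    IndepFun ξ (fun ω => W u ω - W s ω) P :=
  (indep_of_indep_of_le_left (hW.indep s u h).symm (hξ.measurable.comap_le))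

lemma integral_mul_sub {s u : ℝ≥0} (h : s ≤ u) {ξ : Ω → ℝ} (hξ : StronglyMeasurable[𝓕 s] ξ)
    (hi : Integrable ξ P) : ∫ ω, ξ ω * (W u ω - W s ω) ∂P = 0 := by
  have := (hW.indepFun_sub h hξ).integral_mul_eq_mul_integral hi.aestronglyMeasurable
    (hW.memLp_sub s u 1 (by simp)).aestronglyMeasurable
  rw [hW.integral_sub_eq h, mul_zero] at this
  exact this

lemma integral_mul_sub_sq {s u : ℝ≥0} (h : s ≤ u) {ξ : Ω → ℝ} (hξ : StronglyMeasurable[𝓕 s] ξ)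
    (hi : Integrable ξ P) :
    ∫ ω, ξ ω * (W u ω - W s ω) ^ 2 ∂P = (∫ ω, ξ ω ∂P) * ((u : ℝ) - s) := by
  have hind : IndepFun ξ (fun ω => (W u ω - W s ω) ^ 2) P :=
    (hW.indepFun_sub h hξ).comp (φ := id) (ψ := fun x => x ^ 2) measurable_id (by fun_prop)
  have := hind.integral_mul_eq_mul_integral hi.aestronglyMeasurable
    ((hW.memLp_sub s u 2 (by simp)).integrable_sq.aestronglyMeasurable)
  rw [hW.integral_sub_sq h] at this
  exact this

/-- The basic covariance identity behind the Itô isometry. -/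
lemma integral_mul_sub_mul_mul_sub {a b c d : ℝ≥0} (hab : a ≤ b) (hcd : c ≤ d) {ξ η : Ω → ℝ}
    (hξ : StronglyMeasurable[𝓕 a] ξ) (hη : StronglyMeasurable[𝓕 c] η) {K : ℝ}
    (hξK : ∀ ω, |ξ ω| ≤ K) (hηK : ∀ ω, |η ω| ≤ K) :
    ∫ ω, (ξ ω * (W b ω - W a ω)) * (η ω * (W d ω - W c ω)) ∂P
      = (∫ ω, ξ ω * η ω ∂P) * ((min b d - max a c : ℝ≥0) : ℝ) := by
  wlog hac : a ≤ c generalizing a b c d ξ η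
  · have := this hcd hab hη hξ hηK hξK (not_le.1 hac).le
    rw [min_comm, max_comm, show (∫ ω, ξ ω * η ω ∂P) = ∫ ω, η ω * ξ ω ∂P by
      simp only [mul_comm], ← this]
    simp only [mul_comm]
  have hξ' : StronglyMeasurable[𝓕 c] ξ := hξ.mono (𝓕.mono hac)
  have hζ : StronglyMeasurable[𝓕 c] (fun ω => ξ ω * η ω) := hξ'.mul hη
  have hζK : ∀ ω, ‖ξ ω * η ω‖ ≤ K * K := fun ω => by
    rw [Real.norm_eq_abs, abs_mul]
    exact mul_le_mul (hξK ω) (hηK ω) (abs_nonneg _) ((abs_nonneg _).trans (hξK ω))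
  have hζi : Integrable (fun ω => ξ ω * η ω) P :=
    Integrable.of_bound (hζ.mono (𝓕.le c)).aestronglyMeasurable _ (Eventually.of_forall hζK)
  have hWi : ∀ x y : ℝ≥0, MemLp (fun ω => W y ω - W x ω) 2 P := fun x y => hW.memLp_sub x y 2 (by simp)
  have hbm : ∀ {f : Ω → ℝ}, Integrable f P → Integrable (fun ω => (ξ ω * η ω) * f ω) P :=
    fun {f} hf => hf.bdd_mul (c := K * K) (hζ.mono (𝓕.le c)).aestronglyMeasurable
      (Eventually.of_forall hζK)
  have hcm : ∀ x y : ℝ≥0, x ≤ c → y ≤ c →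
      ∫ ω, (ξ ω * η ω) * ((W y ω - W x ω) * (W d ω - W c ω)) ∂P = 0 := by
    intro x y hx hy
    have h1 : StronglyMeasurable[𝓕 c] (fun ω => (ξ ω * η ω) * (W y ω - W x ω)) :=
      hζ.mul ((hW.stronglyMeasurable hy).sub (hW.stronglyMeasurable hx))
    have := hW.integral_mul_sub hcd h1 (hbm ((hWi x y).integrable one_le_two))
    simpa only [mul_assoc] using this
  rcases le_or_gt b c with hbc | hbc
  · have : min b d - max a c = 0 :=
      tsub_eq_zero_of_le ((min_le_left _ _).trans (hbc.trans (le_max_right _ _)))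
    rw [this, NNReal.coe_zero, mul_zero, ← hcm a b (hab.trans hbc) hbc]
    congr 1; ext ω; ring
  · rw [max_eq_right hac]
    have hint : ∀ x y z w : ℝ≥0,
        Integrable (fun ω => (ξ ω * η ω) * ((W y ω - W x ω) * (W w ω - W z ω))) P :=
      fun x y z w => hbm ((hWi x y).integrable_mul_two (hWi z w))
    set m := min b d with hm
    have hmc : c ≤ m := le_min hbc.le hcd
    have hmid : ∫ ω, (ξ ω * η ω) * ((W m ω - W c ω) * (W m ω - W c ω)) ∂P
        = (∫ ω, ξ ω * η ω ∂P) * ((m : ℝ) - c) := by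
      rw [← hW.integral_mul_sub_sq hmc hζ hζi]
      congr 1; ext ω; ring
    have hright : ∀ y : ℝ≥0, m ≤ y →
        ∫ ω, (ξ ω * η ω) * ((W m ω - W c ω) * (W y ω - W m ω)) ∂P = 0 := by
      intro y hy
      have h1 : StronglyMeasurable[𝓕 m] (fun ω => (ξ ω * η ω) * (W m ω - W c ω)) :=
        (hζ.mono (𝓕.mono hmc)).mul
          ((hW.stronglyMeasurable le_rfl).sub (hW.stronglyMeasurable hmc))
      have := hW.integral_mul_sub hy h1 (hbm ((hWi c m).integrable one_le_two))
      simpa only [mul_assoc] using this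
    have hdiag : ∀ ω, (W b ω - W m ω) * (W d ω - W m ω) = 0 := by
      intro ω
      rcases min_choice b d with h | h
      · rw [hm, h]; simp
      · rw [hm, h]; simp
    have hexp : ∀ ω, (ξ ω * (W b ω - W a ω)) * (η ω * (W d ω - W c ω))
        = (ξ ω * η ω) * ((W c ω - W a ω) * (W d ω - W c ω))
          + ((ξ ω * η ω) * ((W m ω - W c ω) * (W m ω - W c ω))
            + ((ξ ω * η ω) * ((W m ω - W c ω) * (W d ω - W m ω))
              + (ξ ω * η ω) * ((W m ω - W c ω) * (W b ω - W m ω)))) := by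
      intro ω
      have := hdiag ω
      linear_combination (ξ ω * η ω) * this
    simp only [hexp]
    rw [integral_add (hint _ _ _ _) ((hint _ _ _ _).fun_add ((hint _ _ _ _).fun_add (hint _ _ _ _))),
      integral_add (hint _ _ _ _) ((hint _ _ _ _).fun_add (hint _ _ _ _)),
      integral_add (hint _ _ _ _) (hint _ _ _ _), hcm a c hac le_rfl, hmid,
      hright d (min_le_right _ _), hright b (min_le_left _ _), NNReal.coe_sub hmc]
    ring

end IsBrownianBasis

/-! ### Elementary stochastic integrals -/

/-- The integrand `c 1_{(a, b]}` together with its elementary integral process. -/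
noncomputable def elemBlock (W : ℝ≥0 → Ω → ℝ) (a b : ℝ≥0) (c : Ω → ℝ) : ProcPair Ω :=
  (fun s ω => (Ioc a b).indicator (fun _ => c ω) s,
    fun s ω => c ω * (W (min b s) ω - W (min a s) ω))

/-- Bounded elementary integrands together with their integral processes. -/
def elemIntegrals (𝓕 : Filtration ℝ≥0 mΩ) (W : ℝ≥0 → Ω → ℝ) :
    Submodule ℝ (ProcPair Ω) :=
  Submodule.span ℝ {x | ∃ (a b : ℝ≥0) (c : Ω → ℝ), a ≤ b ∧ StronglyMeasurable[𝓕 a] c ∧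
    (∃ K, ∀ ω, |c ω| ≤ K) ∧ x = elemBlock W a b c}

lemma elemBlock_mem {a b : ℝ≥0} {c : Ω → ℝ} (hab : a ≤ b) (hc : StronglyMeasurable[𝓕 a] c)
    (hK : ∃ K, ∀ ω, |c ω| ≤ K) : elemBlock W a b c ∈ elemIntegrals 𝓕 W :=
  Submodule.subset_span ⟨a, b, c, hab, hc, hK, rfl⟩

lemma SimpleProcess.mem_elemIntegrals (S : SimpleProcess 𝓕) (W : ℝ≥0 → Ω → ℝ) :
    (S.val, S.integral W) ∈ elemIntegrals 𝓕 W := by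
  have h : (S.val, S.integral W)
      = ∑ i ∈ range S.n, elemBlock W (S.pt i) (S.pt (i + 1)) (S.coef i) := by
    refine Prod.ext ?_ ?_
    · rw [Prod.fst_sum]
      funext s ω
      simp [SimpleProcess.val, elemBlock, Finset.sum_apply]
    · rw [Prod.snd_sum]
      funext s ω
      simp [SimpleProcess.integral, elemBlock, Finset.sum_apply]
  rw [h]
  obtain ⟨K, hK⟩ := S.bdd
  exact Submodule.sum_mem _ fun i _ =>
    elemBlock_mem (S.mono (Nat.le_succ i)) (S.meas i) ⟨K, hK i⟩

/-- The measure `dr ⊗ P` on `(s, u] × Ω`. -/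
noncomputable def cellMeasure (P : Measure Ω) (s u : ℝ≥0) : Measure (ℝ × Ω) :=
  (volume.restrict (Ioc (s : ℝ) u)).prod P

instance (s u : ℝ≥0) : IsFiniteMeasure (cellMeasure P s u) := by
  unfold cellMeasure; infer_instance

/-- The pathwise integral `∫_s^u h h' dr`. -/
noncomputable def cellInt (h h' : ℝ≥0 → Ω → ℝ) (s u : ℝ≥0) (ω : Ω) : ℝ :=
  ∫ r in (s : ℝ)..u, h r.toNNReal ω * h' r.toNNReal ω

/-- `(v, I)` is a bounded measurable integrand with an adapted square integrable integral. -/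
structure ElemRegular (P : Measure Ω) (𝓕 : Filtration ℝ≥0 mΩ)
    (x : ProcPair Ω) : Prop where
  bound : ∃ K, ∀ s ω, |x.1 s ω| ≤ K
  meas : StronglyMeasurable (onProd x.1)
  adapted : ∀ s, StronglyMeasurable[𝓕 s] (x.2 s)
  memLp : ∀ s, MemLp (x.2 s) 2 P
  zero : ∀ ω, x.2 0 ω = 0
  zeroMean : ∀ s u, s ≤ u → HasZeroMeanOn P (𝓕 s) (fun ω => x.2 u ω - x.2 s ω)

/-- `x` clamped to `[s, u]`. -/
def clamp (s u x : ℝ≥0) : ℝ≥0 := max s (min x u)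

lemma le_clamp (s u x : ℝ≥0) : s ≤ clamp s u x := le_max_left _ _

lemma clamp_le {s u : ℝ≥0} (h : s ≤ u) (x : ℝ≥0) : clamp s u x ≤ u :=
  max_le h (min_le_right _ _)

lemma clamp_mono (s u : ℝ≥0) {x y : ℝ≥0} (h : x ≤ y) : clamp s u x ≤ clamp s u y :=
  max_le_max le_rfl (min_le_min_right _ h)

lemma sub_min_eq_sub_clamp (f : ℝ≥0 → ℝ) {s u : ℝ≥0} (h : s ≤ u) (b : ℝ≥0) :
    f (min b u) - f (min b s) = f (clamp s u b) - f s := by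
  unfold clamp
  rcases le_total b s with hb | hb
  · rw [min_eq_left hb, min_eq_left (hb.trans h), max_eq_left hb]; ring
  · rw [min_eq_right hb, max_eq_right (le_min hb h)]

lemma elemBlock_sub (W : ℝ≥0 → Ω → ℝ) (a b : ℝ≥0) (c : Ω → ℝ) {s u : ℝ≥0} (h : s ≤ u) (ω : Ω) :
    (elemBlock W a b c).2 u ω - (elemBlock W a b c).2 s ω
      = c ω * (W (clamp s u b) ω - W (clamp s u a) ω) := by
  have h1 := sub_min_eq_sub_clamp (fun r => W r ω) h b
  have h2 := sub_min_eq_sub_clamp (fun r => W r ω) h a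
  simp only [elemBlock]
  linear_combination c ω * h1 - c ω * h2

lemma clamp_eq_or_le (s u : ℝ≥0) {a b : ℝ≥0} (hab : a ≤ b) :
    clamp s u b = clamp s u a ∨ a ≤ clamp s u a := by
  unfold clamp
  rcases le_total a u with ha | ha
  · right; rw [min_eq_left ha]; exact le_max_right _ _
  · left; rw [min_eq_right ha, min_eq_right (ha.trans hab)]

lemma ElemRegular.of_block (hW : IsBrownianBasis P 𝓕 W) {a b : ℝ≥0} {c : Ω → ℝ} (hab : a ≤ b)
    (hc : StronglyMeasurable[𝓕 a] c) (hK : ∃ K, ∀ ω, |c ω| ≤ K) :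
    ElemRegular P 𝓕 (elemBlock W a b c) := by
  obtain ⟨K, hK⟩ := hK
  have hcm : StronglyMeasurable c := hc.mono (𝓕.le a)
  have hmem : ∀ x y : ℝ≥0, MemLp (fun ω => c ω * (W y ω - W x ω)) 2 P := fun x y =>
    (hW.memLp_sub x y 2 (by simp)).of_le_mul (c := K)
      (hcm.aestronglyMeasurable.mul (hW.memLp_sub x y 2 (by simp)).aestronglyMeasurable)
      (Eventually.of_forall fun ω => by
        rw [norm_mul]; exact mul_le_mul_of_nonneg_right (hK ω) (norm_nonneg _))
  refine ⟨⟨K, fun s ω => ?_⟩, ?_, fun s => ?_, fun s => hmem _ _, fun ω => ?_, fun s u hsu => ?_⟩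
  · by_cases hs : s ∈ Ioc a b
    · simpa [elemBlock, hs] using hK ω
    · have : 0 ≤ K := (abs_nonneg _).trans (hK ω)
      simpa [elemBlock, hs] using this
  · have hset : MeasurableSet {q : ℝ × Ω | q.1.toNNReal ∈ Ioc a b} :=
      (measurable_real_toNNReal.comp measurable_fst) measurableSet_Ioc
    have : onProd (elemBlock W a b c).1
        = {q : ℝ × Ω | q.1.toNNReal ∈ Ioc a b}.indicator (fun q => c q.2) := by
      ext q
      by_cases hq : q.1.toNNReal ∈ Ioc a b
      · rw [Set.indicator_of_mem (by exact hq)]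
        exact Set.indicator_of_mem (f := fun _ => c q.2) hq
      · rw [Set.indicator_of_notMem (by exact hq)]
        exact Set.indicator_of_notMem (f := fun _ => c q.2) hq
    rw [this]
    exact (hcm.comp_measurable measurable_snd).indicator hset
  · simp only [elemBlock]
    rcases le_total a s with has | has
    · exact (hc.mono (𝓕.mono has)).mul ((hW.stronglyMeasurable (min_le_right _ _)).sub
        (hW.stronglyMeasurable (min_le_right _ _)))
    · rw [min_eq_right has, min_eq_right (has.trans hab)]
      simpa using stronglyMeasurable_const
  · simp [elemBlock]
  · intro F hF
    simp only [elemBlock_sub W a b c hsu]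
    rcases clamp_eq_or_le s u hab with h | h
    · simp [h]
    · have h1 : StronglyMeasurable[𝓕 (clamp s u a)] (F.indicator c) :=
        (hc.mono (𝓕.mono h)).indicator (𝓕.mono (le_clamp s u a) _ hF)
      rw [← integral_indicator (𝓕.le _ _ hF)]
      have h2 := hW.integral_mul_sub (clamp_mono s u hab) h1 (Integrable.of_bound
        (h1.mono (𝓕.le _)).aestronglyMeasurable K (Eventually.of_forall fun ω => by
          by_cases hω : ω ∈ F
          · simpa [hω] using hK ω
          · simpa [hω] using (abs_nonneg _).trans (hK ω)))
      rw [← h2]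
      congr 1
      ext ω
      by_cases hω : ω ∈ F <;> simp [hω]

lemma ElemRegular.of_mem (hW : IsBrownianBasis P 𝓕 W)
    (hx : x ∈ elemIntegrals 𝓕 W) : ElemRegular P 𝓕 x := by
  induction hx using Submodule.span_induction with
  | mem x hx =>
    obtain ⟨a, b, c, hab, hc, hK, rfl⟩ := hx
    exact ElemRegular.of_block hW hab hc hK
  | zero =>
    refine ⟨⟨0, by simp⟩, stronglyMeasurable_zero, fun s => stronglyMeasurable_zero,
      fun s => MemLp.zero, by simp, fun s u _ F _ => by simp⟩
  | add x y _ _ hx hy =>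
    obtain ⟨K, hK⟩ := hx.bound
    obtain ⟨L, hL⟩ := hy.bound
    refine ⟨⟨K + L, fun s ω => (abs_add_le _ _).trans (add_le_add (hK s ω) (hL s ω))⟩,
      hx.meas.add hy.meas, fun s => (hx.adapted s).add (hy.adapted s),
      fun s => (hx.memLp s).add (hy.memLp s), fun ω => ?_, fun s u hsu => ?_⟩
    · simp [hx.zero ω, hy.zero ω]
    · have := (hx.zeroMean s u hsu).add (((hx.memLp u).sub (hx.memLp s)).integrable one_le_two)
        (hy.zeroMean s u hsu) (((hy.memLp u).sub (hy.memLp s)).integrable one_le_two)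
      intro F hF
      rw [← this F hF]
      congr 1
      ext ω
      simp only [Prod.snd_add, Pi.add_apply]
      ring
  | smul k x _ hx =>
    obtain ⟨K, hK⟩ := hx.bound
    refine ⟨⟨|k| * K, fun s ω => ?_⟩,
      hx.meas.const_mul k, fun s => (hx.adapted s).const_mul k,
      fun s => (hx.memLp s).const_mul k, fun ω => ?_, fun s u hsu => ?_⟩
    · simp only [Prod.smul_fst, Pi.smul_apply, smul_eq_mul, abs_mul]
      exact mul_le_mul_of_nonneg_left (hK s ω) (abs_nonneg _)
    · simp [hx.zero ω]
    · have := (hx.zeroMean s u hsu).const_mul k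
      intro F hF
      rw [← this F hF]
      congr 1
      ext ω
      simp only [Prod.smul_snd, Pi.smul_apply, smul_eq_mul]
      ring

lemma ElemRegular.memLp_sub (hx : ElemRegular P 𝓕 x)
    (s u : ℝ≥0) : MemLp (fun ω => x.2 u ω - x.2 s ω) 2 P := (hx.memLp u).sub (hx.memLp s)

lemma ElemRegular.memLp_onProd (hx : ElemRegular P 𝓕 x)
    (μ : Measure (ℝ × Ω)) [IsFiniteMeasure μ] (p : ℝ≥0∞) : MemLp (onProd x.1) p μ := by
  obtain ⟨K, hK⟩ := hx.bound
  exact MemLp.of_bound hx.meas.aestronglyMeasurable K (Eventually.of_forall fun q => hK _ _)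

lemma integral_cellMeasure {h h' : ℝ≥0 → Ω → ℝ} {s u : ℝ≥0} (hsu : s ≤ u)
    (hi : Integrable (fun q => onProd h q * onProd h' q) (cellMeasure P s u)) :
    ∫ q, onProd h q * onProd h' q ∂(cellMeasure P s u) = ∫ ω, cellInt h h' s u ω ∂P := by
  have hsu' : (s : ℝ) ≤ u := by exact_mod_cast hsu
  unfold cellMeasure at hi ⊢
  rw [integral_prod_symm _ hi]
  simp only [cellInt, intervalIntegral.integral_of_le hsu', onProd]

lemma integrable_cellInt {h h' : ℝ≥0 → Ω → ℝ} {s u : ℝ≥0} (hsu : s ≤ u)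
    (hi : Integrable (fun q => onProd h q * onProd h' q) (cellMeasure P s u)) :
    Integrable (cellInt h h' s u) P := by
  have hsu' : (s : ℝ) ≤ u := by exact_mod_cast hsu
  have := Integrable.integral_prod_right hi
  refine this.congr (Eventually.of_forall fun ω => ?_)
  simp only [cellInt, intervalIntegral.integral_of_le hsu', onProd]

lemma ElemRegular.intervalIntegrable
    (hx : ElemRegular P 𝓕 x) (hy : ElemRegular P 𝓕 y) (a b : ℝ) (ω : Ω) :
    IntervalIntegrable (fun r : ℝ => x.1 r.toNNReal ω * y.1 r.toNNReal ω) volume a b := by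
  obtain ⟨K, hK⟩ := hx.bound
  obtain ⟨L, hL⟩ := hy.bound
  have hm : StronglyMeasurable (fun r : ℝ => x.1 r.toNNReal ω * y.1 r.toNNReal ω) :=
    (hx.meas.mul hy.meas).comp_measurable measurable_prodMk_right
  refine (intervalIntegrable_const (c := K * L)).mono_fun hm.aestronglyMeasurable
    (Eventually.of_forall fun r => ?_)
  simp only [norm_mul]
  exact mul_le_mul ((hK _ _).trans (le_abs_self _)) ((hL _ _).trans (le_abs_self _))
    (norm_nonneg _) (norm_nonneg _)

lemma cellInt_elemBlock (W : ℝ≥0 → Ω → ℝ) (a b c d : ℝ≥0) (ξ η : Ω → ℝ) {s u : ℝ≥0} (hsu : s ≤ u)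
    (ω : Ω) : cellInt (elemBlock W a b ξ).1 (elemBlock W c d η).1 s u ω
      = ξ ω * η ω * ((min (clamp s u b) (clamp s u d) - max (clamp s u a) (clamp s u c) : ℝ≥0) : ℝ)
      := by
  have hsu' : (s : ℝ) ≤ u := by exact_mod_cast hsu
  rw [cellInt, intervalIntegral.integral_of_le hsu']
  have h1 : ∀ r ∈ Ioc (s : ℝ) u,
      (elemBlock W a b ξ).1 r.toNNReal ω * (elemBlock W c d η).1 r.toNNReal ω
        = (Ioc (max (a : ℝ) c) (min (b : ℝ) d)).indicator (fun _ => ξ ω * η ω) r := by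
    intro r hr
    have hr0 : 0 ≤ r := s.coe_nonneg.trans hr.1.le
    have hm : ∀ x y : ℝ≥0, (x < r.toNNReal ∧ r.toNNReal ≤ y) ↔ ((x : ℝ) < r ∧ r ≤ y) := by
      intro x y
      rw [Real.lt_toNNReal_iff_coe_lt, Real.toNNReal_le_iff_le_coe]
    simp only [elemBlock, Set.indicator_apply, Set.mem_Ioc, hm, max_lt_iff, le_min_iff]
    by_cases h1 : (a : ℝ) < r ∧ r ≤ b <;> by_cases h2 : (c : ℝ) < r ∧ r ≤ d <;> simp [h1, h2]
    all_goals tauto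
  rw [setIntegral_congr_fun measurableSet_Ioc h1, integral_indicator measurableSet_Ioc,
    Measure.restrict_restrict measurableSet_Ioc, Set.Ioc_inter_Ioc, setIntegral_const,
    measureReal_def, Real.volume_Ioc, smul_eq_mul, mul_comm]
  congr 1
  rw [ENNReal.toReal_ofReal', NNReal.coe_sub_def]
  simp only [clamp, NNReal.coe_min, NNReal.coe_max]
  rcases le_total (a : ℝ) c with h1 | h1 <;> rcases le_total (b : ℝ) d with h2 | h2 <;>
    grind

lemma integral_abs_le_sqrt {f : Ω → ℝ} (hf : MemLp f 2 P) {A : ℝ} (hA : ∫ ω, f ω ^ 2 ∂P ≤ A) :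
    ∫ ω, |f ω| ∂P ≤ √A := by
  refine Real.le_sqrt_of_sq_le (le_trans ?_ hA)
  have h := variance_nonneg (fun ω => |f ω|) P
  rw [variance_eq_sub (show MemLp (fun ω => |f ω|) 2 P from hf.abs)] at h
  simp only [Pi.pow_apply, sq_abs] at h
  linarith

lemma integrable_onProd_mul (hx : ElemRegular P 𝓕 x) (hy : ElemRegular P 𝓕 y) (s u : ℝ≥0) :
    Integrable (fun q => onProd x.1 q * onProd y.1 q) (cellMeasure P s u) :=
  (hx.memLp_onProd _ 2).integrable_mul_two (hy.memLp_onProd _ 2)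

/-- The weighted sum of the differences between products of increments and integrated products
of the integrands. -/
noncomputable def covDefect (x y : ProcPair Ω) {s u : ℝ≥0}
    (π : TimePartition s u) (c : ℕ → ℝ) (ω : Ω) : ℝ :=
  ∑ i ∈ range π.n, c i * ((x.2 (π.pt (i + 1)) ω - x.2 (π.pt i) ω)
    * (y.2 (π.pt (i + 1)) ω - y.2 (π.pt i) ω) - cellInt x.1 y.1 (π.pt i) (π.pt (i + 1)) ω)

/-- The products of increments of the two integral processes converge in `L¹`, with arbitrary
bounded deterministic weights, to the integrated product of the integrands. -/
def CovConv (P : Measure Ω) (x y : ProcPair Ω) (s u : ℝ≥0) : Prop :=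
  ∀ ε : ℝ, 0 < ε → ∃ η : ℝ, 0 < η ∧ ∀ π : TimePartition s u,
    (∀ i < π.n, (π.pt (i + 1) : ℝ) - π.pt i < η) → ∀ c : ℕ → ℝ, (∀ i, |c i| ≤ 1) →
      ∫ ω, |covDefect x y π c ω| ∂P ≤ ε

lemma ElemRegular.integrable_covDefect
    (hx : ElemRegular P 𝓕 x) (hy : ElemRegular P 𝓕 y) {s u : ℝ≥0} (π : TimePartition s u)
    (c : ℕ → ℝ) : Integrable (covDefect x y π c) P :=
  integrable_finsetSum _ fun i _ => (((hx.memLp_sub _ _).integrable_mul_two (hy.memLp_sub _ _)).sub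
    (integrable_cellInt (π.mono (Nat.le_succ i)) (integrable_onProd_mul hx hy _ _))).const_mul _

lemma cellInt_comm (h h' : ℝ≥0 → Ω → ℝ) (s u : ℝ≥0) (ω : Ω) :
    cellInt h h' s u ω = cellInt h' h s u ω := by
  simp only [cellInt, mul_comm]

lemma cellInt_add {x x' y : ProcPair Ω} (hx : ElemRegular P 𝓕 x)
    (hx' : ElemRegular P 𝓕 x') (hy : ElemRegular P 𝓕 y) (s u : ℝ≥0) (ω : Ω) :
    cellInt (x + x').1 y.1 s u ω = cellInt x.1 y.1 s u ω + cellInt x'.1 y.1 s u ω := by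
  simp only [cellInt]
  rw [← intervalIntegral.integral_add (hx.intervalIntegrable hy _ _ ω)
    (hx'.intervalIntegrable hy _ _ ω)]
  simp only [Prod.fst_add, Pi.add_apply, add_mul]

lemma cellInt_smul (x y : ProcPair Ω) (k : ℝ) (s u : ℝ≥0) (ω : Ω) :
    cellInt (k • x).1 y.1 s u ω = k * cellInt x.1 y.1 s u ω := by
  simp only [cellInt]
  rw [← intervalIntegral.integral_const_mul]
  simp only [Prod.smul_fst, Pi.smul_apply, smul_eq_mul, mul_assoc]

lemma covDefect_comm (x y : ProcPair Ω) {s u : ℝ≥0}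
    (π : TimePartition s u) (c : ℕ → ℝ) (ω : Ω) : covDefect x y π c ω = covDefect y x π c ω := by
  unfold covDefect
  refine sum_congr rfl fun i _ => ?_
  rw [cellInt_comm, mul_comm (x.2 _ ω - _)]

lemma CovConv.symm {s u : ℝ≥0} (h : CovConv P x y s u) :
    CovConv P y x s u := by
  simpa only [CovConv, covDefect_comm y x] using h

lemma CovConv.add {x x' y : ProcPair Ω} (hx : ElemRegular P 𝓕 x)
    (hx' : ElemRegular P 𝓕 x') (hy : ElemRegular P 𝓕 y) {s u : ℝ≥0} (h : CovConv P x y s u)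
    (h' : CovConv P x' y s u) : CovConv P (x + x') y s u := by
  intro ε hε
  obtain ⟨η, hη, hd⟩ := h (ε / 2) (by positivity)
  obtain ⟨η', hη', hd'⟩ := h' (ε / 2) (by positivity)
  refine ⟨min η η', lt_min hη hη', fun π hπ c hc => ?_⟩
  have h1 := hd π (fun i hi => (hπ i hi).trans_le (min_le_left _ _)) c hc
  have h2 := hd' π (fun i hi => (hπ i hi).trans_le (min_le_right _ _)) c hc
  have heq : ∀ ω, covDefect (x + x') y π c ω = covDefect x y π c ω + covDefect x' y π c ω := by
    intro ω
    unfold covDefect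
    rw [← sum_add_distrib]
    refine sum_congr rfl fun i _ => ?_
    rw [cellInt_add hx hx' hy]
    simp only [Prod.snd_add, Pi.add_apply]
    ring
  calc ∫ ω, |covDefect (x + x') y π c ω| ∂P
      ≤ ∫ ω, (|covDefect x y π c ω| + |covDefect x' y π c ω|) ∂P := by
        refine integral_mono_of_nonneg (Eventually.of_forall fun ω => abs_nonneg _)
          ((hx.integrable_covDefect hy π c).abs.add (hx'.integrable_covDefect hy π c).abs)
          (Eventually.of_forall fun ω => ?_)
        simp only [heq]
        exact abs_add_le _ _
    _ = ∫ ω, |covDefect x y π c ω| ∂P + ∫ ω, |covDefect x' y π c ω| ∂P :=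
        integral_add (hx.integrable_covDefect hy π c).abs (hx'.integrable_covDefect hy π c).abs
    _ ≤ ε := by linarith

lemma CovConv.smul {s u : ℝ≥0} (h : CovConv P x y s u) (k : ℝ) : CovConv P (k • x) y s u := by
  intro ε hε
  obtain ⟨η, hη, hd⟩ := h (ε / (|k| + 1)) (by positivity)
  refine ⟨η, hη, fun π hπ c hc => ?_⟩
  have heq : ∀ ω, |covDefect (k • x) y π c ω| = |k| * |covDefect x y π c ω| := by
    intro ω
    rw [← abs_mul]
    congr 1
    unfold covDefect
    rw [mul_sum]
    refine sum_congr rfl fun i _ => ?_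
    rw [cellInt_smul]
    simp only [Prod.smul_snd, Pi.smul_apply, smul_eq_mul]
    ring
  simp only [heq]
  rw [integral_const_mul]
  have h1 := hd π hπ c hc
  rw [le_div_iff₀ (by positivity)] at h1
  have h2 : 0 ≤ ∫ ω, |covDefect x y π c ω| ∂P := integral_nonneg fun ω => abs_nonneg _
  nlinarith

lemma CovConv.zero (y : ProcPair Ω) (s u : ℝ≥0) : CovConv P 0 y s u := by
  intro ε hε
  refine ⟨1, one_pos, fun π hπ c hc => ?_⟩
  simpa [covDefect, cellInt] using hε.le

/-- The length of `(a, b] ∩ (c, d] ∩ (s, u]`. -/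
noncomputable def overlap (a b c d s u : ℝ≥0) : ℝ :=
  ((min (clamp s u b) (clamp s u d) - max (clamp s u a) (clamp s u c) : ℝ≥0) : ℝ)

lemma overlap_nonneg (a b c d s u : ℝ≥0) : 0 ≤ overlap a b c d s u := NNReal.coe_nonneg _

lemma overlap_le (a b c d : ℝ≥0) {s u : ℝ≥0} (h : s ≤ u) : overlap a b c d s u ≤ (u : ℝ) - s := by
  rw [overlap, ← NNReal.coe_sub h, NNReal.coe_le_coe]
  exact tsub_le_tsub ((min_le_left _ _).trans (clamp_le h b))
    ((le_clamp s u a).trans (le_max_left _ _))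

lemma integral_elemBlock_mul (hW : IsBrownianBasis P 𝓕 W) {a b c d : ℝ≥0} (hab : a ≤ b)
    (hcd : c ≤ d) {ξ η : Ω → ℝ} (hξ : StronglyMeasurable[𝓕 a] ξ) (hη : StronglyMeasurable[𝓕 c] η)
    (hξK : ∃ K, ∀ ω, |ξ ω| ≤ K) (hηK : ∃ K, ∀ ω, |η ω| ≤ K) (s u : ℝ≥0) :
    ∫ ω, (ξ ω * (W (clamp s u b) ω - W (clamp s u a) ω))
        * (η ω * (W (clamp s u d) ω - W (clamp s u c) ω)) ∂P
      = (∫ ω, ξ ω * η ω ∂P) * overlap a b c d s u := by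
  obtain ⟨K, hK⟩ := hξK
  obtain ⟨L, hL⟩ := hηK
  rcases clamp_eq_or_le s u hab with h | h
  · have : overlap a b c d s u = 0 := by
      rw [overlap, h, tsub_eq_zero_of_le ((min_le_left _ _).trans (le_max_left _ _)),
        NNReal.coe_zero]
    simp [h, this]
  rcases clamp_eq_or_le s u hcd with h' | h'
  · have : overlap a b c d s u = 0 := by
      rw [overlap, h', tsub_eq_zero_of_le ((min_le_right _ _).trans (le_max_right _ _)),
        NNReal.coe_zero]
    simp [h', this]
  exact hW.integral_mul_sub_mul_mul_sub (clamp_mono s u hab) (clamp_mono s u hcd)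
    (hξ.mono (𝓕.mono h)) (hη.mono (𝓕.mono h')) (K := max K L)
    (fun ω => (hK ω).trans (le_max_left _ _)) (fun ω => (hL ω).trans (le_max_right _ _))

/-- Itô isometry for elementary integrals. -/
lemma integral_sub_mul_sub_of_mem (hW : IsBrownianBasis P 𝓕 W)
    (hx : x ∈ elemIntegrals 𝓕 W) (hy : y ∈ elemIntegrals 𝓕 W) {s u : ℝ≥0} (hsu : s ≤ u) :
    ∫ ω, (x.2 u ω - x.2 s ω) * (y.2 u ω - y.2 s ω) ∂P = ∫ ω, cellInt x.1 y.1 s u ω ∂P := by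
  have hlin : ∀ {x x' y : ProcPair Ω}, ElemRegular P 𝓕 x →
      ElemRegular P 𝓕 x' → ElemRegular P 𝓕 y →
      (∫ ω, (x.2 u ω - x.2 s ω) * (y.2 u ω - y.2 s ω) ∂P = ∫ ω, cellInt x.1 y.1 s u ω ∂P) →
      (∫ ω, (x'.2 u ω - x'.2 s ω) * (y.2 u ω - y.2 s ω) ∂P = ∫ ω, cellInt x'.1 y.1 s u ω ∂P) →
      ∫ ω, ((x + x').2 u ω - (x + x').2 s ω) * (y.2 u ω - y.2 s ω) ∂P
        = ∫ ω, cellInt (x + x').1 y.1 s u ω ∂P := by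
    intro x x' y hx hx' hy h1 h2
    simp only [cellInt_add hx hx' hy]
    rw [integral_add (integrable_cellInt hsu (integrable_onProd_mul hx hy s u))
      (integrable_cellInt hsu (integrable_onProd_mul hx' hy s u)), ← h1, ← h2,
      ← integral_add ((hx.memLp_sub _ _).integrable_mul_two (hy.memLp_sub _ _))
        ((hx'.memLp_sub _ _).integrable_mul_two (hy.memLp_sub _ _))]
    congr 1
    ext ω
    simp only [Prod.snd_add, Pi.add_apply]
    ring
  have hsm : ∀ {x y : ProcPair Ω} (k : ℝ),
      (∫ ω, (x.2 u ω - x.2 s ω) * (y.2 u ω - y.2 s ω) ∂P = ∫ ω, cellInt x.1 y.1 s u ω ∂P) →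
      ∫ ω, ((k • x).2 u ω - (k • x).2 s ω) * (y.2 u ω - y.2 s ω) ∂P
        = ∫ ω, cellInt (k • x).1 y.1 s u ω ∂P := by
    intro x y k h1
    simp only [cellInt_smul]
    rw [integral_const_mul, ← h1, ← integral_const_mul]
    congr 1
    ext ω
    simp only [Prod.smul_snd, Pi.smul_apply, smul_eq_mul]
    ring
  have hsymm : ∀ {x y : ProcPair Ω},
      (∫ ω, (x.2 u ω - x.2 s ω) * (y.2 u ω - y.2 s ω) ∂P = ∫ ω, cellInt x.1 y.1 s u ω ∂P) →
      ∫ ω, (y.2 u ω - y.2 s ω) * (x.2 u ω - x.2 s ω) ∂P = ∫ ω, cellInt y.1 x.1 s u ω ∂P := by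
    intro x y h
    simp only [cellInt_comm y.1 x.1, ← h, mul_comm]
  induction hx using Submodule.span_induction with
  | zero => simp [cellInt]
  | add x x' hxm hxm' h1 h2 =>
    exact hlin (.of_mem hW hxm) (.of_mem hW hxm') (.of_mem hW hy) h1 h2
  | smul k x _ h1 => exact hsm k h1
  | mem x hx =>
    induction hy using Submodule.span_induction with
    | zero => simp [cellInt]
    | add y y' hym hym' h1 h2 =>
      exact hsymm (hlin (.of_mem hW hym) (.of_mem hW hym')
        (.of_mem hW (Submodule.subset_span hx)) (hsymm h1) (hsymm h2))
    | smul k y _ h1 => exact hsymm (hsm k (hsymm h1))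
    | mem y hy =>
      obtain ⟨a, b, ξ, hab, hξ, hξK, rfl⟩ := hx
      obtain ⟨c, d, η, hcd, hη, hηK, rfl⟩ := hy
      simp only [elemBlock_sub W _ _ _ hsu, cellInt_elemBlock W _ _ _ _ _ _ hsu]
      rw [integral_elemBlock_mul hW hab hcd hξ hη hξK hηK s u, integral_mul_const]
      rfl

lemma covConv_elemBlock (hW : IsBrownianBasis P 𝓕 W) {a b c d : ℝ≥0} (hab : a ≤ b)
    (hcd : c ≤ d) {ξ η : Ω → ℝ} (hξK : ∃ K, ∀ ω, |ξ ω| ≤ K) (hηK : ∃ K, ∀ ω, |η ω| ≤ K)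
    (s u : ℝ≥0) : CovConv P (elemBlock W a b ξ) (elemBlock W c d η) s u := by
  intro ε hε
  obtain ⟨K, hK⟩ := hξK
  obtain ⟨L, hL⟩ := hηK
  obtain ⟨C, hC, h4⟩ := hW.integral_sub_pow_four
  obtain ⟨ω₀⟩ : Nonempty Ω := nonempty_of_isProbabilityMeasure P
  have hK0 : 0 ≤ K := (abs_nonneg _).trans (hK ω₀)
  have hL0 : 0 ≤ L := (abs_nonneg _).trans (hL ω₀)
  set D := (2 * C + 2) * (|(u : ℝ) - s| + 1) * (K * L + 1) ^ 2 with hD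
  have hDpos : 0 < D := by positivity
  refine ⟨ε ^ 2 / D, by positivity, fun π hπ w hw => ?_⟩
  set A : ℕ → Ω → ℝ := fun i ω =>
    W (clamp (π.pt i) (π.pt (i + 1)) b) ω - W (clamp (π.pt i) (π.pt (i + 1)) a) ω with hA
  set B : ℕ → Ω → ℝ := fun i ω =>
    W (clamp (π.pt i) (π.pt (i + 1)) d) ω - W (clamp (π.pt i) (π.pt (i + 1)) c) ω with hB
  set l : ℕ → ℝ := fun i => overlap a b c d (π.pt i) (π.pt (i + 1)) with hl
  set Q : ℕ → Ω → ℝ := fun i ω => w i * (A i ω * B i ω - l i) with hQ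
  have hstep : ∀ i, π.pt i ≤ π.pt (i + 1) := fun i => π.mono (Nat.le_succ i)
  have heq : ∀ ω, covDefect (elemBlock W a b ξ) (elemBlock W c d η) π w ω
      = (ξ ω * η ω) * ∑ i ∈ range π.n, Q i ω := by
    intro ω
    unfold covDefect
    rw [mul_sum]
    refine sum_congr rfl fun i _ => ?_
    rw [elemBlock_sub W _ _ _ (hstep i), elemBlock_sub W _ _ _ (hstep i),
      cellInt_elemBlock W _ _ _ _ _ _ (hstep i)]
    simp only [hQ, hA, hB, hl, overlap]
    ring
  have hA4 : ∀ i, MemLp (A i) 4 P := fun i => hW.memLp_sub _ _ 4 (by simp)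
  have hB4 : ∀ i, MemLp (B i) 4 P := fun i => hW.memLp_sub _ _ 4 (by simp)
  have hA4i : ∀ i, Integrable (fun ω => A i ω ^ 4) P := fun i => by
    simpa [Even.pow_abs (show Even 4 by decide)] using (hA4 i).integrable_norm_pow' (p := 4)
  have hB4i : ∀ i, Integrable (fun ω => B i ω ^ 4) P := fun i => by
    simpa [Even.pow_abs (show Even 4 by decide)] using (hB4 i).integrable_norm_pow' (p := 4)
  have hABm : ∀ i, AEStronglyMeasurable (fun ω => A i ω * B i ω) P :=
    fun i => (hA4 i).aestronglyMeasurable.mul (hB4 i).aestronglyMeasurable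
  have hABi : ∀ i, Integrable (fun ω => (A i ω * B i ω) ^ 2) P := fun i => by
    refine ((hA4i i).add (hB4i i)).mono' ((hABm i).pow 2) (Eventually.of_forall fun ω => ?_)
    rw [Real.norm_eq_abs, abs_of_nonneg (sq_nonneg _), Pi.add_apply]
    nlinarith [sq_nonneg (A i ω ^ 2 - B i ω ^ 2), sq_nonneg (A i ω ^ 2), sq_nonneg (B i ω ^ 2)]
  have hAB : ∀ i, MemLp (fun ω => A i ω * B i ω) 2 P := fun i =>
    (memLp_two_iff_integrable_sq (hABm i)).2 (hABi i)
  have hQ2 : ∀ i, MemLp (Q i) 2 P := fun i => ((hAB i).sub (memLp_const _)).const_mul _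
  have hQm : ∀ i, StronglyMeasurable[𝓕 (π.pt (i + 1))] (Q i) := by
    intro i
    have h1 : ∀ x, StronglyMeasurable[𝓕 (π.pt (i + 1))] (W (clamp (π.pt i) (π.pt (i + 1)) x)) :=
      fun x => hW.stronglyMeasurable (clamp_le (hstep i) x)
    exact ((((h1 b).sub (h1 a)).mul ((h1 d).sub (h1 c))).sub stronglyMeasurable_const).const_mul _
  have hQz : ∀ i, HasZeroMeanOn P (𝓕 (π.pt i)) (Q i) := by
    intro i
    refine HasZeroMeanOn.const_mul (fun F hF => ?_) _
    rw [integral_sub ((hAB i).integrable one_le_two).integrableOn (integrable_const _)]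
    have hFm : MeasurableSet F := 𝓕.le _ _ hF
    have h1 : StronglyMeasurable[𝓕 (clamp (π.pt i) (π.pt (i + 1)) a)]
        (F.indicator fun _ => (1 : ℝ)) :=
      stronglyMeasurable_const.indicator (𝓕.mono (le_clamp _ _ _) _ hF)
    have h2 := hW.integral_mul_sub_mul_mul_sub (clamp_mono (π.pt i) (π.pt (i + 1)) hab)
      (clamp_mono (π.pt i) (π.pt (i + 1)) hcd) h1 (stronglyMeasurable_const (b := (1 : ℝ)))
      (K := 1) (fun ω => by by_cases hω : ω ∈ F <;> simp [hω]) (fun ω => by simp)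
    simp only [mul_one, one_mul] at h2
    rw [integral_indicator hFm] at h2
    have h3 : ∫ ω in F, A i ω * B i ω ∂P = ∫ ω, F.indicator (fun _ => (1 : ℝ)) ω
        * (W (clamp (π.pt i) (π.pt (i + 1)) b) ω - W (clamp (π.pt i) (π.pt (i + 1)) a) ω)
        * (W (clamp (π.pt i) (π.pt (i + 1)) d) ω - W (clamp (π.pt i) (π.pt (i + 1)) c) ω) ∂P := by
      rw [← integral_indicator hFm]
      congr 1
      ext ω
      by_cases hω : ω ∈ F <;> simp [hω, hA, hB]
    rw [h3, h2]
    simp only [hl, overlap, integral_const, smul_eq_mul, mul_one]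
    ring
  have hQsq : ∀ i < π.n, ∫ ω, Q i ω ^ 2 ∂P
      ≤ (2 * C + 2) * ((π.pt (i + 1) : ℝ) - π.pt i) * (ε ^ 2 / D) := by
    intro i hi
    set δ := (π.pt (i + 1) : ℝ) - π.pt i with hδ
    have hδ0 : 0 ≤ δ := sub_nonneg.2 (π.pt_le_succ i)
    have hfour : ∀ x y : ℝ≥0, x ≤ y →
        ∫ ω, (W (clamp (π.pt i) (π.pt (i + 1)) y) ω - W (clamp (π.pt i) (π.pt (i + 1)) x) ω) ^ 4 ∂P
          ≤ C * δ ^ 2 := by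
      intro x y hxy
      rw [h4 _ _ (clamp_mono _ _ hxy)]
      have e1 : (clamp (π.pt i) (π.pt (i + 1)) y : ℝ) ≤ π.pt (i + 1) := by
        exact_mod_cast clamp_le (hstep i) y
      have e2 : (π.pt i : ℝ) ≤ clamp (π.pt i) (π.pt (i + 1)) x := by
        exact_mod_cast le_clamp _ _ x
      have e3 : (clamp (π.pt i) (π.pt (i + 1)) x : ℝ) ≤ clamp (π.pt i) (π.pt (i + 1)) y := by
        exact_mod_cast clamp_mono _ _ hxy
      refine mul_le_mul_of_nonneg_left (pow_le_pow_left₀ (by linarith) (by linarith) 2) hC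
    have hl1 : l i ≤ δ := overlap_le _ _ _ _ (hstep i)
    have hl0 : 0 ≤ l i := overlap_nonneg _ _ _ _ _ _
    have hw2 : w i ^ 2 ≤ 1 := by rw [← sq_abs]; exact pow_le_one₀ (abs_nonneg _) (hw i)
    have hb1 : ∫ ω, Q i ω ^ 2 ∂P ≤ ∫ ω, (A i ω ^ 4 + B i ω ^ 4 + 2 * δ ^ 2) ∂P := by
      refine integral_mono (hQ2 i).integrable_sq
        (((hA4i i).add (hB4i i)).add (integrable_const _)) fun ω => ?_
      have e1 : Q i ω ^ 2 ≤ (A i ω * B i ω - l i) ^ 2 := by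
        simp only [hQ, mul_pow]
        nlinarith [sq_nonneg (A i ω * B i ω - l i)]
      refine e1.trans ?_
      have e2 : l i ^ 2 ≤ δ ^ 2 := pow_le_pow_left₀ hl0 hl1 2
      nlinarith [sq_nonneg (A i ω ^ 2 - B i ω ^ 2), sq_nonneg (A i ω * B i ω + l i)]
    rw [integral_add ((hA4i i).fun_add (hB4i i)) (integrable_const _),
      integral_add (hA4i i) (hB4i i)] at hb1
    simp only [integral_const, probReal_univ, smul_eq_mul, one_mul] at hb1
    have hb2 : ∫ ω, Q i ω ^ 2 ∂P ≤ (2 * C + 2) * (δ * δ) := by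
      have := hfour a b hab
      have := hfour c d hcd
      simp only [hA, hB] at hb1
      nlinarith
    refine hb2.trans ?_
    rw [mul_assoc]
    exact mul_le_mul_of_nonneg_left (mul_le_mul_of_nonneg_left (hπ i hi).le hδ0) (by linarith)
  have hS2 : MemLp (fun ω => ∑ i ∈ range π.n, Q i ω) 2 P :=
    memLp_finsetSum _ fun i _ => hQ2 i
  have hSsq : ∫ ω, (∑ i ∈ range π.n, Q i ω) ^ 2 ∂P ≤ (ε / (K * L + 1)) ^ 2 := by
    rw [integral_sum_sq_eq π.mono (fun i _ => hQ2 i) (fun i _ => hQm i) (fun i _ => hQz i)]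
    refine (sum_le_sum fun i hi => hQsq i (Finset.mem_range.1 hi)).trans ?_
    rw [← sum_mul, ← mul_sum, π.sum_sub_real (fun r => r), hD, div_pow]
    have e1 : (u : ℝ) - s ≤ |(u : ℝ) - s| + 1 := by linarith [le_abs_self ((u : ℝ) - s)]
    rw [mul_div_assoc', div_le_div_iff₀ (by positivity) (by positivity)]
    have e2 : (2 * C + 2) * ((u : ℝ) - s) ≤ (2 * C + 2) * (|(u : ℝ) - s| + 1) :=
      mul_le_mul_of_nonneg_left e1 (by positivity)
    have e3 : 0 ≤ ε ^ 2 * (K * L + 1) ^ 2 := by positivity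
    nlinarith [mul_le_mul_of_nonneg_left e2 e3]
  have hS1 := integral_abs_le_sqrt hS2 hSsq
  rw [Real.sqrt_sq (by positivity)] at hS1
  calc ∫ ω, |covDefect (elemBlock W a b ξ) (elemBlock W c d η) π w ω| ∂P
      ≤ ∫ ω, (K * L) * |∑ i ∈ range π.n, Q i ω| ∂P := by
        refine integral_mono_of_nonneg (Eventually.of_forall fun ω => abs_nonneg _)
          ((hS2.integrable one_le_two).abs.const_mul _) (Eventually.of_forall fun ω => ?_)
        simp only [heq, abs_mul]
        gcongr
        · exact hK ω
        · exact hL ω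
    _ = (K * L) * ∫ ω, |∑ i ∈ range π.n, Q i ω| ∂P := integral_const_mul _ _
    _ ≤ (K * L) * (ε / (K * L + 1)) := mul_le_mul_of_nonneg_left hS1 (by positivity)
    _ ≤ ε := by
        rw [mul_div_assoc', div_le_iff₀ (by positivity)]
        nlinarith

/-- Covariation of elementary integrals. -/
lemma covConv_of_mem (hW : IsBrownianBasis P 𝓕 W)
    (hx : x ∈ elemIntegrals 𝓕 W) (hy : y ∈ elemIntegrals 𝓕 W) (s u : ℝ≥0) :
    CovConv P x y s u := by
  induction hx using Submodule.span_induction with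
  | zero => exact CovConv.zero y s u
  | add x x' hxm hxm' h1 h2 =>
    exact CovConv.add (.of_mem hW hxm) (.of_mem hW hxm') (.of_mem hW hy) h1 h2
  | smul k x _ h1 => exact h1.smul k
  | mem x hx =>
    induction hy using Submodule.span_induction with
    | zero => exact (CovConv.zero x s u).symm
    | add y y' hym hym' h1 h2 =>
      exact (CovConv.add (.of_mem hW hym) (.of_mem hW hym')
        (.of_mem hW (Submodule.subset_span hx)) h1.symm h2.symm).symm
    | smul k y _ h1 => exact (h1.symm.smul k).symm
    | mem y hy =>
      obtain ⟨a, b, ξ, hab, hξ, hξK, rfl⟩ := hx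
      obtain ⟨c, d, η, hcd, hη, hηK, rfl⟩ := hy
      exact covConv_elemBlock hW hab hcd hξK hηK s u

lemma tendsto_integral_mul_of_tendsto_eLpNorm {α : Type*} {m : MeasurableSpace α} {μ : Measure α}
    {f g : ℕ → α → ℝ} {F G : α → ℝ} (hf : ∀ k, MemLp (f k) 2 μ) (hg : ∀ k, MemLp (g k) 2 μ)
    (hF : MemLp F 2 μ) (hG : MemLp G 2 μ)
    (h : Tendsto (fun k => eLpNorm (fun a => f k a - F a) 2 μ) atTop (𝓝 0))
    (h' : Tendsto (fun k => eLpNorm (fun a => g k a - G a) 2 μ) atTop (𝓝 0)) :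
    Tendsto (fun k => ∫ a, f k a * g k a ∂μ) atTop (𝓝 (∫ a, F a * G a ∂μ)) := by
  have key : ∀ {a b : α → ℝ} (ha : MemLp a 2 μ) (hb : MemLp b 2 μ),
      inner ℝ (ha.toLp a) (hb.toLp b) = ∫ x, a x * b x ∂μ := by
    intro a b ha hb
    rw [L2.inner_def]
    refine integral_congr_ae ?_
    filter_upwards [ha.coeFn_toLp, hb.coeFn_toLp] with x h1 h2
    rw [h1, h2]
    simp [mul_comm]
  have h1 : Tendsto (fun k => (hf k).toLp (f k)) atTop (𝓝 (hF.toLp F)) :=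
    (Lp.tendsto_Lp_iff_tendsto_eLpNorm'' f hf F hF).2 h
  have h2 : Tendsto (fun k => (hg k).toLp (g k)) atTop (𝓝 (hG.toLp G)) :=
    (Lp.tendsto_Lp_iff_tendsto_eLpNorm'' g hg G hG).2 h'
  simpa only [key] using h1.inner (𝕜 := ℝ) h2

instance : IsFiniteMeasure (prodMeasure P T) := by
  unfold prodMeasure; infer_instance

lemma cellMeasure_le {s u : ℝ≥0} (hu : u ≤ T) : cellMeasure P s u ≤ prodMeasure P T := by
  have hsub : Ioc (s : ℝ) u ⊆ Ioc 0 (T : ℝ) :=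
    Set.Ioc_subset_Ioc s.coe_nonneg (by exact_mod_cast hu)
  have : cellMeasure P s u = (prodMeasure P T).restrict (Ioc (s : ℝ) u ×ˢ Set.univ) := by
    unfold cellMeasure prodMeasure
    rw [← Measure.prod_restrict, Measure.restrict_restrict measurableSet_Ioc,
      Set.inter_eq_left.2 hsub, Measure.restrict_univ]
  rw [this]
  exact Measure.restrict_le_self

/-- An integrand in `L²(dr ⊗ P)` on `[0, T]` together with its Itô integral process. -/
structure IsItoPair (P : Measure Ω) (𝓕 : Filtration ℝ≥0 mΩ) (W : ℝ≥0 → Ω → ℝ) (T : ℝ≥0)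
    (x : ProcPair Ω) : Prop where
  memLp : MemLp (onProd x.1) 2 (prodMeasure P T)
  adapted : ∀ s ≤ T, StronglyMeasurable[𝓕 s] (x.2 s)
  approx : ∃ y : ℕ → ProcPair Ω, (∀ k, y k ∈ elemIntegrals 𝓕 W) ∧
    Tendsto (fun k => eLpNorm (fun q => onProd (y k).1 q - onProd x.1 q) 2 (prodMeasure P T))
      atTop (𝓝 0) ∧
    ∀ s ≤ T, Tendsto (fun k => eLpNorm (fun ω => (y k).2 s ω - x.2 s ω) 2 P) atTop (𝓝 0)

lemma IsItoIntegral.isItoPair {h N : ℝ≥0 → Ω → ℝ} (H : IsItoIntegral P 𝓕 W T h N)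
    (hh : MemLp (onProd h) 2 (prodMeasure P T)) : IsItoPair P 𝓕 W T (h, N) := by
  obtain ⟨S, h1, h2⟩ := H.approx
  exact ⟨hh, H.adapted, fun k => ((S k).val, (S k).integral W), fun k =>
    (S k).mem_elemIntegrals W, h1, h2⟩

namespace IsItoPair

lemma of_mem (hW : IsBrownianBasis P 𝓕 W) (hx : x ∈ elemIntegrals 𝓕 W) :
    IsItoPair P 𝓕 W T x := by
  have hr := ElemRegular.of_mem hW hx
  refine ⟨hr.memLp_onProd _ 2, fun s _ => hr.adapted s, fun _ => x, fun _ => hx, ?_, fun s _ => ?_⟩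
  · simp
  · simp

lemma memLp_eval (hW : IsBrownianBasis P 𝓕 W) (hx : IsItoPair P 𝓕 W T x) {s : ℝ≥0} (hs : s ≤ T) :
    MemLp (x.2 s) 2 P := by
  obtain ⟨y, hy, -, h2⟩ := hx.approx
  obtain ⟨k, hk⟩ := ((h2 s hs).eventually (gt_mem_nhds one_pos)).exists
  have hyk := ElemRegular.of_mem hW (hy k)
  have hd : MemLp (fun ω => (y k).2 s ω - x.2 s ω) 2 P :=
    ⟨((hyk.adapted s).mono (𝓕.le s)).aestronglyMeasurable.sub
      ((hx.adapted s hs).mono (𝓕.le s)).aestronglyMeasurable, hk.trans ENNReal.one_lt_top⟩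
  refine ((hyk.memLp s).sub hd).ae_eq (Eventually.of_forall fun ω => ?_)
  simp

lemma memLp_sub (hW : IsBrownianBasis P 𝓕 W) (hx : IsItoPair P 𝓕 W T x) {s u : ℝ≥0} (hs : s ≤ T)
    (hu : u ≤ T) : MemLp (fun ω => x.2 u ω - x.2 s ω) 2 P :=
  (hx.memLp_eval hW hu).sub (hx.memLp_eval hW hs)

lemma memLp_cell (hx : IsItoPair P 𝓕 W T x) (s : ℝ≥0) {u : ℝ≥0} (hu : u ≤ T) :
    MemLp (onProd x.1) 2 (cellMeasure P s u) := hx.memLp.mono_measure (cellMeasure_le hu)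

lemma add (hx : IsItoPair P 𝓕 W T x) (hy : IsItoPair P 𝓕 W T y) (hW : IsBrownianBasis P 𝓕 W) :
    IsItoPair P 𝓕 W T (x + y) := by
  obtain ⟨a, ha, ha1, ha2⟩ := hx.approx
  obtain ⟨b, hb, hb1, hb2⟩ := hy.approx
  refine ⟨hx.memLp.add hy.memLp, fun s hs => (hx.adapted s hs).add (hy.adapted s hs),
    fun k => a k + b k, fun k => Submodule.add_mem _ (ha k) (hb k), ?_, fun s hs => ?_⟩
  · refine tendsto_of_tendsto_of_tendsto_of_le_of_le tendsto_const_nhds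
      (by simpa using ha1.add hb1) (fun _ => zero_le) fun k => ?_
    have h1 := (((ElemRegular.of_mem hW (ha k)).memLp_onProd (prodMeasure P T) 2).sub hx.memLp)
    have h2 := (((ElemRegular.of_mem hW (hb k)).memLp_onProd (prodMeasure P T) 2).sub hy.memLp)
    refine le_trans (le_of_eq ?_) (eLpNorm_add_le h1.aestronglyMeasurable h2.aestronglyMeasurable
      one_le_two)
    congr 1
    ext q
    simp only [onProd, Prod.fst_add, Pi.add_apply]
    ring
  · refine tendsto_of_tendsto_of_tendsto_of_le_of_le tendsto_const_nhds
      (by simpa using (ha2 s hs).add (hb2 s hs)) (fun _ => zero_le) fun k => ?_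
    have h1 := ((ElemRegular.of_mem hW (ha k)).memLp s).sub (hx.memLp_eval hW hs)
    have h2 := ((ElemRegular.of_mem hW (hb k)).memLp s).sub (hy.memLp_eval hW hs)
    refine le_trans (le_of_eq ?_) (eLpNorm_add_le h1.aestronglyMeasurable h2.aestronglyMeasurable
      one_le_two)
    congr 1
    ext q
    simp only [Prod.snd_add, Pi.add_apply]
    ring

lemma smul (hx : IsItoPair P 𝓕 W T x) (c : ℝ) : IsItoPair P 𝓕 W T (c • x) := by
  obtain ⟨a, ha, ha1, ha2⟩ := hx.approx
  refine ⟨hx.memLp.const_mul c, fun s hs => (hx.adapted s hs).const_mul c,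
    fun k => c • a k, fun k => Submodule.smul_mem _ c (ha k), ?_, fun s hs => ?_⟩
  · have := ENNReal.Tendsto.const_mul (a := ‖c‖ₑ) ha1 (Or.inr enorm_ne_top)
    rw [mul_zero] at this
    refine this.congr fun k => ?_
    rw [← eLpNorm_const_smul]
    congr 1
    ext q
    simp only [onProd, Prod.smul_fst, Pi.smul_apply, smul_eq_mul]
    ring
  · have := ENNReal.Tendsto.const_mul (a := ‖c‖ₑ) (ha2 s hs) (Or.inr enorm_ne_top)
    rw [mul_zero] at this
    refine this.congr fun k => ?_
    rw [← eLpNorm_const_smul]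
    congr 1
    ext q
    simp only [Prod.smul_snd, Pi.smul_apply, smul_eq_mul]
    ring

lemma sub (hx : IsItoPair P 𝓕 W T x) (hy : IsItoPair P 𝓕 W T y) (hW : IsBrownianBasis P 𝓕 W) :
    IsItoPair P 𝓕 W T (x - y) := by
  have := hx.add (hy.smul (-1)) hW
  rwa [neg_one_smul, ← sub_eq_add_neg] at this

lemma eval_zero (hW : IsBrownianBasis P 𝓕 W) (hx : IsItoPair P 𝓕 W T x) :
    x.2 0 =ᵐ[P] 0 := by
  obtain ⟨y, hy, -, h2⟩ := hx.approx
  have h3 := h2 0 (zero_le)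
  have h4 : ∀ k, eLpNorm (fun ω => (y k).2 0 ω - x.2 0 ω) 2 P = eLpNorm (x.2 0) 2 P := by
    intro k
    rw [← eLpNorm_neg]
    congr 1
    ext ω
    simp [(ElemRegular.of_mem hW (hy k)).zero ω]
  simp only [h4] at h3
  have h5 := tendsto_nhds_unique h3 tendsto_const_nhds
  exact (eLpNorm_eq_zero_iff (hx.memLp_eval hW (zero_le)).aestronglyMeasurable
    two_ne_zero).1 h5.symm

lemma tendsto_eLpNorm_sub (hW : IsBrownianBasis P 𝓕 W) (hx : IsItoPair P 𝓕 W T x)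
    {a : ℕ → ProcPair Ω} (ha : ∀ k, a k ∈ elemIntegrals 𝓕 W)
    (h : ∀ s ≤ T, Tendsto (fun k => eLpNorm (fun ω => (a k).2 s ω - x.2 s ω) 2 P) atTop (𝓝 0))
    {s u : ℝ≥0} (hs : s ≤ T) (hu : u ≤ T) :
    Tendsto (fun k => eLpNorm (fun ω => ((a k).2 u ω - (a k).2 s ω) - (x.2 u ω - x.2 s ω)) 2 P)
      atTop (𝓝 0) := by
  refine tendsto_of_tendsto_of_tendsto_of_le_of_le tendsto_const_nhds
    (by simpa using (h u hu).add (h s hs)) (fun _ => zero_le) fun k => ?_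
  have h1 := ((ElemRegular.of_mem hW (ha k)).memLp u).sub (hx.memLp_eval hW hu)
  have h2 := ((ElemRegular.of_mem hW (ha k)).memLp s).sub (hx.memLp_eval hW hs)
  refine le_trans (le_of_eq ?_) (eLpNorm_sub_le h1.aestronglyMeasurable h2.aestronglyMeasurable
    one_le_two)
  congr 1
  ext q
  simp only [Pi.sub_apply]
  ring

lemma zeroMean (hW : IsBrownianBasis P 𝓕 W) (hx : IsItoPair P 𝓕 W T x) {s u : ℝ≥0} (hsu : s ≤ u)
    (hu : u ≤ T) : HasZeroMeanOn P (𝓕 s) (fun ω => x.2 u ω - x.2 s ω) := by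
  intro F hF
  obtain ⟨a, ha, -, ha2⟩ := hx.approx
  have hFm := 𝓕.le s F hF
  have hind : MemLp (F.indicator fun _ => (1 : ℝ)) 2 P := (memLp_const 1).indicator hFm
  have h1 := tendsto_integral_mul_of_tendsto_eLpNorm (μ := P) (g := fun _ => F.indicator fun _ => 1)
    (fun k => (ElemRegular.of_mem hW (ha k)).memLp_sub s u) (fun _ => hind)
    (hx.memLp_sub hW (hsu.trans hu) hu) hind
    (hx.tendsto_eLpNorm_sub hW ha ha2 (hsu.trans hu) hu) (by simp)
  have h2 : ∀ f : Ω → ℝ, ∫ ω, f ω * F.indicator (fun _ => (1 : ℝ)) ω ∂P = ∫ ω in F, f ω ∂P := by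
    intro f
    rw [← integral_indicator hFm]
    congr 1
    ext ω
    by_cases hω : ω ∈ F <;> simp [hω]
  simp only [h2] at h1
  have h3 : ∀ k, ∫ ω in F, ((a k).2 u ω - (a k).2 s ω) ∂P = 0 := fun k =>
    (ElemRegular.of_mem hW (ha k)).zeroMean s u hsu F hF
  simp only [h3] at h1
  exact (tendsto_nhds_unique h1 tendsto_const_nhds)

lemma integrable_mul_cell (hx : IsItoPair P 𝓕 W T x) (hy : IsItoPair P 𝓕 W T y) (s : ℝ≥0)
    {u : ℝ≥0} (hu : u ≤ T) :
    Integrable (fun q => onProd x.1 q * onProd y.1 q) (cellMeasure P s u) :=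
  (hx.memLp_cell s hu).integrable_mul_two (hy.memLp_cell s hu)

lemma integrable_cellInt (hx : IsItoPair P 𝓕 W T x) (hy : IsItoPair P 𝓕 W T y) {s u : ℝ≥0}
    (hsu : s ≤ u) (hu : u ≤ T) : Integrable (cellInt x.1 y.1 s u) P :=
  Liquidation.integrable_cellInt hsu (hx.integrable_mul_cell hy s hu)

/-- Itô isometry. -/
lemma isometry (hW : IsBrownianBasis P 𝓕 W) (hx : IsItoPair P 𝓕 W T x)
    (hy : IsItoPair P 𝓕 W T y) {s u : ℝ≥0} (hsu : s ≤ u) (hu : u ≤ T) :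
    ∫ ω, (x.2 u ω - x.2 s ω) * (y.2 u ω - y.2 s ω) ∂P = ∫ ω, cellInt x.1 y.1 s u ω ∂P := by
  obtain ⟨a, ha, ha1, ha2⟩ := hx.approx
  obtain ⟨b, hb, hb1, hb2⟩ := hy.approx
  rw [← integral_cellMeasure hsu (hx.integrable_mul_cell hy s hu)]
  have hra := fun k => ElemRegular.of_mem hW (ha k)
  have hrb := fun k => ElemRegular.of_mem hW (hb k)
  have h1 := tendsto_integral_mul_of_tendsto_eLpNorm (fun k => (hra k).memLp_sub s u)
    (fun k => (hrb k).memLp_sub s u)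
    (hx.memLp_sub hW (hsu.trans hu) hu) (hy.memLp_sub hW (hsu.trans hu) hu)
    (hx.tendsto_eLpNorm_sub hW ha ha2 (hsu.trans hu) hu)
    (hy.tendsto_eLpNorm_sub hW hb hb2 (hsu.trans hu) hu)
  have hle : ∀ f : ℝ × Ω → ℝ, eLpNorm f 2 (cellMeasure P s u) ≤ eLpNorm f 2 (prodMeasure P T) :=
    fun f => eLpNorm_mono_measure f (cellMeasure_le hu)
  have h2 := tendsto_integral_mul_of_tendsto_eLpNorm
    (fun k => (hra k).memLp_onProd (cellMeasure P s u) 2)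
    (fun k => (hrb k).memLp_onProd (cellMeasure P s u) 2) (hx.memLp_cell s hu) (hy.memLp_cell s hu)
    (tendsto_of_tendsto_of_tendsto_of_le_of_le tendsto_const_nhds ha1 (fun _ => zero_le)
      fun k => hle _)
    (tendsto_of_tendsto_of_tendsto_of_le_of_le tendsto_const_nhds hb1 (fun _ => zero_le)
      fun k => hle _)
  refine tendsto_nhds_unique h1 (h2.congr fun k => ?_)
  rw [integral_sub_mul_sub_of_mem hW (ha k) (hb k) hsu,
    integral_cellMeasure hsu (integrable_onProd_mul (hra k) (hrb k) s u)]

lemma ae_intervalIntegrable (hx : IsItoPair P 𝓕 W T x) (hy : IsItoPair P 𝓕 W T y) :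
    ∀ᵐ ω ∂P, IntervalIntegrable (fun r : ℝ => x.1 r.toNNReal ω * y.1 r.toNNReal ω) volume
      0 (T : ℝ) := by
  have h := hx.memLp.integrable_mul_two hy.memLp
  unfold prodMeasure at h
  filter_upwards [h.prod_left_ae] with ω hω
  rw [intervalIntegrable_iff_integrableOn_Ioc_of_le T.coe_nonneg]
  exact hω

end IsItoPair

lemma intervalIntegrable_sub_interval {f : ℝ → ℝ} (h : IntervalIntegrable f volume 0 (T : ℝ))
    {s u : ℝ≥0} (hs : s ≤ T) (hu : u ≤ T) : IntervalIntegrable f volume (s : ℝ) u := by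
  refine h.mono_set ?_
  rw [Set.uIcc_of_le T.coe_nonneg]
  exact Set.uIcc_subset_Icc ⟨s.coe_nonneg, by exact_mod_cast hs⟩
    ⟨u.coe_nonneg, by exact_mod_cast hu⟩

lemma cellInt_self_nonneg (h : ℝ≥0 → Ω → ℝ) {s u : ℝ≥0} (hsu : s ≤ u) (ω : Ω) :
    0 ≤ cellInt h h s u ω :=
  intervalIntegral.integral_nonneg (by exact_mod_cast hsu) fun r _ => mul_self_nonneg _

lemma sum_cellInt {h h' : ℝ≥0 → Ω → ℝ} {ω : Ω}
    (hi : IntervalIntegrable (fun r : ℝ => h r.toNNReal ω * h' r.toNNReal ω) volume 0 (T : ℝ))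
    {s u : ℝ≥0} (hu : u ≤ T) (π : TimePartition s u) :
    ∑ i ∈ range π.n, cellInt h h' (π.pt i) (π.pt (i + 1)) ω = cellInt h h' s u ω :=
  π.sum_integral (intervalIntegrable_sub_interval hi (π.le.trans hu) hu)

lemma abs_cellInt_le {h h' : ℝ≥0 → Ω → ℝ} {ω : Ω}
    (hi : IntervalIntegrable (fun r : ℝ => h r.toNNReal ω * h r.toNNReal ω) volume 0 (T : ℝ))
    (hi' : IntervalIntegrable (fun r : ℝ => h' r.toNNReal ω * h' r.toNNReal ω) volume 0 (T : ℝ))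
    {s u : ℝ≥0} (hsu : s ≤ u) (hu : u ≤ T) {l : ℝ} (hl : 0 < l) :
    |cellInt h h' s u ω| ≤ (l * cellInt h h s u ω + l⁻¹ * cellInt h' h' s u ω) / 2 := by
  have hsu' : (s : ℝ) ≤ u := by exact_mod_cast hsu
  have h1 := intervalIntegrable_sub_interval hi (hsu.trans hu) hu
  have h2 := intervalIntegrable_sub_interval hi' (hsu.trans hu) hu
  unfold cellInt
  rw [← intervalIntegral.integral_const_mul, ← intervalIntegral.integral_const_mul,
    ← intervalIntegral.integral_add (h1.const_mul _) (h2.const_mul _),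
    ← intervalIntegral.integral_div]
  rw [← Real.norm_eq_abs]
  refine intervalIntegral.norm_integral_le_of_norm_le hsu' (Eventually.of_forall fun r _ => ?_)
    (((h1.const_mul _).add (h2.const_mul _)).div_const 2)
  rw [Real.norm_eq_abs, abs_le]
  have e1 : 0 ≤ l⁻¹ * (l * h r.toNNReal ω - h' r.toNNReal ω) ^ 2 := by positivity
  have e2 : 0 ≤ l⁻¹ * (l * h r.toNNReal ω + h' r.toNNReal ω) ^ 2 := by positivity
  have e3 : l⁻¹ * l = 1 := inv_mul_cancel₀ hl.ne'
  have e4 : ∀ a b : ℝ, l⁻¹ * (l * a - b) ^ 2 = l * (a * a) - 2 * (a * b) + l⁻¹ * (b * b) := by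
    intro a b
    linear_combination (l * a ^ 2 - 2 * a * b) * e3
  have e5 : ∀ a b : ℝ, l⁻¹ * (l * a + b) ^ 2 = l * (a * a) + 2 * (a * b) + l⁻¹ * (b * b) := by
    intro a b
    linear_combination (l * a ^ 2 + 2 * a * b) * e3
  rw [e4] at e1
  rw [e5] at e2
  constructor <;> linarith

namespace IsItoPair

lemma integrable_covDefect (hW : IsBrownianBasis P 𝓕 W) (hx : IsItoPair P 𝓕 W T x)
    (hy : IsItoPair P 𝓕 W T y) {s u : ℝ≥0} (hu : u ≤ T) (π : TimePartition s u) (c : ℕ → ℝ) :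
    Integrable (covDefect x y π c) P :=
  integrable_finsetSum _ fun i hi => by
    have hi1 := (π.pt_le (Finset.mem_range.1 hi)).trans hu
    have hi0 := (π.mono (Nat.le_succ i)).trans hi1
    exact (((hx.memLp_sub hW hi0 hi1).integrable_mul_two (hy.memLp_sub hW hi0 hi1)).sub
      (hx.integrable_cellInt hy (π.mono (Nat.le_succ i)) hi1)).const_mul _

lemma integral_cellInt_le (hx : IsItoPair P 𝓕 W T x) {s u : ℝ≥0} (hsu : s ≤ u) (hu : u ≤ T) :
    ∫ ω, cellInt x.1 x.1 s u ω ∂P ≤ ∫ q, onProd x.1 q * onProd x.1 q ∂(prodMeasure P T) := by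
  rw [← integral_cellMeasure hsu (hx.integrable_mul_cell hx s hu)]
  exact integral_mono_measure (cellMeasure_le hu)
    (Eventually.of_forall fun q => mul_self_nonneg _) (hx.memLp.integrable_mul_two hx.memLp)

lemma integral_abs_covDefect_le (hW : IsBrownianBasis P 𝓕 W) (hx : IsItoPair P 𝓕 W T x)
    (hy : IsItoPair P 𝓕 W T y) {s u : ℝ≥0} (hu : u ≤ T) (π : TimePartition s u) {c : ℕ → ℝ}
    (hc : ∀ i, |c i| ≤ 1) {l : ℝ} (hl : 0 < l) :
    ∫ ω, |covDefect x y π c ω| ∂P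
      ≤ l * ∫ q, onProd x.1 q * onProd x.1 q ∂(prodMeasure P T)
        + l⁻¹ * ∫ q, onProd y.1 q * onProd y.1 q ∂(prodMeasure P T) := by
  have hm : ∀ i ∈ range π.n, π.pt (i + 1) ≤ T := fun i hi =>
    (π.pt_le (Finset.mem_range.1 hi)).trans hu
  have hm' : ∀ i ∈ range π.n, π.pt i ≤ T := fun i hi =>
    (π.mono (Nat.le_succ i)).trans (hm i hi)
  set f : ℕ → Ω → ℝ := fun i ω =>
    (l / 2) * ((x.2 (π.pt (i + 1)) ω - x.2 (π.pt i) ω) * (x.2 (π.pt (i + 1)) ω - x.2 (π.pt i) ω))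
    + (l⁻¹ / 2) * ((y.2 (π.pt (i + 1)) ω - y.2 (π.pt i) ω)
      * (y.2 (π.pt (i + 1)) ω - y.2 (π.pt i) ω)) with hf
  set g : ℕ → Ω → ℝ := fun i ω => (l / 2) * cellInt x.1 x.1 (π.pt i) (π.pt (i + 1)) ω
    + (l⁻¹ / 2) * cellInt y.1 y.1 (π.pt i) (π.pt (i + 1)) ω with hg
  have hxi : ∀ i ∈ range π.n, Integrable (fun ω => (x.2 (π.pt (i + 1)) ω - x.2 (π.pt i) ω)
      * (x.2 (π.pt (i + 1)) ω - x.2 (π.pt i) ω)) P := fun i hi =>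
    (hx.memLp_sub hW (hm' i hi) (hm i hi)).integrable_mul_two
      (hx.memLp_sub hW (hm' i hi) (hm i hi))
  have hyi : ∀ i ∈ range π.n, Integrable (fun ω => (y.2 (π.pt (i + 1)) ω - y.2 (π.pt i) ω)
      * (y.2 (π.pt (i + 1)) ω - y.2 (π.pt i) ω)) P := fun i hi =>
    (hy.memLp_sub hW (hm' i hi) (hm i hi)).integrable_mul_two
      (hy.memLp_sub hW (hm' i hi) (hm i hi))
  have hxc : ∀ i ∈ range π.n, Integrable (cellInt x.1 x.1 (π.pt i) (π.pt (i + 1))) P :=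
    fun i hi => hx.integrable_cellInt hx (π.mono (Nat.le_succ i)) (hm i hi)
  have hyc : ∀ i ∈ range π.n, Integrable (cellInt y.1 y.1 (π.pt i) (π.pt (i + 1))) P :=
    fun i hi => hy.integrable_cellInt hy (π.mono (Nat.le_succ i)) (hm i hi)
  have hfi : ∀ i ∈ range π.n, Integrable (f i) P := fun i hi =>
    ((hxi i hi).const_mul _).add ((hyi i hi).const_mul _)
  have hgi : ∀ i ∈ range π.n, Integrable (g i) P := fun i hi =>
    ((hxc i hi).const_mul _).add ((hyc i hi).const_mul _)
  have hfg : ∀ i ∈ range π.n, ∫ ω, f i ω ∂P = ∫ ω, g i ω ∂P := by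
    intro i hi
    simp only [hf, hg]
    rw [integral_add ((hxi i hi).const_mul _) ((hyi i hi).const_mul _),
      integral_add ((hxc i hi).const_mul _) ((hyc i hi).const_mul _)]
    simp only [integral_const_mul]
    rw [hx.isometry hW hx (π.mono (Nat.le_succ i)) (hm i hi),
      hy.isometry hW hy (π.mono (Nat.le_succ i)) (hm i hi)]
  have hpt : ∀ᵐ ω ∂P, |covDefect x y π c ω| ≤ ∑ i ∈ range π.n, (f i ω + g i ω) := by
    filter_upwards [hx.ae_intervalIntegrable hx, hy.ae_intervalIntegrable hy] with ω h1 h2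
    refine (abs_sum_le_sum_abs _ _).trans (sum_le_sum fun i hi => ?_)
    rw [abs_mul]
    have e1 := abs_cellInt_le h1 h2 (π.mono (Nat.le_succ i)) (hm i hi) hl
    set a := x.2 (π.pt (i + 1)) ω - x.2 (π.pt i) ω
    set b := y.2 (π.pt (i + 1)) ω - y.2 (π.pt i) ω
    have e2 : |a * b| ≤ (l / 2) * (a * a) + (l⁻¹ / 2) * (b * b) := by
      have e3 : l⁻¹ * l = 1 := inv_mul_cancel₀ hl.ne'
      have e4 : 0 ≤ l⁻¹ * (l * a - b) ^ 2 := by positivity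
      have e5 : 0 ≤ l⁻¹ * (l * a + b) ^ 2 := by positivity
      have e6 : l⁻¹ * (l * a - b) ^ 2 = l * (a * a) - 2 * (a * b) + l⁻¹ * (b * b) := by
        linear_combination (l * a ^ 2 - 2 * a * b) * e3
      have e7 : l⁻¹ * (l * a + b) ^ 2 = l * (a * a) + 2 * (a * b) + l⁻¹ * (b * b) := by
        linear_combination (l * a ^ 2 + 2 * a * b) * e3
      rw [e6] at e4
      rw [e7] at e5
      rw [abs_le]
      constructor <;> linarith
    have e8 : |a * b - cellInt x.1 y.1 (π.pt i) (π.pt (i + 1)) ω| ≤ f i ω + g i ω := by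
      refine (abs_sub _ _).trans ?_
      simp only [hf, hg]
      linarith
    calc |c i| * |a * b - cellInt x.1 y.1 (π.pt i) (π.pt (i + 1)) ω|
        ≤ 1 * |a * b - cellInt x.1 y.1 (π.pt i) (π.pt (i + 1)) ω| :=
          mul_le_mul_of_nonneg_right (hc i) (abs_nonneg _)
      _ ≤ f i ω + g i ω := by rwa [one_mul]
  have hxs := integral_congr_ae (μ := P) (f := fun ω => ∑ i ∈ range π.n, g i ω)
    (g := fun ω => (l / 2) * cellInt x.1 x.1 s u ω + (l⁻¹ / 2) * cellInt y.1 y.1 s u ω) (by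
      filter_upwards [hx.ae_intervalIntegrable hx, hy.ae_intervalIntegrable hy] with ω h1 h2
      simp only [hg]
      rw [sum_add_distrib, ← mul_sum, ← mul_sum, sum_cellInt h1 hu,
        sum_cellInt h2 hu])
  rw [integral_finsetSum _ hgi, integral_add ((hx.integrable_cellInt hx π.le hu).const_mul _)
    ((hy.integrable_cellInt hy π.le hu).const_mul _), integral_const_mul, integral_const_mul] at hxs
  calc ∫ ω, |covDefect x y π c ω| ∂P ≤ ∫ ω, ∑ i ∈ range π.n, (f i ω + g i ω) ∂P :=
        integral_mono_ae (hx.integrable_covDefect hW hy hu π c).abs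
          (integrable_finsetSum _ fun i hi => (hfi i hi).add (hgi i hi)) hpt
    _ = ∑ i ∈ range π.n, (∫ ω, g i ω ∂P + ∫ ω, g i ω ∂P) := by
        rw [integral_finsetSum _ fun i hi => (hfi i hi).fun_add (hgi i hi)]
        refine sum_congr rfl fun i hi => ?_
        rw [integral_add (hfi i hi) (hgi i hi), hfg i hi]
    _ = l * ∫ ω, cellInt x.1 x.1 s u ω ∂P + l⁻¹ * ∫ ω, cellInt y.1 y.1 s u ω ∂P := by
        rw [sum_add_distrib, hxs]; ring
    _ ≤ _ := add_le_add (mul_le_mul_of_nonneg_left (hx.integral_cellInt_le π.le hu) hl.le)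
        (mul_le_mul_of_nonneg_left (hy.integral_cellInt_le π.le hu) (by positivity))

lemma covDefect_sub_ae (hx : IsItoPair P 𝓕 W T x) {x' : ProcPair Ω} (hx' : IsItoPair P 𝓕 W T x')
    (hy : IsItoPair P 𝓕 W T y) {s u : ℝ≥0} (hu : u ≤ T) (π : TimePartition s u) (c : ℕ → ℝ) :
    ∀ᵐ ω ∂P, covDefect x y π c ω = covDefect (x - x') y π c ω + covDefect x' y π c ω := by
  filter_upwards [hx.ae_intervalIntegrable hy, hx'.ae_intervalIntegrable hy] with ω h1 h2
  unfold covDefect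
  rw [← sum_add_distrib]
  refine sum_congr rfl fun i hi => ?_
  have hi1 := (π.pt_le (Finset.mem_range.1 hi)).trans hu
  have hi0 := (π.mono (Nat.le_succ i)).trans hi1
  have e1 : cellInt (x - x').1 y.1 (π.pt i) (π.pt (i + 1)) ω
      = cellInt x.1 y.1 (π.pt i) (π.pt (i + 1)) ω
        - cellInt x'.1 y.1 (π.pt i) (π.pt (i + 1)) ω := by
    simp only [cellInt]
    rw [← intervalIntegral.integral_sub (intervalIntegrable_sub_interval h1 hi0 hi1)
      (intervalIntegrable_sub_interval h2 hi0 hi1)]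
    simp only [Prod.fst_sub, Pi.sub_apply, sub_mul]
  rw [e1]
  simp only [Prod.snd_sub, Pi.sub_apply]
  ring

lemma tendsto_integral_sq_sub (hW : IsBrownianBasis P 𝓕 W) (hx : IsItoPair P 𝓕 W T x)
    {a : ℕ → ProcPair Ω} (ha : ∀ k, a k ∈ elemIntegrals 𝓕 W)
    (h : Tendsto (fun k => eLpNorm (fun q => onProd (a k).1 q - onProd x.1 q) 2 (prodMeasure P T))
      atTop (𝓝 0)) :
    Tendsto (fun k => ∫ q, onProd (x - a k).1 q * onProd (x - a k).1 q ∂(prodMeasure P T))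
      atTop (𝓝 0) := by
  have hd : ∀ k, MemLp (fun q => onProd (a k).1 q - onProd x.1 q) 2 (prodMeasure P T) := fun k =>
    ((ElemRegular.of_mem hW (ha k)).memLp_onProd _ 2).sub hx.memLp
  have := tendsto_integral_mul_of_tendsto_eLpNorm (F := fun _ => 0) (G := fun _ => 0) hd hd
    MemLp.zero MemLp.zero (by simpa using h) (by simpa using h)
  simp only [mul_zero, integral_zero] at this
  refine this.congr fun k => integral_congr_ae (Eventually.of_forall fun q => ?_)
  simp only [onProd, Prod.fst_sub, Pi.sub_apply]
  ring

/-- Covariation of Itô integrals along deterministic partitions. -/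
lemma covConv (hW : IsBrownianBasis P 𝓕 W) (hx : IsItoPair P 𝓕 W T x)
    (hy : IsItoPair P 𝓕 W T y) (s : ℝ≥0) {u : ℝ≥0} (hu : u ≤ T) : CovConv P x y s u := by
  intro ε hε
  obtain ⟨a, ha, ha1, -⟩ := hx.approx
  obtain ⟨b, hb, hb1, -⟩ := hy.approx
  set A := ∫ q, onProd y.1 q * onProd y.1 q ∂(prodMeasure P T) with hA
  have hA0 : 0 ≤ A := integral_nonneg fun q => mul_self_nonneg _
  set l := 5 * (A + 1) / ε with hl
  have hl0 : 0 < l := by positivity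
  obtain ⟨k, hk⟩ := ((hx.tendsto_integral_sq_sub hW ha ha1).eventually
    (gt_mem_nhds (show 0 < ε / (5 * l) by positivity))).exists
  have hak : IsItoPair P 𝓕 W T (a k) := .of_mem hW (ha k)
  set B := ∫ q, onProd (a k).1 q * onProd (a k).1 q ∂(prodMeasure P T) with hB
  have hB0 : 0 ≤ B := integral_nonneg fun q => mul_self_nonneg _
  set l' := 5 * (B + 1) / ε with hl'
  have hl'0 : 0 < l' := by positivity
  obtain ⟨j, hj⟩ := ((hy.tendsto_integral_sq_sub hW hb hb1).eventually
    (gt_mem_nhds (show 0 < ε / (5 * l') by positivity))).exists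
  have hbj : IsItoPair P 𝓕 W T (b j) := .of_mem hW (hb j)
  obtain ⟨η, hη, hd⟩ := covConv_of_mem hW (ha k) (hb j) s u (ε / 5) (by positivity)
  refine ⟨η, hη, fun π hπ c hc => ?_⟩
  have h1 := (hx.sub hak hW).integral_abs_covDefect_le hW hy hu π hc hl0
  have h2 := (hy.sub hbj hW).integral_abs_covDefect_le hW hak hu π hc hl'0
  have h3 := hd π hπ c hc
  have hi1 := (hx.sub hak hW).integrable_covDefect hW hy hu π c
  have hi2 := (hy.sub hbj hW).integrable_covDefect hW hak hu π c
  have hi3 := hak.integrable_covDefect hW hbj hu π c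
  have hpt : ∀ᵐ ω ∂P, |covDefect x y π c ω| ≤ |covDefect (x - a k) y π c ω|
      + (|covDefect (y - b j) (a k) π c ω| + |covDefect (a k) (b j) π c ω|) := by
    filter_upwards [hx.covDefect_sub_ae hak hy hu π c, hy.covDefect_sub_ae hbj hak hu π c]
      with ω e1 e2
    rw [e1, covDefect_comm (a k) y, e2, covDefect_comm (b j)]
    exact (abs_add_le _ _).trans (add_le_add le_rfl (abs_add_le _ _))
  have h4 := integral_mono_ae (hx.integrable_covDefect hW hy hu π c).abs
    (hi1.abs.add (hi2.abs.add hi3.abs)) hpt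
  rw [integral_add' hi1.abs (hi2.abs.add hi3.abs), integral_add' hi2.abs hi3.abs] at h4
  have e1 : l * (ε / (5 * l)) = ε / 5 := by field_simp
  have e2 : l' * (ε / (5 * l')) = ε / 5 := by field_simp
  have e3 : l⁻¹ * A ≤ ε / 5 := by
    rw [hl, inv_div, div_mul_eq_mul_div, div_le_div_iff₀ (by positivity) (by positivity)]
    nlinarith
  have e4 : l'⁻¹ * B ≤ ε / 5 := by
    rw [hl', inv_div, div_mul_eq_mul_div, div_le_div_iff₀ (by positivity) (by positivity)]
    nlinarith
  have e5 := mul_le_mul_of_nonneg_left hk.le hl0.le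
  have e6 := mul_le_mul_of_nonneg_left hj.le hl'0.le
  linarith

end IsItoPair

/-- Every subsequence of `f` has a further subsequence that converges almost surely to `F`. -/
def TendstoAESubseq (P : Measure Ω) (f : ℕ → Ω → ℝ) (F : Ω → ℝ) : Prop :=
  ∀ ns : ℕ → ℕ, StrictMono ns → ∃ ms : ℕ → ℕ, StrictMono ms ∧
    ∀ᵐ ω ∂P, Tendsto (fun k => f (ns (ms k)) ω) atTop (𝓝 (F ω))

namespace TendstoAESubseq

variable {f g : ℕ → Ω → ℝ} {F G : Ω → ℝ}

lemma of_ae (h : ∀ᵐ ω ∂P, Tendsto (fun k => f k ω) atTop (𝓝 (F ω))) : TendstoAESubseq P f F :=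
  fun ns hns => ⟨id, strictMono_id, by
    filter_upwards [h] with ω hω using hω.comp hns.tendsto_atTop⟩

lemma of_tendstoInMeasure (h : TendstoInMeasure P f atTop F) : TendstoAESubseq P f F := by
  intro ns hns
  obtain ⟨ms, hms, hae⟩ := (h.comp hns.tendsto_atTop).exists_seq_tendsto_ae
  exact ⟨ms, hms, hae⟩

lemma tendstoInMeasure (h : TendstoAESubseq P f F) (hf : ∀ k, AEStronglyMeasurable (f k) P) :
    TendstoInMeasure P f atTop F :=
  (exists_seq_tendstoInMeasure_atTop_iff hf).2 h

lemma aestronglyMeasurable (h : TendstoAESubseq P f F) (hf : ∀ k, AEStronglyMeasurable (f k) P) :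
    AEStronglyMeasurable F P :=
  TendstoInMeasure.aestronglyMeasurable hf (h.tendstoInMeasure hf)

lemma exists_seq (h : TendstoAESubseq P f F) : ∃ ms : ℕ → ℕ, StrictMono ms ∧
    ∀ᵐ ω ∂P, Tendsto (fun k => f (ms k) ω) atTop (𝓝 (F ω)) := h id strictMono_id

/-- Limits may be transported along almost sure implications between convergences. -/
lemma map {f' : ℕ → Ω → ℝ} {F' : Ω → ℝ} (h : TendstoAESubseq P f F)
    (himp : ∀ᵐ ω ∂P, ∀ ns : ℕ → ℕ, StrictMono ns → Tendsto (fun k => f (ns k) ω) atTop (𝓝 (F ω)) →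
      Tendsto (fun k => f' (ns k) ω) atTop (𝓝 (F' ω))) : TendstoAESubseq P f' F' := by
  intro ns hns
  obtain ⟨ms, hms, hae⟩ := h ns hns
  refine ⟨ms, hms, ?_⟩
  filter_upwards [hae, himp] with ω h1 h2
  exact h2 _ (hns.comp hms) h1

lemma add (h : TendstoAESubseq P f F) (h' : TendstoAESubseq P g G) :
    TendstoAESubseq P (fun k ω => f k ω + g k ω) (fun ω => F ω + G ω) := by
  intro ns hns
  obtain ⟨ms, hms, hae⟩ := h ns hns
  obtain ⟨ls, hls, hae'⟩ := h' (ns ∘ ms) (hns.comp hms)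
  refine ⟨ms ∘ ls, hms.comp hls, ?_⟩
  filter_upwards [hae, hae'] with ω h1 h2
  exact (h1.comp hls.tendsto_atTop).add h2

lemma mul_left (h : TendstoAESubseq P f F) (a : Ω → ℝ) :
    TendstoAESubseq P (fun k ω => a ω * f k ω) (fun ω => a ω * F ω) :=
  h.map (Eventually.of_forall fun _ _ _ hω => hω.const_mul _)

lemma sub (h : TendstoAESubseq P f F) (h' : TendstoAESubseq P g G) :
    TendstoAESubseq P (fun k ω => f k ω - g k ω) (fun ω => F ω - G ω) := by
  have := h.add (h'.mul_left fun _ => -1)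
  simpa [sub_eq_add_neg] using this

lemma congr (h : TendstoAESubseq P f F) (hf : ∀ᵐ ω ∂P, ∀ k, f k ω = g k ω)
    (hF : ∀ᵐ ω ∂P, F ω = G ω) : TendstoAESubseq P g G := by
  refine h.map ?_
  filter_upwards [hf, hF] with ω h1 h2 ns _ h3
  rw [← h2]
  exact h3.congr fun k => h1 _

lemma unique (h : TendstoAESubseq P f F) (h' : TendstoAESubseq P f G) : F =ᵐ[P] G := by
  obtain ⟨ms, hms, hae⟩ := h.exists_seq
  obtain ⟨ls, hls, hae'⟩ := h' ms hms
  filter_upwards [hae, hae'] with ω h1 h2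
  exact tendsto_nhds_unique (h1.comp hls.tendsto_atTop) h2

lemma of_integral_abs (hf : ∀ k, Integrable (f k) P)
    (h : Tendsto (fun k => ∫ ω, |f k ω| ∂P) atTop (𝓝 0)) :
    TendstoAESubseq P f (fun _ => 0) := by
  refine of_tendstoInMeasure (tendstoInMeasure_of_tendsto_eLpNorm one_ne_zero
    (fun k => (hf k).aestronglyMeasurable) aestronglyMeasurable_const ?_)
  have h1 : ∀ k, eLpNorm (f k - fun _ => 0) 1 P = ENNReal.ofReal (∫ ω, |f k ω| ∂P) := by
    intro k
    have : (f k - fun _ => (0 : ℝ)) = f k := by ext; simp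
    rw [this, eLpNorm_one_eq_lintegral_enorm, ← ofReal_integral_norm_eq_lintegral_enorm (hf k)]
    rfl
  simp only [h1]
  have := ENNReal.tendsto_ofReal h
  rwa [ENNReal.ofReal_zero] at this

lemma of_integral_sq (hf : ∀ k, MemLp (f k) 2 P)
    (h : Tendsto (fun k => ∫ ω, f k ω ^ 2 ∂P) atTop (𝓝 0)) :
    TendstoAESubseq P f (fun _ => 0) := by
  refine of_integral_abs (fun k => (hf k).integrable one_le_two) ?_
  have h1 := (Real.continuous_sqrt.tendsto 0).comp h
  rw [Real.sqrt_zero] at h1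
  exact tendsto_of_tendsto_of_tendsto_of_le_of_le tendsto_const_nhds h1
    (fun k => integral_nonneg fun ω => abs_nonneg _) fun k => integral_abs_le_sqrt (hf k) le_rfl

end TendstoAESubseq

lemma ConvergesAlongPartitions.tendstoAESubseq {t s : ℝ≥0} {S : TimePartition t s → Ω → ℝ}
    {L : Ω → ℝ} (h : ConvergesAlongPartitions P S L) {π : ℕ → TimePartition t s}
    (hπ : MeshTendsto π) : TendstoAESubseq P (fun k => S (π k)) L := by
  refine .of_tendstoInMeasure (tendstoInMeasure_iff_dist.2 fun ε hε => ?_)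
  rw [ENNReal.tendsto_nhds_zero]
  intro δ hδ
  rcases eq_or_ne δ ⊤ with rfl | hδ'
  · exact Eventually.of_forall fun _ => le_top
  obtain ⟨η, hη, hd⟩ := h ε hε δ.toReal (ENNReal.toReal_pos hδ.ne' hδ')
  filter_upwards [hπ η hη] with k hk
  have := hd (π k) hk
  rw [ENNReal.ofReal_toReal hδ'] at this
  simpa only [Real.dist_eq] using this

lemma convergesAlongPartitions_of_seq {t s : ℝ≥0} {S : TimePartition t s → Ω → ℝ}
    {L : Ω → ℝ} (hS : ∀ π, AEStronglyMeasurable (S π) P)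
    (h : ∀ π : ℕ → TimePartition t s, MeshTendsto π → TendstoAESubseq P (fun k => S (π k)) L) :
    ConvergesAlongPartitions P S L := by
  intro ε hε δ hδ
  by_contra hcon
  push Not at hcon
  choose π hπ hbad using fun k : ℕ => hcon (1 / ((k : ℝ) + 1)) (by positivity)
  have hmesh : MeshTendsto π := by
    intro η hη
    filter_upwards [tendsto_one_div_add_atTop_nhds_zero_nat.eventually (gt_mem_nhds hη)] with k hk
    exact fun i hi => (hπ k i hi).trans hk
  have h1 := tendstoInMeasure_iff_dist.1 ((h π hmesh).tendstoInMeasure fun k => hS _) ε hε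
  obtain ⟨k, hk⟩ := (h1.eventually (gt_mem_nhds (ENNReal.ofReal_pos.2 hδ))).exists
  simp only [Real.dist_eq] at hk
  exact absurd (hbad k) (not_lt.2 hk.le)

namespace IsItoPair

lemma tendstoAESubseq_covDefect (hW : IsBrownianBasis P 𝓕 W) (hx : IsItoPair P 𝓕 W T x)
    (hy : IsItoPair P 𝓕 W T y) {s u : ℝ≥0} (hu : u ≤ T) {π : ℕ → TimePartition s u}
    (hπ : MeshTendsto π) {c : ℕ → ℕ → ℝ} {K : ℝ} (hc : ∀ k, ∀ i < (π k).n, |c k i| ≤ K) :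
    TendstoAESubseq P (fun k => covDefect x y (π k) (c k)) (fun _ => 0) := by
  refine .of_integral_abs (fun k => hx.integrable_covDefect hW hy hu _ _) ?_
  rw [Metric.tendsto_atTop']
  intro ε hε
  set C := |K| + 1 with hC
  have hCpos : 0 < C := by positivity
  obtain ⟨η, hη, hd⟩ := hx.covConv hW hy s hu (ε / (2 * C)) (by positivity)
  obtain ⟨n, hn⟩ := eventually_atTop.1 (hπ η hη)
  refine ⟨n, fun k hk => ?_⟩
  set c' : ℕ → ℝ := fun i => if i < (π k).n then C⁻¹ * c k i else 0 with hc'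
  have h1 := hd (π k) (hn k hk.le) c' (fun i => by
    simp only [hc']
    split_ifs with hi
    · rw [abs_mul, abs_inv, abs_of_pos hCpos, inv_mul_le_iff₀ hCpos, mul_one]
      exact (hc k i hi).trans ((le_abs_self K).trans (by linarith))
    · simp)
  have h2 : ∀ ω, |covDefect x y (π k) (c k) ω| = C * |covDefect x y (π k) c' ω| := by
    intro ω
    suffices this : covDefect x y (π k) (c k) ω = C * covDefect x y (π k) c' ω by
      rw [this, abs_mul, abs_of_pos hCpos]
    unfold covDefect
    rw [mul_sum]
    refine sum_congr rfl fun i hi => ?_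
    simp only [hc', Finset.mem_range.1 hi, if_true]
    field_simp
  simp only [h2]
  rw [integral_const_mul, Real.dist_eq, sub_zero, abs_mul, abs_of_pos hCpos,
    abs_of_nonneg (integral_nonneg fun ω => abs_nonneg _)]
  have h3 := mul_le_mul_of_nonneg_left h1 hCpos.le
  have h4 : C * (ε / (2 * C)) = ε / 2 := by field_simp
  linarith

/-- Weighted covariation sums of Itô integrals. -/
lemma tendstoAESubseq_sum (hW : IsBrownianBasis P 𝓕 W) (hx : IsItoPair P 𝓕 W T x)
    (hy : IsItoPair P 𝓕 W T y) {s u : ℝ≥0} (hu : u ≤ T) {π : ℕ → TimePartition s u}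
    (hπ : MeshTendsto π) {g : ℝ → ℝ} (hg : ContinuousOn g (Icc (s : ℝ) u)) :
    TendstoAESubseq P (fun k ω => ∑ i ∈ range (π k).n, g ((π k).pt i) *
        ((x.2 ((π k).pt (i + 1)) ω - x.2 ((π k).pt i) ω)
          * (y.2 ((π k).pt (i + 1)) ω - y.2 ((π k).pt i) ω)))
      (fun ω => ∫ r in (s : ℝ)..u, g r * (x.1 r.toNNReal ω * y.1 r.toNNReal ω)) := by
  obtain ⟨K, hK⟩ := exists_bound_of_continuousOn hg
  have h1 := hx.tendstoAESubseq_covDefect hW hy hu hπ (c := fun k i => g ((π k).pt i))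
    (K := K) fun k i hi => hK _ ((π k).mem_Icc hi.le)
  have h2 : TendstoAESubseq P (fun k ω => ∑ i ∈ range (π k).n, g ((π k).pt i) *
      cellInt x.1 y.1 ((π k).pt i) ((π k).pt (i + 1)) ω)
      (fun ω => ∫ r in (s : ℝ)..u, g r * (x.1 r.toNNReal ω * y.1 r.toNNReal ω)) := by
    refine .of_ae ?_
    filter_upwards [hx.ae_intervalIntegrable hy] with ω hω
    have hp := IsPrimitiveOn.of_intervalIntegrable
      (intervalIntegrable_sub_interval hω ((π 0).le.trans hu) hu) 0
    refine (tendsto_sum_left hπ hp hg).congr fun k => sum_congr rfl fun i hi => ?_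
    have hi := Finset.mem_range.1 hi
    rw [hp.sub_eq ((π k).mem_Icc hi.le) ((π k).mem_Icc hi)]
    rfl
  refine (h1.add h2).congr (Eventually.of_forall fun ω k => ?_)
    (Eventually.of_forall fun ω => zero_add _)
  unfold covDefect
  rw [← sum_add_distrib]
  exact sum_congr rfl fun i _ => by ring

/-- The Itô integral is determined by its integrand. -/
lemma ae_eq_of_fst_eq (hW : IsBrownianBasis P 𝓕 W) (hx : IsItoPair P 𝓕 W T x)
    (hy : IsItoPair P 𝓕 W T y) (h : x.1 = y.1) {s : ℝ≥0} (hs : s ≤ T) : x.2 s =ᵐ[P] y.2 s := by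
  have hd := hx.sub hy hW
  have h1 := hd.isometry hW hd (zero_le) hs
  have h2 : (x - y).1 = 0 := by rw [Prod.fst_sub, h, sub_self]
  rw [h2] at h1
  have h3 : ∫ ω, ((x - y).2 s ω - (x - y).2 0 ω) * ((x - y).2 s ω - (x - y).2 0 ω) ∂P = 0 := by
    rw [h1]; simp [cellInt]
  have hm := hd.memLp_sub hW (zero_le) hs
  rw [integral_eq_zero_iff_of_nonneg (fun ω => mul_self_nonneg _) (hm.integrable_mul_two hm)] at h3
  filter_upwards [h3, hd.eval_zero hW] with ω h4 h5
  have h6 := mul_self_eq_zero.1 h4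
  rw [h5] at h6
  simp only [Prod.snd_sub, Pi.sub_apply, Pi.zero_apply, sub_zero] at h6
  linarith

lemma ae_forall_eq_of_fst_eq (hW : IsBrownianBasis P 𝓕 W) (hx : IsItoPair P 𝓕 W T x)
    (hy : IsItoPair P 𝓕 W T y) (h : x.1 = y.1)
    (hxc : ∀ᵐ ω ∂P, ContinuousOn (fun s => x.2 s ω) (Icc 0 T))
    (hyc : ∀ᵐ ω ∂P, ContinuousOn (fun s => y.2 s ω) (Icc 0 T)) :
    ∀ᵐ ω ∂P, ∀ s ≤ T, x.2 s ω = y.2 s ω := by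
  obtain ⟨D, hD, hDd⟩ := TopologicalSpace.exists_countable_dense (Icc (0 : ℝ≥0) T)
  have h1 : ∀ᵐ ω ∂P, ∀ d ∈ D, x.2 d.1 ω = y.2 d.1 ω := by
    rw [ae_ball_iff hD]
    exact fun d _ => hx.ae_eq_of_fst_eq hW hy h d.2.2
  filter_upwards [h1, hxc, hyc] with ω h2 h3 h4 s hs
  have h5 := Continuous.ext_on hDd (continuousOn_iff_continuous_domRestrict.1 h3)
    (continuousOn_iff_continuous_domRestrict.1 h4) (fun d hd => h2 d hd)
  exact congrFun h5 ⟨s, zero_le, hs⟩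

end IsItoPair

lemma continuousOn_comp_toNNReal {f : ℝ≥0 → ℝ} {s u : ℝ≥0} (h : ContinuousOn f (Icc s u)) :
    ContinuousOn (fun r : ℝ => f r.toNNReal) (Icc (s : ℝ) u) := by
  refine h.comp continuous_real_toNNReal.continuousOn fun r hr => ⟨?_, ?_⟩
  · exact NNReal.le_toNNReal_of_coe_le hr.1
  · exact Real.toNNReal_le_iff_le_coe.2 hr.2

/-- Integration by parts for a deterministic factor: `∫ g h dW = g N - ∫ N dg`. -/
lemma IsItoPair.ae_eq_mul_sub_integral (hW : IsBrownianBasis P 𝓕 W) {h N N' : ℝ≥0 → Ω → ℝ}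
    (hx : IsItoPair P 𝓕 W T (h, N)) {g g' : ℝ → ℝ} (hg : IsPrimitiveOn g g' 0 T)
    (hy : IsItoPair P 𝓕 W T (fun s ω => g s * h s ω, N'))
    (hNc : ∀ᵐ ω ∂P, ContinuousOn (fun s => N s ω) (Icc 0 T)) {s : ℝ≥0} (hs : s ≤ T) :
    ∀ᵐ ω ∂P, N' s ω = g s * N s ω - ∫ r in (0 : ℝ)..s, N r.toNNReal ω * g' r := by
  have hgs : IsPrimitiveOn g g' (0 : ℝ≥0) s := hg.mono (by simp)
    ⟨s.coe_nonneg, by exact_mod_cast hs⟩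
  have hgc : ContinuousOn g (Icc ((0 : ℝ≥0) : ℝ) s) := hgs.continuousOn
  set π : ℕ → TimePartition 0 s := fun k => TimePartition.uniform 0 s (zero_le) k with hπd
  have hπ : MeshTendsto π := meshTendsto_uniform _
  have hptT : ∀ k, ∀ i < (π k).n, (π k).pt (i + 1) ≤ T := fun k i hi =>
    ((π k).pt_le hi).trans hs
  have hptT' : ∀ k, ∀ i < (π k).n, (π k).pt i ≤ T := fun k i hi =>
    ((π k).pt_le hi.le).trans hs
  set z : ℕ → ℕ → ProcPair Ω := fun k i =>
    g ((π k).pt i) • (h, N) - ((fun (s : ℝ≥0) ω => g s * h s ω), N') with hz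
  have hzI : ∀ k i, IsItoPair P 𝓕 W T (z k i) := fun k i => (hx.smul _).sub hy hW
  set Q : ℕ → ℕ → Ω → ℝ := fun k i ω =>
    (z k i).2 ((π k).pt (i + 1)) ω - (z k i).2 ((π k).pt i) ω with hQ
  have hQ2 : ∀ k, ∀ i < (π k).n, MemLp (Q k i) 2 P := fun k i hi =>
    (hzI k i).memLp_sub hW (hptT' k i hi) (hptT k i hi)
  have hsum2 : ∀ k, MemLp (fun ω => ∑ i ∈ range (π k).n, Q k i ω) 2 P := fun k =>
    memLp_finsetSum _ fun i hi => hQ2 k i (Finset.mem_range.1 hi)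
  have hsq : Tendsto (fun k => ∫ ω, (∑ i ∈ range (π k).n, Q k i ω) ^ 2 ∂P) atTop (𝓝 0) := by
    set A := ∫ ω, cellInt h h 0 s ω ∂P with hA
    have hA0 : 0 ≤ A := integral_nonneg fun ω => cellInt_self_nonneg h (zero_le) ω
    rw [Metric.tendsto_atTop']
    intro ε hε
    set δ := √(ε / (2 * (A + 1))) with hδ
    have hδ0 : 0 < δ := Real.sqrt_pos.2 (by positivity)
    have huc := isCompact_Icc.uniformContinuousOn_of_continuous hgc
    rw [Metric.uniformContinuousOn_iff] at huc
    obtain ⟨η, hη, hd⟩ := huc δ hδ0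
    obtain ⟨n, hn⟩ := eventually_atTop.1 (hπ η hη)
    refine ⟨n, fun k hk => ?_⟩
    rw [Real.dist_eq, sub_zero, abs_of_nonneg (integral_nonneg fun ω => sq_nonneg _),
      integral_sum_sq_eq (𝓕 := 𝓕) (π k).mono (hQ2 k) (fun i hi => ?_) (fun i hi => ?_)]
    · have hcell : ∀ i < (π k).n, ∫ ω, Q k i ω ^ 2 ∂P
          ≤ δ ^ 2 * ∫ ω, cellInt h h ((π k).pt i) ((π k).pt (i + 1)) ω ∂P := by
        intro i hi
        have e1 := (hzI k i).isometry hW (hzI k i) ((π k).mono (Nat.le_succ i)) (hptT k i hi)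
        simp only [hQ, pow_two] at e1 ⊢
        rw [e1, ← integral_const_mul]
        refine integral_mono_ae
          ((hzI k i).integrable_cellInt (hzI k i) ((π k).mono (Nat.le_succ i)) (hptT k i hi))
          ((hx.integrable_cellInt hx ((π k).mono (Nat.le_succ i)) (hptT k i hi)).const_mul _) ?_
        filter_upwards [(hzI k i).ae_intervalIntegrable (hzI k i), hx.ae_intervalIntegrable hx]
          with ω h1 h2
        have i1 := intervalIntegrable_sub_interval h1 (hptT' k i hi) (hptT k i hi)
        have i2 := intervalIntegrable_sub_interval h2 (hptT' k i hi) (hptT k i hi)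
        simp only [cellInt]
        rw [← intervalIntegral.integral_const_mul]
        refine intervalIntegral.integral_mono_on ((π k).pt_le_succ i) i1 (i2.const_mul _) ?_
        intro r hr
        have hr0 : (0 : ℝ) ≤ r := ((π k).pt i).coe_nonneg.trans hr.1
        have hrs : r ∈ Icc ((0 : ℝ≥0) : ℝ) s :=
          ⟨hr0, hr.2.trans ((π k).mem_Icc hi).2⟩
        have hdist := hd _ ((π k).mem_Icc hi.le) r hrs (by
          rw [Real.dist_eq, abs_sub_comm, abs_of_nonneg (sub_nonneg.2 hr.1)]
          linarith [hn k hk.le i hi, hr.2])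
        rw [Real.dist_eq] at hdist
        have e2 : (z k i).1 r.toNNReal ω = (g ((π k).pt i) - g r) * h r.toNNReal ω := by
          simp only [hz, Prod.fst_sub, Prod.smul_fst, Pi.sub_apply, Pi.smul_apply, smul_eq_mul,
            Real.coe_toNNReal r hr0]
          ring
        rw [e2]
        have e3 : (g ((π k).pt i) - g r) ^ 2 ≤ δ ^ 2 := by
          rw [← sq_abs]; exact pow_le_pow_left₀ (abs_nonneg _) hdist.le 2
        nlinarith [mul_le_mul_of_nonneg_right e3 (mul_self_nonneg (h r.toNNReal ω))]
      have hbound := sum_le_sum fun i hi => hcell i (Finset.mem_range.1 hi)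
      refine lt_of_le_of_lt hbound ?_
      rw [← mul_sum, ← integral_finsetSum _ fun i hi =>
        hx.integrable_cellInt hx ((π k).mono (Nat.le_succ i)) (hptT k i (Finset.mem_range.1 hi))]
      have e4 : ∫ ω, ∑ i ∈ range (π k).n,
          cellInt h h ((π k).pt i) ((π k).pt (i + 1)) ω ∂P = A := by
        refine integral_congr_ae ?_
        filter_upwards [hx.ae_intervalIntegrable hx] with ω h1
        exact sum_cellInt h1 hs (π k)
      rw [e4, hδ, Real.sq_sqrt (by positivity), div_mul_eq_mul_div, div_lt_iff₀ (by positivity)]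
      nlinarith
    · exact ((hzI k i).adapted _ (hptT k i hi)).sub
        (((hzI k i).adapted _ (hptT' k i hi)).mono (𝓕.mono ((π k).mono (Nat.le_succ i))))
    · exact (hzI k i).zeroMean hW ((π k).mono (Nat.le_succ i)) (hptT k i hi)
  have h1 := TendstoAESubseq.of_integral_sq hsum2 hsq
  have h2 : TendstoAESubseq P (fun k ω => ∑ i ∈ range (π k).n, Q k i ω)
      (fun ω => (g s * N s ω - g 0 * N 0 ω - ∫ r in (0 : ℝ)..s, N r.toNNReal ω * g' r)
        - (N' s ω - N' 0 ω)) := by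
    refine .of_ae ?_
    filter_upwards [hNc] with ω hω
    have hc : ContinuousOn (fun r : ℝ => N r.toNNReal ω) (Icc ((0 : ℝ≥0) : ℝ) s) :=
      continuousOn_comp_toNNReal (hω.mono (Set.Icc_subset_Icc_right hs))
    have h3 := tendsto_sum_primitive_mul_sub hπ hgs hc
    simp only [Real.toNNReal_coe, NNReal.coe_zero, Real.toNNReal_zero] at h3
    refine (h3.sub_const (N' s ω - N' 0 ω)).congr fun k => ?_
    rw [← (π k).sum_sub fun r => N' r ω, ← sum_sub_distrib]
    refine sum_congr rfl fun i _ => ?_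
    simp only [hQ, hz, Prod.snd_sub, Prod.smul_snd, Pi.sub_apply, Pi.smul_apply, smul_eq_mul]
    ring
  filter_upwards [h1.unique h2, hx.eval_zero hW, hy.eval_zero hW] with ω e1 e2 e3
  rw [e2, e3] at e1
  simp only [Pi.zero_apply] at e1
  linarith

/-! ### Doob's maximal inequality -/

/-- The running maximum of `|x 0|, …, |x n|`. -/
noncomputable def runMax (x : ℕ → ℝ) : ℕ → ℝ
  | 0 => |x 0|
  | n + 1 => max (runMax x n) |x (n + 1)|

lemma abs_le_runMax (x : ℕ → ℝ) (n : ℕ) : |x n| ≤ runMax x n := by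
  cases n with
  | zero => exact le_rfl
  | succ n => exact le_max_right _ _

lemma runMax_mono (x : ℕ → ℝ) : Monotone (runMax x) :=
  monotone_nat_of_le_succ fun _ => le_max_left _ _

lemma runMax_nonneg (x : ℕ → ℝ) (n : ℕ) : 0 ≤ runMax x n := (abs_nonneg _).trans (abs_le_runMax x n)

lemma sum_runMax_mul_sub_le (x : ℕ → ℝ) (n : ℕ) :
    ∑ i ∈ range n, runMax x i * (|x (i + 1)| - |x i|)
      ≤ runMax x n * |x n| - runMax x n ^ 2 / 2 := by
  induction n with
  | zero => simp only [Finset.range_zero, Finset.sum_empty, runMax]; nlinarith [sq_nonneg |x 0|]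
  | succ n ih =>
    rw [sum_range_succ]
    simp only [runMax]
    rcases le_total (runMax x n) |x (n + 1)| with h | h
    · rw [max_eq_right h]; nlinarith [sq_nonneg (runMax x n - |x (n + 1)|)]
    · rw [max_eq_left h]; nlinarith

lemma memLp_runMax {x : ℕ → Ω → ℝ} {n : ℕ} (hx : ∀ i ≤ n, MemLp (x i) 2 P) :
    MemLp (fun ω => runMax (fun i => x i ω) n) 2 P := by
  induction n with
  | zero => exact (hx 0 le_rfl).abs
  | succ n ih => exact (ih fun i hi => hx i (hi.trans (Nat.le_succ n))).sup (hx _ le_rfl).abs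

lemma stronglyMeasurable_runMax {m : MeasurableSpace Ω} {x : ℕ → Ω → ℝ} {n : ℕ}
    (hx : ∀ i ≤ n, StronglyMeasurable[m] (x i)) :
    StronglyMeasurable[m] (fun ω => runMax (fun i => x i ω) n) := by
  induction n with
  | zero => exact (hx 0 le_rfl).norm
  | succ n ih => exact (ih fun i hi => hx i (hi.trans (Nat.le_succ n))).sup (hx _ le_rfl).norm

/-- Doob's `L²` inequality in discrete time. -/
lemma integral_runMax_sq_le {p : ℕ → ℝ≥0} (hp : Monotone p) {x : ℕ → Ω → ℝ} {n : ℕ}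
    (hx : ∀ i ≤ n, MemLp (x i) 2 P) (hm : ∀ i ≤ n, StronglyMeasurable[𝓕 (p i)] (x i))
    (hz : ∀ i < n, HasZeroMeanOn P (𝓕 (p i)) (fun ω => x (i + 1) ω - x i ω)) :
    ∫ ω, runMax (fun i => x i ω) n ^ 2 ∂P ≤ 4 * ∫ ω, x n ω ^ 2 ∂P := by
  have hmax : ∀ i ≤ n, MemLp (fun ω => runMax (fun i => x i ω) i) 2 P := fun i hi =>
    memLp_runMax fun j hj => hx j (hj.trans hi)
  have hterm : ∀ i ∈ range n,
      Integrable (fun ω => runMax (fun i => x i ω) i * (|x (i + 1) ω| - |x i ω|)) P := by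
    intro i hi
    have hi := Finset.mem_range.1 hi
    exact (hmax i hi.le).integrable_mul_two ((hx (i + 1) hi).abs.sub (hx i hi.le).abs)
  have hpos : 0 ≤ ∑ i ∈ range n,
      ∫ ω, runMax (fun i => x i ω) i * (|x (i + 1) ω| - |x i ω|) ∂P := by
    refine sum_nonneg fun i hi => ?_
    have hi' := Finset.mem_range.1 hi
    set ζ : Ω → ℝ := fun ω => runMax (fun i => x i ω) i * (if 0 ≤ x i ω then 1 else -1) with hζ
    have hζm : StronglyMeasurable[𝓕 (p i)] ζ := by
      refine (stronglyMeasurable_runMax fun j hj =>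
        (hm j (hj.trans hi'.le)).mono (𝓕.mono (hp hj))).mul ?_
      refine StronglyMeasurable.ite ?_ stronglyMeasurable_const stronglyMeasurable_const
      exact (hm i hi'.le).measurable measurableSet_Ici
    have hζ2 : MemLp ζ 2 P := by
      refine (hmax i hi'.le).of_le (hζm.mono (𝓕.le _)).aestronglyMeasurable
        (Eventually.of_forall fun ω => ?_)
      simp only [hζ, norm_mul]
      split_ifs <;> simp
    have hd2 : MemLp (fun ω => x (i + 1) ω - x i ω) 2 P := (hx (i + 1) hi').sub (hx i hi'.le)
    have h0 := (hz i hi').integral_mul_eq_zero (𝓕.le _) (hd2.integrable one_le_two) hζm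
      (hζ2.integrable_mul_two hd2)
    rw [← h0]
    refine integral_mono (hζ2.integrable_mul_two hd2) (hterm i hi) fun ω => ?_
    simp only [hζ]
    rw [mul_assoc]
    refine mul_le_mul_of_nonneg_left ?_ (runMax_nonneg _ _)
    split_ifs with h
    · rw [abs_of_nonneg h]; linarith [le_abs_self (x (i + 1) ω)]
    · rw [abs_of_neg (not_le.1 h)]; linarith [neg_abs_le (x (i + 1) ω)]
  have h1 := integral_mono (μ := P) (integrable_finsetSum _ hterm)
    (((hmax n le_rfl).integrable_mul_two (hx n le_rfl).abs).sub
      ((hmax n le_rfl).integrable_sq.div_const 2)) fun ω => sum_runMax_mul_sub_le (fun i => x i ω) n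
  rw [integral_finsetSum _ hterm] at h1
  have h2 := hpos.trans h1
  have h3 : ∫ ω, (runMax (fun i => x i ω) n * |x n ω| - runMax (fun i => x i ω) n ^ 2 / 2) ∂P
      ≤ ∫ ω, (x n ω ^ 2 - runMax (fun i => x i ω) n ^ 2 / 4) ∂P := by
    refine integral_mono (((hmax n le_rfl).integrable_mul_two (hx n le_rfl).abs).sub
      ((hmax n le_rfl).integrable_sq.div_const 2)) ((hx n le_rfl).integrable_sq.sub
      ((hmax n le_rfl).integrable_sq.div_const 4)) fun ω => ?_
    have := sq_abs (x n ω)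
    simp only
    nlinarith [sq_nonneg (runMax (fun i => x i ω) n / 2 - |x n ω|)]
  rw [integral_sub (hx n le_rfl).integrable_sq ((hmax n le_rfl).integrable_sq.div_const 4),
    integral_div] at h3
  have h4 := h2.trans h3
  linarith

/-- The supremum of a continuous Itô integral process is dominated by a square integrable
random variable. -/
lemma IsItoPair.exists_memLp_bound (hW : IsBrownianBasis P 𝓕 W) (hx : IsItoPair P 𝓕 W T x)
    (hc : ∀ᵐ ω ∂P, ContinuousOn (fun s => x.2 s ω) (Icc 0 T)) :
    ∃ G : Ω → ℝ, MemLp G 2 P ∧ ∀ᵐ ω ∂P, ∀ s ≤ T, |x.2 s ω| ≤ G ω := by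
  set π : ℕ → TimePartition 0 T := fun k => TimePartition.uniform 0 T (zero_le) k with hπd
  have hπ : MeshTendsto π := meshTendsto_uniform _
  set M : ℕ → Ω → ℝ := fun k ω => runMax (fun i => x.2 (min ((π k).pt i) T) ω) (π k).n with hM
  have hmp : ∀ k i, min ((π k).pt i) T ≤ T := fun k i => min_le_right _ _
  have hmm : ∀ k, Monotone fun i => min ((π k).pt i) T := fun k i j h =>
    min_le_min_right _ ((π k).mono h)
  have hM2 : ∀ k, MemLp (M k) 2 P := fun k =>
    memLp_runMax fun i _ => hx.memLp_eval hW (hmp k i)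
  have hbound : ∀ k, ∫ ω, M k ω ^ 2 ∂P ≤ 4 * ∫ ω, x.2 T ω ^ 2 ∂P := by
    intro k
    have h1 := integral_runMax_sq_le (P := P) (𝓕 := 𝓕) (n := (π k).n) (hmm k)
      (x := fun i => x.2 (min ((π k).pt i) T)) (fun i _ => hx.memLp_eval hW (hmp k i))
      (fun i _ => hx.adapted _ (hmp k i))
      (fun i _ => hx.zeroMean hW (hmm k (Nat.le_succ i)) (hmp k _))
    simpa only [(π k).last, min_self] using h1
  set C := 4 * ∫ ω, x.2 T ω ^ 2 ∂P with hC
  set Φ : Ω → ℝ≥0∞ := fun ω => liminf (fun k => ENNReal.ofReal (M k ω ^ 2)) atTop with hΦ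
  have hMm : ∀ k, Measurable (fun ω => ENNReal.ofReal (M k ω ^ 2)) := fun k =>
    (((stronglyMeasurable_runMax fun i _ =>
      (hx.adapted _ (hmp k i)).mono (𝓕.le _)).measurable).pow_const 2).ennreal_ofReal
  have hΦm : Measurable Φ := Measurable.liminf hMm
  have hΦi : ∫⁻ ω, Φ ω ∂P ≤ ENNReal.ofReal C := by
    refine (lintegral_liminf_le hMm).trans ?_
    refine liminf_le_of_frequently_le' (Frequently.of_forall fun k => ?_)
    rw [← ofReal_integral_eq_lintegral_ofReal (hM2 k).integrable_sq
      (Eventually.of_forall fun ω => sq_nonneg _)]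
    exact ENNReal.ofReal_le_ofReal (hbound k)
  have hΦfin : ∀ᵐ ω ∂P, Φ ω < ∞ :=
    ae_lt_top hΦm (ne_of_lt (hΦi.trans_lt ENNReal.ofReal_lt_top))
  refine ⟨fun ω => √(Φ ω).toReal, ?_, ?_⟩
  · have hm : AEStronglyMeasurable (fun ω => √(Φ ω).toReal) P :=
      (Real.continuous_sqrt.measurable.comp hΦm.ennreal_toReal).aestronglyMeasurable
    rw [memLp_two_iff_integrable_sq hm]
    simp only [Real.sq_sqrt ENNReal.toReal_nonneg]
    exact integrable_toReal_of_lintegral_ne_top hΦm.aemeasurable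
      (ne_of_lt (hΦi.trans_lt ENNReal.ofReal_lt_top))
  · filter_upwards [hc, hΦfin] with ω hω hfin s hs
    refine Real.abs_le_sqrt ?_
    rw [← ENNReal.ofReal_le_iff_le_toReal hfin.ne]
    have hcell : ∀ k, ∃ i ≤ (π k).n, |((π k).pt i : ℝ) - s| ≤ T * (1 / ((k : ℝ) + 1)) := by
      intro k
      rcases eq_or_lt_of_le (zero_le (a := s)) with h0 | h0
      · refine ⟨0, Nat.zero_le _, ?_⟩
        rw [(π k).first, ← h0]; simp; positivity
      · obtain ⟨i, hi, hri, -⟩ := (π k).exists_cell (r := s)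
          ⟨by exact_mod_cast h0, by exact_mod_cast hs⟩
        refine ⟨i, hi.le, ?_⟩
        rw [abs_sub_comm, abs_of_nonneg (by linarith [hri.1])]
        refine le_trans (sub_le_sub_right hri.2 _) (le_of_eq ?_)
        simp only [hπd, TimePartition.uniform] at hi ⊢
        have hi' : ((i + 1 : ℕ) : ℝ≥0) ≤ k + 1 := by exact_mod_cast hi
        have hi'' : (i : ℝ≥0) ≤ k + 1 := by exact_mod_cast hi.le
        rw [min_eq_left hi', min_eq_left hi'']
        push_cast
        simp
        field_simp
        ring
    choose i hi hclose using hcell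
    have hlim : Tendsto (fun k => (π k).pt (i k)) atTop (𝓝[Icc 0 T] s) := by
      refine tendsto_nhdsWithin_of_tendsto_nhds_of_eventually_within _ ?_
        (Eventually.of_forall fun k => ⟨zero_le, (π k).pt_le (hi k)⟩)
      rw [← NNReal.tendsto_coe, tendsto_iff_dist_tendsto_zero]
      refine squeeze_zero (fun k => dist_nonneg) (fun k => ?_)
        (by simpa only [mul_zero] using
          (tendsto_one_div_add_atTop_nhds_zero_nat (𝕜 := ℝ)).const_mul (T : ℝ))
      rw [Real.dist_eq]
      exact hclose k
    have hlim2 : Tendsto (fun k => ENNReal.ofReal (x.2 ((π k).pt (i k)) ω ^ 2)) atTop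
        (𝓝 (ENNReal.ofReal (x.2 s ω ^ 2))) :=
      ENNReal.tendsto_ofReal (((hω s ⟨zero_le, hs⟩).tendsto.comp hlim).pow 2)
    rw [← hlim2.liminf_eq]
    refine liminf_le_liminf (Eventually.of_forall fun k => ?_)
    refine ENNReal.ofReal_le_ofReal ?_
    rw [← sq_abs (x.2 _ ω)]
    refine pow_le_pow_left₀ (abs_nonneg _) ?_ 2
    have e1 := abs_le_runMax (fun i => x.2 (min ((π k).pt i) T) ω) (i k)
    rw [min_eq_left ((π k).pt_le (hi k))] at e1
    exact e1.trans (runMax_mono _ (hi k))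

/-! ### Càdlàg paths and dominated processes -/

/-- The smallest point of a grid of width `1 / (n + 1)` to the right of `r`, projected to
`[t, T]`. -/
noncomputable def gridPt (t T : ℝ≥0) (n : ℕ) (r : ℝ) : ℝ≥0 :=
  max t (min T (((⌊((n : ℝ) + 1) * r⌋₊ : ℝ≥0) + 1) / ((n : ℝ≥0) + 1)))

lemma toNNReal_le_gridPt (n : ℕ) {r : ℝ} (hr : r ∈ Ico (t : ℝ) T) :
    r.toNNReal ≤ gridPt t T n r := by
  refine le_max_of_le_right (le_min (Real.toNNReal_le_iff_le_coe.2 hr.2.le) ?_)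
  rw [Real.toNNReal_le_iff_le_coe]
  push_cast
  rw [le_div_iff₀ (by positivity)]
  have := Nat.lt_floor_add_one (((n : ℝ) + 1) * r)
  linarith

lemma gridPt_le (n : ℕ) {r : ℝ} (hr : r ∈ Ico (t : ℝ) T) :
    (gridPt t T n r : ℝ) ≤ r + 1 / ((n : ℝ) + 1) := by
  have h0 : (0 : ℝ) ≤ r := t.coe_nonneg.trans hr.1
  have hp : (0 : ℝ) < 1 / ((n : ℝ) + 1) := by positivity
  unfold gridPt
  rw [NNReal.coe_max, NNReal.coe_min]
  refine max_le (by linarith [hr.1]) ((min_le_right _ _).trans ?_)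
  push_cast
  rw [div_le_iff₀ (by positivity)]
  have := Nat.floor_le (a := ((n : ℝ) + 1) * r) (by positivity)
  field_simp
  linarith

lemma tendsto_gridPt {r : ℝ} (hr : r ∈ Ico (t : ℝ) T) :
    Tendsto (fun n => gridPt t T n r) atTop (𝓝[Ici r.toNNReal] r.toNNReal) := by
  refine tendsto_nhdsWithin_of_tendsto_nhds_of_eventually_within _ ?_
    (Eventually.of_forall fun n => toNNReal_le_gridPt n hr)
  rw [← NNReal.tendsto_coe, Real.coe_toNNReal r (t.coe_nonneg.trans hr.1)]
  refine tendsto_of_tendsto_of_tendsto_of_le_of_le (tendsto_const_nhds (x := r)) ?_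
    (fun n => ?_) (fun n => gridPt_le n hr)
  · simpa only [add_zero] using
      (tendsto_one_div_add_atTop_nhds_zero_nat (𝕜 := ℝ)).const_add r
  · exact Real.toNNReal_le_iff_le_coe.1 (toNNReal_le_gridPt n hr)

lemma toNNReal_mem_Icc {r : ℝ} (hr : r ∈ Icc (t : ℝ) T) :
    r.toNNReal ∈ Icc t T :=
  ⟨NNReal.le_toNNReal_of_coe_le hr.1, Real.toNNReal_le_iff_le_coe.2 hr.2⟩

lemma toNNReal_mem_Ico {r : ℝ} (hr : r ∈ Ico (t : ℝ) T) :
    r.toNNReal ∈ Ico t T := by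
  refine ⟨NNReal.le_toNNReal_of_coe_le hr.1, ?_⟩
  rw [Real.toNNReal_lt_iff_lt_coe (t.coe_nonneg.trans hr.1)]
  exact hr.2

/-- Joint measurability of right-continuous processes. -/
lemma aestronglyMeasurable_onProd (htT : t ≤ T) {X : ℝ≥0 → Ω → ℝ}
    (hX : ∀ s ∈ Icc t T, StronglyMeasurable (X s))
    (hc : ∀ᵐ ω ∂P, ∀ s ∈ Ico t T, ContinuousWithinAt (fun s => X s ω) (Ici s) s) :
    AEStronglyMeasurable (onProd X) ((volume.restrict (Ioc (t : ℝ) T)).prod P) := by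
  refine aestronglyMeasurable_of_tendsto_ae atTop
    (f := fun n (q : ℝ × Ω) => X (gridPt t T n q.1) q.2) (fun n => ?_) ?_
  · have h1 : Measurable fun q : ℕ × Ω =>
        X (max t (min T (((q.1 : ℝ≥0) + 1) / ((n : ℝ≥0) + 1)))) q.2 :=
      measurable_from_prod_countable_right fun k => (hX
        (max t (min T (((k : ℝ≥0) + 1) / ((n : ℝ≥0) + 1))))
        ⟨le_max_left _ _, max_le htT (min_le_left _ _)⟩).measurable
    have h2 : Measurable fun q : ℝ × Ω => ((⌊((n : ℝ) + 1) * q.1⌋₊, q.2) : ℕ × Ω) :=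
      (Nat.measurable_floor.comp (measurable_fst.const_mul _)).prodMk measurable_snd
    exact (h1.comp h2).aestronglyMeasurable
  · have h1 : ∀ᵐ q ∂((volume.restrict (Ioc (t : ℝ) T)).prod P), q.1 ∈ Ico (t : ℝ) T := by
      refine Measure.quasiMeasurePreserving_fst.ae (p := fun r => r ∈ Ico (t : ℝ) T) ?_
      rw [ae_restrict_iff' measurableSet_Ioc]
      filter_upwards [Measure.ae_ne volume (T : ℝ)] with r hr hr'
      exact ⟨hr'.1.le, lt_of_le_of_ne hr'.2 hr⟩
    have h2 := (Measure.quasiMeasurePreserving_snd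
      (μ := volume.restrict (Ioc (t : ℝ) T)) (ν := P)).ae hc
    filter_upwards [h1, h2] with q hq1 hq2
    exact (hq2 _ (toNNReal_mem_Ico hq1)).tendsto.comp (tendsto_gridPt hq1)

lemma IsCadlagOn.exists_bound {f : ℝ≥0 → ℝ} (h : IsCadlagOn f t T) :
    ∃ K, ∀ s ∈ Icc t T, |f s| ≤ K := by
  refine isCompact_Icc.induction_on (p := fun S => ∃ K, ∀ s ∈ S, |f s| ≤ K) ⟨0, by simp⟩
    (fun S S' hS ⟨K, hK⟩ => ⟨K, fun s hs => hK s (hS hs)⟩)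
    (fun S S' ⟨K, hK⟩ ⟨K', hK'⟩ => ⟨max K K', fun s hs => hs.elim
      (fun h => (hK s h).trans (le_max_left _ _)) fun h => (hK' s h).trans (le_max_right _ _)⟩) ?_
  intro s hs
  have hR : ∃ U ∈ 𝓝 s, ∀ r ∈ U, r ∈ Icc t T → s ≤ r → |f r| ≤ |f s| + 1 := by
    rcases lt_or_eq_of_le hs.2 with hsT | rfl
    · have h1 : ∀ᶠ r in 𝓝[≥] s, |f r| < |f s| + 1 :=
        (h.1 s ⟨hs.1, hsT⟩).abs.eventually_lt_const (by linarith)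
      obtain ⟨U, hU, hU'⟩ := mem_nhdsWithin_iff_exists_mem_nhds_inter.1 h1
      exact ⟨U, hU, fun r hr _ hsr => (hU' ⟨hr, hsr⟩ : |f r| < _).le⟩
    · refine ⟨Set.univ, univ_mem, fun r _ hr hsr => ?_⟩
      rw [le_antisymm hr.2 hsr]; linarith
  have hL : ∃ K, ∃ U ∈ 𝓝 s, ∀ r ∈ U, r ∈ Icc t T → r < s → |f r| ≤ K := by
    rcases lt_or_eq_of_le hs.1 with hst | rfl
    · obtain ⟨l, hl⟩ := h.2 s ⟨hst, hs.2⟩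
      have h1 : ∀ᶠ r in 𝓝[<] s, |f r| < |l| + 1 := hl.abs.eventually_lt_const (by linarith)
      obtain ⟨U, hU, hU'⟩ := mem_nhdsWithin_iff_exists_mem_nhds_inter.1 h1
      exact ⟨_, U, hU, fun r hr _ hsr => (hU' ⟨hr, hsr⟩ : |f r| < _).le⟩
    · exact ⟨0, Set.univ, univ_mem, fun r _ hr hsr => absurd hsr (not_lt.2 hr.1)⟩
  obtain ⟨U, hU, hU'⟩ := hR
  obtain ⟨K, V, hV, hV'⟩ := hL
  refine ⟨U ∩ V ∩ Icc t T, inter_mem (mem_nhdsWithin_of_mem_nhds (inter_mem hU hV))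
    self_mem_nhdsWithin, max K (|f s| + 1), fun r hr => ?_⟩
  rcases lt_or_ge r s with h1 | h1
  · exact (hV' r hr.1.2 hr.2 h1).trans (le_max_left _ _)
  · exact (hU' r hr.1.1 hr.2 h1).trans (le_max_right _ _)

lemma IsCadlagOn.intervalIntegrable {f : ℝ≥0 → ℝ} (h : IsCadlagOn f t T)
    (htT : t ≤ T) : IntervalIntegrable (fun r : ℝ => f r.toNNReal) volume t T := by
  have h1 := aestronglyMeasurable_onProd (P := Measure.dirac ()) htT (X := fun s _ => f s)
    (fun s _ => stronglyMeasurable_const) (Eventually.of_forall fun _ => h.1)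
  have h2 : AEStronglyMeasurable (fun r : ℝ => f r.toNNReal)
      (volume.restrict (Ioc (t : ℝ) T)) := by
    have := h1.prod_swap.prodMk_left
    rw [ae_dirac_eq] at this
    exact this
  obtain ⟨K, hK⟩ := h.exists_bound
  rw [intervalIntegrable_iff_integrableOn_Ioc_of_le (by exact_mod_cast htT)]
  refine Integrable.of_bound h2 K ?_
  rw [ae_restrict_iff' measurableSet_Ioc]
  exact Eventually.of_forall fun r hr => hK _ (toNNReal_mem_Icc ⟨hr.1.le, hr.2⟩)

/-- The process `U` is adapted, jointly measurable and dominated by a square integrable random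
variable on `[t, T]`. -/
structure IsDominated (P : Measure Ω) (𝓕 : Filtration ℝ≥0 mΩ) (t T : ℝ≥0)
    (U : ℝ≥0 → Ω → ℝ) : Prop where
  adapted : ∀ s ∈ Icc t T, StronglyMeasurable[𝓕 s] (U s)
  meas : AEStronglyMeasurable (onProd U) ((volume.restrict (Ioc (t : ℝ) T)).prod P)
  bound : ∃ G : Ω → ℝ, MemLp G 2 P ∧ ∀ᵐ ω ∂P, ∀ s ∈ Icc t T, |U s ω| ≤ G ω

namespace IsDominated

variable {U V : ℝ≥0 → Ω → ℝ}

lemma add (hU : IsDominated P 𝓕 t T U) (hV : IsDominated P 𝓕 t T V) :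
    IsDominated P 𝓕 t T (fun s ω => U s ω + V s ω) := by
  obtain ⟨G, hG, hGb⟩ := hU.bound
  obtain ⟨G', hG', hGb'⟩ := hV.bound
  refine ⟨fun s hs => (hU.adapted s hs).add (hV.adapted s hs), hU.meas.add hV.meas,
    fun ω => G ω + G' ω, hG.add hG', ?_⟩
  filter_upwards [hGb, hGb'] with ω h1 h2 s hs
  exact (abs_add_le _ _).trans (add_le_add (h1 s hs) (h2 s hs))

/-- Multiplication by a bounded deterministic function. -/
lemma det_mul (hU : IsDominated P 𝓕 t T U) {g : ℝ≥0 → ℝ}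
    (hg : AEStronglyMeasurable (fun r : ℝ => g r.toNNReal) (volume.restrict (Ioc (t : ℝ) T)))
    (hb : ∃ K, ∀ s ∈ Icc t T, |g s| ≤ K) : IsDominated P 𝓕 t T (fun s ω => g s * U s ω) := by
  obtain ⟨G, hG, hGb⟩ := hU.bound
  obtain ⟨K, hK⟩ := hb
  refine ⟨fun s hs => (hU.adapted s hs).const_mul _, ?_, fun ω => |K| * G ω, hG.const_mul _, ?_⟩
  · exact (hg.comp_quasiMeasurePreserving Measure.quasiMeasurePreserving_fst).mul hU.meas
  · filter_upwards [hGb] with ω h1 s hs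
    rw [abs_mul]
    exact mul_le_mul ((hK s hs).trans (le_abs_self K)) (h1 s hs) (abs_nonneg _) (abs_nonneg _)

lemma const_mul (hU : IsDominated P 𝓕 t T U) (c : ℝ) :
    IsDominated P 𝓕 t T (fun s ω => c * U s ω) :=
  hU.det_mul (g := fun _ => c) aestronglyMeasurable_const ⟨|c|, fun _ _ => le_rfl⟩

lemma sub (hU : IsDominated P 𝓕 t T U) (hV : IsDominated P 𝓕 t T V) :
    IsDominated P 𝓕 t T (fun s ω => U s ω - V s ω) := by
  simpa [sub_eq_add_neg] using hU.add (hV.const_mul (-1))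

lemma randomVariable {ζ : Ω → ℝ} (hζ : StronglyMeasurable[𝓕 t] ζ) (h2 : MemLp ζ 2 P) :
    IsDominated P 𝓕 t T (fun _ ω => ζ ω) :=
  ⟨fun _ hs => hζ.mono (𝓕.mono hs.1),
    h2.1.comp_quasiMeasurePreserving Measure.quasiMeasurePreserving_snd,
    fun ω => |ζ ω|, h2.abs, Eventually.of_forall fun _ _ _ => le_rfl⟩

lemma const (c : ℝ) : IsDominated P 𝓕 t T (fun _ _ => c) :=
  randomVariable stronglyMeasurable_const (memLp_const c)

lemma det {g : ℝ≥0 → ℝ}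
    (hg : AEStronglyMeasurable (fun r : ℝ => g r.toNNReal) (volume.restrict (Ioc (t : ℝ) T)))
    (hb : ∃ K, ∀ s ∈ Icc t T, |g s| ≤ K) : IsDominated P 𝓕 t T (fun s _ => g s) := by
  simpa using (const (P := P) (𝓕 := 𝓕) (t := t) (T := T) 1).det_mul hg hb

lemma memLp (hU : IsDominated P 𝓕 t T U) {s : ℝ≥0} (hs : s ∈ Icc t T) : MemLp (U s) 2 P := by
  obtain ⟨G, hG, hGb⟩ := hU.bound
  refine hG.of_le ((hU.adapted s hs).mono (𝓕.le s)).aestronglyMeasurable ?_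
  filter_upwards [hGb] with ω hω
  exact (hω s hs).trans (le_abs_self _)

lemma integrable (hU : IsDominated P 𝓕 t T U) {s : ℝ≥0} (hs : s ∈ Icc t T) :
    Integrable (U s) P := (hU.memLp hs).integrable one_le_two

/-- The product of two dominated processes is integrable on `[t, T] × Ω`. -/
lemma integrable_onProd_mul (hU : IsDominated P 𝓕 t T U) (hV : IsDominated P 𝓕 t T V) :
    Integrable (onProd fun s ω => U s ω * V s ω)
      ((volume.restrict (Ioc (t : ℝ) T)).prod P) := by
  obtain ⟨G, hG, hGb⟩ := hU.bound
  obtain ⟨G', hG', hGb'⟩ := hV.bound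
  have hi : Integrable (fun q : ℝ × Ω => G q.2 * G' q.2)
      ((volume.restrict (Ioc (t : ℝ) T)).prod P) :=
    (hG.integrable_mul_two hG').comp_snd _
  refine hi.mono (hU.meas.mul hV.meas) ?_
  have h1 : ∀ᵐ q ∂((volume.restrict (Ioc (t : ℝ) T)).prod P), q.1 ∈ Ioc (t : ℝ) T :=
    Measure.quasiMeasurePreserving_fst.ae (p := fun r => r ∈ Ioc (t : ℝ) T)
      (ae_restrict_mem measurableSet_Ioc)
  have h2 := (Measure.quasiMeasurePreserving_snd
      (μ := volume.restrict (Ioc (t : ℝ) T)) (ν := P)).ae (hGb.and hGb')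
  filter_upwards [h1, h2] with q hq1 hq2
  have hm := toNNReal_mem_Icc (Set.Ioc_subset_Icc_self hq1)
  simp only [onProd, norm_mul, Real.norm_eq_abs]
  exact mul_le_mul ((hq2.1 _ hm).trans (le_abs_self _)) ((hq2.2 _ hm).trans (le_abs_self _))
    (abs_nonneg _) (abs_nonneg _)

lemma integrable_onProd (hU : IsDominated P 𝓕 t T U) :
    Integrable (onProd U) ((volume.restrict (Ioc (t : ℝ) T)).prod P) := by
  simpa using hU.integrable_onProd_mul (const (P := P) (𝓕 := 𝓕) 1)

lemma mono (hU : IsDominated P 𝓕 t T U) {s u : ℝ≥0} (hs : t ≤ s) (hu : u ≤ T) :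
    IsDominated P 𝓕 s u U := by
  obtain ⟨G, hG, hGb⟩ := hU.bound
  refine ⟨fun r hr => hU.adapted r ⟨hs.trans hr.1, hr.2.trans hu⟩, hU.meas.mono_measure ?_, G, hG,
    hGb.mono fun ω h r hr => h r ⟨hs.trans hr.1, hr.2.trans hu⟩⟩
  exact Measure.prod_mono (Measure.restrict_mono (Set.Ioc_subset_Ioc (by exact_mod_cast hs)
    (by exact_mod_cast hu)) le_rfl) le_rfl

end IsDominated

/-- Fubini's theorem for a process integrable on `[t, T] × Ω`. -/
lemma integral_timeIntegral (htT : t ≤ T) {U : ℝ≥0 → Ω → ℝ}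
    (h : Integrable (onProd U) ((volume.restrict (Ioc (t : ℝ) T)).prod P)) :
    (∀ᵐ ω ∂P, IntervalIntegrable (fun r : ℝ => U r.toNNReal ω) volume t T) ∧
    Integrable (fun ω => timeIntegral t T fun s => U s ω) P ∧
    IntervalIntegrable (fun r : ℝ => ∫ ω, U r.toNNReal ω ∂P) volume t T ∧
    ∫ ω, timeIntegral t T (fun s => U s ω) ∂P = timeIntegral t T fun s => ∫ ω, U s ω ∂P := by
  have hle : (t : ℝ) ≤ T := by exact_mod_cast htT
  refine ⟨?_, ?_, ?_, ?_⟩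
  · filter_upwards [h.prod_left_ae] with ω hω
    exact (intervalIntegrable_iff_integrableOn_Ioc_of_le hle).2 hω
  · simp only [timeIntegral, intervalIntegral.integral_of_le hle]
    exact h.integral_prod_right
  · exact (intervalIntegrable_iff_integrableOn_Ioc_of_le hle).2 h.integral_prod_left
  · simp only [timeIntegral, intervalIntegral.integral_of_le hle]
    exact (integral_integral_swap (f := fun (r : ℝ) ω => U r.toNNReal ω) h).symm

variable {p : Params} {e₀ : ℝ} {σ : ℝ≥0 → Ω → ℝ} {ξ : Ω → Fin 3 → ℝ} {Z N : ℝ≥0 → Ω → ℝ}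
  {𝒳 : ℝ≥0 → Ω → Fin 3 → ℝ} {A B : ℝ → Matrix (Fin 3) (Fin 3) ℝ} {D : ℝ → Fin 3 → ℝ}

/-! ### The state process in the variables `(X, Y + γ₂ X, C)` -/

/-- The drift of `Y + γ₂ X` (and of `Y` outside of the impact of `Z`). -/
noncomputable def driftY (p : Params) (e₀ : ℝ) (x m : Fin 3 → ℝ) : ℝ :=
  -p.ρ * x 1 - p.γ₁ * (p.β - p.α) * x 2 - p.α * p.γ₁ * m 0 + p.α * p.γ₁ * e₀

/-- The drift of `C`. -/
noncomputable def driftC (p : Params) (e₀ : ℝ) (x m : Fin 3 → ℝ) : ℝ :=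
  -(p.β - p.α) * x 2 - p.α * m 0 + p.α * e₀

/-- `Y + γ₂ X`, the component of the state that does not react to `Z` instantaneously. -/
noncomputable def fundamental (p : Params) (x : Fin 3 → ℝ) : ℝ := x 1 + p.γ₂ * x 0

/-- A path `x` of the state with initial value `x₀`, mean `m`, martingale part `n` and
strategy `z`. -/
structure IsStatePath (p : Params) (e₀ : ℝ) (t T : ℝ≥0) (x₀ : Fin 3 → ℝ) (m : ℝ≥0 → Fin 3 → ℝ)
    (n z : ℝ≥0 → ℝ) (x : ℝ≥0 → Fin 3 → ℝ) : Prop where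
  position : ∀ s ∈ Icc t T, x s 0 = x₀ 0 - z s
  fundamental_start : fundamental p (x t) = fundamental p x₀
  fundamental_primitive : IsPrimitiveOn
    (fun r : ℝ => fundamental p (x r.toNNReal) - n r.toNNReal)
    (fun r : ℝ => driftY p e₀ (x r.toNNReal) (m r.toNNReal)) t T
  child_start : x t 2 = x₀ 2
  child_primitive : IsPrimitiveOn (fun r : ℝ => x r.toNNReal 2)
    (fun r : ℝ => driftC p e₀ (x r.toNNReal) (m r.toNNReal)) t T

/-- Almost every path of `𝒳` satisfies the state equations. -/
abbrev HasStatePaths (P : Measure Ω) (p : Params) (e₀ : ℝ)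
    (t T : ℝ≥0) (ξ : Ω → Fin 3 → ℝ) (N Z : ℝ≥0 → Ω → ℝ) (𝒳 : ℝ≥0 → Ω → Fin 3 → ℝ) : Prop :=
  ∀ᵐ ω ∂P, IsStatePath p e₀ t T (ξ ω) (mean P 𝒳) (fun s => N s ω) (fun s => Z s ω)
    (fun s => 𝒳 s ω)

lemma isItoPair_zero (hW : IsBrownianBasis P 𝓕 W) : IsItoPair P 𝓕 W T (0, 0) :=
  IsItoPair.of_mem hW (Submodule.zero_mem _)

lemma IsItoIntegral.ae_eq_zero (hW : IsBrownianBasis P 𝓕 W)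
    (h : IsItoIntegral P 𝓕 W T (fun _ _ => 0) N) : ∀ᵐ ω ∂P, ∀ s ≤ T, N s ω = 0 := by
  have hx := h.isItoPair (by
    have : onProd (fun (_ : ℝ≥0) (_ : Ω) => (0 : ℝ)) = fun _ => 0 := rfl
    rw [this]; exact MemLp.zero)
  exact hx.ae_forall_eq_of_fst_eq hW (isItoPair_zero hW) rfl h.cont
    (Eventually.of_forall fun ω => continuousOn_const)

/-- The equations satisfied by almost every path of the state process. -/
lemma IsState.exists_isStatePath (hW : IsBrownianBasis P 𝓕 W) (htT : t ≤ T)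
    (h : IsState P 𝓕 W p e₀ σ t T ξ Z 𝒳) : ∃ N : ℝ≥0 → Ω → ℝ, IsItoIntegral P 𝓕 W T σ N ∧
      HasStatePaths P p e₀ t T ξ N Z 𝒳 := by
  obtain ⟨N, hN, hsde⟩ := h.sde
  refine ⟨N 1, hN 1, ?_⟩
  have hm := h.integrable_mean 0
  have hle : (t : ℝ) ≤ T := by exact_mod_cast htT
  filter_upwards [hsde, (hN 0).ae_eq_zero hW, (hN 2).ae_eq_zero hW] with ω hω h0 h2
  have hi : ∀ i, IntervalIntegrable (fun r : ℝ => 𝒳 r.toNNReal ω i) volume t T := fun i =>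
    (h.cadlag ω i).intervalIntegrable htT
  have hX : ∀ s ∈ Icc t T, 𝒳 s ω 0 = ξ ω 0 - Z s ω := by
    intro s hs
    have := hω s hs 0
    rw [h0 s hs.2, h0 t htT] at this
    rw [this]
    simp [timeIntegral, Params.H, Params.Hbar, Params.G, Params.K, dotProduct,
      Fin.sum_univ_three]
    ring
  have hdY : ∀ r, (p.H *ᵥ 𝒳 r ω + p.Hbar *ᵥ mean P 𝒳 r + p.G e₀) 1
      = driftY p e₀ (𝒳 r ω) (mean P 𝒳 r) := by
    intro r
    simp [driftY, Params.H, Params.Hbar, Params.G, dotProduct,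
      Fin.sum_univ_three]
    ring
  have hdC : ∀ r, (p.H *ᵥ 𝒳 r ω + p.Hbar *ᵥ mean P 𝒳 r + p.G e₀) 2
      = driftC p e₀ (𝒳 r ω) (mean P 𝒳 r) := by
    intro r
    simp [driftC, Params.H, Params.Hbar, Params.G, dotProduct,
      Fin.sum_univ_three]
    ring
  have hiY : IntervalIntegrable (fun r : ℝ => driftY p e₀ (𝒳 r.toNNReal ω) (mean P 𝒳 r.toNNReal))
      volume t T :=
    ((((hi 1).const_mul _).sub ((hi 2).const_mul _)).sub (hm.const_mul _)).add
      intervalIntegrable_const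
  have hiC : IntervalIntegrable (fun r : ℝ => driftC p e₀ (𝒳 r.toNNReal ω) (mean P 𝒳 r.toNNReal))
      volume t T :=
    (((hi 2).const_mul _).sub (hm.const_mul _)).add intervalIntegrable_const
  have hY : ∀ s ∈ Icc t T, fundamental p (𝒳 s ω) = fundamental p (ξ ω)
      + (∫ r in (t : ℝ)..s, driftY p e₀ (𝒳 r.toNNReal ω) (mean P 𝒳 r.toNNReal))
      + (N 1 s ω - N 1 t ω) := by
    intro s hs
    have h1 := hω s hs 1
    simp only [hdY, timeIntegral] at h1
    unfold fundamental
    rw [h1, hX s hs]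
    simp [Params.K]
    ring
  have hC : ∀ s ∈ Icc t T, 𝒳 s ω 2 = ξ ω 2
      + ∫ r in (t : ℝ)..s, driftC p e₀ (𝒳 r.toNNReal ω) (mean P 𝒳 r.toNNReal) := by
    intro s hs
    have h1 := hω s hs 2
    rw [h2 s hs.2, h2 t htT] at h1
    simp only [hdC, timeIntegral] at h1
    rw [h1]
    simp [Params.K]
  have ht : t ∈ Icc t T := ⟨le_rfl, htT⟩
  have hYt : fundamental p (𝒳 t ω) = fundamental p (ξ ω) := by simpa using hY t ht
  have hCt : 𝒳 t ω 2 = ξ ω 2 := by simpa using hC t ht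
  refine ⟨hX, hYt, ⟨hiY, fun s hs => ?_⟩, hCt, ⟨hiC, fun s hs => ?_⟩⟩
  · have h1 := hY _ (toNNReal_mem_Icc hs)
    rw [Real.coe_toNNReal s (t.coe_nonneg.trans hs.1)] at h1
    rw [Real.toNNReal_coe, h1, hYt]
    ring
  · have h1 := hC _ (toNNReal_mem_Icc hs)
    rw [Real.coe_toNNReal s (t.coe_nonneg.trans hs.1)] at h1
    rw [Real.toNNReal_coe, h1, hCt]

namespace IsDominated

/-- A right-continuous adapted process with a square integrable bound is dominated. -/
lemma of_cadlag (htT : t ≤ T) {U : ℝ≥0 → Ω → ℝ} (hU : ∀ s ∈ Icc t T, StronglyMeasurable[𝓕 s] (U s))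
    (hc : ∀ᵐ ω ∂P, ∀ s ∈ Ico t T, ContinuousWithinAt (fun s => U s ω) (Ici s) s)
    (hb : ∃ G : Ω → ℝ, MemLp G 2 P ∧ ∀ᵐ ω ∂P, ∀ s ∈ Icc t T, |U s ω| ≤ G ω) :
    IsDominated P 𝓕 t T U :=
  ⟨hU, aestronglyMeasurable_onProd htT (fun s hs => (hU s hs).mono (𝓕.le s)) hc, hb⟩

/-- The expectation of a dominated process, as a process. -/
lemma expectation (htT : t ≤ T) {U : ℝ≥0 → Ω → ℝ} (hU : IsDominated P 𝓕 t T U) :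
    IsDominated P 𝓕 t T (fun s _ => ∫ ω, U s ω ∂P) := by
  have h1 := (integral_timeIntegral htT hU.integrable_onProd).2.2.1
  rw [intervalIntegrable_iff_integrableOn_Ioc_of_le (by exact_mod_cast htT)] at h1
  refine det (g := fun s => ∫ ω, U s ω ∂P) h1.aestronglyMeasurable ?_
  obtain ⟨G, hG, hGb⟩ := hU.bound
  refine ⟨∫ ω, G ω ∂P, fun s hs => (abs_integral_le_integral_abs).trans ?_⟩
  exact integral_mono_ae (hU.integrable hs).abs (hG.integrable one_le_two)
    (hGb.mono fun ω h => h s hs)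

end IsDominated

lemma IsItoPair.isDominated (hW : IsBrownianBasis P 𝓕 W) (htT : t ≤ T) (hx : IsItoPair P 𝓕 W T x)
    (hc : ∀ᵐ ω ∂P, ContinuousOn (fun s => x.2 s ω) (Icc 0 T)) : IsDominated P 𝓕 t T x.2 := by
  obtain ⟨G, hG, hGb⟩ := hx.exists_memLp_bound hW hc
  refine .of_cadlag htT (fun s hs => hx.adapted s hs.2) ?_
    ⟨G, hG, hGb.mono fun ω h s hs => h s hs.2⟩
  filter_upwards [hc] with ω hω s hs
  refine (hω s ⟨zero_le, hs.2.le⟩).mono_of_mem_nhdsWithin ?_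
  filter_upwards [Ico_mem_nhdsGE hs.2] with r hr using ⟨zero_le, hr.2.le⟩

/-- Grönwall's inequality with an integrable inhomogeneity. -/
lemma le_add_integral_mul_exp {φ g : ℝ → ℝ} {a b K L : ℝ} (hab : a ≤ b) (hL : 0 ≤ L)
    (hφ : ContinuousOn φ (Icc a b)) (hg : IntervalIntegrable g volume a b)
    (hg0 : ∀ r ∈ Ioc a b, 0 ≤ g r)
    (h : ∀ s ∈ Icc a b, φ s ≤ K + ∫ r in a..s, (L * φ r + g r)) (hK : 0 ≤ K) :
    ∀ s ∈ Icc a b, φ s ≤ (K + ∫ r in a..b, g r) * Real.exp (L * (b - a)) := by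
  intro s hs
  have hmain : ∀ s ∈ Icc a b, φ s ≤ (K + ∫ r in a..b, g r) + L * ∫ r in a..s, φ r := by
    intro s hs
    refine (h s hs).trans ?_
    have hsub : Set.uIcc a s ⊆ Set.uIcc a b := by
      rw [Set.uIcc_of_le hs.1, Set.uIcc_of_le hab]; exact Set.Icc_subset_Icc_right hs.2
    have hφi : IntervalIntegrable φ volume a s := by
      refine ContinuousOn.intervalIntegrable (hφ.mono ?_)
      rw [Set.uIcc_of_le hs.1]; exact Set.Icc_subset_Icc_right hs.2
    rw [intervalIntegral.integral_add (hφi.const_mul L) (hg.mono_set hsub),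
      intervalIntegral.integral_const_mul]
    have : ∫ r in a..s, g r ≤ ∫ r in a..b, g r := by
      refine intervalIntegral.integral_mono_interval le_rfl hs.1 hs.2 ?_ hg
      exact (ae_restrict_iff' measurableSet_Ioc).2 (Eventually.of_forall hg0)
    linarith
  have h1 := le_mul_exp_of_le_add_integral hab hL hφ hmain s hs
  refine h1.trans (mul_le_mul_of_nonneg_left (Real.exp_le_exp.2 ?_) ?_)
  · exact mul_le_mul_of_nonneg_left (by linarith [hs.2]) hL
  · exact add_nonneg hK (intervalIntegral.integral_nonneg_of_ae_restrict hab
      ((ae_restrict_iff' measurableSet_Icc).2 (by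
        filter_upwards [Measure.ae_ne volume a] with r hr hr'
        exact hg0 r ⟨lt_of_le_of_ne hr'.1 (Ne.symm hr), hr'.2⟩)))

lemma memLp_two_of_sq_le {Φ : Ω → ℝ≥0∞} (hΦ : Measurable Φ) (h : ∫⁻ ω, Φ ω ∂P < ∞) :
    MemLp (fun ω => √(Φ ω).toReal) 2 P := by
  have hm : AEStronglyMeasurable (fun ω => √(Φ ω).toReal) P :=
    (Real.continuous_sqrt.measurable.comp hΦ.ennreal_toReal).aestronglyMeasurable
  rw [memLp_two_iff_integrable_sq hm]
  simp only [Real.sq_sqrt ENNReal.toReal_nonneg]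
  exact integrable_toReal_of_lintegral_ne_top hΦ.aemeasurable h.ne

/-- An admissible strategy is dominated by a square integrable random variable. -/
lemma IsAdmissible.exists_bound (htT : t ≤ T) (h : IsAdmissible P 𝓕 t T Z) :
    ∃ G : Ω → ℝ, MemLp G 2 P ∧ ∀ᵐ ω ∂P, ∀ s ∈ Icc t T, |Z s ω| ≤ G ω := by
  set d : ℕ × ℕ → ℝ≥0 := fun q => max t (min T (((q.2 : ℝ≥0) + 1) / ((q.1 : ℝ≥0) + 1))) with hd
  have hdm : ∀ q, d q ∈ Icc t T := fun q => ⟨le_max_left _ _, max_le htT (min_le_left _ _)⟩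
  set Φ : Ω → ℝ≥0∞ := fun ω => ⨆ q, ENNReal.ofReal (Z (d q) ω ^ 2) with hΦ
  have hΦm : Measurable Φ := Measurable.iSup fun q =>
    (((h.adapted _ (hdm q).2).mono (𝓕.le _)).measurable.pow_const 2).ennreal_ofReal
  have hΦi : ∫⁻ ω, Φ ω ∂P < ∞ := by
    refine lt_of_le_of_lt (lintegral_mono fun ω => ?_) h.sup_sq
    exact iSup_le fun q => le_iSup₂ (f := fun s _ => ENNReal.ofReal (Z s ω ^ 2)) (d q) (hdm q)
  refine ⟨_, memLp_two_of_sq_le hΦm hΦi, ?_⟩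
  filter_upwards [ae_lt_top hΦm hΦi.ne] with ω hω s hs
  refine Real.abs_le_sqrt ?_
  rw [← ENNReal.ofReal_le_iff_le_toReal hω.ne]
  rcases lt_or_eq_of_le hs.2 with hsT | rfl
  · have hs' : (s : ℝ) ∈ Ico (t : ℝ) T := ⟨by exact_mod_cast hs.1, by exact_mod_cast hsT⟩
    have h1 := tendsto_gridPt hs'
    rw [Real.toNNReal_coe] at h1
    have h2 := ENNReal.tendsto_ofReal
      ((((h.cadlag ω).1 s ⟨hs.1, hsT⟩).tendsto.comp h1).pow 2)
    refine le_of_tendsto h2 (Eventually.of_forall fun n => ?_)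
    exact le_iSup (fun q => ENNReal.ofReal (Z (d q) ω ^ 2)) (n, ⌊((n : ℝ) + 1) * s⌋₊)
  · have : d (0, ⌈(s : ℝ)⌉₊) = s := by
      have h3 : s ≤ ((⌈(s : ℝ)⌉₊ : ℝ≥0) + 1) / (((0 : ℕ) : ℝ≥0) + 1) := by
        rw [Nat.cast_zero, zero_add, div_one, ← NNReal.coe_le_coe]
        push_cast
        linarith [Nat.le_ceil (s : ℝ)]
      simp only [hd]
      rw [min_eq_left h3, max_eq_right htT]
    have h4 := le_iSup (fun q => ENNReal.ofReal (Z (d q) ω ^ 2)) (0, ⌈(s : ℝ)⌉₊)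
    rwa [this] at h4

lemma abs_integral_le_integral {f g : ℝ → ℝ} {a b : ℝ} (hab : a ≤ b)
    (hg : IntervalIntegrable g volume a b) (h : ∀ r ∈ Ioo a b, |f r| ≤ g r) :
    |∫ r in a..b, f r| ≤ ∫ r in a..b, g r := by
  have := intervalIntegral.norm_integral_le_of_norm_le (f := f) hab ?_ hg
  · simpa only [Real.norm_eq_abs] using this
  · filter_upwards [Measure.ae_ne volume b] with r hr hr'
    exact h r ⟨hr'.1, lt_of_le_of_ne hr'.2 hr⟩

/-- Pathwise domination of the state by its initial value and the martingale part, once the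
position obeys a linear growth estimate. -/
lemma IsStatePath.le_exp (hp : p.Standing) (htT : t ≤ T) {x₀ : Fin 3 → ℝ} {m : ℝ≥0 → Fin 3 → ℝ}
    {n z : ℝ≥0 → ℝ} {x : ℝ≥0 → Fin 3 → ℝ} (h : IsStatePath p e₀ t T x₀ m n z x)
    (hn : ContinuousOn n (Icc t T)) {Gn : ℝ} (hGn : ∀ s ∈ Icc t T, |n s| ≤ Gn)
    (hm : IntervalIntegrable (fun r : ℝ => m r.toNNReal 0) volume t T)
    {χ g₀ : ℝ → ℝ} {L₀ G₀ : ℝ} (hL₀ : 0 ≤ L₀) (hG₀ : 0 ≤ G₀)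
    (hχ : ContinuousOn χ (Icc (t : ℝ) T)) (hχ0 : ∀ r ∈ Icc (t : ℝ) T, 0 ≤ χ r)
    (hg₀ : IntervalIntegrable g₀ volume t T) (hg₀0 : ∀ r ∈ Ioc (t : ℝ) T, 0 ≤ g₀ r)
    (hxχ : ∀ r ∈ Ioo (t : ℝ) T, |x r.toNNReal 0| ≤ χ r)
    (hχle : ∀ s ∈ Icc (t : ℝ) T, χ s ≤ G₀ + ∫ r in (t : ℝ)..s,
      (L₀ * (χ r + |fundamental p (x r.toNNReal)| + |x r.toNNReal 2|) + g₀ r)) :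
    ∀ s ∈ Icc (t : ℝ) T, χ s + |fundamental p (x s.toNNReal)| + |x s.toNNReal 2|
      ≤ (G₀ + |fundamental p x₀| + |x₀ 2| + 2 * Gn
          + ∫ r in (t : ℝ)..T, (g₀ r + (p.α * p.γ₁ + p.α) * (|m r.toNNReal 0| + |e₀|)))
        * Real.exp ((L₀ + (p.ρ * (1 + p.γ₂) + p.γ₁ * (p.β - p.α) + (p.β - p.α))) * (T - t)) := by
  obtain ⟨hγ₁, hγ₂, hα, hβ, hρ, hlam, hαβ, ha⟩ := hp
  have hle : (t : ℝ) ≤ T := by exact_mod_cast htT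
  have hnc : ContinuousOn (fun r : ℝ => n r.toNNReal) (Icc (t : ℝ) T) :=
    continuousOn_comp_toNNReal hn
  have hPc : ContinuousOn (fun r : ℝ => fundamental p (x r.toNNReal)) (Icc (t : ℝ) T) :=
    (h.fundamental_primitive.continuousOn.add hnc).congr fun r _ => (sub_add_cancel _ _).symm
  have hCc := h.child_primitive.continuousOn
  have hGn0 : 0 ≤ Gn := (abs_nonneg _).trans (hGn t ⟨le_rfl, htT⟩)
  have hφc : ContinuousOn (fun s : ℝ => χ s + |fundamental p (x s.toNNReal)| + |x s.toNNReal 2|)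
      (Icc (t : ℝ) T) := (hχ.add hPc.abs).add hCc.abs
  have hmi : IntervalIntegrable (fun r : ℝ => (p.α * p.γ₁ + p.α) * (|m r.toNNReal 0| + |e₀|))
      volume t T := (hm.abs.add intervalIntegrable_const).const_mul _
  have hk : 0 ≤ p.γ₁ * (p.β - p.α) := mul_nonneg hγ₁ hαβ.le
  refine le_add_integral_mul_exp hle (by positivity) hφc (hg₀.add hmi)
    (fun r hr => add_nonneg (hg₀0 r hr) (by positivity)) (fun s hs => ?_) (by positivity)
  have hsT := hs.2
  have hsub : Set.uIcc (t : ℝ) s ⊆ Set.uIcc (t : ℝ) T := by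
    rw [Set.uIcc_of_le hs.1, Set.uIcc_of_le hle]; exact Set.Icc_subset_Icc_right hsT
  have hφi : IntervalIntegrable
      (fun s : ℝ => χ s + |fundamental p (x s.toNNReal)| + |x s.toNNReal 2|) volume t s :=
    ContinuousOn.intervalIntegrable (hφc.mono (by
      rw [Set.uIcc_of_le hs.1]; exact Set.Icc_subset_Icc_right hsT))
  set φ : ℝ → ℝ := fun s => χ s + |fundamental p (x s.toNNReal)| + |x s.toNNReal 2| with hφ
  have hm' := hm.mono_set hsub
  have hg' := hg₀.mono_set hsub
  have hPle : |fundamental p (x s.toNNReal)| ≤ |fundamental p x₀| + 2 * Gn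
      + ∫ r in (t : ℝ)..s, ((p.ρ * (1 + p.γ₂) + p.γ₁ * (p.β - p.α)) * φ r
        + p.α * p.γ₁ * (|m r.toNNReal 0| + |e₀|)) := by
    have e1 := h.fundamental_primitive.eq s hs
    rw [Real.toNNReal_coe, h.fundamental_start] at e1
    have e2 : fundamental p (x s.toNNReal) = fundamental p x₀ + (n s.toNNReal - n t)
        + ∫ r in (t : ℝ)..s, driftY p e₀ (x r.toNNReal) (m r.toNNReal) := by linarith
    rw [e2]
    refine (abs_add_le _ _).trans (add_le_add ((abs_add_le _ _).trans (add_le_add le_rfl ?_)) ?_)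
    · refine (abs_sub _ _).trans ?_
      linarith [hGn _ (toNNReal_mem_Icc hs), hGn t ⟨le_rfl, htT⟩]
    · refine abs_integral_le_integral hs.1 ((hφi.const_mul _).add
        ((hm'.abs.add intervalIntegrable_const).const_mul _)) fun r hr => ?_
      have hrT : r ∈ Ioo (t : ℝ) T := ⟨hr.1, hr.2.trans_le hsT⟩
      have hx := hxχ r hrT
      have hY : x r.toNNReal 1 = fundamental p (x r.toNNReal) - p.γ₂ * x r.toNNReal 0 := by
        unfold fundamental; ring
      unfold driftY
      rw [hY]
      have b1 : |-p.ρ * (fundamental p (x r.toNNReal) - p.γ₂ * x r.toNNReal 0)|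
          ≤ p.ρ * (|fundamental p (x r.toNNReal)| + p.γ₂ * χ r) := by
        rw [abs_mul, abs_neg, abs_of_nonneg hρ]
        refine mul_le_mul_of_nonneg_left ((abs_sub _ _).trans (add_le_add le_rfl ?_)) hρ
        rw [abs_mul, abs_of_pos hγ₂]
        exact mul_le_mul_of_nonneg_left hx hγ₂.le
      have b2 : |p.γ₁ * (p.β - p.α) * x r.toNNReal 2|
          = p.γ₁ * (p.β - p.α) * |x r.toNNReal 2| := by rw [abs_mul, abs_of_nonneg hk]
      have b3 : |p.α * p.γ₁ * m r.toNNReal 0| = p.α * p.γ₁ * |m r.toNNReal 0| := by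
        rw [abs_mul, abs_of_nonneg (mul_nonneg hα hγ₁)]
      have b4 : |p.α * p.γ₁ * e₀| = p.α * p.γ₁ * |e₀| := by
        rw [abs_mul, abs_of_nonneg (mul_nonneg hα hγ₁)]
      refine (abs_add_le _ _).trans ?_
      refine (add_le_add_left ((abs_sub _ _).trans
        (add_le_add_left ((abs_sub _ _).trans (add_le_add_left b1 _)) _)) _).trans ?_
      rw [b2, b3, b4]
      simp only [hφ]
      have c1 : 0 ≤ p.ρ * (χ r) := mul_nonneg hρ (hχ0 r ⟨hrT.1.le, hrT.2.le⟩)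
      have c1' : 0 ≤ p.ρ * p.γ₂ * |fundamental p (x r.toNNReal)| := by positivity
      have c2 : 0 ≤ p.ρ * (1 + p.γ₂) * |x r.toNNReal 2| := by positivity
      have c3 : 0 ≤ p.γ₁ * (p.β - p.α) * (χ r + |fundamental p (x r.toNNReal)|) :=
        mul_nonneg hk (add_nonneg (hχ0 r ⟨hrT.1.le, hrT.2.le⟩) (abs_nonneg _))
      nlinarith
  have hCle : |x s.toNNReal 2| ≤ |x₀ 2|
      + ∫ r in (t : ℝ)..s, ((p.β - p.α) * φ r + p.α * (|m r.toNNReal 0| + |e₀|)) := by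
    have e1 := h.child_primitive.eq s hs
    rw [Real.toNNReal_coe, h.child_start] at e1
    rw [e1]
    refine (abs_add_le _ _).trans (add_le_add le_rfl ?_)
    refine abs_integral_le_integral hs.1 ((hφi.const_mul _).add
        ((hm'.abs.add intervalIntegrable_const).const_mul _)) fun r hr => ?_
    unfold driftC
    have b1 : |-(p.β - p.α) * x r.toNNReal 2| = (p.β - p.α) * |x r.toNNReal 2| := by
      rw [abs_mul, abs_neg, abs_of_pos hαβ]
    have b3 : |p.α * m r.toNNReal 0| = p.α * |m r.toNNReal 0| := by
      rw [abs_mul, abs_of_nonneg hα]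
    have b4 : |p.α * e₀| = p.α * |e₀| := by rw [abs_mul, abs_of_nonneg hα]
    refine (abs_add_le _ _).trans ?_
    refine (add_le_add_left (abs_sub _ _) _).trans ?_
    rw [b1, b3, b4]
    simp only [hφ]
    have c3 : 0 ≤ (p.β - p.α) * (χ r + |fundamental p (x r.toNNReal)|) :=
      mul_nonneg hαβ.le (add_nonneg (hχ0 r ⟨hr.1.le, hr.2.le.trans hsT⟩) (abs_nonneg _))
    nlinarith
  have hχs := hχle s hs
  have i1 : IntervalIntegrable (fun r : ℝ => (p.ρ * (1 + p.γ₂) + p.γ₁ * (p.β - p.α)) * φ r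
      + p.α * p.γ₁ * (|m r.toNNReal 0| + |e₀|)) volume t s :=
    (hφi.const_mul _).add ((hm'.abs.add intervalIntegrable_const).const_mul _)
  have i2 : IntervalIntegrable (fun r : ℝ => (p.β - p.α) * φ r
      + p.α * (|m r.toNNReal 0| + |e₀|)) volume t s :=
    (hφi.const_mul _).add ((hm'.abs.add intervalIntegrable_const).const_mul _)
  have i0 : IntervalIntegrable (fun r : ℝ => L₀ * φ r + g₀ r) volume t s :=
    (hφi.const_mul _).add hg'
  have hsum : (∫ r in (t : ℝ)..s, (L₀ * φ r + g₀ r))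
      + (∫ r in (t : ℝ)..s, ((p.ρ * (1 + p.γ₂) + p.γ₁ * (p.β - p.α)) * φ r
        + p.α * p.γ₁ * (|m r.toNNReal 0| + |e₀|)))
      + (∫ r in (t : ℝ)..s, ((p.β - p.α) * φ r + p.α * (|m r.toNNReal 0| + |e₀|)))
      = ∫ r in (t : ℝ)..s,
        ((L₀ + (p.ρ * (1 + p.γ₂) + p.γ₁ * (p.β - p.α) + (p.β - p.α))) * φ r
          + (g₀ r + (p.α * p.γ₁ + p.α) * (|m r.toNNReal 0| + |e₀|))) := by
    rw [← intervalIntegral.integral_add i0 i1, ← intervalIntegral.integral_add (i0.add i1) i2]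
    refine intervalIntegral.integral_congr fun r _ => ?_
    ring
  rw [← hsum]
  simp only [hφ] at hχs ⊢
  linarith

/-- The components of the state are dominated by a square integrable random variable. -/
lemma exists_bound_of_isStatePath (hp : p.Standing) (hW : IsBrownianBasis P 𝓕 W) (htT : t ≤ T)
    (hσ2 : MemLp (onProd σ) 2 (prodMeasure P T)) (hξ2 : ∀ i, MemLp (fun ω => ξ ω i) 2 P)
    (hN : IsItoIntegral P 𝓕 W T σ N)
    (hm : IntervalIntegrable (fun r : ℝ => mean P 𝒳 r.toNNReal 0) volume t T)
    (hpath : HasStatePaths P p e₀ t T ξ N Z 𝒳)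
    {G₀ GT : Ω → ℝ} (hG₀ : MemLp G₀ 2 P) (hGT : MemLp GT 2 P) {L₀ : ℝ} (hL₀ : 0 ≤ L₀) {g₀ : ℝ → ℝ}
    (hg₀ : IntervalIntegrable g₀ volume t T) (hg₀0 : ∀ r ∈ Ioc (t : ℝ) T, 0 ≤ g₀ r)
    (hT : ∀ᵐ ω ∂P, |𝒳 T ω 0| ≤ GT ω)
    (hχ : ∀ᵐ ω ∂P, 0 ≤ G₀ ω ∧ ∃ χ : ℝ → ℝ, ContinuousOn χ (Icc (t : ℝ) T) ∧
      (∀ r ∈ Icc (t : ℝ) T, 0 ≤ χ r) ∧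
      (∀ r ∈ Ico (t : ℝ) T, |𝒳 r.toNNReal ω 0| ≤ χ r) ∧
      ∀ s ∈ Icc (t : ℝ) T, χ s ≤ G₀ ω + ∫ r in (t : ℝ)..s,
        (L₀ * (χ r + |fundamental p (𝒳 r.toNNReal ω)| + |𝒳 r.toNNReal ω 2|) + g₀ r)) :
    ∃ G : Ω → ℝ, MemLp G 2 P ∧ ∀ᵐ ω ∂P, ∀ s ∈ Icc t T, ∀ i, |𝒳 s ω i| ≤ G ω := by
  obtain ⟨GN, hGN, hGNb⟩ := (hN.isItoPair hσ2).exists_memLp_bound hW hN.cont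
  set E := Real.exp ((L₀ + (p.ρ * (1 + p.γ₂) + p.γ₁ * (p.β - p.α) + (p.β - p.α))) * (T - t))
  set c := ∫ r in (t : ℝ)..T, (g₀ r + (p.α * p.γ₁ + p.α) * (|mean P 𝒳 r.toNNReal 0| + |e₀|))
  set F : Ω → ℝ := fun ω => (G₀ ω + |fundamental p (ξ ω)| + |ξ ω 2| + 2 * GN ω + c) * E with hF
  have hF2 : MemLp F 2 P := by
    have h1 : MemLp (fun ω => fundamental p (ξ ω)) 2 P := (hξ2 1).add ((hξ2 0).const_mul _)
    exact ((((hG₀.add h1.abs).add (hξ2 2).abs).add (hGN.const_mul 2)).add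
      (memLp_const c)).mul_const E
  refine ⟨fun ω => (1 + p.γ₂) * F ω + (1 + p.γ₂) * GT ω,
    (hF2.const_mul _).add (hGT.const_mul _), ?_⟩
  filter_upwards [hpath, hGNb, hN.cont, hT, hχ] with ω h1 h2 h3 h4 h5 s hs
  obtain ⟨hG₀0, χ, hχ1, hχ2, hχ3, hχ4⟩ := h5
  have hmain := h1.le_exp hp htT (h3.mono (Set.Icc_subset_Icc_left (zero_le)))
    (fun s hs => h2 s hs.2) hm hL₀ hG₀0 hχ1 hχ2 hg₀ hg₀0 (fun r hr => hχ3 r ⟨hr.1.le, hr.2⟩) hχ4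
  have hs' : (s : ℝ) ∈ Icc (t : ℝ) T := ⟨by exact_mod_cast hs.1, by exact_mod_cast hs.2⟩
  have h6 := hmain s hs'
  rw [Real.toNNReal_coe] at h6
  have hGT0 : 0 ≤ GT ω := (abs_nonneg _).trans h4
  have hχs := hχ2 s hs'
  have hγ₂ := hp.γ₂_pos
  change _ ≤ F ω at h6
  have hX : |𝒳 s ω 0| ≤ χ s + GT ω := by
    rcases lt_or_eq_of_le hs.2 with h | rfl
    · have := hχ3 s ⟨hs'.1, by exact_mod_cast h⟩
      rw [Real.toNNReal_coe] at this
      linarith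
    · linarith
  have hfa := abs_nonneg (fundamental p (𝒳 s ω))
  have hCa := abs_nonneg (𝒳 s ω 2)
  have hF0 : 0 ≤ F ω := by linarith
  have q1 := mul_nonneg hγ₂.le hF0
  have q2 := mul_nonneg hγ₂.le hGT0
  intro i
  fin_cases i
  · simp only [Fin.zero_eta]; linarith
  · have hY : 𝒳 s ω 1 = fundamental p (𝒳 s ω) - p.γ₂ * 𝒳 s ω 0 := by unfold fundamental; ring
    simp only [Fin.mk_one]
    rw [hY]
    refine (abs_sub _ _).trans ?_
    rw [abs_mul, abs_of_pos hγ₂]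
    have := mul_le_mul_of_nonneg_left (hX.trans (add_le_add_left (by linarith : χ s ≤ F ω) _)) hγ₂.le
    linarith
  · simp only [Fin.reduceFinMk]; linarith

/-- The state driven by a dominated strategy is dominated. -/
lemma IsState.isDominated_of_bound (htT : t ≤ T) (h : IsState P 𝓕 W p e₀ σ t T ξ Z 𝒳)
    (hb : ∃ G : Ω → ℝ, MemLp G 2 P ∧ ∀ᵐ ω ∂P, ∀ s ∈ Icc t T, ∀ i, |𝒳 s ω i| ≤ G ω) (i : Fin 3) :
    IsDominated P 𝓕 t T (fun s ω => 𝒳 s ω i) := by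
  obtain ⟨G, hG, hGb⟩ := hb
  exact .of_cadlag htT (fun s hs => h.adapted s hs i)
    (Eventually.of_forall fun ω => (h.cadlag ω i).1) ⟨G, hG, hGb.mono fun ω hω s hs => hω s hs i⟩

lemma IsAdmissible.exists_state_bound (hp : p.Standing) (hW : IsBrownianBasis P 𝓕 W) (htT : t ≤ T)
    (hσ2 : MemLp (onProd σ) 2 (prodMeasure P T)) (hξ2 : ∀ i, MemLp (fun ω => ξ ω i) 2 P)
    (hZ : IsAdmissible P 𝓕 t T Z) (h : IsState P 𝓕 W p e₀ σ t T ξ Z 𝒳) :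
    ∃ G : Ω → ℝ, MemLp G 2 P ∧ ∀ᵐ ω ∂P, ∀ s ∈ Icc t T, ∀ i, |𝒳 s ω i| ≤ G ω := by
  obtain ⟨N, hN, hpath⟩ := h.exists_isStatePath hW htT
  obtain ⟨G, hG, hGb⟩ := hZ.exists_bound htT
  have hX : ∀ᵐ ω ∂P, ∀ s ∈ Icc t T, |𝒳 s ω 0| ≤ |ξ ω 0| + G ω := by
    filter_upwards [hpath, hGb] with ω h1 h2 s hs
    rw [h1.position s hs]
    exact (abs_sub _ _).trans (add_le_add le_rfl (h2 s hs))
  have hG2 : MemLp (fun ω => |ξ ω 0| + G ω) 2 P := (hξ2 0).abs.add hG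
  refine exists_bound_of_isStatePath hp hW htT hσ2 hξ2 hN (h.integrable_mean 0) hpath hG2 hG2
    (L₀ := 0) le_rfl (g₀ := fun _ => 0) intervalIntegrable_const (fun _ _ => le_rfl)
    (hX.mono fun ω hω => hω T ⟨htT, le_rfl⟩) ?_
  filter_upwards [hX] with ω hω
  have h0 : 0 ≤ |ξ ω 0| + G ω := (abs_nonneg _).trans (hω t ⟨le_rfl, htT⟩)
  refine ⟨h0, fun _ => |ξ ω 0| + G ω, continuousOn_const, fun _ _ => h0,
    fun r hr => hω _ (toNNReal_mem_Icc ⟨hr.1, hr.2.le⟩), fun s _ => by simp⟩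

lemma IsDominated.toConst {U : ℝ≥0 → Ω → ℝ} (h : IsDominated P 𝓕 t T U) :
    IsDominated P (Filtration.const ℝ≥0 mΩ le_rfl) t T U :=
  ⟨fun s hs => (h.adapted s hs).mono (𝓕.le s), h.meas, h.bound⟩

/-- `U` is an Itô process on `[t, T]` with drift `b` and martingale part `∫ x.1 dW = x.2`, all of
whose components are dominated. -/
structure IsItoProcess (P : Measure Ω) (𝓕 : Filtration ℝ≥0 mΩ) (W : ℝ≥0 → Ω → ℝ) (t T : ℝ≥0)
    (U b : ℝ≥0 → Ω → ℝ) (x : ProcPair Ω) : Prop where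
  dom : IsDominated P 𝓕 t T U
  drift_dom : IsDominated P 𝓕 t T b
  ito : IsItoPair P 𝓕 W T x
  mart_dom : IsDominated P 𝓕 t T x.2
  path : ∀ᵐ ω ∂P, IsPrimitiveOn (fun r : ℝ => U r.toNNReal ω - x.2 r.toNNReal ω)
    (fun r : ℝ => b r.toNNReal ω) t T

namespace IsItoProcess

variable {U b V c : ℝ≥0 → Ω → ℝ}

lemma coe_mem {s : ℝ≥0} (hs : s ∈ Icc t T) : (s : ℝ) ∈ Icc (t : ℝ) T :=
  ⟨by exact_mod_cast hs.1, by exact_mod_cast hs.2⟩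

/-- Subtraction of a deterministic absolutely continuous function. -/
lemma sub_det (hU : IsItoProcess P 𝓕 W t T U b x) {m m' : ℝ≥0 → ℝ}
    (hm : IsPrimitiveOn (fun r : ℝ => m r.toNNReal) (fun r : ℝ => m' r.toNNReal) t T)
    (hmd : IsDominated P 𝓕 t T fun s _ => m s) (hmd' : IsDominated P 𝓕 t T fun s _ => m' s) :
    IsItoProcess P 𝓕 W t T (fun s ω => U s ω - m s) (fun s ω => b s ω - m' s) x := by
  refine ⟨hU.dom.sub hmd, hU.drift_dom.sub hmd', hU.ito, hU.mart_dom, ?_⟩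
  filter_upwards [hU.path] with ω hω
  have h := hω.sub hm
  refine ⟨h.integrable, fun s hs => ?_⟩
  have := h.eq s hs
  linarith

/-- The path of the absolutely continuous part. -/
lemma sub_eq (hU : IsItoProcess P 𝓕 W t T U b x) : ∀ᵐ ω ∂P, ∀ s ∈ Icc t T,
    U s ω - (x.2 s ω - x.2 t ω) = U t ω + timeIntegral t s fun r => b r ω := by
  filter_upwards [hU.path] with ω hω s hs
  have := hω.eq s (coe_mem hs)
  simp only [Real.toNNReal_coe] at this
  unfold timeIntegral
  linarith

lemma integral_mart_sub (hW : IsBrownianBasis P 𝓕 W) (hx : IsItoPair P 𝓕 W T x) {s : ℝ≥0}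
    (hs : s ∈ Icc t T) : ∫ ω, (x.2 s ω - x.2 t ω) ∂P = 0 := by
  have := hx.zeroMean hW hs.1 hs.2 Set.univ MeasurableSet.univ
  simpa using this

lemma isPrimitiveOn_of_eq {f f' : ℝ≥0 → ℝ}
    (hi : IntervalIntegrable (fun r : ℝ => f' r.toNNReal) volume t T)
    (h : ∀ s ∈ Icc t T, f s = f t + timeIntegral t s f') :
    IsPrimitiveOn (fun r : ℝ => f r.toNNReal) (fun r : ℝ => f' r.toNNReal) t T := by
  refine ⟨hi, fun s hs => ?_⟩
  have := h _ (toNNReal_mem_Icc hs)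
  rw [this, Real.toNNReal_coe, timeIntegral, Real.coe_toNNReal s (t.coe_nonneg.trans hs.1)]

lemma expectation (hW : IsBrownianBasis P 𝓕 W) (htT : t ≤ T) (hU : IsItoProcess P 𝓕 W t T U b x) :
    IsPrimitiveOn (fun r : ℝ => ∫ ω, U r.toNNReal ω ∂P) (fun r : ℝ => ∫ ω, b r.toNNReal ω ∂P)
      t T := by
  refine isPrimitiveOn_of_eq (f := fun s => ∫ ω, U s ω ∂P) (f' := fun s => ∫ ω, b s ω ∂P)
    (integral_timeIntegral htT hU.drift_dom.integrable_onProd).2.2.1 fun s hs => ?_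
  have ht : t ∈ Icc t T := ⟨le_rfl, htT⟩
  have hb := integral_timeIntegral hs.1 (hU.drift_dom.mono le_rfl hs.2).integrable_onProd
  rw [← hb.2.2.2]
  have h1 := integral_mart_sub (t := t) hW hU.ito hs
  have hx : Integrable (fun ω => x.2 s ω - x.2 t ω) P :=
    (hU.mart_dom.integrable hs).sub (hU.mart_dom.integrable ht)
  have h2 : ∫ ω, (U s ω - (x.2 s ω - x.2 t ω)) ∂P
      = ∫ ω, (U t ω + timeIntegral t s fun r => b r ω) ∂P :=
    integral_congr_ae (hU.sub_eq.mono fun ω h => h s hs)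
  rw [integral_sub (hU.dom.integrable hs) hx, integral_add (hU.dom.integrable ht) hb.2.1] at h2
  linarith

lemma center (hW : IsBrownianBasis P 𝓕 W) (htT : t ≤ T) (hU : IsItoProcess P 𝓕 W t T U b x) :
    IsItoProcess P 𝓕 W t T (fun s ω => U s ω - ∫ ω', U s ω' ∂P)
      (fun s ω => b s ω - ∫ ω', b s ω' ∂P) x :=
  hU.sub_det (hU.expectation hW htT) (hU.dom.expectation htT) (hU.drift_dom.expectation htT)

/-- The absolutely continuous part of an Itô process. -/
lemma sub_mart (hW : IsBrownianBasis P 𝓕 W) (htT : t ≤ T) (hU : IsItoProcess P 𝓕 W t T U b x) :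
    IsItoProcess P 𝓕 W t T (fun s ω => U s ω - (x.2 s ω - x.2 t ω)) b 0 := by
  have ht : t ∈ Icc t T := ⟨le_rfl, htT⟩
  refine ⟨hU.dom.sub (hU.mart_dom.sub (.randomVariable (hU.mart_dom.adapted t ht)
    (hU.mart_dom.memLp ht))), hU.drift_dom, isItoPair_zero hW, .const 0, ?_⟩
  filter_upwards [hU.path] with ω hω
  refine ⟨hω.integrable, fun s hs => ?_⟩
  have := hω.eq s hs
  simp only [Prod.snd_zero, Pi.zero_apply, Real.toNNReal_coe] at this ⊢
  linarith

lemma expectation_ac_mul_mart (hW : IsBrownianBasis P 𝓕 W) (htT : t ≤ T)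
    (hV : IsItoProcess P 𝓕 W t T V b 0) (hx : IsItoPair P 𝓕 W T x)
    (hxd : IsDominated P 𝓕 t T x.2) {s : ℝ≥0} (hs : s ∈ Icc t T) :
    ∫ ω, V s ω * (x.2 s ω - x.2 t ω) ∂P
      = timeIntegral t s fun r => ∫ ω, b r ω * (x.2 r ω - x.2 t ω) ∂P := by
  have ht : t ∈ Icc t T := ⟨le_rfl, htT⟩
  set D : Ω → ℝ := fun ω => x.2 s ω - x.2 t ω with hD
  have hD2 : MemLp D 2 P := (hxd.memLp hs).sub (hxd.memLp ht)
  have hDm : StronglyMeasurable D :=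
    ((hxd.adapted s hs).mono (𝓕.le s)).sub ((hxd.adapted t ht).mono (𝓕.le t))
  have hbD := integral_timeIntegral hs.1
    ((hV.drift_dom.mono le_rfl hs.2).toConst.integrable_onProd_mul
      (IsDominated.randomVariable (T := s) (t := t) hDm hD2))
  have h1 : ∫ ω, V s ω * D ω ∂P
      = ∫ ω, (V t ω * D ω + timeIntegral t s fun r => b r ω * D ω) ∂P := by
    refine integral_congr_ae ?_
    filter_upwards [hV.sub_eq] with ω hω
    have := hω s hs
    simp only [Prod.snd_zero, Pi.zero_apply, sub_zero] at this
    simp only [this, timeIntegral, intervalIntegral.integral_mul_const]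
    ring
  rw [h1, integral_add ((hV.dom.memLp ht).integrable_mul_two hD2) hbD.2.1, hbD.2.2.2,
    (hx.zeroMean hW hs.1 hs.2).integral_mul_eq_zero (𝓕.le t) (hD2.integrable one_le_two)
      (hV.dom.adapted t ht) ((hV.dom.memLp ht).integrable_mul_two hD2), zero_add]
  unfold timeIntegral
  refine intervalIntegral.integral_congr fun r hr => ?_
  rw [Set.uIcc_of_le (by exact_mod_cast hs.1)] at hr
  have hr' := toNNReal_mem_Icc hr
  set u := r.toNNReal
  have hu : u ∈ Icc t T := ⟨hr'.1, hr'.2.trans hs.2⟩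
  have hsu : MemLp (fun ω => x.2 s ω - x.2 u ω) 2 P := (hxd.memLp hs).sub (hxd.memLp hu)
  have hut : MemLp (fun ω => x.2 u ω - x.2 t ω) 2 P := (hxd.memLp hu).sub (hxd.memLp ht)
  have hbu := hV.drift_dom.memLp hu
  have h0 := (hx.zeroMean hW hr'.2 hs.2).integral_mul_eq_zero (𝓕.le u)
    (hsu.integrable one_le_two) (hV.drift_dom.adapted u hu) (hbu.integrable_mul_two hsu)
  have h2 : (fun ω => b u ω * D ω)
      = fun ω => b u ω * (x.2 u ω - x.2 t ω) + b u ω * (x.2 s ω - x.2 u ω) := by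
    ext ω; simp only [hD]; ring
  simp only
  rw [h2, integral_add (hbu.integrable_mul_two hut) (hbu.integrable_mul_two hsu), h0, add_zero]

/-- Integration by parts in mean for two Itô processes. -/
lemma expectation_mul (hW : IsBrownianBasis P 𝓕 W) (htT : t ≤ T)
    (hU : IsItoProcess P 𝓕 W t T U b x) (hV : IsItoProcess P 𝓕 W t T V c y) :
    IsPrimitiveOn (fun r : ℝ => ∫ ω, U r.toNNReal ω * V r.toNNReal ω ∂P)
      (fun r : ℝ => (∫ ω, b r.toNNReal ω * V r.toNNReal ω ∂P)
        + (∫ ω, U r.toNNReal ω * c r.toNNReal ω ∂P)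
        + ∫ ω, x.1 r.toNNReal ω * y.1 r.toNNReal ω ∂P) t T := by
  have ht : t ∈ Icc t T := ⟨le_rfl, htT⟩
  have hxy : ∀ u ≤ T, Integrable (onProd fun s ω => x.1 s ω * y.1 s ω)
      ((volume.restrict (Ioc (t : ℝ) u)).prod P) := fun u hu =>
    hU.ito.integrable_mul_cell hV.ito t hu
  have i1 := (integral_timeIntegral htT
    (hU.drift_dom.integrable_onProd_mul hV.dom)).2.2.1
  have i2 := (integral_timeIntegral htT
    (hU.dom.integrable_onProd_mul hV.drift_dom)).2.2.1
  have i3 := (integral_timeIntegral htT (hxy T le_rfl)).2.2.1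
  refine isPrimitiveOn_of_eq (f := fun s => ∫ ω, U s ω * V s ω ∂P)
    (f' := fun s => (∫ ω, b s ω * V s ω ∂P) + (∫ ω, U s ω * c s ω ∂P)
      + ∫ ω, x.1 s ω * y.1 s ω ∂P) ((i1.add i2).add i3) fun s hs => ?_
  have hts : (t : ℝ) ≤ s := by exact_mod_cast hs.1
  have hsub : Set.uIcc (t : ℝ) s ⊆ Set.uIcc (t : ℝ) T := by
    rw [Set.uIcc_of_le hts, Set.uIcc_of_le (by exact_mod_cast htT)]
    exact Set.Icc_subset_Icc_right (by exact_mod_cast hs.2)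
  set U' : ℝ≥0 → Ω → ℝ := fun s ω => U s ω - (x.2 s ω - x.2 t ω) with hU'
  set V' : ℝ≥0 → Ω → ℝ := fun s ω => V s ω - (y.2 s ω - y.2 t ω) with hV'
  have hA : IsItoProcess P 𝓕 W t T U' b 0 := hU.sub_mart hW htT
  have hB : IsItoProcess P 𝓕 W t T V' c 0 := hV.sub_mart hW htT
  have e1 := hA.expectation_ac_mul_mart hW htT hV.ito hV.mart_dom hs
  have e2 := hB.expectation_ac_mul_mart hW htT hU.ito hU.mart_dom hs
  have e3 := hU.ito.isometry hW hV.ito hs.1 hs.2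
  have e4 := (integral_timeIntegral hs.1 (hxy s hs.2)).2.2.2
  have dx : IsDominated P 𝓕 t T fun s ω => x.2 s ω - x.2 t ω :=
    hU.mart_dom.sub (.randomVariable (hU.mart_dom.adapted t ht) (hU.mart_dom.memLp ht))
  have dy : IsDominated P 𝓕 t T fun s ω => y.2 s ω - y.2 t ω :=
    hV.mart_dom.sub (.randomVariable (hV.mart_dom.adapted t ht) (hV.mart_dom.memLp ht))
  have j1 := integral_timeIntegral hs.1
    ((hA.drift_dom.integrable_onProd_mul hB.dom).mono_measure
      (Measure.prod_mono (Measure.restrict_mono (Set.Ioc_subset_Ioc_right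
        (by exact_mod_cast hs.2)) le_rfl) le_rfl) : Integrable (onProd fun s ω => b s ω * V' s ω)
          ((volume.restrict (Ioc (t : ℝ) s)).prod P))
  have j2 := integral_timeIntegral hs.1
    ((hA.dom.integrable_onProd_mul hB.drift_dom).mono_measure
      (Measure.prod_mono (Measure.restrict_mono (Set.Ioc_subset_Ioc_right
        (by exact_mod_cast hs.2)) le_rfl) le_rfl) : Integrable (onProd fun s ω => U' s ω * c s ω)
          ((volume.restrict (Ioc (t : ℝ) s)).prod P))
  have e5 : ∫ ω, U' s ω * V' s ω ∂P = (∫ ω, U' t ω * V' t ω ∂P)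
      + ((timeIntegral t s fun r => ∫ ω, b r ω * V' r ω ∂P)
        + timeIntegral t s fun r => ∫ ω, U' r ω * c r ω ∂P) := by
    rw [← j1.2.2.2, ← j2.2.2.2, ← integral_add j1.2.1 j2.2.1,
      ← integral_add ((hA.dom.memLp ht).integrable_mul_two (hB.dom.memLp ht)) (j1.2.1.fun_add j2.2.1)]
    refine integral_congr_ae ?_
    filter_upwards [hA.path, hB.path, j1.1, j2.1] with ω h1 h2 k1 k2
    simp only [Prod.snd_zero, Pi.zero_apply, sub_zero] at h1 h2
    have := (h1.mul h2 (by exact_mod_cast htT)).eq s (coe_mem hs)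
    simp only [Real.toNNReal_coe] at this
    rw [intervalIntegral.integral_add k1 k2] at this
    exact this
  have hUm := hU.dom.memLp hs
  have split : ∫ ω, U s ω * V s ω ∂P = (∫ ω, U' s ω * V' s ω ∂P)
      + ((∫ ω, U' s ω * (y.2 s ω - y.2 t ω) ∂P) + ((∫ ω, V' s ω * (x.2 s ω - x.2 t ω) ∂P)
        + ∫ ω, (x.2 s ω - x.2 t ω) * (y.2 s ω - y.2 t ω) ∂P)) := by
    have k1 := (hA.dom.memLp hs).integrable_mul_two (hB.dom.memLp hs)
    have k2 := (hA.dom.memLp hs).integrable_mul_two (dy.memLp hs)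
    have k3 := (hB.dom.memLp hs).integrable_mul_two (dx.memLp hs)
    have k4 := (dx.memLp hs).integrable_mul_two (dy.memLp hs)
    rw [← integral_add k3 k4, ← integral_add k2 (k3.fun_add k4),
      ← integral_add k1 (k2.fun_add (k3.fun_add k4))]
    congr 1; ext ω; simp only [hU', hV']; ring
  have split_t : ∫ ω, U' t ω * V' t ω ∂P = ∫ ω, U t ω * V t ω ∂P := by
    simp only [hU', hV', sub_self, sub_zero]
  have q1 : ∀ r ∈ Icc t T, ∫ ω, b r ω * V r ω ∂P
      = (∫ ω, b r ω * V' r ω ∂P) + ∫ ω, b r ω * (y.2 r ω - y.2 t ω) ∂P := by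
    intro r hr
    rw [← integral_add ((hA.drift_dom.memLp hr).integrable_mul_two (hB.dom.memLp hr))
      ((hA.drift_dom.memLp hr).integrable_mul_two (dy.memLp hr))]
    congr 1; ext ω; simp only [hV']; ring
  have q2 : ∀ r ∈ Icc t T, ∫ ω, U r ω * c r ω ∂P
      = (∫ ω, U' r ω * c r ω ∂P) + ∫ ω, c r ω * (x.2 r ω - x.2 t ω) ∂P := by
    intro r hr
    rw [← integral_add ((hA.dom.memLp hr).integrable_mul_two (hB.drift_dom.memLp hr))
      ((hB.drift_dom.memLp hr).integrable_mul_two (dx.memLp hr))]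
    congr 1; ext ω; simp only [hU']; ring
  have l1 := (integral_timeIntegral htT (hA.drift_dom.integrable_onProd_mul dy)).2.2.1.mono_set hsub
  have l2 := (integral_timeIntegral htT (hB.drift_dom.integrable_onProd_mul dx)).2.2.1.mono_set hsub
  have final : timeIntegral t s (fun r => (∫ ω, b r ω * V r ω ∂P) + (∫ ω, U r ω * c r ω ∂P)
      + ∫ ω, x.1 r ω * y.1 r ω ∂P)
      = ((timeIntegral t s fun r => ∫ ω, b r ω * V' r ω ∂P)
        + timeIntegral t s fun r => ∫ ω, b r ω * (y.2 r ω - y.2 t ω) ∂P)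
      + ((timeIntegral t s fun r => ∫ ω, U' r ω * c r ω ∂P)
        + timeIntegral t s fun r => ∫ ω, c r ω * (x.2 r ω - x.2 t ω) ∂P)
      + timeIntegral t s fun r => ∫ ω, x.1 r ω * y.1 r ω ∂P := by
    simp only [timeIntegral]
    rw [← intervalIntegral.integral_add j1.2.2.1 l1, ← intervalIntegral.integral_add j2.2.2.1 l2,
      ← intervalIntegral.integral_add (j1.2.2.1.add l1) (j2.2.2.1.add l2),
      ← intervalIntegral.integral_add ((j1.2.2.1.add l1).add (j2.2.2.1.add l2))
        (i3.mono_set hsub)]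
    refine intervalIntegral.integral_congr fun r hr => ?_
    rw [Set.uIcc_of_le hts] at hr
    have hr' := toNNReal_mem_Icc hr
    have hr'' : r.toNNReal ∈ Icc t T := ⟨hr'.1, hr'.2.trans hs.2⟩
    rw [q1 _ hr'', q2 _ hr'']
  rw [final, split, e5, split_t, e1, e2, e3]
  have e6 : ∫ ω, cellInt x.1 y.1 t s ω ∂P
      = timeIntegral t s fun r => ∫ ω, x.1 r ω * y.1 r ω ∂P := e4
  rw [e6]
  ring

end IsItoProcess

/-! ### Completion of squares -/

section Algebra

variable {p : Params} {e₀ T : ℝ} {A B : ℝ → Matrix (Fin 3) (Fin 3) ℝ} {D : ℝ → Fin 3 → ℝ}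

/-- The coefficient of the square of the fundamental price in the value function. -/
noncomputable def quadCoef (p : Params) (A : ℝ → Matrix (Fin 3) (Fin 3) ℝ) (s : ℝ) : ℝ :=
  (A s 0 0 / p.γ₂ - 1 / 2) / p.γ₂

/-- The coefficient of the mixed term in the value function. -/
noncomputable def mixedCoef (p : Params) (A : ℝ → Matrix (Fin 3) (Fin 3) ℝ) (s : ℝ) : ℝ :=
  A s 0 2 / p.γ₂

lemma IA_dotProduct (hp : p.Standing) (s : ℝ) (x : Fin 3 → ℝ) :
    IA p A s ⬝ᵥ x = -p.aTilde * x 0 + IA p A s 1 * fundamental p x + IA p A s 2 * x 2 := by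
  have := hp.γ₂_pos.ne'
  simp only [dotProduct, Fin.sum_univ_three, IA, fundamental, Params.aTilde, Matrix.cons_val_zero,
    Matrix.cons_val_one, Matrix.cons_val]
  field_simp
  ring

lemma IB_dotProduct (hp : p.Standing) (s : ℝ) (x : Fin 3 → ℝ) :
    IB p B s ⬝ᵥ x = -p.a * x 0 + IB p B s 1 * fundamental p x + IB p B s 2 * x 2 := by
  have := hp.γ₂_pos.ne'
  simp only [dotProduct, Fin.sum_univ_three, IB, fundamental, Params.a, Matrix.cons_val_zero,
    Matrix.cons_val_one, Matrix.cons_val]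
  field_simp
  ring

lemma Params.Standing.aTilde_pos (hp : p.Standing) : 0 < p.aTilde := by
  have h1 := hp.a_pos
  have h2 := mul_nonneg hp.γ₁_nonneg hp.α_nonneg
  unfold Params.aTilde
  linarith

/-- Right-hand sides of the equations for `A₁₁, A₁₃, A₃₃`. -/
noncomputable def rateA (p : Params) (A : ℝ → Matrix (Fin 3) (Fin 3) ℝ) (s : ℝ) : Fin 3 → ℝ :=
  ![-p.lam + (p.ρ * A s 0 0 + p.lam) ^ 2 / (p.γ₂ * p.ρ + p.lam),
    p.γ₁ * (p.β - p.α) / p.γ₂ * A s 0 0 + (p.β - p.α) * A s 0 2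
      - (p.ρ * A s 0 0 + p.lam) * (p.γ₁ * (p.β - p.α) - 2 * p.ρ * A s 0 2)
        / (2 * (p.γ₂ * p.ρ + p.lam)),
    2 * (p.β - p.α) * A s 2 2 + 2 * (p.γ₁ * (p.β - p.α) / p.γ₂) * A s 0 2
      + (p.γ₁ * (p.β - p.α) - 2 * p.ρ * A s 0 2) ^ 2
        / (4 * (p.γ₂ * p.ρ + p.lam))]

/-- Right-hand sides of the equations for `B₁₁, B₁₃, B₃₃`. -/
noncomputable def rateB (p : Params) (B : ℝ → Matrix (Fin 3) (Fin 3) ℝ) (s : ℝ) : Fin 3 → ℝ :=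
  ![2 * (p.γ₁ * p.α / p.γ₂) * B s 0 0 + 2 * p.α * B s 0 2 - p.lam
      + (2 * (p.γ₁ * p.α - p.γ₂ * p.ρ) * B s 0 0 + p.γ₁ * p.γ₂ * p.α
          + 2 * p.α * p.γ₂ * B s 0 2 - 2 * p.γ₂ * p.lam) ^ 2
        / (4 * p.γ₂ ^ 2 * (p.γ₂ * p.ρ - p.γ₁ * p.α + p.lam)),
    p.γ₁ * (p.β - p.α) / p.γ₂ * B s 0 0 + p.α * B s 2 2
      + (p.β - p.α + p.γ₁ * p.α / p.γ₂) * B s 0 2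
      + (2 * (p.γ₁ * p.α - p.γ₂ * p.ρ) * B s 0 0 + p.γ₁ * p.γ₂ * p.α
          + 2 * p.α * p.γ₂ * B s 0 2 - 2 * p.γ₂ * p.lam)
        * ((2 * (p.γ₁ * p.α - p.γ₂ * p.ρ) * B s 0 2 + 2 * p.γ₂ * p.α * B s 2 2
            + p.γ₁ * p.γ₂ * (p.β - p.α))
          / (4 * p.γ₂ ^ 2 * (p.γ₂ * p.ρ - p.γ₁ * p.α + p.lam))),
    2 * (p.β - p.α) * B s 2 2 + 2 * (p.γ₁ * (p.β - p.α) / p.γ₂) * B s 0 2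
      + (2 * (p.γ₁ * p.α - p.γ₂ * p.ρ) * B s 0 2 + 2 * p.γ₂ * p.α * B s 2 2
          + p.γ₁ * p.γ₂ * (p.β - p.α)) ^ 2
        / (4 * p.γ₂ ^ 2 * (p.γ₂ * p.ρ - p.γ₁ * p.α + p.lam))]

/-- Right-hand sides of the equations for `D₁, D₃`. -/
noncomputable def rateD (p : Params) (e₀ : ℝ) (B : ℝ → Matrix (Fin 3) (Fin 3) ℝ)
    (D : ℝ → Fin 3 → ℝ) (s : ℝ) : Fin 2 → ℝ :=
  ![-(2 * p.γ₁ * p.α * e₀ / p.γ₂) * B s 0 0 - 2 * p.α * e₀ * B s 0 2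
      + p.γ₁ * p.α / p.γ₂ * D s 0 + p.α * D s 2
      + (-(2 * p.lam * p.γ₂) + 2 * (p.γ₁ * p.α - p.γ₂ * p.ρ) * B s 0 0 + p.γ₁ * p.γ₂ * p.α
          + 2 * p.α * p.γ₂ * B s 0 2)
        * ((-(p.γ₁ * p.γ₂ * p.α * e₀) + (p.γ₁ * p.α - p.γ₂ * p.ρ) * D s 0
            + p.α * p.γ₂ * D s 2)
          / (2 * p.γ₂ ^ 2 * (p.γ₂ * p.ρ - p.γ₁ * p.α + p.lam))),
    -(2 * p.α * e₀ * B s 2 2) - 2 * p.γ₁ * p.α * e₀ / p.γ₂ * B s 0 2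
      + p.γ₁ * (p.β - p.α) / p.γ₂ * D s 0 + (p.β - p.α) * D s 2
      + (2 * (p.γ₁ * p.α - p.γ₂ * p.ρ) * B s 0 2 + 2 * p.γ₂ * p.α * B s 2 2
          + p.γ₁ * p.γ₂ * (p.β - p.α))
        * ((-(p.γ₁ * p.γ₂ * p.α * e₀) + (p.γ₁ * p.α - p.γ₂ * p.ρ) * D s 0
            + p.α * p.γ₂ * D s 2)
          / (2 * p.γ₂ ^ 2 * (p.γ₂ * p.ρ - p.γ₁ * p.α + p.lam)))]

/-- Completion of squares for the centred state. -/
lemma completion_centred (hp : p.Standing) (s x q c : ℝ) :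
    (x * (-p.ρ * (q - p.γ₂ * x) - p.γ₁ * (p.β - p.α) * c) + p.lam * (x * x))
      + (rateA p A s 0 / p.γ₂ / p.γ₂ * (q * q)
        + quadCoef p A s * (2 * (q * (-p.ρ * (q - p.γ₂ * x) - p.γ₁ * (p.β - p.α) * c)))
        + 2 * (rateA p A s 1 / p.γ₂ * (q * c)
          + mixedCoef p A s * ((-p.ρ * (q - p.γ₂ * x) - p.γ₁ * (p.β - p.α) * c) * c
            + q * (-(p.β - p.α) * c)))
        + (rateA p A s 2 * (c * c) + A s 2 2 * (2 * (c * (-(p.β - p.α) * c)))))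
      = 1 / p.aTilde * (-p.aTilde * x + IA p A s 1 * q + IA p A s 2 * c) ^ 2 := by
  have h1 := hp.γ₂_pos.ne'
  have h2 := hp.aTilde_pos.ne'
  have h3 : p.γ₂ * p.ρ + p.lam = p.aTilde := rfl
  have h4 : p.lam = p.aTilde - p.γ₂ * p.ρ := by rw [← h3]; ring
  simp only [quadCoef, mixedCoef, rateA, IA, h3, Matrix.cons_val_zero,
    Matrix.cons_val_one, Matrix.cons_val]
  rw [h4]
  generalize p.aTilde = k at h2
  clear h3 h4
  field_simp
  ring

/-- The inhomogeneity in the completion of squares for the mean. -/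
noncomputable def meanRest (p : Params) (e₀ : ℝ) (D : ℝ → Fin 3 → ℝ) (s : ℝ) : ℝ :=
  -(ID p e₀ D s ^ 2 / p.a) + (D s 0 / p.γ₂ * (p.α * p.γ₁ * e₀) + D s 2 * (p.α * e₀))

/-- Completion of squares for the mean of the state. -/
lemma completion_mean (hp : p.Standing) (s x q c : ℝ) :
    (x * (-p.ρ * (q - p.γ₂ * x) - p.γ₁ * (p.β - p.α) * c - p.α * p.γ₁ * x + p.α * p.γ₁ * e₀)
        + p.lam * (x * x))
      + (rateB p B s 0 / p.γ₂ / p.γ₂ * (q * q)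
        + quadCoef p B s * (2 * (q * (-p.ρ * (q - p.γ₂ * x) - p.γ₁ * (p.β - p.α) * c
            - p.α * p.γ₁ * x + p.α * p.γ₁ * e₀)))
        + 2 * (rateB p B s 1 / p.γ₂ * (q * c)
          + mixedCoef p B s * ((-p.ρ * (q - p.γ₂ * x) - p.γ₁ * (p.β - p.α) * c
              - p.α * p.γ₁ * x + p.α * p.γ₁ * e₀) * c
            + q * (-(p.β - p.α) * c - p.α * x + p.α * e₀)))
        + (rateB p B s 2 * (c * c) + B s 2 2 * (2 * (c * (-(p.β - p.α) * c - p.α * x + p.α * e₀))))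
        + (rateD p e₀ B D s 0 / p.γ₂ * q + D s 0 / p.γ₂ * (-p.ρ * (q - p.γ₂ * x)
            - p.γ₁ * (p.β - p.α) * c - p.α * p.γ₁ * x + p.α * p.γ₁ * e₀))
        + (rateD p e₀ B D s 1 * c + D s 2 * (-(p.β - p.α) * c - p.α * x + p.α * e₀)))
      = 1 / p.a * (-p.a * x + IB p B s 1 * q + IB p B s 2 * c + ID p e₀ D s) ^ 2
        + meanRest p e₀ D s := by
  have h1 := hp.γ₂_pos.ne'
  have h2 := hp.a_pos.ne'
  have h3 : p.γ₂ * p.ρ - p.γ₁ * p.α + p.lam = p.a := rfl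
  have h4 : p.lam = p.a - p.γ₂ * p.ρ + p.γ₁ * p.α := by rw [← h3]; ring
  have h5 : p.a ≠ 0 := h2
  simp only [quadCoef, mixedCoef, rateB, rateD, meanRest, IB, ID, h3, Matrix.cons_val_zero,
    Matrix.cons_val_one, Matrix.cons_val]
  rw [h4]
  generalize p.a = k at h5
  clear h2 h3 h4
  field_simp
  ring

end Algebra

/-- The regularity of a controlled state that is needed for the computation of second moments. -/
structure IsControlledState (P : Measure Ω) (𝓕 : Filtration ℝ≥0 mΩ) (W : ℝ≥0 → Ω → ℝ)
    (p : Params) (e₀ : ℝ) (σ : ℝ≥0 → Ω → ℝ) (t T : ℝ≥0) (ξ : Ω → Fin 3 → ℝ)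
    (N : ℝ≥0 → Ω → ℝ) (𝒳 : ℝ≥0 → Ω → Fin 3 → ℝ) : Prop where
  dom : ∀ i, IsDominated P 𝓕 t T (fun s ω => 𝒳 s ω i)
  fund : IsItoProcess P 𝓕 W t T (fun s ω => fundamental p (𝒳 s ω))
    (fun s ω => driftY p e₀ (𝒳 s ω) (mean P 𝒳 s)) (σ, N)
  child : IsItoProcess P 𝓕 W t T (fun s ω => 𝒳 s ω 2)
    (fun s ω => driftC p e₀ (𝒳 s ω) (mean P 𝒳 s)) 0
  fund_start : ∀ᵐ ω ∂P, fundamental p (𝒳 t ω) = fundamental p (ξ ω)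
  child_start : ∀ᵐ ω ∂P, 𝒳 t ω 2 = ξ ω 2

lemma isControlledState_of_bound (hW : IsBrownianBasis P 𝓕 W) (htT : t ≤ T)
    (hσ2 : MemLp (onProd σ) 2 (prodMeasure P T)) (hN : IsItoIntegral P 𝓕 W T σ N)
    (h : IsState P 𝓕 W p e₀ σ t T ξ Z 𝒳) (hpath : HasStatePaths P p e₀ t T ξ N Z 𝒳)
    (hb : ∃ G : Ω → ℝ, MemLp G 2 P ∧ ∀ᵐ ω ∂P, ∀ s ∈ Icc t T, ∀ i, |𝒳 s ω i| ≤ G ω) :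
    IsControlledState P 𝓕 W p e₀ σ t T ξ N 𝒳 := by
  have hd := h.isDominated_of_bound htT hb
  have hx := hN.isItoPair hσ2
  have hm : IsDominated P 𝓕 t T (fun s _ => mean P 𝒳 s 0) := (hd 0).expectation htT
  refine ⟨hd, ⟨(hd 1).add ((hd 0).const_mul _), ?_, hx, hx.isDominated hW htT hN.cont, ?_⟩,
    ⟨hd 2, ?_, isItoPair_zero hW, .const 0, ?_⟩, ?_, ?_⟩
  · exact ((((hd 1).const_mul _).sub ((hd 2).const_mul _)).sub (hm.const_mul _)).add (.const _)
  · exact hpath.mono fun ω hω => hω.fundamental_primitive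
  · exact (((hd 2).const_mul _).sub (hm.const_mul _)).add (.const _)
  · filter_upwards [hpath] with ω hω
    simpa using hω.child_primitive
  · exact hpath.mono fun ω hω => hω.fundamental_start
  · exact hpath.mono fun ω hω => hω.child_start

lemma integral_sum_const_mul {n : ℕ} (c : Fin n → ℝ) (f : Fin n → Ω → ℝ)
    (hf : ∀ j, Integrable (f j) P) :
    ∫ ω, ∑ j, c j * f j ω ∂P = ∑ j, c j * ∫ ω, f j ω ∂P := by
  rw [integral_finsetSum _ fun j _ => (hf j).const_mul _]
  exact sum_congr rfl fun j _ => integral_const_mul _ _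

/-- Coefficients of the value function, as primitives of their rates. -/
lemma SolvesA.isPrimitiveOn {T : ℝ≥0} (hA : SolvesA p T A) :
    IsPrimitiveOn (fun r => A r 0 0) (fun r => rateA p A r 0) 0 T ∧
    IsPrimitiveOn (fun r => A r 0 2) (fun r => rateA p A r 1) 0 T ∧
    IsPrimitiveOn (fun r => A r 2 2) (fun r => rateA p A r 2) 0 T := by
  have h0 : ContinuousOn (fun r => A r 0 0) (Icc 0 T) := fun s hs =>
    (hA.ode₁₁ s hs).continuousWithinAt
  have h1 : ContinuousOn (fun r => A r 0 2) (Icc 0 T) := fun s hs =>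
    (hA.ode₁₃ s hs).continuousWithinAt
  have h2 : ContinuousOn (fun r => A r 2 2) (Icc 0 T) := fun s hs =>
    (hA.ode₃₃ s hs).continuousWithinAt
  refine ⟨.of_hasDerivWithinAt T.coe_nonneg hA.ode₁₁ ?_,
    .of_hasDerivWithinAt T.coe_nonneg hA.ode₁₃ ?_, .of_hasDerivWithinAt T.coe_nonneg hA.ode₃₃ ?_⟩
  all_goals
    simp only [rateA, Matrix.cons_val_zero, Matrix.cons_val_one, Matrix.cons_val]
    fun_prop

lemma SolvesB.isPrimitiveOn {T : ℝ≥0} (hB : SolvesB p T B) :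
    IsPrimitiveOn (fun r => B r 0 0) (fun r => rateB p B r 0) 0 T ∧
    IsPrimitiveOn (fun r => B r 0 2) (fun r => rateB p B r 1) 0 T ∧
    IsPrimitiveOn (fun r => B r 2 2) (fun r => rateB p B r 2) 0 T := by
  have h0 : ContinuousOn (fun r => B r 0 0) (Icc 0 T) := fun s hs =>
    (hB.ode₁₁ s hs).continuousWithinAt
  have h1 : ContinuousOn (fun r => B r 0 2) (Icc 0 T) := fun s hs =>
    (hB.ode₁₃ s hs).continuousWithinAt
  have h2 : ContinuousOn (fun r => B r 2 2) (Icc 0 T) := fun s hs =>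
    (hB.ode₃₃ s hs).continuousWithinAt
  refine ⟨.of_hasDerivWithinAt T.coe_nonneg hB.ode₁₁ ?_,
    .of_hasDerivWithinAt T.coe_nonneg hB.ode₁₃ ?_, .of_hasDerivWithinAt T.coe_nonneg hB.ode₃₃ ?_⟩
  all_goals
    simp only [rateB, Matrix.cons_val_zero, Matrix.cons_val_one, Matrix.cons_val]
    fun_prop

lemma SolvesD.isPrimitiveOn {T : ℝ≥0} (hB : SolvesB p T B) (hD : SolvesD p e₀ T B D) :
    IsPrimitiveOn (fun r => D r 0) (fun r => rateD p e₀ B D r 0) 0 T ∧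
    IsPrimitiveOn (fun r => D r 2) (fun r => rateD p e₀ B D r 1) 0 T := by
  have h0 : ContinuousOn (fun r => B r 0 0) (Icc 0 T) := fun s hs =>
    (hB.ode₁₁ s hs).continuousWithinAt
  have h1 : ContinuousOn (fun r => B r 0 2) (Icc 0 T) := fun s hs =>
    (hB.ode₁₃ s hs).continuousWithinAt
  have h2 : ContinuousOn (fun r => B r 2 2) (Icc 0 T) := fun s hs =>
    (hB.ode₃₃ s hs).continuousWithinAt
  have h3 : ContinuousOn (fun r => D r 0) (Icc 0 T) := fun s hs =>
    (hD.ode₁ s hs).continuousWithinAt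
  have h4 : ContinuousOn (fun r => D r 2) (Icc 0 T) := fun s hs =>
    (hD.ode₃ s hs).continuousWithinAt
  refine ⟨.of_hasDerivWithinAt T.coe_nonneg hD.ode₁ ?_,
    .of_hasDerivWithinAt T.coe_nonneg hD.ode₃ ?_⟩
  all_goals
    simp only [rateD, Matrix.cons_val_zero, Matrix.cons_val_one]
    fun_prop

lemma quadCoef_isPrimitiveOn {a b : ℝ} {r : ℝ → ℝ} (h : IsPrimitiveOn (fun r => A r 0 0) r a b) :
    IsPrimitiveOn (quadCoef p A) (fun s => r s / p.γ₂ / p.γ₂) a b := by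
  have h1 := ((h.const_mul (1 / p.γ₂)).sub (.const (1 / 2) a b)).const_mul (1 / p.γ₂)
  have e1 : (fun s => 1 / p.γ₂ * (1 / p.γ₂ * A s 0 0 - 1 / 2)) = quadCoef p A := by
    ext s; unfold quadCoef; ring
  have e2 : (fun s => 1 / p.γ₂ * (1 / p.γ₂ * r s - 0)) = fun s => r s / p.γ₂ / p.γ₂ := by
    ext s; ring
  rwa [e1, e2] at h1

lemma mixedCoef_isPrimitiveOn {a b : ℝ} {r : ℝ → ℝ} (h : IsPrimitiveOn (fun r => A r 0 2) r a b) :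
    IsPrimitiveOn (mixedCoef p A) (fun s => r s / p.γ₂) a b := by
  have h1 := h.const_mul (1 / p.γ₂)
  have e1 : (fun s => 1 / p.γ₂ * A s 0 2) = mixedCoef p A := by
    ext s; unfold mixedCoef; ring
  have e2 : (fun s => 1 / p.γ₂ * r s) = fun s => r s / p.γ₂ := by
    ext s; ring
  rwa [e1, e2] at h1

/-- The covariance functional of the value function at the initial time, evaluated at a random
vector. -/
noncomputable def centredValue (P : Measure Ω) (p : Params) (A : ℝ → Matrix (Fin 3) (Fin 3) ℝ)
    (s : ℝ) (x : Ω → Fin 3 → ℝ) : ℝ :=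
  quadCoef p A s * (∫ ω, (fundamental p (x ω) - ∫ ω', fundamental p (x ω') ∂P)
      * (fundamental p (x ω) - ∫ ω', fundamental p (x ω') ∂P) ∂P)
    + 2 * (mixedCoef p A s * ∫ ω, (fundamental p (x ω) - ∫ ω', fundamental p (x ω') ∂P)
      * (x ω 2 - ∫ ω', x ω' 2 ∂P) ∂P)
    + A s 2 2 * ∫ ω, (x ω 2 - ∫ ω', x ω' 2 ∂P) * (x ω 2 - ∫ ω', x ω' 2 ∂P) ∂P

/-- The part of the value function that depends on the mean of the state. -/
noncomputable def meanValue (P : Measure Ω) (p : Params) (B : ℝ → Matrix (Fin 3) (Fin 3) ℝ)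
    (D : ℝ → Fin 3 → ℝ) (s : ℝ) (x : Ω → Fin 3 → ℝ) : ℝ :=
  quadCoef p B s * ((∫ ω, fundamental p (x ω) ∂P) * ∫ ω, fundamental p (x ω) ∂P)
    + 2 * (mixedCoef p B s * ((∫ ω, fundamental p (x ω) ∂P) * ∫ ω, x ω 2 ∂P))
    + B s 2 2 * ((∫ ω, x ω 2 ∂P) * ∫ ω, x ω 2 ∂P)
    + D s 0 / p.γ₂ * (∫ ω, fundamental p (x ω) ∂P) + D s 2 * ∫ ω, x ω 2 ∂P

namespace IsControlledState

lemma integral_fundamental (h : IsControlledState P 𝓕 W p e₀ σ t T ξ N 𝒳) {s : ℝ≥0}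
    (hs : s ∈ Icc t T) : ∫ ω, fundamental p (𝒳 s ω) ∂P = fundamental p (mean P 𝒳 s) := by
  unfold fundamental mean
  rw [integral_add ((h.dom 1).integrable hs) (((h.dom 0).integrable hs).const_mul _),
    integral_const_mul]

lemma integral_driftY (h : IsControlledState P 𝓕 W p e₀ σ t T ξ N 𝒳) {s : ℝ≥0}
    (hs : s ∈ Icc t T) (m : Fin 3 → ℝ) :
    ∫ ω, driftY p e₀ (𝒳 s ω) m ∂P = driftY p e₀ (mean P 𝒳 s) m := by
  have := integral_sum_const_mul (P := P) ![-p.ρ, -(p.γ₁ * (p.β - p.α)),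
      - p.α * p.γ₁ * m 0 + p.α * p.γ₁ * e₀] ![fun ω => 𝒳 s ω 1, fun ω => 𝒳 s ω 2, fun _ => 1]
    (by
      intro j; fin_cases j
      · exact (h.dom 1).integrable hs
      · exact (h.dom 2).integrable hs
      · exact integrable_const _)
  simp only [Fin.sum_univ_three, Matrix.cons_val_zero, Matrix.cons_val_one, Matrix.cons_val,
    integral_const, probReal_univ, smul_eq_mul, mul_one] at this
  unfold driftY
  calc _ = ∫ ω, (-p.ρ * 𝒳 s ω 1 + -(p.γ₁ * (p.β - p.α)) * 𝒳 s ω 2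
        + (-p.α * p.γ₁ * m 0 + p.α * p.γ₁ * e₀)) ∂P := by congr 1; ext ω; ring
    _ = _ := by rw [this]; simp only [mean]; ring

lemma integral_driftC (h : IsControlledState P 𝓕 W p e₀ σ t T ξ N 𝒳) {s : ℝ≥0}
    (hs : s ∈ Icc t T) (m : Fin 3 → ℝ) :
    ∫ ω, driftC p e₀ (𝒳 s ω) m ∂P = driftC p e₀ (mean P 𝒳 s) m := by
  have := integral_sum_const_mul (P := P) ![-(p.β - p.α), - p.α * m 0 + p.α * e₀]
    ![fun ω => 𝒳 s ω 2, fun _ => 1]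
    (by
      intro j; fin_cases j
      · exact (h.dom 2).integrable hs
      · exact integrable_const _)
  simp only [Fin.sum_univ_two, Matrix.cons_val_zero, Matrix.cons_val_one,
    integral_const, probReal_univ, smul_eq_mul, mul_one] at this
  unfold driftC
  calc _ = ∫ ω, (-(p.β - p.α) * 𝒳 s ω 2 + (-p.α * m 0 + p.α * e₀)) ∂P := by
        congr 1; ext ω; ring
    _ = _ := by rw [this]; simp only [mean]; ring

/-- The mean running cost. -/
noncomputable def runningCost (P : Measure Ω) (p : Params) (e₀ : ℝ) (𝒳 : ℝ≥0 → Ω → Fin 3 → ℝ)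
    (s : ℝ≥0) : ℝ :=
  ∫ ω, (𝒳 s ω 0 * driftY p e₀ (𝒳 s ω) (mean P 𝒳 s) + p.lam * 𝒳 s ω 0 ^ 2) ∂P

/-- The mean squared deviation from the optimality conditions. -/
noncomputable def deviation (P : Measure Ω) (p : Params) (e₀ : ℝ)
    (A B : ℝ → Matrix (Fin 3) (Fin 3) ℝ) (D : ℝ → Fin 3 → ℝ) (𝒳 : ℝ≥0 → Ω → Fin 3 → ℝ)
    (s : ℝ≥0) : ℝ :=
  1 / p.aTilde * (∫ ω, (IA p A s ⬝ᵥ (𝒳 s ω - mean P 𝒳 s)) ^ 2 ∂P)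
    + 1 / p.a * (IB p B s ⬝ᵥ mean P 𝒳 s + ID p e₀ D s) ^ 2

/-- The rate of change of `centredValue` along the state, from the equations for the moments. -/
lemma runningCost_add_rate (hp : p.Standing) (h : IsControlledState P 𝓕 W p e₀ σ t T ξ N 𝒳)
    {s : ℝ≥0} (hs : s ∈ Icc t T) {U V bU bV : Ω → ℝ}
    (hU : U = fun ω => fundamental p (𝒳 s ω) - ∫ ω', fundamental p (𝒳 s ω') ∂P)
    (hV : V = fun ω => 𝒳 s ω 2 - ∫ ω', 𝒳 s ω' 2 ∂P)
    (hbU : bU = fun ω => driftY p e₀ (𝒳 s ω) (mean P 𝒳 s)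
      - ∫ ω', driftY p e₀ (𝒳 s ω') (mean P 𝒳 s) ∂P)
    (hbV : bV = fun ω => driftC p e₀ (𝒳 s ω) (mean P 𝒳 s)
      - ∫ ω', driftC p e₀ (𝒳 s ω') (mean P 𝒳 s) ∂P)
    {mU mV bmU bmV : ℝ} (hmU : mU = ∫ ω, fundamental p (𝒳 s ω) ∂P)
    (hmV : mV = ∫ ω, 𝒳 s ω 2 ∂P) (hbmU : bmU = ∫ ω, driftY p e₀ (𝒳 s ω) (mean P 𝒳 s) ∂P)
    (hbmV : bmV = ∫ ω, driftC p e₀ (𝒳 s ω) (mean P 𝒳 s) ∂P) :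
    runningCost P p e₀ 𝒳 s
      + (rateA p A s 0 / p.γ₂ / p.γ₂ * (∫ ω, U ω * U ω ∂P)
        + quadCoef p A s * ((∫ ω, bU ω * U ω ∂P) + ∫ ω, U ω * bU ω ∂P)
        + 2 * (rateA p A s 1 / p.γ₂ * (∫ ω, U ω * V ω ∂P)
          + mixedCoef p A s * ((∫ ω, bU ω * V ω ∂P) + ∫ ω, U ω * bV ω ∂P))
        + (rateA p A s 2 * (∫ ω, V ω * V ω ∂P)
          + A s 2 2 * ((∫ ω, bV ω * V ω ∂P) + ∫ ω, V ω * bV ω ∂P)))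
      + (rateB p B s 0 / p.γ₂ / p.γ₂ * (mU * mU) + quadCoef p B s * (bmU * mU + mU * bmU)
        + 2 * (rateB p B s 1 / p.γ₂ * (mU * mV) + mixedCoef p B s * (bmU * mV + mU * bmV))
        + (rateB p B s 2 * (mV * mV) + B s 2 2 * (bmV * mV + mV * bmV))
        + (rateD p e₀ B D s 0 / p.γ₂ * mU + D s 0 / p.γ₂ * bmU)
        + (rateD p e₀ B D s 1 * mV + D s 2 * bmV))
      = deviation P p e₀ A B D 𝒳 s + meanRest p e₀ D s := by
  set m := mean P 𝒳 s with hm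
  set X : Ω → ℝ := fun ω => 𝒳 s ω 0 - m 0 with hX
  have eU : mU = fundamental p m := hmU.trans (h.integral_fundamental hs)
  have eV : mV = m 2 := hmV
  have ebU : bmU = driftY p e₀ m m := hbmU.trans (h.integral_driftY hs m)
  have ebV : bmV = driftC p e₀ m m := hbmV.trans (h.integral_driftC hs m)
  have hbU' : ∀ ω, bU ω = -p.ρ * (U ω - p.γ₂ * X ω) - p.γ₁ * (p.β - p.α) * V ω := by
    intro ω
    rw [hbU, hU, hV]
    simp only [h.integral_driftY hs m, h.integral_fundamental hs]
    simp only [driftY, fundamental, hX, hm, mean]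
    ring
  have hbV' : ∀ ω, bV ω = -(p.β - p.α) * V ω := by
    intro ω
    rw [hbV, hV]
    simp only [h.integral_driftC hs m]
    simp only [driftC, hm, mean]
    ring
  have dX : MemLp X 2 P := ((h.dom 0).memLp hs).sub (memLp_const _)
  have dU : MemLp U 2 P := by rw [hU]; exact (h.fund.dom.memLp hs).sub (memLp_const _)
  have dV : MemLp V 2 P := by rw [hV]; exact ((h.dom 2).memLp hs).sub (memLp_const _)
  have dbU : MemLp bU 2 P := by
    rw [hbU]; exact (h.fund.drift_dom.memLp hs).sub (memLp_const _)
  have dbV : MemLp bV 2 P := by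
    rw [hbV]; exact (h.child.drift_dom.memLp hs).sub (memLp_const _)
  have iX : ∫ ω, X ω ∂P = 0 := by
    rw [hX, integral_sub ((h.dom 0).integrable hs) (integrable_const _)]
    simp [hm, mean]
  have ibU : ∫ ω, bU ω ∂P = 0 := by
    rw [hbU, integral_sub (h.fund.drift_dom.integrable hs) (integrable_const _)]
    simp only [integral_const, probReal_univ, one_smul]
    exact sub_self _
  -- the running cost splits into a centred part and a part that depends on the mean
  have key1 : runningCost P p e₀ 𝒳 s = (∫ ω, X ω * bU ω ∂P) + p.lam * (∫ ω, X ω * X ω ∂P)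
      + (m 0 * bmU + p.lam * (m 0 * m 0)) := by
    have := integral_sum_const_mul (P := P) ![1, p.lam, m 0, bmU + 2 * p.lam * m 0,
        m 0 * bmU + p.lam * (m 0 * m 0)]
      ![fun ω => X ω * bU ω, fun ω => X ω * X ω, bU, X, fun _ => 1]
      (by
        intro j; fin_cases j
        · exact dX.integrable_mul_two dbU
        · exact dX.integrable_mul_two dX
        · exact dbU.integrable one_le_two
        · exact dX.integrable one_le_two
        · exact integrable_const _)
    simp only [Fin.sum_univ_five, Matrix.cons_val_zero, Matrix.cons_val_one, Matrix.cons_val,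
      integral_const, probReal_univ, smul_eq_mul, mul_one, one_mul, iX, ibU, mul_zero,
      add_zero] at this
    rw [← this]
    unfold runningCost
    congr 1; ext ω
    have : driftY p e₀ (𝒳 s ω) (mean P 𝒳 s) = bU ω + bmU := by rw [hbU, hbmU]; ring
    rw [this]
    simp only [hX]
    ring
  have key2 : 1 / p.aTilde * (∫ ω, (IA p A s ⬝ᵥ (𝒳 s ω - m)) ^ 2 ∂P)
      = (∫ ω, X ω * bU ω ∂P) + p.lam * (∫ ω, X ω * X ω ∂P)
      + (rateA p A s 0 / p.γ₂ / p.γ₂ * (∫ ω, U ω * U ω ∂P)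
        + quadCoef p A s * ((∫ ω, bU ω * U ω ∂P) + ∫ ω, U ω * bU ω ∂P)
        + 2 * (rateA p A s 1 / p.γ₂ * (∫ ω, U ω * V ω ∂P)
          + mixedCoef p A s * ((∫ ω, bU ω * V ω ∂P) + ∫ ω, U ω * bV ω ∂P))
        + (rateA p A s 2 * (∫ ω, V ω * V ω ∂P)
          + A s 2 2 * ((∫ ω, bV ω * V ω ∂P) + ∫ ω, V ω * bV ω ∂P))) := by
    have := integral_sum_const_mul (P := P) ![1, p.lam, rateA p A s 0 / p.γ₂ / p.γ₂,
        quadCoef p A s, quadCoef p A s, 2 * (rateA p A s 1 / p.γ₂), 2 * mixedCoef p A s,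
        2 * mixedCoef p A s, rateA p A s 2, A s 2 2, A s 2 2]
      ![fun ω => X ω * bU ω, fun ω => X ω * X ω, fun ω => U ω * U ω, fun ω => bU ω * U ω,
        fun ω => U ω * bU ω, fun ω => U ω * V ω, fun ω => bU ω * V ω, fun ω => U ω * bV ω,
        fun ω => V ω * V ω, fun ω => bV ω * V ω, fun ω => V ω * bV ω]
      (by
        intro j; fin_cases j
        · exact dX.integrable_mul_two dbU
        · exact dX.integrable_mul_two dX
        · exact dU.integrable_mul_two dU
        · exact dbU.integrable_mul_two dU
        · exact dU.integrable_mul_two dbU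
        · exact dU.integrable_mul_two dV
        · exact dbU.integrable_mul_two dV
        · exact dU.integrable_mul_two dbV
        · exact dV.integrable_mul_two dV
        · exact dbV.integrable_mul_two dV
        · exact dV.integrable_mul_two dbV)
    simp only [Fin.sum_univ_succ, Fin.sum_univ_zero, Matrix.cons_val_zero, Matrix.cons_val_succ,
      add_zero, one_mul] at this
    rw [← integral_const_mul]
    refine Eq.trans ?_ (this.trans (by ring))
    congr 1; ext ω
    have hfund : fundamental p (𝒳 s ω - m) = U ω := by
      rw [hU]; simp only [h.integral_fundamental hs]
      simp only [fundamental, Pi.sub_apply, hm]; ring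
    have hsub : (𝒳 s ω - m) 2 = V ω := by rw [hV]; simp [hm, mean]
    rw [IA_dotProduct hp, hfund, hsub]
    have := completion_centred (A := A) hp s (X ω) (U ω) (V ω)
    rw [← hbU', ← hbV'] at this
    have h0 : (𝒳 s ω - m) 0 = X ω := rfl
    rw [h0, ← this]
    ring
  have key3 := completion_mean (B := B) (D := D) (e₀ := e₀) hp s (m 0) mU mV
  have e1 : -p.ρ * (mU - p.γ₂ * m 0) - p.γ₁ * (p.β - p.α) * mV - p.α * p.γ₁ * m 0
      + p.α * p.γ₁ * e₀ = bmU := by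
    rw [ebU, eU, eV]; simp only [driftY, fundamental]; ring
  have e2 : -(p.β - p.α) * mV - p.α * m 0 + p.α * e₀ = bmV := by
    rw [ebV, eV]; simp only [driftC]
  have e3 : IB p B s ⬝ᵥ m = -p.a * m 0 + IB p B s 1 * mU + IB p B s 2 * mV := by
    rw [IB_dotProduct hp, eU, eV]
  rw [e1, e2, ← e3] at key3
  unfold deviation
  rw [← hm, key2, key1]
  linarith

end IsControlledState

/-- The part of the value that comes from the noise and from the inhomogeneity. -/
noncomputable def restRate (P : Measure Ω) (p : Params) (e₀ : ℝ) (σ : ℝ≥0 → Ω → ℝ)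
    (A : ℝ → Matrix (Fin 3) (Fin 3) ℝ) (D : ℝ → Fin 3 → ℝ) (s : ℝ≥0) : ℝ :=
  quadCoef p A s * (∫ ω, σ s ω * σ s ω ∂P) + meanRest p e₀ D s

/-- The minimal expected running cost. -/
noncomputable def valueAt (P : Measure Ω) (p : Params) (e₀ : ℝ) (σ : ℝ≥0 → Ω → ℝ)
    (A B : ℝ → Matrix (Fin 3) (Fin 3) ℝ) (D : ℝ → Fin 3 → ℝ) (t T : ℝ≥0) (ξ : Ω → Fin 3 → ℝ) : ℝ :=
  centredValue P p A t ξ + meanValue P p B D t ξ + timeIntegral t T (restRate P p e₀ σ A D)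

lemma integrable_onProd_sq (hσ2 : MemLp (onProd σ) 2 (prodMeasure P T)) :
    Integrable (onProd fun s ω => σ s ω * σ s ω)
      ((volume.restrict (Ioc (t : ℝ) T)).prod P) := by
  refine (hσ2.integrable_mul_two hσ2).mono_measure ?_
  exact Measure.prod_mono (Measure.restrict_mono (Set.Ioc_subset_Ioc_left t.coe_nonneg) le_rfl)
    le_rfl

lemma timeIntegral_eq_zero (htT : t ≤ T) {f : ℝ≥0 → ℝ} (h0 : ∀ s ∈ Ico t T, f s = 0) :
    timeIntegral t T f = 0 := by
  unfold timeIntegral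
  rw [intervalIntegral.integral_congr_ae (g := fun _ => (0 : ℝ)), intervalIntegral.integral_zero]
  filter_upwards [Measure.ae_ne volume (T : ℝ)] with r hr hr'
  rw [Set.uIoc_of_le (by exact_mod_cast htT)] at hr'
  exact h0 _ (toNNReal_mem_Ico ⟨hr'.1.le, lt_of_le_of_ne hr'.2 hr⟩)

namespace IsControlledState

/-- The expected running cost, as the value plus the accumulated squared deviation from the
optimality conditions. -/
lemma timeIntegral_runningCost (hp : p.Standing) (hW : IsBrownianBasis P 𝓕 W) (htT : t ≤ T)
    (h : IsControlledState P 𝓕 W p e₀ σ t T ξ N 𝒳)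
    (hA : SolvesA p T A) (hB : SolvesB p T B) (hD : SolvesD p e₀ T B D) :
    IntervalIntegrable (fun r : ℝ => deviation P p e₀ A B D 𝒳 r.toNNReal) volume t T ∧
    timeIntegral t T (runningCost P p e₀ 𝒳)
      = valueAt P p e₀ σ A B D t T ξ + timeIntegral t T (deviation P p e₀ A B D 𝒳) := by
  have hle : (t : ℝ) ≤ T := by exact_mod_cast htT
  have hsub0 : (t : ℝ) ∈ Icc (0 : ℝ) T := ⟨t.coe_nonneg, hle⟩
  have hsubT : (T : ℝ) ∈ Icc (0 : ℝ) T := ⟨T.coe_nonneg, le_rfl⟩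
  obtain ⟨A0, A1, A2⟩ := hA.isPrimitiveOn
  obtain ⟨B0, B1, B2⟩ := hB.isPrimitiveOn
  obtain ⟨D0, D2⟩ := SolvesD.isPrimitiveOn hB hD
  have a0 := quadCoef_isPrimitiveOn (p := p) (A0.mono hsub0 hsubT)
  have a1 := mixedCoef_isPrimitiveOn (p := p) (A1.mono hsub0 hsubT)
  have a2 := A2.mono hsub0 hsubT
  have b0 := quadCoef_isPrimitiveOn (p := p) (B0.mono hsub0 hsubT)
  have b1 := mixedCoef_isPrimitiveOn (p := p) (B1.mono hsub0 hsubT)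
  have b2 := B2.mono hsub0 hsubT
  have d0 := (D0.mono hsub0 hsubT).const_mul (1 / p.γ₂)
  have d2 := D2.mono hsub0 hsubT
  have hU := h.fund.center hW htT
  have hV := h.child.center hW htT
  have eUU := hU.expectation_mul hW htT hU
  have eUV := hU.expectation_mul hW htT hV
  have eVV := hV.expectation_mul hW htT hV
  have mU := h.fund.expectation hW htT
  have mV := h.child.expectation hW htT
  have c1 : ∫ ω, fundamental p (𝒳 t ω) ∂P = ∫ ω, fundamental p (ξ ω) ∂P :=
    integral_congr_ae h.fund_start
  have c2 : ∫ ω, 𝒳 t ω 2 ∂P = ∫ ω, ξ ω 2 ∂P := integral_congr_ae h.child_start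
  have c3 : ∀ a b : ℝ, ∫ ω, (fundamental p (𝒳 t ω) - a) * (fundamental p (𝒳 t ω) - b) ∂P
      = ∫ ω, (fundamental p (ξ ω) - a) * (fundamental p (ξ ω) - b) ∂P := fun a b =>
    integral_congr_ae (h.fund_start.mono fun ω hω => by simp only [hω])
  have c4 : ∀ a b : ℝ, ∫ ω, (fundamental p (𝒳 t ω) - a) * (𝒳 t ω 2 - b) ∂P
      = ∫ ω, (fundamental p (ξ ω) - a) * (ξ ω 2 - b) ∂P := fun a b =>
    integral_congr_ae (by
      filter_upwards [h.fund_start, h.child_start] with ω h1 h2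
      simp only [h1, h2])
  have c5 : ∀ a b : ℝ, ∫ ω, (𝒳 t ω 2 - a) * (𝒳 t ω 2 - b) ∂P
      = ∫ ω, (ξ ω 2 - a) * (ξ ω 2 - b) ∂P := fun a b =>
    integral_congr_ae (h.child_start.mono fun ω hω => by simp only [hω])
  have hγ := hp.γ₂_pos.ne'
  have qA : quadCoef p A T = 0 := by unfold quadCoef; rw [hA.term₁₁]; field_simp; ring
  have qB : quadCoef p B T = 0 := by unfold quadCoef; rw [hB.term₁₁]; field_simp; ring
  have mA : mixedCoef p A T = 0 := by unfold mixedCoef; rw [hA.term₁₃]; simp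
  have mB : mixedCoef p B T = 0 := by unfold mixedCoef; rw [hB.term₁₃]; simp
  obtain ⟨F, F', hF, hFT, hFt, hF'⟩ : ∃ F F' : ℝ → ℝ, IsPrimitiveOn F F' t T ∧ F T = 0 ∧
      F t = centredValue P p A t ξ + meanValue P p B D t ξ ∧
      ∀ r ∈ Icc (t : ℝ) T, runningCost P p e₀ 𝒳 r.toNNReal + F' r
        = deviation P p e₀ A B D 𝒳 r.toNNReal + restRate P p e₀ σ A D r.toNNReal := by
    refine ⟨_, _, ((((a0.mul eUU hle).add ((a1.mul eUV hle).const_mul 2)).add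
      (a2.mul eVV hle)).add
      (((((b0.mul (mU.mul mU hle) hle).add ((b1.mul (mU.mul mV hle) hle).const_mul 2)).add
      (b2.mul (mV.mul mV hle) hle)).add (d0.mul mU hle)).add (d2.mul mV hle))),
      ?_, ?_, fun r hr => ?_⟩
    · simp only [qA, qB, mA, mB, hA.term₃₃, hB.term₃₃, hD.term₁, hD.term₃, zero_mul, mul_zero,
        add_zero]
    · simp only [Real.toNNReal_coe, c1, c2, c3, c4, c5]
      unfold centredValue meanValue
      ring
    · have hs := toNNReal_mem_Icc hr
      have := h.runningCost_add_rate (A := A) (B := B) (D := D) hp hs rfl rfl rfl rfl rfl rfl rfl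
        rfl
      unfold restRate
      rw [Real.coe_toNNReal r (t.coe_nonneg.trans hr.1)] at this ⊢
      simp only [Prod.fst_zero, Pi.zero_apply, mul_zero, integral_zero, add_zero]
      linear_combination this
  -- integrability
  have iR : IntervalIntegrable (fun r : ℝ => runningCost P p e₀ 𝒳 r.toNNReal) volume t T := by
    have k1 := (integral_timeIntegral htT
      ((h.dom 0).integrable_onProd_mul h.fund.drift_dom)).2.2.1
    have k2 := (integral_timeIntegral htT
      ((h.dom 0).integrable_onProd_mul (h.dom 0))).2.2.1
    refine (k1.add (k2.const_mul p.lam)).congr_ae ?_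
    refine (ae_restrict_iff' measurableSet_uIoc).2 (Eventually.of_forall fun r hr => ?_)
    rw [Set.uIoc_of_le hle] at hr
    have hs := toNNReal_mem_Icc (Set.Ioc_subset_Icc_self hr)
    have k3 := ((h.dom 0).memLp hs).integrable_mul_two (h.fund.drift_dom.memLp hs)
    have k4 := ((h.dom 0).memLp hs).integrable_mul_two ((h.dom 0).memLp hs)
    unfold runningCost
    simp only [pow_two]
    rw [integral_add k3 (k4.const_mul _), integral_const_mul]
  have iK : IntervalIntegrable (fun r : ℝ => restRate P p e₀ σ A D r.toNNReal) volume t T := by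
    have k1 := (integral_timeIntegral htT (integrable_onProd_sq (t := t) h.fund.ito.memLp)).2.2.1
    have c0 : ContinuousOn (fun r => D r 0) (Icc (t : ℝ) T) :=
      (D0.mono hsub0 hsubT).continuousOn
    have c2 : ContinuousOn (fun r => D r 2) (Icc (t : ℝ) T) := d2.continuousOn
    have c : ContinuousOn (meanRest p e₀ D) (Icc (t : ℝ) T) := by
      unfold meanRest ID; fun_prop
    have k2 : IntervalIntegrable (meanRest p e₀ D) volume t T :=
      ContinuousOn.intervalIntegrable (by rwa [Set.uIcc_of_le hle])
    have k3 := (k1.continuousOn_mul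
      (g := quadCoef p A) (by rw [Set.uIcc_of_le hle]; exact a0.continuousOn)).add k2
    refine k3.congr_ae ?_
    refine (ae_restrict_iff' measurableSet_uIoc).2 (Eventually.of_forall fun r hr => ?_)
    rw [Set.uIoc_of_le hle] at hr
    unfold restRate
    simp only [Real.coe_toNNReal r (t.coe_nonneg.trans hr.1.le)]
  have iD : IntervalIntegrable (fun r : ℝ => deviation P p e₀ A B D 𝒳 r.toNNReal) volume t T := by
    refine ((iR.add hF.integrable).sub iK).congr_ae ?_
    refine (ae_restrict_iff' measurableSet_uIoc).2 (Eventually.of_forall fun r hr => ?_)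
    rw [Set.uIoc_of_le hle] at hr
    simp only
    rw [hF' r (Set.Ioc_subset_Icc_self hr)]
    ring
  refine ⟨iD, ?_⟩
  have h1 := hF.eq T ⟨hle, le_rfl⟩
  have h2 : ∫ r in (t : ℝ)..T, (runningCost P p e₀ 𝒳 r.toNNReal + F' r)
      = ∫ r in (t : ℝ)..T, (deviation P p e₀ A B D 𝒳 r.toNNReal
        + restRate P p e₀ σ A D r.toNNReal) :=
    intervalIntegral.integral_congr fun r hr => hF' r (by rwa [Set.uIcc_of_le hle] at hr)
  rw [intervalIntegral.integral_add iR hF.integrable, intervalIntegral.integral_add iD iK] at h2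
  unfold valueAt timeIntegral
  linarith

lemma deviation_nonneg (hp : p.Standing) (s : ℝ≥0) : 0 ≤ deviation P p e₀ A B D 𝒳 s := by
  have h1 := hp.aTilde_pos
  have h2 : 0 < p.a := hp.a_pos
  have h3 : 0 ≤ ∫ ω, (IA p A s ⬝ᵥ (𝒳 s ω - mean P 𝒳 s)) ^ 2 ∂P :=
    integral_nonneg fun ω => sq_nonneg _
  unfold deviation
  positivity

lemma valueAt_le (hp : p.Standing) (hW : IsBrownianBasis P 𝓕 W) (htT : t ≤ T)
    (h : IsControlledState P 𝓕 W p e₀ σ t T ξ N 𝒳)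
    (hA : SolvesA p T A) (hB : SolvesB p T B) (hD : SolvesD p e₀ T B D) :
    valueAt P p e₀ σ A B D t T ξ ≤ timeIntegral t T (runningCost P p e₀ 𝒳) := by
  rw [(h.timeIntegral_runningCost hp hW htT hA hB hD).2]
  refine le_add_of_nonneg_right (intervalIntegral.integral_nonneg (by exact_mod_cast htT)
    fun r _ => deviation_nonneg hp _)

lemma eq_valueAt (hp : p.Standing) (hW : IsBrownianBasis P 𝓕 W) (htT : t ≤ T)
    (h : IsControlledState P 𝓕 W p e₀ σ t T ξ N 𝒳)
    (hA : SolvesA p T A) (hB : SolvesB p T B) (hD : SolvesD p e₀ T B D)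
    (h0 : ∀ s ∈ Ico t T, deviation P p e₀ A B D 𝒳 s = 0) :
    timeIntegral t T (runningCost P p e₀ 𝒳) = valueAt P p e₀ σ A B D t T ξ := by
  rw [(h.timeIntegral_runningCost hp hW htT hA hB hD).2, add_eq_left]
  exact timeIntegral_eq_zero htT h0

end IsControlledState

/-! ### A Kunita–Watanabe inequality for a fixed path -/

/-- The integral of `h` over `(t, T]` with respect to `df - dg`. -/
noncomputable def stieltjesDiff (f g : StieltjesFunction ℝ) (t T : ℝ) (h : ℝ → ℝ) : ℝ :=
  (∫ r in Ioc t T, h r ∂f.measure) - ∫ r in Ioc t T, h r ∂g.measure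

instance (f : StieltjesFunction ℝ) (t T : ℝ) : IsFiniteMeasure (f.measure.restrict (Ioc t T)) :=
  ⟨by rw [Measure.restrict_apply_univ, f.measure_Ioc]; exact ENNReal.ofReal_lt_top⟩

lemma stieltjes_measureReal_Ioc (f : StieltjesFunction ℝ) {a b : ℝ} (hab : a ≤ b) :
    f.measure.real (Ioc a b) = f b - f a := by
  rw [measureReal_def, f.measure_Ioc, ENNReal.toReal_ofReal (sub_nonneg.2 (f.mono hab))]

lemma integral_const_Ioc (f : StieltjesFunction ℝ) (c : ℝ) {a b : ℝ} (hab : a ≤ b) :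
    ∫ _ in Ioc a b, c ∂f.measure = c * (f b - f a) := by
  rw [setIntegral_const, stieltjes_measureReal_Ioc f hab, smul_eq_mul, mul_comm]

lemma tendsto_sum_stieltjes {π : ℕ → TimePartition t T} (hπ : MeshTendsto π)
    (f : StieltjesFunction ℝ) {h : ℝ → ℝ} (hh : Continuous h) :
    Tendsto (fun k => ∑ i ∈ range (π k).n,
        h ((π k).pt i) * (f ((π k).pt (i + 1)) - f ((π k).pt i))) atTop
      (𝓝 (∫ r in Ioc (t : ℝ) T, h r ∂f.measure)) := by
  have hle : (t : ℝ) ≤ T := by exact_mod_cast (π 0).le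
  rw [Metric.tendsto_atTop']
  intro ε hε
  set C := f T - f t with hC
  have hC0 : 0 ≤ C := sub_nonneg.2 (f.mono hle)
  set δ := ε / (2 * (C + 1)) with hδ
  have hδ0 : 0 < δ := by positivity
  have huc := isCompact_Icc.uniformContinuousOn_of_continuous
    (hh.continuousOn (s := Icc (t : ℝ) T))
  rw [Metric.uniformContinuousOn_iff] at huc
  obtain ⟨η, hη, hd⟩ := huc δ hδ0
  obtain ⟨n, hn⟩ := eventually_atTop.1 (hπ η hη)
  refine ⟨n, fun k hk => ?_⟩
  have hint : ∀ a b : ℝ, IntervalIntegrable h f.measure a b := fun a b =>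
    hh.intervalIntegrable a b
  have hsum : ∫ r in Ioc (t : ℝ) T, h r ∂f.measure
      = ∑ i ∈ range (π k).n,
        ∫ r in Ioc ((π k).pt i : ℝ) ((π k).pt (i + 1)), h r ∂f.measure := by
    have := intervalIntegral.sum_integral_adjacent_intervals (μ := f.measure) (f := h)
      (a := fun i => ((π k).pt i : ℝ)) (n := (π k).n) fun i _ => hint _ _
    simp only [(π k).first, (π k).last] at this
    rw [← intervalIntegral.integral_of_le hle, ← this]
    exact sum_congr rfl fun i _ =>
      intervalIntegral.integral_of_le ((π k).pt_le_succ i)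
  rw [Real.dist_eq, hsum, ← sum_sub_distrib]
  have hcell : ∀ i ∈ range (π k).n,
      |h ((π k).pt i) * (f ((π k).pt (i + 1)) - f ((π k).pt i))
        - ∫ r in Ioc ((π k).pt i : ℝ) ((π k).pt (i + 1)), h r ∂f.measure|
      ≤ δ * (f ((π k).pt (i + 1)) - f ((π k).pt i)) := by
    intro i hi
    have hi := Finset.mem_range.1 hi
    have hle' := (π k).pt_le_succ i
    rw [← integral_const_Ioc f _ hle', ← integral_sub (integrable_const _)
      ((intervalIntegrable_iff_integrableOn_Ioc_of_le hle').1 (hint _ _)),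
      ← stieltjes_measureReal_Ioc f hle', ← Real.norm_eq_abs]
    refine norm_setIntegral_le_of_norm_le_const (by rw [f.measure_Ioc]; exact ENNReal.ofReal_lt_top)
      fun r hr => ?_
    have := hd _ ((π k).mem_Icc hi.le) r ⟨((π k).mem_Icc hi.le).1.trans hr.1.le,
      hr.2.trans ((π k).mem_Icc hi).2⟩ (by
        rw [Real.dist_eq, abs_sub_comm, abs_of_pos (sub_pos.2 hr.1)]
        linarith [hn k hk.le i hi, hr.2])
    rw [Real.dist_eq] at this
    exact this.le
  refine lt_of_le_of_lt ((abs_sum_le_sum_abs _ _).trans (sum_le_sum hcell)) ?_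
  rw [← mul_sum, (π k).sum_sub_real f, ← hC, hδ, div_mul_eq_mul_div,
    div_lt_iff₀ (by positivity)]
  nlinarith

/-- A bound for step functions extends to all integrands. -/
lemma stieltjesDiff_sq_le (htT : t ≤ T) {f g : StieltjesFunction ℝ} {q : ℝ}
    (hq : ∀ n (c : ℕ → ℝ), (∑ i ∈ range (TimePartition.uniform t T htT n).n,
        c i * ((f ((TimePartition.uniform t T htT n).pt (i + 1))
            - f ((TimePartition.uniform t T htT n).pt i))
          - (g ((TimePartition.uniform t T htT n).pt (i + 1))
            - g ((TimePartition.uniform t T htT n).pt i)))) ^ 2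
      ≤ q * ∑ i ∈ range (TimePartition.uniform t T htT n).n,
        c i ^ 2 * (((TimePartition.uniform t T htT n).pt (i + 1) : ℝ)
          - (TimePartition.uniform t T htT n).pt i)) {h : ℝ → ℝ} (hq0 : 0 ≤ q)
    (hf : IntegrableOn h (Ioc (t : ℝ) T) f.measure) (hg : IntegrableOn h (Ioc (t : ℝ) T) g.measure)
    (h2 : IntervalIntegrable (fun r => h r * h r) volume t T)
    (hm : AEStronglyMeasurable h (volume.restrict (Ioc (t : ℝ) T))) :
    stieltjesDiff f g t T h ^ 2 ≤ q * ∫ r in (t : ℝ)..T, h r * h r := by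
  have hle : (t : ℝ) ≤ T := by exact_mod_cast htT
  -- continuous integrands
  have hcont : ∀ h : ℝ → ℝ, Continuous h →
      stieltjesDiff f g t T h ^ 2 ≤ q * ∫ r in (t : ℝ)..T, h r * h r := by
    intro h hh
    have hπ := meshTendsto_uniform htT
    have e1 := ((tendsto_sum_stieltjes hπ f hh).sub (tendsto_sum_stieltjes hπ g hh)).pow 2
    have e2 := (tendsto_sum_left hπ (IsPrimitiveOn.of_hasDerivWithinAt (u := id)
      (u' := fun _ => 1) hle (fun s _ => (hasDerivAt_id s).hasDerivWithinAt) continuousOn_const)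
      (f := fun r => h r * h r) (by fun_prop)).const_mul q
    simp only [mul_one] at e2
    refine le_of_tendsto_of_tendsto' e1 e2 fun k => ?_
    rw [← sum_sub_distrib]
    refine le_trans (le_of_eq ?_) ((hq k fun i => h ((TimePartition.uniform t T htT k).pt i)).trans
      (le_of_eq ?_))
    · congr 1; exact sum_congr rfl fun i _ => by ring
    · congr 1; exact sum_congr rfl fun i _ => by simp only [id]; ring
  -- square integrable integrands
  set μ := f.measure.restrict (Ioc (t : ℝ) T) + g.measure.restrict (Ioc (t : ℝ) T)
    + volume.restrict (Ioc (t : ℝ) T) with hμ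
  have l1 : f.measure.restrict (Ioc (t : ℝ) T) ≤ μ := by
    rw [hμ, add_assoc]; exact Measure.le_add_right le_rfl
  have l2 : g.measure.restrict (Ioc (t : ℝ) T) ≤ μ :=
    Measure.le_add_right (Measure.le_add_left le_rfl)
  have l3 : volume.restrict (Ioc (t : ℝ) T) ≤ μ := Measure.le_add_left le_rfl
  have hL2 : ∀ h : ℝ → ℝ, MemLp h 2 μ →
      stieltjesDiff f g t T h ^ 2 ≤ q * ∫ r in (t : ℝ)..T, h r * h r := by
    intro h hh
    have hpos : ∀ n : ℕ, ENNReal.ofReal (1 / ((n : ℝ) + 1)) ≠ 0 := fun n => by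
      rw [ne_eq, ENNReal.ofReal_eq_zero, not_le]; positivity
    choose a ha ha2 using fun n : ℕ =>
      hh.exists_boundedContinuous_eLpNorm_sub_le (ENNReal.ofNat_ne_top) (hpos n)
    have hlim : Tendsto (fun n => eLpNorm (fun r => a n r - h r) 2 μ) atTop (𝓝 0) := by
      have h0 := ENNReal.tendsto_ofReal (tendsto_one_div_add_atTop_nhds_zero_nat (𝕜 := ℝ))
      rw [ENNReal.ofReal_zero] at h0
      refine tendsto_of_tendsto_of_tendsto_of_le_of_le tendsto_const_nhds h0
        (fun n => zero_le) fun n => ?_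
      have := ha n
      rw [eLpNorm_sub_comm] at this
      exact this
    have hlim' : ∀ ν ≤ μ, Tendsto (fun n => eLpNorm (fun r => a n r - h r) 2 ν) atTop (𝓝 0) :=
      fun ν hν => tendsto_of_tendsto_of_tendsto_of_le_of_le tendsto_const_nhds hlim
        (fun n => zero_le) fun n => eLpNorm_mono_measure _ hν
    have hint : ∀ ν ≤ μ, IsFiniteMeasure ν →
        Tendsto (fun n => ∫ r, a n r ∂ν) atTop (𝓝 (∫ r, h r ∂ν)) := by
      intro ν hν _
      have := tendsto_integral_mul_of_tendsto_eLpNorm (μ := ν)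
        (fun n => (ha2 n).mono_measure hν) (g := fun _ _ => (1 : ℝ)) (fun _ => memLp_const 1)
        (hh.mono_measure hν) (memLp_const 1) (hlim' ν hν) (by simp)
      simpa only [mul_one] using this
    have hsq := tendsto_integral_mul_of_tendsto_eLpNorm (fun n => (ha2 n).mono_measure l3)
      (fun n => (ha2 n).mono_measure l3) (hh.mono_measure l3) (hh.mono_measure l3) (hlim' _ l3)
      (hlim' _ l3)
    refine le_of_tendsto_of_tendsto' (((hint _ l1 inferInstance).sub (hint _ l2 inferInstance)).pow 2)
      ((hsq.const_mul q).trans_eq (by rw [intervalIntegral.integral_of_le hle])) fun n => ?_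
    have := hcont (a n) (a n).continuous
    rwa [intervalIntegral.integral_of_le hle] at this
  -- truncation
  have hmμ : AEStronglyMeasurable h μ := by
    rw [hμ, aestronglyMeasurable_add_measure_iff, aestronglyMeasurable_add_measure_iff]
    exact ⟨⟨hf.aestronglyMeasurable, hg.aestronglyMeasurable⟩, hm⟩
  set b : ℕ → ℝ → ℝ := fun n r => max (-(n : ℝ)) (min (h r) n) with hb
  have hbm : ∀ n, AEStronglyMeasurable (b n) μ := fun n =>
    aestronglyMeasurable_const.sup (hmμ.inf aestronglyMeasurable_const)
  have hb1 : ∀ n r, |b n r| ≤ n := fun n r => abs_le.2 ⟨le_max_left _ _,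
    max_le (by linarith [n.cast_nonneg (α := ℝ)]) (min_le_right _ _)⟩
  have hb2 : ∀ n r, |b n r| ≤ |h r| := by
    intro n r
    have hn := n.cast_nonneg (α := ℝ)
    refine abs_le.2 ⟨?_, max_le (by linarith [abs_nonneg (h r)])
      ((min_le_left _ _).trans (le_abs_self _))⟩
    rcases le_total (h r) n with h' | h'
    · exact le_max_of_le_right (by rw [min_eq_left h']; exact neg_abs_le _)
    · exact le_max_of_le_right (by rw [min_eq_right h']; linarith [abs_nonneg (h r)])
  have hb3 : ∀ r, Tendsto (fun n => b n r) atTop (𝓝 (h r)) := by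
    intro r
    refine tendsto_const_nhds.congr' ?_
    filter_upwards [eventually_ge_atTop ⌈|h r|⌉₊] with n hn
    have h1 : |h r| ≤ n := (Nat.le_ceil _).trans (by exact_mod_cast hn)
    rw [abs_le] at h1
    simp only [hb]
    rw [min_eq_left h1.2, max_eq_right h1.1]
  have hlim : ∀ ν ≤ μ, Integrable h ν →
      Tendsto (fun n => ∫ r, b n r ∂ν) atTop (𝓝 (∫ r, h r ∂ν)) := fun ν hν hi =>
    tendsto_integral_of_dominated_convergence (fun r => |h r|)
      (fun n => (hbm n).mono_measure hν) hi.abs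
      (fun n => Eventually.of_forall (hb2 n)) (Eventually.of_forall hb3)
  refine le_of_tendsto_of_tendsto' (((hlim _ l1 hf).sub (hlim _ l2 hg)).pow 2) tendsto_const_nhds
    fun n => ?_
  have hbn : MemLp (b n) 2 μ := MemLp.of_bound (hbm n) n (Eventually.of_forall (hb1 n))
  refine (hL2 (b n) hbn).trans (mul_le_mul_of_nonneg_left ?_ hq0)
  refine intervalIntegral.integral_mono_on hle ?_ h2 fun r _ => ?_
  · rw [intervalIntegrable_iff_integrableOn_Ioc_of_le hle]
    exact (hbn.mono_measure l3).integrable_mul (hbn.mono_measure l3)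
  · rw [← abs_mul_abs_self (b n r), ← abs_mul_abs_self (h r)]
    exact mul_self_le_mul_self (abs_nonneg _) (hb2 n r)

/-! ### Further rules for almost sure convergence along subsequences -/

namespace TendstoAESubseq

variable {f g : ℕ → Ω → ℝ} {F G : Ω → ℝ}

lemma mul (h : TendstoAESubseq P f F) (h' : TendstoAESubseq P g G) :
    TendstoAESubseq P (fun k ω => f k ω * g k ω) (fun ω => F ω * G ω) := by
  intro ns hns
  obtain ⟨ms, hms, hae⟩ := h ns hns
  obtain ⟨ls, hls, hae'⟩ := h' (ns ∘ ms) (hns.comp hms)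
  refine ⟨ms ∘ ls, hms.comp hls, ?_⟩
  filter_upwards [hae, hae'] with ω h1 h2
  exact (h1.comp hls.tendsto_atTop).mul h2

lemma comp_continuous (h : TendstoAESubseq P f F) {φ : ℝ → ℝ} (hφ : Continuous φ) :
    TendstoAESubseq P (fun k ω => φ (f k ω)) (fun ω => φ (F ω)) :=
  h.map (Eventually.of_forall fun _ _ _ hω => (hφ.tendsto _).comp hω)

lemma le (h : TendstoAESubseq P f F) (h' : TendstoAESubseq P g G)
    (hfg : ∀ᵐ ω ∂P, ∀ k, f k ω ≤ g k ω) : ∀ᵐ ω ∂P, F ω ≤ G ω := by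
  obtain ⟨ms, hms, hae⟩ := h.exists_seq
  obtain ⟨ls, hls, hae'⟩ := h' ms hms
  filter_upwards [hae, hae', hfg] with ω h1 h2 h3
  exact le_of_tendsto_of_tendsto' (h1.comp hls.tendsto_atTop) h2 fun k => h3 _

/-- Convergence in probability by approximation. -/
lemma of_approx {L : ℕ → Ω → ℝ} (hL : TendstoAESubseq P L fun _ => 0)
    (hLm : ∀ n, AEStronglyMeasurable (L n) P)
    (h : ∀ n, ∃ H : ℕ → Ω → ℝ, (∀ k, AEStronglyMeasurable (H k) P) ∧ TendstoAESubseq P H (L n) ∧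
      ∀ k, ∀ᵐ ω ∂P, |f k ω - F ω| ≤ H k ω) : TendstoAESubseq P f F := by
  refine of_tendstoInMeasure (tendstoInMeasure_iff_dist.2 fun ε hε => ?_)
  rw [ENNReal.tendsto_nhds_zero]
  intro δ hδ
  have hδ2 : 0 < δ / 2 := ENNReal.half_pos hδ.ne'
  have h1 := tendstoInMeasure_iff_dist.1 (hL.tendstoInMeasure hLm) (ε / 2) (by positivity)
  rw [ENNReal.tendsto_nhds_zero] at h1
  obtain ⟨n, hn⟩ := (h1 _ hδ2).exists
  obtain ⟨H, hHm, hH, hb⟩ := h n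
  have h2 := tendstoInMeasure_iff_dist.1 (hH.tendstoInMeasure hHm) (ε / 2) (by positivity)
  rw [ENNReal.tendsto_nhds_zero] at h2
  filter_upwards [h2 _ hδ2] with k hk
  simp only [Real.dist_eq, sub_zero] at hn hk ⊢
  calc P {ω | ε ≤ |f k ω - F ω|}
      ≤ P ({ω | ε / 2 ≤ |H k ω - L n ω|} ∪ {ω | ε / 2 ≤ |L n ω|}) := by
        refine measure_mono_ae ?_
        filter_upwards [hb k] with ω hω (hω' : ε ≤ |f k ω - F ω|)
        by_contra hcon
        have hcon := not_or.1 (show ¬(ε / 2 ≤ |H k ω - L n ω| ∨ ε / 2 ≤ |L n ω|) from hcon)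
        have c1 := not_le.1 hcon.1
        have c2 := not_le.1 hcon.2
        have := le_abs_self (H k ω - L n ω)
        have := le_abs_self (L n ω)
        linarith
    _ ≤ δ / 2 + δ / 2 := (measure_union_le _ _).trans (add_le_add hk hn)
    _ = δ := ENNReal.add_halves δ

end TendstoAESubseq

/-- The sum of the products of the increments of two processes along a partition. -/
noncomputable def covSum {t s : ℝ≥0} (x y : ℝ≥0 → Ω → ℝ) (π : TimePartition t s) (ω : Ω) : ℝ :=
  ∑ i ∈ range π.n, (x (π.pt (i + 1)) ω - x (π.pt i) ω) * (y (π.pt (i + 1)) ω - y (π.pt i) ω)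

lemma covSum_sq_le {s : ℝ≥0} (x y : ℝ≥0 → Ω → ℝ) (π : TimePartition t s) (ω : Ω) :
    covSum x y π ω ^ 2 ≤ covSum y y π ω * covSum x x π ω := by
  have := Finset.sum_mul_sq_le_sq_mul_sq (range π.n)
    (fun i => x (π.pt (i + 1)) ω - x (π.pt i) ω) (fun i => y (π.pt (i + 1)) ω - y (π.pt i) ω)
  simp only [covSum, ← pow_two]
  rwa [mul_comm] at this

lemma covSum_self_nonneg {s : ℝ≥0} (x : ℝ≥0 → Ω → ℝ) (π : TimePartition t s) (ω : Ω) :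
    0 ≤ covSum x x π ω := sum_nonneg fun _ _ => mul_self_nonneg _

lemma stronglyMeasurable_covSum {x y : ℝ≥0 → Ω → ℝ} (hx : ∀ s ≤ T, StronglyMeasurable[𝓕 s] (x s))
    (hy : ∀ s ≤ T, StronglyMeasurable[𝓕 s] (y s)) {s : ℝ≥0} (hs : s ≤ T) (π : TimePartition t s) :
    StronglyMeasurable (covSum x y π) := by
  have hm : ∀ {z : ℝ≥0 → Ω → ℝ}, (∀ s ≤ T, StronglyMeasurable[𝓕 s] (z s)) → ∀ i ≤ π.n,
      StronglyMeasurable (z (π.pt i)) := fun hz i hi =>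
    (hz _ ((π.pt_le hi).trans hs)).mono (𝓕.le _)
  refine Finset.stronglyMeasurable_fun_sum _ fun i hi => ?_
  have hi := Finset.mem_range.1 hi
  exact ((hm hx _ hi).sub (hm hx _ hi.le)).mul ((hm hy _ hi).sub (hm hy _ hi.le))

lemma IsCovariation.tendstoAESubseq {s : ℝ≥0} {Z U : ℝ≥0 → Ω → ℝ} {L : Ω → ℝ}
    (h : IsCovariation P t s Z (fun _ => 0) U (U t) L) {π : ℕ → TimePartition t s}
    (hπ : MeshTendsto π) : TendstoAESubseq P (fun k => covSum U Z (π k)) L := by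
  refine (ConvergesAlongPartitions.tendstoAESubseq h hπ).congr
    (Eventually.of_forall fun ω k => ?_) (Eventually.of_forall fun _ => rfl)
  simp only [covSum, sub_self, mul_zero, zero_add]
  exact sum_congr rfl fun i _ => mul_comm _ _

lemma IsQuadVar.tendstoAESubseq {Z : ℝ≥0 → Ω → ℝ} {Q : Ω → ℝ} (h : IsQuadVar P t T Z Q)
    {π : ℕ → TimePartition t T} (hπ : MeshTendsto π) :
    TendstoAESubseq P (fun k => covSum Z Z (π k)) (fun ω => Q ω - Z t ω ^ 2) := by
  refine ((ConvergesAlongPartitions.tendstoAESubseq h hπ).sub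
    (.of_ae (f := fun _ ω => Z t ω ^ 2) (Eventually.of_forall fun _ => tendsto_const_nhds))).congr
    (Eventually.of_forall fun ω k => ?_) (Eventually.of_forall fun _ => rfl)
  simp only [covSum]; ring

/-- Stopping one factor or both factors makes no difference in the limit. -/
lemma tendsto_sum_of_le {π : ℕ → TimePartition t T} (hπ : MeshTendsto π) {c : ℝ≥0} (htc : t ≤ c)
    (hc : c ≤ T) {w z : ℝ≥0 → ℝ} (hw : ContinuousOn w (Icc t T)) {K : ℝ}
    (hz : ∀ s ∈ Icc t T, |z s| ≤ K) :
    Tendsto (fun k => (∑ i ∈ range (π k).n,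
        (w (min ((π k).pt (i + 1)) c) - w (min ((π k).pt i) c))
          * (z ((π k).pt (i + 1)) - z ((π k).pt i)))
      - ∑ i ∈ range (π k).n, (w (min ((π k).pt (i + 1)) c) - w (min ((π k).pt i) c))
          * (z (min ((π k).pt (i + 1)) c) - z (min ((π k).pt i) c))) atTop (𝓝 0) := by
  have hK : 0 ≤ K := (abs_nonneg _).trans (hz t ⟨le_rfl, htc.trans hc⟩)
  rw [Metric.tendsto_atTop']
  intro ε hε
  have hosc := (hπ.stopAt htc hc).eventually_abs_sub_lt
    ((continuousOn_comp_toNNReal hw).mono (Set.Icc_subset_Icc_right (by exact_mod_cast hc)))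
    (ε := ε / (2 * K + 1)) (by positivity)
  obtain ⟨n, hn⟩ := eventually_atTop.1 hosc
  refine ⟨n, fun k hk => ?_⟩
  have hn := hn k hk.le
  simp only [TimePartition.stopAt, Real.toNNReal_coe] at hn
  rw [Real.dist_eq, sub_zero, ← sum_sub_distrib]
  rcases htc.eq_or_lt with rfl | htc'
  · rw [Finset.sum_eq_zero]
    · simpa using hε
    · intro i _
      rw [min_eq_right ((π k).le_pt i), min_eq_right ((π k).le_pt (i + 1))]; ring
  obtain ⟨i, hi, hci, hne⟩ := (π k).exists_cell (r := c)
    ⟨by exact_mod_cast htc', by exact_mod_cast hc⟩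
  have hi0 : (π k).pt i < c := by exact_mod_cast hci.1
  have hi1 : c ≤ (π k).pt (i + 1) := by exact_mod_cast hci.2
  rw [Finset.sum_eq_single_of_mem i (Finset.mem_range.2 hi)]
  · have hb := hn i hi
    rw [min_eq_left hi0.le, min_eq_right hi1] at hb ⊢
    have h1 := hz _ ⟨(π k).le_pt (i + 1), (π k).pt_le hi⟩
    have h2 := hz c ⟨htc, hc⟩
    rw [← mul_sub, abs_mul, show z ((π k).pt (i + 1)) - z ((π k).pt i) - (z c - z ((π k).pt i))
      = z ((π k).pt (i + 1)) - z c by ring]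
    have h3 : |z ((π k).pt (i + 1)) - z c| ≤ 2 * K := (abs_sub _ _).trans (by linarith)
    rw [lt_div_iff₀ (by positivity)] at hb
    nlinarith [abs_nonneg (w c - w ((π k).pt i)), abs_nonneg (z ((π k).pt (i + 1)) - z c)]
  · intro j hj hji
    have hj := Finset.mem_range.1 hj
    rcases lt_or_ge ((π k).pt j) c with h1 | h1
    · rcases le_or_gt c ((π k).pt (j + 1)) with h2 | h2
      · exact absurd ⟨by exact_mod_cast h1, by exact_mod_cast h2⟩ (hne j hji)
      · rw [min_eq_left h2.le, min_eq_left h1.le]; ring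
    · rw [min_eq_right h1, min_eq_right (h1.trans ((π k).mono (Nat.le_succ j)))]; ring

/-- `f` and `g` represent the covariation process `v` of `Z` and `W` on `[t, T]`. -/
structure RepresentsCov (P : Measure Ω) (W Z : ℝ≥0 → Ω → ℝ) (t T : ℝ≥0) (v : ℝ≥0 → Ω → ℝ)
    (f g : Ω → StieltjesFunction ℝ) : Prop where
  cov : ∀ s ∈ Icc t T, IsCovariation P t s Z (fun _ => 0) W (W t) (v s)
  eq : ∀ᵐ ω ∂P, ∀ s ∈ Icc t T, v s ω - v t ω = (f ω s - f ω t) - (g ω s - g ω t)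

lemma setIntegral_indicator_Ioc (f : StieltjesFunction ℝ) (htT : t ≤ T) {a b : ℝ≥0} (hab : a ≤ b)
    (κ : ℝ) : ∫ r in Ioc (t : ℝ) T, (Ioc a b).indicator (fun _ => κ) r.toNNReal ∂f.measure
      = κ * (f (clamp t T b) - f (clamp t T a)) := by
  have hle : ((clamp t T a : ℝ≥0) : ℝ) ≤ clamp t T b := by exact_mod_cast clamp_mono t T hab
  rw [← integral_const_Ioc f κ hle, ← integral_indicator measurableSet_Ioc,
    ← integral_indicator measurableSet_Ioc]
  refine integral_congr_ae (Eventually.of_forall fun r => ?_)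
  have hmem : r ∈ Ioc ((clamp t T a : ℝ≥0) : ℝ) (clamp t T b)
      ↔ r ∈ Ioc (t : ℝ) T ∧ r.toNNReal ∈ Ioc a b := by
    have htT' : (t : ℝ) ≤ T := by exact_mod_cast htT
    have ha := a.coe_nonneg
    simp only [clamp, NNReal.coe_max, NNReal.coe_min, Set.mem_Ioc, max_lt_iff, le_max_iff,
      min_lt_iff, le_min_iff, Real.lt_toNNReal_iff_coe_lt, Real.toNNReal_le_iff_le_coe]
    constructor
    · rintro ⟨⟨h1, h2⟩, h3⟩
      rcases h3 with h3 | h3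
      · exact absurd h1 (not_lt.2 h3)
      · exact ⟨⟨h1, h3.2⟩, h2.resolve_right (not_lt.2 h3.2), h3.1⟩
    · rintro ⟨⟨h1, h2⟩, h3, h4⟩
      exact ⟨⟨h1, Or.inl h3⟩, Or.inr ⟨h4, h2⟩⟩
  by_cases hr : r ∈ Ioc ((clamp t T a : ℝ≥0) : ℝ) (clamp t T b)
  · have h := hmem.1 hr
    simp only [Set.indicator_of_mem hr, Set.indicator_of_mem h.1, Set.indicator_of_mem h.2]
  · rw [Set.indicator_of_notMem hr]
    by_cases h1 : r ∈ Ioc (t : ℝ) T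
    · rw [Set.indicator_of_mem h1, Set.indicator_of_notMem fun h2 => hr (hmem.2 ⟨h1, h2⟩)]
    · rw [Set.indicator_of_notMem h1]

lemma ElemRegular.integrableOn_stieltjes
    (hx : ElemRegular P 𝓕 x) (f : StieltjesFunction ℝ) (t T : ℝ≥0) (ω : Ω) :
    IntegrableOn (fun r : ℝ => x.1 r.toNNReal ω) (Ioc (t : ℝ) T) f.measure := by
  obtain ⟨K, hK⟩ := hx.bound
  have hm : StronglyMeasurable (fun r : ℝ => x.1 r.toNNReal ω) :=
    hx.meas.comp_measurable measurable_prodMk_right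
  exact Integrable.of_bound hm.aestronglyMeasurable K (Eventually.of_forall fun r => hK _ _)

namespace RepresentsCov

variable {Z v : ℝ≥0 → Ω → ℝ} {f g : Ω → StieltjesFunction ℝ}

lemma tendstoAESubseq_elem (hW : IsBrownianBasis P 𝓕 W) (h : RepresentsCov P W Z t T v f g)
    (hZc : ∀ ω, IsCadlagOn (fun s => Z s ω) t T) {π : ℕ → TimePartition t T}
    (hπ : MeshTendsto π) (hx : x ∈ elemIntegrals 𝓕 W) :
    TendstoAESubseq P (fun k => covSum x.2 Z (π k))
      (fun ω => stieltjesDiff (f ω) (g ω) t T fun r => x.1 r.toNNReal ω) := by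
  have htT := (π 0).le
  induction hx using Submodule.span_induction with
  | mem x hx =>
    obtain ⟨a, b, κ, hab, -, -, rfl⟩ := hx
    have hone : ∀ c, t ≤ c → c ≤ T → TendstoAESubseq P (fun k ω => ∑ i ∈ range (π k).n,
        (W (min ((π k).pt (i + 1)) c) ω - W (min ((π k).pt i) c) ω)
          * (Z ((π k).pt (i + 1)) ω - Z ((π k).pt i) ω)) (v c) := by
      intro c htc hc
      refine ((h.cov c ⟨htc, hc⟩).tendstoAESubseq (hπ.stopAt htc hc)).map ?_
      filter_upwards [hW.brownian.cont] with ω hω ns hns hlim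
      obtain ⟨K, hK⟩ := (hZc ω).exists_bound
      have := (tendsto_sum_of_le (hπ.comp hns.tendsto_atTop) htc hc
        (w := fun s => W s ω) (z := fun s => Z s ω) hω.continuousOn hK).add hlim
      rw [zero_add] at this
      refine this.congr fun k => ?_
      simp only [covSum, TimePartition.stopAt]
      ring
    have hclamp : ∀ c, t ≤ clamp t T c ∧ clamp t T c ≤ T := fun c =>
      ⟨le_clamp _ _ _, clamp_le htT _⟩
    refine (((hone _ (hclamp b).1 (hclamp b).2).sub (hone _ (hclamp a).1 (hclamp a).2)).mul_left
      κ).congr (Eventually.of_forall fun ω k => ?_) ?_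
    · rw [covSum, ← sum_sub_distrib, mul_sum]
      refine sum_congr rfl fun i hi => ?_
      have hi := Finset.mem_range.1 hi
      have hinc : ∀ c, W (min ((π k).pt (i + 1)) (clamp t T c)) ω
          - W (min ((π k).pt i) (clamp t T c)) ω
          = W (min c ((π k).pt (i + 1))) ω - W (min c ((π k).pt i)) ω := by
        intro c
        have h0 := (π k).le_pt i
        have h1 := (π k).pt_le hi
        have h2 := (π k).mono (Nat.le_succ i)
        rcases le_total c t with hc | hc
        · have : clamp t T c = t := by
            rw [clamp, max_eq_left ((min_le_left _ _).trans hc)]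
          rw [this, min_eq_right h0, min_eq_right (h0.trans h2), min_eq_left (hc.trans h0),
            min_eq_left (hc.trans (h0.trans h2)), sub_self, sub_self]
        · rw [clamp, max_eq_right (le_min hc htT), min_comm c T, ← min_assoc, ← min_assoc,
            min_eq_left h1, min_eq_left (h2.trans h1), min_comm c, min_comm c]
      rw [hinc, hinc]
      simp only [elemBlock]
      ring
    · filter_upwards [h.eq] with ω hω
      have h1 := hω _ (hclamp b)
      have h2 := hω _ (hclamp a)
      simp only [stieltjesDiff, elemBlock, setIntegral_indicator_Ioc _ htT hab]
      linear_combination κ ω * h1 - κ ω * h2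
  | zero =>
    refine .of_ae (Eventually.of_forall fun ω => ?_)
    simp [covSum, stieltjesDiff]
  | add x y hx hy ihx ihy =>
    have hx' := ElemRegular.of_mem hW hx
    have hy' := ElemRegular.of_mem hW hy
    refine (ihx.add ihy).congr (Eventually.of_forall fun ω k => ?_)
      (Eventually.of_forall fun ω => ?_)
    · simp only [covSum, ← sum_add_distrib, Prod.snd_add, Pi.add_apply]
      exact sum_congr rfl fun i _ => by ring
    · simp only [stieltjesDiff, Prod.fst_add, Pi.add_apply]
      rw [integral_add (hx'.integrableOn_stieltjes _ _ _ _) (hy'.integrableOn_stieltjes _ _ _ _),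
        integral_add (hx'.integrableOn_stieltjes _ _ _ _) (hy'.integrableOn_stieltjes _ _ _ _)]
      ring
  | smul κ x hx ih =>
    refine (ih.mul_left fun _ => κ).congr (Eventually.of_forall fun ω k => ?_)
      (Eventually.of_forall fun ω => ?_)
    · simp only [covSum, mul_sum, Prod.smul_snd, Pi.smul_apply, smul_eq_mul]
      exact sum_congr rfl fun i _ => by ring
    · simp only [stieltjesDiff, Prod.smul_fst, Pi.smul_apply, smul_eq_mul, integral_const_mul]
      ring

/-- The Kunita–Watanabe inequality for a fixed elementary integrand. -/
lemma sq_le_of_elem (hW : IsBrownianBasis P 𝓕 W) (h : RepresentsCov P W Z t T v f g)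
    (hZc : ∀ ω, IsCadlagOn (fun s => Z s ω) t T) (htT : t ≤ T) {Q : Ω → ℝ}
    (hQ : IsQuadVar P t T Z Q) (hx : x ∈ elemIntegrals 𝓕 W) :
    ∀ᵐ ω ∂P, stieltjesDiff (f ω) (g ω) t T (fun r => x.1 r.toNNReal ω) ^ 2
      ≤ (Q ω - Z t ω ^ 2) * cellInt x.1 x.1 t T ω := by
  have hπ := meshTendsto_uniform htT
  have hxp := IsItoPair.of_mem (T := T) hW hx
  have h1 := (h.tendstoAESubseq_elem hW hZc hπ hx).comp_continuous (continuous_pow 2)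
  have h2 := hxp.tendstoAESubseq_sum hW hxp le_rfl hπ (g := fun _ => 1) continuousOn_const
  simp only [one_mul] at h2
  exact h1.le ((hQ.tendstoAESubseq hπ).mul h2)
    (Eventually.of_forall fun ω k => covSum_sq_le _ _ _ _)

lemma quadVar_nonneg (htT : t ≤ T) {Q : Ω → ℝ} (hQ : IsQuadVar P t T Z Q) :
    ∀ᵐ ω ∂P, 0 ≤ Q ω - Z t ω ^ 2 :=
  TendstoAESubseq.le (f := fun _ _ => 0) (.of_ae (Eventually.of_forall fun _ => tendsto_const_nhds))
    (hQ.tendstoAESubseq (meshTendsto_uniform htT))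
    (Eventually.of_forall fun _ _ => covSum_self_nonneg _ _ _)

lemma step_sq_le (hW : IsBrownianBasis P 𝓕 W) (h : RepresentsCov P W Z t T v f g)
    (hZc : ∀ ω, IsCadlagOn (fun s => Z s ω) t T) {Q : Ω → ℝ} (hQ : IsQuadVar P t T Z Q)
    (q : TimePartition t T) :
    ∀ᵐ ω ∂P, ∀ c : ℕ → ℝ, (∑ i ∈ range q.n, c i * ((f ω (q.pt (i + 1)) - f ω (q.pt i))
        - (g ω (q.pt (i + 1)) - g ω (q.pt i)))) ^ 2
      ≤ (Q ω - Z t ω ^ 2) * ∑ i ∈ range q.n,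
        c i ^ 2 * ((q.pt (i + 1) : ℝ) - q.pt i) := by
  obtain ⟨D, hD, hDd⟩ := TopologicalSpace.exists_countable_dense (ℕ → ℝ)
  have key : ∀ c : ℕ → ℝ, ∀ᵐ ω ∂P,
      (∑ i ∈ range q.n, c i * ((f ω (q.pt (i + 1)) - f ω (q.pt i))
        - (g ω (q.pt (i + 1)) - g ω (q.pt i)))) ^ 2
      ≤ (Q ω - Z t ω ^ 2) * ∑ i ∈ range q.n,
        c i ^ 2 * ((q.pt (i + 1) : ℝ) - q.pt i) := by
    intro c
    have hblock : ∀ i, elemBlock W (q.pt i) (q.pt (i + 1)) (fun _ : Ω => c i)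
        ∈ elemIntegrals 𝓕 W := fun i =>
      elemBlock_mem (q.mono (Nat.le_succ i)) stronglyMeasurable_const ⟨|c i|, fun _ => le_rfl⟩
    set x := ∑ i ∈ range q.n, elemBlock W (q.pt i) (q.pt (i + 1)) (fun _ : Ω => c i) with hx
    have hxm : x ∈ elemIntegrals 𝓕 W := Submodule.sum_mem _ fun i _ => hblock i
    have hval : ∀ s ω, x.1 s ω = ∑ i ∈ range q.n,
        (Ioc (q.pt i) (q.pt (i + 1))).indicator (fun _ => c i) s := by
      intro s ω
      rw [hx, Prod.fst_sum]
      simp [elemBlock, Finset.sum_apply]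
    filter_upwards [h.sq_le_of_elem hW hZc q.le hQ hxm] with ω hω
    refine le_trans (le_of_eq ?_) (hω.trans (le_of_eq ?_))
    · congr 1
      have hcl : ∀ i ≤ q.n, clamp t T (q.pt i) = q.pt i := fun i hi => by
        rw [clamp, min_eq_left (q.pt_le hi), max_eq_right (q.le_pt i)]
      have hint : ∀ F : StieltjesFunction ℝ, ∫ r in Ioc (t : ℝ) T, x.1 r.toNNReal ω ∂F.measure
          = ∑ i ∈ range q.n, c i * (F (q.pt (i + 1)) - F (q.pt i)) := by
        intro F
        simp only [hval]
        have hi : ∀ i, Integrable (fun r : ℝ => (Ioc (q.pt i) (q.pt (i + 1))).indicator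
            (fun _ => c i) r.toNNReal) (F.measure.restrict (Ioc (t : ℝ) T)) := fun i =>
          (ElemRegular.of_mem hW (hblock i)).integrableOn_stieltjes F t T ω
        rw [integral_finsetSum _ fun i _ => hi i]
        refine sum_congr rfl fun i hi => ?_
        have hi := Finset.mem_range.1 hi
        rw [setIntegral_indicator_Ioc F q.le (q.mono (Nat.le_succ i)), hcl _ hi.le, hcl _ hi]
      rw [stieltjesDiff, hint, hint, ← sum_sub_distrib]
      exact sum_congr rfl fun i _ => by ring
    · congr 1
      have hxr := ElemRegular.of_mem hW hxm
      rw [← sum_cellInt (T := T) (hxr.intervalIntegrable hxr _ _ ω) le_rfl q]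
      refine sum_congr rfl fun i hi => ?_
      have hle := q.pt_le_succ i
      have hcell : ∀ r ∈ Ioc (q.pt i : ℝ) (q.pt (i + 1)), x.1 r.toNNReal ω = c i := by
        intro r hr
        have hmem : ∀ j, r.toNNReal ∈ Ioc (q.pt j) (q.pt (j + 1))
            ↔ r ∈ Ioc (q.pt j : ℝ) (q.pt (j + 1)) := fun j => by
          rw [Set.mem_Ioc, Set.mem_Ioc, Real.lt_toNNReal_iff_coe_lt, Real.toNNReal_le_iff_le_coe]
        have hrT : r ∈ Ioc (t : ℝ) T := ⟨(q.mem_Icc (Finset.mem_range.1 hi).le).1.trans_lt hr.1,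
          hr.2.trans (q.mem_Icc (Finset.mem_range.1 hi)).2⟩
        obtain ⟨i', -, hi', hne⟩ := q.exists_cell hrT
        have hii : i = i' := by
          by_contra hcon
          exact hne i hcon hr
        rw [hval, Finset.sum_eq_single_of_mem i hi, Set.indicator_of_mem ((hmem i).2 hr)]
        intro j _ hji
        exact Set.indicator_of_notMem (fun hj => hne j (hii ▸ hji) ((hmem j).1 hj)) _
      rw [cellInt, intervalIntegral.integral_of_le hle,
        setIntegral_congr_fun measurableSet_Ioc fun r hr => by rw [hcell r hr],
        ← intervalIntegral.integral_of_le hle, intervalIntegral.integral_const, smul_eq_mul]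
      ring
  have hall := (ae_ball_iff hD).2 fun c _ => key c
  filter_upwards [hall] with ω hω
  have hcl : IsClosed {c : ℕ → ℝ | (∑ i ∈ range q.n,
        c i * ((f ω (q.pt (i + 1)) - f ω (q.pt i)) - (g ω (q.pt (i + 1)) - g ω (q.pt i)))) ^ 2
      ≤ (Q ω - Z t ω ^ 2) * ∑ i ∈ range q.n,
        c i ^ 2 * ((q.pt (i + 1) : ℝ) - q.pt i)} := by
    refine isClosed_le ?_ ?_ <;> fun_prop
  have hsub := (hcl.closure_subset_iff).2 (show D ⊆ _ from hω)
  rw [hDd.closure_eq] at hsub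
  exact fun c => hsub (Set.mem_univ c)

end RepresentsCov

/-- `∫ h d[Z, W]` is the covariation of `Z` and `∫ h dW`. -/
lemma IsCovariationIntegral.tendstoAESubseq (hW : IsBrownianBasis P 𝓕 W) {h N Z : ℝ≥0 → Ω → ℝ}
    {Q R : Ω → ℝ} (hcov : IsCovariationIntegral P t T h Z W R) (hQ : IsQuadVar P t T Z Q)
    (hZa : ∀ s ≤ T, StronglyMeasurable[𝓕 s] (Z s)) (hZc : ∀ ω, IsCadlagOn (fun s => Z s ω) t T)
    (hN : IsItoPair P 𝓕 W T (h, N)) (hhm : StronglyMeasurable (onProd h))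
    {π : ℕ → TimePartition t T} (hπ : MeshTendsto π) :
    TendstoAESubseq P (fun k => covSum N Z (π k)) R := by
  have htT := (π 0).le
  have htT' : (t : ℝ) ≤ T := by exact_mod_cast htT
  obtain ⟨v, hv, hst⟩ := hcov
  have hst' : ∀ ω, ∃ F : StieltjesFunction ℝ × StieltjesFunction ℝ,
      IsStieltjesIntegral t T (fun s => h s ω) (fun s => v s ω) (R ω) →
      (∀ s ∈ Icc t T, v s ω - v t ω = (F.1 s - F.1 t) - (F.2 s - F.2 t)) ∧
      IntegrableOn (fun r : ℝ => h r.toNNReal ω) (Ioc (t : ℝ) T) F.1.measure ∧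
      IntegrableOn (fun r : ℝ => h r.toNNReal ω) (Ioc (t : ℝ) T) F.2.measure ∧
      R ω = stieltjesDiff F.1 F.2 t T fun r => h r.toNNReal ω := by
    intro ω
    by_cases hω : IsStieltjesIntegral t T (fun s => h s ω) (fun s => v s ω) (R ω)
    · obtain ⟨f, g, h1, h2, h3, h4⟩ := hω
      exact ⟨(f, g), fun _ => ⟨h1, h2, h3, h4⟩⟩
    · exact ⟨(StieltjesFunction.id, StieltjesFunction.id), fun hc => absurd hc hω⟩
  choose F hF using hst'
  have hrep : RepresentsCov P W Z t T v (fun ω => (F ω).1) (fun ω => (F ω).2) := by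
    refine ⟨hv, ?_⟩
    filter_upwards [hst] with ω hω using (hF ω hω).1
  obtain ⟨a, ha, ha1, -⟩ := hN.approx
  have hap := fun n => IsItoPair.of_mem (T := T) hW (ha n)
  have hd := fun n => hN.sub (hap n) hW
  set q : Ω → ℝ := fun ω => Q ω - Z t ω ^ 2 with hq
  have hq0 : ∀ᵐ ω ∂P, 0 ≤ q ω := RepresentsCov.quadVar_nonneg htT hQ
  set Δ : ℕ → Ω → ℝ := fun n => cellInt ((h, N) - a n).1 ((h, N) - a n).1 t T with hΔ
  have hΔi : ∀ n, Integrable (Δ n) P := fun n => (hd n).integrable_cellInt (hd n) htT le_rfl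
  have hΔ0 : ∀ n ω, 0 ≤ Δ n ω := fun n ω => cellInt_self_nonneg _ htT ω
  have hqt := hQ.tendstoAESubseq hπ
  have hqm : AEStronglyMeasurable q P := hqt.aestronglyMeasurable fun k =>
    (stronglyMeasurable_covSum hZa hZa le_rfl _).aestronglyMeasurable
  have hL0 : TendstoAESubseq P Δ fun _ => 0 := by
    refine .of_integral_abs hΔi (squeeze_zero (fun k => integral_nonneg fun _ => abs_nonneg _)
      (fun k => ?_) (hN.tendsto_integral_sq_sub hW ha ha1))
    refine le_trans (le_of_eq ?_) ((hd k).integral_cellInt_le htT le_rfl)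
    exact integral_congr_ae (Eventually.of_forall fun ω => abs_of_nonneg (hΔ0 k ω))
  have hL : TendstoAESubseq P (fun n ω => 2 * √(q ω * Δ n ω)) fun _ => 0 := by
    have := ((hL0.mul_left q).comp_continuous Real.continuous_sqrt).mul_left fun _ => 2
    simpa using this
  set SD : ℕ → Ω → ℝ := fun n ω =>
    stieltjesDiff (F ω).1 (F ω).2 t T fun r => (a n).1 r.toNNReal ω with hSD
  have hel : ∀ n, TendstoAESubseq P (fun k => covSum (a n).2 Z (π k)) (SD n) := fun n =>
    hrep.tendstoAESubseq_elem hW hZc hπ (ha n)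
  have ham : ∀ n k, AEStronglyMeasurable (covSum (a n).2 Z (π k)) P := fun n k =>
    (stronglyMeasurable_covSum (hap n).adapted hZa le_rfl _).aestronglyMeasurable
  have hSDm : ∀ n, AEStronglyMeasurable (SD n) P := fun n => (hel n).aestronglyMeasurable (ham n)
  have hLm : ∀ n, AEStronglyMeasurable (fun ω => √(q ω * Δ n ω)) P := fun n =>
    Real.continuous_sqrt.comp_aestronglyMeasurable (hqm.mul (hΔi n).aestronglyMeasurable)
  refine .of_approx hL (fun n => (hLm n).const_mul 2) fun n => ?_
  have hKW : ∀ᵐ ω ∂P, |SD n ω - R ω| ≤ √(q ω * Δ n ω) := by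
    have hstep : ∀ᵐ ω ∂P, ∀ m, _ := ae_all_iff.2 fun m =>
      hrep.step_sq_le hW hZc hQ (TimePartition.uniform t T htT m)
    have hxr := ElemRegular.of_mem hW (ha n)
    filter_upwards [hst, hstep, hq0, (hd n).ae_intervalIntegrable (hd n)] with ω h1 h2 h3 h4
    obtain ⟨-, h5, h6, h7⟩ := hF ω h1
    have e1 := hxr.integrableOn_stieltjes (F ω).1 t T ω
    have e2 := hxr.integrableOn_stieltjes (F ω).2 t T ω
    have := stieltjesDiff_sq_le htT h2 (h := fun r => h r.toNNReal ω - (a n).1 r.toNNReal ω) h3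
      (h5.sub e1) (h6.sub e2) (intervalIntegrable_sub_interval h4 htT le_rfl)
      ((hhm.comp_measurable measurable_prodMk_right).sub
        (hxr.meas.comp_measurable measurable_prodMk_right)).aestronglyMeasurable
    rw [← Real.sqrt_sq_eq_abs]
    refine Real.sqrt_le_sqrt (le_trans (le_of_eq ?_) this)
    rw [h7]
    simp only [hSD, stieltjesDiff]
    rw [integral_sub h5 e1, integral_sub h6 e2]
    ring
  have hdd := (hd n).tendstoAESubseq_sum hW (hd n) le_rfl hπ (g := fun _ => 1) continuousOn_const
  simp only [one_mul] at hdd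
  have hddm : ∀ k, AEStronglyMeasurable (covSum ((h, N) - a n).2 ((h, N) - a n).2 (π k)) P :=
    fun k => (stronglyMeasurable_covSum (hd n).adapted (hd n).adapted le_rfl _).aestronglyMeasurable
  have hzzm : ∀ k, AEStronglyMeasurable (covSum Z Z (π k)) P := fun k =>
    (stronglyMeasurable_covSum hZa hZa le_rfl _).aestronglyMeasurable
  refine ⟨fun k ω => |covSum (a n).2 Z (π k) ω - SD n ω|
    + √(covSum Z Z (π k) ω * covSum ((h, N) - a n).2 ((h, N) - a n).2 (π k) ω)
    + √(q ω * Δ n ω), fun k => ?_, ?_, fun k => ?_⟩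
  · exact ((continuous_abs.comp_aestronglyMeasurable ((ham n k).sub (hSDm n))).add
      (Real.continuous_sqrt.comp_aestronglyMeasurable ((hzzm k).mul (hddm k)))).add (hLm n)
  · have c1 := ((hel n).sub (.of_ae (f := fun _ => SD n) (F := SD n)
      (Eventually.of_forall fun _ => tendsto_const_nhds))).comp_continuous continuous_abs
    have c2 := (hqt.mul hdd).comp_continuous Real.continuous_sqrt
    refine ((c1.add c2).add (.of_ae (f := fun _ ω => √(q ω * Δ n ω))
      (Eventually.of_forall fun _ => tendsto_const_nhds))).congr
      (Eventually.of_forall fun ω k => rfl) (Eventually.of_forall fun ω => ?_)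
    simp only [sub_self, abs_zero, zero_add, hΔ, cellInt]
    ring
  · filter_upwards [hKW] with ω h1
    have h2 : covSum N Z (π k) ω
        = covSum (a n).2 Z (π k) ω + covSum ((h, N) - a n).2 Z (π k) ω := by
      simp only [covSum, ← sum_add_distrib, Prod.snd_sub, Pi.sub_apply]
      exact sum_congr rfl fun i _ => by ring
    have h3 : |covSum ((h, N) - a n).2 Z (π k) ω|
        ≤ √(covSum Z Z (π k) ω * covSum ((h, N) - a n).2 ((h, N) - a n).2 (π k) ω) := by
      rw [← Real.sqrt_sq_eq_abs]
      exact Real.sqrt_le_sqrt (covSum_sq_le _ _ _ _)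
    rw [h2]
    calc _ = |(covSum (a n).2 Z (π k) ω - SD n ω) + covSum ((h, N) - a n).2 Z (π k) ω
          + (SD n ω - R ω)| := by congr 1; ring
      _ ≤ _ := (abs_add_three _ _ _).trans (add_le_add_three le_rfl h3 h1)

/-- Truncation at the levels `± L`. -/
noncomputable def clip (L x : ℝ) : ℝ := max (-L) (min x L)

lemma continuous_clip (L : ℝ) : Continuous (clip L) :=
  continuous_const.max (continuous_id.min continuous_const)

lemma abs_clip_le {L : ℝ} (hL : 0 ≤ L) (x : ℝ) : |clip L x| ≤ L :=
  abs_le.2 ⟨le_max_left _ _, max_le (by linarith) (min_le_right _ _)⟩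

lemma clip_of_abs_le {L x : ℝ} (h : |x| ≤ L) : clip L x = x := by
  rw [abs_le] at h
  rw [clip, min_eq_left h.2, max_eq_right h.1]

lemma abs_clip_le_abs {L : ℝ} (hL : 0 ≤ L) (x : ℝ) : |clip L x| ≤ |x| := by
  rcases le_or_gt |x| L with h | h
  · rw [clip_of_abs_le h]
  · exact (abs_clip_le hL x).trans h.le

lemma abs_clip_sub_le {L : ℝ} (hL : 0 < L) (x : ℝ) : |clip L x - x| ≤ x ^ 2 / L := by
  rcases le_or_gt |x| L with h | h
  · rw [clip_of_abs_le h, sub_self, abs_zero]; positivity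
  · rw [le_div_iff₀ hL, ← sq_abs x]
    have h1 : |clip L x - x| ≤ |x| := by
      rcases abs_cases x with ⟨hx, h0⟩ | ⟨hx, h0⟩
      · rw [hx] at h ⊢
        rw [clip, min_eq_right h.le, max_eq_right (by linarith), abs_sub_comm,
          abs_of_nonneg (by linarith)]
        linarith
      · rw [hx] at h ⊢
        rw [clip, min_eq_left (by linarith), max_eq_left (by linarith),
          abs_of_nonneg (by linarith)]
        linarith
    nlinarith [abs_nonneg (clip L x - x)]

/-- Elementary integrals of bounded adapted processes against an Itô integral. -/
lemma IsItoPair.sum_mul_sub (hW : IsBrownianBasis P 𝓕 W)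
    (hx : IsItoPair P 𝓕 W T x) {X : ℝ≥0 → Ω → ℝ}
    (hX : ∀ s ∈ Icc t T, StronglyMeasurable[𝓕 s] (X s)) {K : ℝ} (hK : ∀ s ω, |X s ω| ≤ K)
    (π : TimePartition t T) {S : Ω → ℝ} (hS : S = fun ω => ∑ i ∈ range π.n,
      X (π.pt i) ω * (x.2 (π.pt (i + 1)) ω - x.2 (π.pt i) ω)) :
    MemLp S 2 P ∧ ∫ ω, S ω ∂P = 0 ∧
      ∫ ω, S ω ^ 2 ∂P ≤ K ^ 2 * ∫ q, onProd x.1 q * onProd x.1 q ∂(prodMeasure P T) := by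
  have hle : ∀ i < π.n, π.pt i ≤ T ∧ π.pt (i + 1) ≤ T := fun i hi => ⟨π.pt_le hi.le, π.pt_le hi⟩
  have hd := fun i (hi : i < π.n) => hx.memLp_sub hW (hle i hi).1 (hle i hi).2
  have hXm : ∀ i < π.n, StronglyMeasurable[𝓕 (π.pt i)] (X (π.pt i)) := fun i hi =>
    hX _ ⟨π.le_pt i, (hle i hi).1⟩
  have hterm : ∀ i < π.n, MemLp (fun ω => X (π.pt i) ω * (x.2 (π.pt (i + 1)) ω - x.2 (π.pt i) ω))
      2 P := fun i hi => (hd i hi).of_le_mul (c := K)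
    (((hXm i hi).mono (𝓕.le _)).aestronglyMeasurable.mul (hd i hi).aestronglyMeasurable)
    (Eventually.of_forall fun ω => by
      rw [norm_mul]; exact mul_le_mul_of_nonneg_right (hK _ ω) (norm_nonneg _))
  have hz : ∀ i < π.n, HasZeroMeanOn P (𝓕 (π.pt i))
      (fun ω => X (π.pt i) ω * (x.2 (π.pt (i + 1)) ω - x.2 (π.pt i) ω)) := fun i hi =>
    (hx.zeroMean hW (π.mono (Nat.le_succ i)) (hle i hi).2).mul (𝓕.le _)
      ((hd i hi).integrable one_le_two) (hXm i hi) ((hterm i hi).integrable one_le_two)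
  subst hS
  refine ⟨memLp_finsetSum _ fun i hi => hterm i (Finset.mem_range.1 hi), ?_, ?_⟩
  · rw [integral_finsetSum _ fun i hi => (hterm i (Finset.mem_range.1 hi)).integrable one_le_two]
    exact Finset.sum_eq_zero fun i hi => (hz i (Finset.mem_range.1 hi)).integral_eq_zero
  · rw [integral_sum_sq_eq π.mono hterm (fun i hi => ((hXm i hi).mono (𝓕.mono
      (π.mono (Nat.le_succ i)))).mul ((hx.adapted _ (hle i hi).2).sub
      ((hx.adapted _ (hle i hi).1).mono (𝓕.mono (π.mono (Nat.le_succ i)))))) hz]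
    calc ∑ i ∈ range π.n, ∫ ω, (X (π.pt i) ω
          * (x.2 (π.pt (i + 1)) ω - x.2 (π.pt i) ω)) ^ 2 ∂P
        ≤ ∑ i ∈ range π.n, K ^ 2 * ∫ ω, cellInt x.1 x.1 (π.pt i) (π.pt (i + 1)) ω ∂P := by
          refine sum_le_sum fun i hi => ?_
          have hi := Finset.mem_range.1 hi
          rw [← hx.isometry hW hx (π.mono (Nat.le_succ i)) (hle i hi).2, ← integral_const_mul]
          refine integral_mono (hterm i hi).integrable_sq
            (((hd i hi).integrable_mul_two (hd i hi)).const_mul _) fun ω => ?_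
          have h1 : X (π.pt i) ω ^ 2 ≤ K ^ 2 := by
            rw [← sq_abs]; exact pow_le_pow_left₀ (abs_nonneg _) (hK _ ω) 2
          simp only [mul_pow, ← pow_two]
          exact mul_le_mul_of_nonneg_right h1 (sq_nonneg _)
      _ = K ^ 2 * ∫ ω, cellInt x.1 x.1 t T ω ∂P := by
          rw [← mul_sum, ← integral_finsetSum _ fun i hi =>
            hx.integrable_cellInt hx (π.mono (Nat.le_succ i)) (hle i (Finset.mem_range.1 hi)).2]
          congr 1
          refine integral_congr_ae ?_
          filter_upwards [hx.ae_intervalIntegrable hx] with ω hω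
          exact sum_cellInt hω le_rfl π
      _ ≤ _ := mul_le_mul_of_nonneg_left (hx.integral_cellInt_le π.le le_rfl) (sq_nonneg _)

/-- An integrable limit of elementary integrals of a dominated process against an Itô integral
has mean zero. -/
lemma IsDominated.integral_limit_eq_zero (hW : IsBrownianBasis P 𝓕 W) {X : ℝ≥0 → Ω → ℝ}
    (hX : IsDominated P 𝓕 t T X) (hx : IsItoPair P 𝓕 W T x) {π : ℕ → TimePartition t T} {M : Ω → ℝ}
    (h : TendstoAESubseq P (fun k ω => ∑ i ∈ range (π k).n,
      X ((π k).pt i) ω * (x.2 ((π k).pt (i + 1)) ω - x.2 ((π k).pt i) ω)) M)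
    (hM : Integrable M P) : ∫ ω, M ω ∂P = 0 := by
  obtain ⟨ms, -, hlim⟩ := h.exists_seq
  obtain ⟨G₀, hG₀, hGb₀⟩ := hX.bound
  obtain ⟨G, hGm, hG0⟩ := hG₀.1
  have hG2 : MemLp G 2 P := hG₀.ae_eq hG0
  have hGb : ∀ᵐ ω ∂P, ∀ s ∈ Icc t T, |X s ω| ≤ G ω := by
    filter_upwards [hGb₀, hG0] with ω h1 h2
    rwa [← h2]
  set C := ∫ q, onProd x.1 q * onProd x.1 q ∂(prodMeasure P T) with hC
  have hC0 : 0 ≤ C := integral_nonneg fun q => mul_self_nonneg _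
  set B : ℕ → Set Ω := fun n => {ω | (n : ℝ) < G ω} with hB
  have hBm : ∀ n, MeasurableSet (B n) := fun n => measurableSet_lt measurable_const hGm.measurable
  set S : ℕ → ℕ → Ω → ℝ := fun n k ω => ∑ i ∈ range (π k).n,
    clip n (X ((π k).pt i) ω) * (x.2 ((π k).pt (i + 1)) ω - x.2 ((π k).pt i) ω) with hS
  have hSp := fun (n k : ℕ) => hx.sum_mul_sub hW (X := fun s ω => clip n (X s ω)) (K := n)
    (fun s hs => (continuous_clip n).comp_stronglyMeasurable (hX.adapted s hs))
    (fun s ω => abs_clip_le n.cast_nonneg _) (π k) (S := S n k) rfl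
  set F : ℕ → Ω → ℝ := fun n => (B n)ᶜ.indicator fun ω => clip ((n : ℝ) ^ 3) (M ω) with hF
  -- the bound at level `n`
  have key : ∀ η : ℝ, 0 < η → ∀ n : ℕ, 1 ≤ n → |∫ ω, F n ω ∂P|
      ≤ (η * C + (n : ℝ) ^ 2 * P.real (B n) / η) / 2 + C * (1 / n) := by
    intro η hη n hn
    have hn0 : (0 : ℝ) < n := by exact_mod_cast hn
    set FS : ℕ → Ω → ℝ := fun k => (B n)ᶜ.indicator fun ω => clip ((n : ℝ) ^ 3) (S n k ω) with hFS
    have hFSm : ∀ k, AEStronglyMeasurable (FS k) P := fun k =>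
      ((continuous_clip _).comp_aestronglyMeasurable (hSp n k).1.1).indicator (hBm n).compl
    have hFSb : ∀ k ω, ‖FS k ω‖ ≤ (n : ℝ) ^ 3 := fun k ω => by
      by_cases hω : ω ∈ (B n)ᶜ
      · simp only [hFS, Set.indicator_of_mem hω]; exact abs_clip_le (by positivity) _
      · simp only [hFS, Set.indicator_of_notMem hω, norm_zero]; positivity
    have hk : ∀ k, |∫ ω, FS k ω ∂P|
        ≤ (η * C + (n : ℝ) ^ 2 * P.real (B n) / η) / 2 + C * (1 / n) := by
      intro k
      obtain ⟨hS2, hS0, hSC⟩ := hSp n k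
      rw [← hC] at hSC
      clear_value C
      have hSi := hS2.integrable one_le_two
      have hFSi : Integrable (FS k) P :=
        Integrable.of_bound (hFSm k) _ (Eventually.of_forall (hFSb k))
      have h1 : ∫ ω, FS k ω ∂P = ∫ ω, (FS k ω - S n k ω) ∂P := by
        rw [integral_sub hFSi hSi, hS0, sub_zero]
      have hind : Integrable ((B n).indicator fun _ => (1 : ℝ)) P :=
        (integrable_const 1).indicator (hBm n)
      have h2 : ∀ ω, |FS k ω - S n k ω| ≤ (η / n ^ 2 / 2 + 1 / n ^ 3) * S n k ω ^ 2
          + n ^ 2 / η / 2 * (B n).indicator (fun _ => 1) ω := by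
        intro ω
        by_cases hω : ω ∈ B n
        · rw [hFS]
          dsimp only
          rw [Set.indicator_of_notMem (not_not.2 hω), Set.indicator_of_mem hω, zero_sub, abs_neg]
          have e1 : 0 ≤ 1 / (n : ℝ) ^ 3 * S n k ω ^ 2 := by positivity
          have e2 : |S n k ω| ≤ η / n ^ 2 / 2 * S n k ω ^ 2 + n ^ 2 / η / 2 := by
            rw [← sq_abs (S n k ω)]
            have : η / (n : ℝ) ^ 2 / 2 * |S n k ω| ^ 2 + n ^ 2 / η / 2 - |S n k ω|
                = (η * |S n k ω| - n ^ 2) ^ 2 / (2 * η * n ^ 2) := by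
              field_simp; ring
            have h3 : 0 ≤ (η * |S n k ω| - (n : ℝ) ^ 2) ^ 2 / (2 * η * n ^ 2) := by positivity
            linarith
          linarith
        · rw [hFS]
          dsimp only
          rw [Set.indicator_of_mem (by exact hω), Set.indicator_of_notMem hω]
          refine (abs_clip_sub_le (by positivity) _).trans ?_
          have e1 : 0 ≤ η / (n : ℝ) ^ 2 / 2 * S n k ω ^ 2 := by positivity
          rw [div_eq_mul_one_div, mul_comm]
          linarith
      have hSsq := hS2.integrable_sq
      rw [h1]
      refine (abs_integral_le_integral_abs).trans ((integral_mono (hFSi.sub hSi).abs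
        ((hSsq.const_mul _).fun_add (hind.const_mul _)) h2).trans ?_)
      rw [integral_add (hSsq.const_mul _) (hind.const_mul _), integral_const_mul,
        integral_const_mul, integral_indicator_const _ (hBm n), smul_eq_mul, mul_one]
      have h4 := mul_le_mul_of_nonneg_left hSC
        (show 0 ≤ η / (n : ℝ) ^ 2 / 2 + 1 / n ^ 3 by positivity)
      refine (add_le_add h4 le_rfl).trans (le_of_eq ?_)
      field_simp
      ring
    refine le_of_tendsto_of_tendsto' (b := atTop) (Tendsto.abs ?_)
      tendsto_const_nhds fun k => hk (ms k)
    refine tendsto_integral_of_dominated_convergence (fun _ => (n : ℝ) ^ 3)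
      (fun k => hFSm (ms k)) (integrable_const _) (fun k => Eventually.of_forall (hFSb _)) ?_
    filter_upwards [hlim, hGb] with ω h1 h2
    by_cases hω : ω ∈ (B n)ᶜ
    · have hω' : G ω ≤ n := not_lt.1 hω
      have heq : ∀ k, S n k ω = ∑ i ∈ range (π k).n,
          X ((π k).pt i) ω * (x.2 ((π k).pt (i + 1)) ω - x.2 ((π k).pt i) ω) := fun k =>
        sum_congr rfl fun i hi => by
          rw [clip_of_abs_le ((h2 _ ⟨(π k).le_pt i,
            (π k).pt_le (Finset.mem_range.1 hi).le⟩).trans hω')]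
      simp only [hFS, hF, Set.indicator_of_mem hω, heq]
      exact ((continuous_clip _).tendsto _).comp h1
    · simp only [hFS, hF, Set.indicator_of_notMem hω]
      exact tendsto_const_nhds
  -- the limit
  have hlevel : ∀ ω, ∀ᶠ n : ℕ in atTop, G ω ≤ n ∧ |M ω| ≤ n ∧ 1 ≤ n := fun ω => by
    filter_upwards [eventually_ge_atTop ⌈G ω⌉₊, eventually_ge_atTop ⌈|M ω|⌉₊,
      eventually_ge_atTop 1] with n h1 h2 h3
    exact ⟨(Nat.le_ceil _).trans (by exact_mod_cast h1),
      (Nat.le_ceil _).trans (by exact_mod_cast h2), h3⟩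
  have hFlim : Tendsto (fun n => ∫ ω, F n ω ∂P) atTop (𝓝 (∫ ω, M ω ∂P)) := by
    refine tendsto_integral_of_dominated_convergence (fun ω => |M ω|)
      (fun n => ((continuous_clip _).comp_aestronglyMeasurable hM.1).indicator (hBm n).compl)
      hM.abs (fun n => Eventually.of_forall fun ω => ?_) (Eventually.of_forall fun ω => ?_)
    · by_cases hω : ω ∈ (B n)ᶜ
      · simp only [hF, Set.indicator_of_mem hω]; exact abs_clip_le_abs (by positivity) _
      · simp only [hF, Set.indicator_of_notMem hω, norm_zero]; exact abs_nonneg _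
    · refine tendsto_const_nhds.congr' ?_
      filter_upwards [hlevel ω] with n hn
      have h1 : (1 : ℝ) ≤ n := by exact_mod_cast hn.2.2
      simp only [hF, Set.indicator_of_mem (show ω ∈ (B n)ᶜ from not_lt.2 hn.1)]
      rw [clip_of_abs_le (hn.2.1.trans (by nlinarith [sq_nonneg (n : ℝ)]))]
  have hBlim : Tendsto (fun n : ℕ => (n : ℝ) ^ 2 * P.real (B n)) atTop (𝓝 0) := by
    have h1 : Tendsto (fun n => ∫ ω, (B n).indicator (fun ω => G ω ^ 2) ω ∂P) atTop (𝓝 0) := by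
      have := tendsto_integral_of_dominated_convergence (μ := P)
        (F := fun n => (B n).indicator (fun ω => G ω ^ 2)) (f := fun _ => 0) (fun ω => G ω ^ 2)
        (fun n => hG2.integrable_sq.1.indicator (hBm n)) hG2.integrable_sq
        (fun n => Eventually.of_forall fun ω => by
          refine (norm_indicator_le_norm_self _ _).trans (le_of_eq ?_)
          exact Real.norm_of_nonneg (sq_nonneg _))
        (Eventually.of_forall fun ω => by
          refine tendsto_const_nhds.congr' ?_
          filter_upwards [hlevel ω] with n hn
          rw [Set.indicator_of_notMem (show ω ∉ B n from not_lt.2 hn.1)])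
      simpa using this
    refine squeeze_zero (fun n => by positivity) (fun n => ?_) h1
    have : (n : ℝ) ^ 2 * P.real (B n) = ∫ ω, (B n).indicator (fun _ => (n : ℝ) ^ 2) ω ∂P := by
      rw [integral_indicator_const _ (hBm n), smul_eq_mul, mul_comm]
    rw [this]
    refine integral_mono ((integrable_const _).indicator (hBm n))
      (hG2.integrable_sq.indicator (hBm n)) fun ω => Set.indicator_le_indicator' fun hω => ?_
    exact pow_le_pow_left₀ n.cast_nonneg (le_of_lt hω) 2
  have hη : ∀ η : ℝ, 0 < η → |∫ ω, M ω ∂P| ≤ η * C / 2 := by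
    intro η hη
    have hr : Tendsto (fun n : ℕ => (η * C + (n : ℝ) ^ 2 * P.real (B n) / η) / 2 + C * (1 / n))
        atTop (𝓝 ((η * C + 0 / η) / 2 + C * 0)) :=
      (((hBlim.div_const η).const_add _).div_const 2).add
        (tendsto_one_div_atTop_nhds_zero_nat.const_mul C)
    simp only [zero_div, add_zero, mul_zero] at hr
    refine le_of_tendsto_of_tendsto hFlim.abs hr ?_
    filter_upwards [eventually_ge_atTop 1] with n hn using key η hη n hn
  have hz : |∫ ω, M ω ∂P| ≤ 0 := by
    refine le_of_forall_pos_le_add fun ε hε => ?_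
    refine (hη (ε / (C + 1)) (by positivity)).trans ?_
    rw [zero_add, div_mul_eq_mul_div, div_div, div_le_iff₀ (by positivity)]
    nlinarith
  exact abs_eq_zero.1 (le_antisymm hz (abs_nonneg _))

/-- Summation by parts for the cost along a partition, on a path that is closed at time `T`. -/
lemma IsStatePath.sum_cost {x₀ : Fin 3 → ℝ} {m : ℝ≥0 → Fin 3 → ℝ} {n z : ℝ≥0 → ℝ}
    {x : ℝ≥0 → Fin 3 → ℝ} (h : IsStatePath p e₀ t T x₀ m n z x) (hT : x T 0 = 0)
    (π : TimePartition t T) :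
    (x₀ 1 * z t + ∑ i ∈ range π.n, x (π.pt i) 1 * (z (π.pt (i + 1)) - z (π.pt i)))
      + p.γ₂ / 2 * (z t ^ 2 + ∑ i ∈ range π.n,
        (z (π.pt (i + 1)) - z (π.pt i)) * (z (π.pt (i + 1)) - z (π.pt i)))
    = (p.γ₂ / 2 * x₀ 0 ^ 2 + x₀ 0 * x₀ 1)
      + (∑ i ∈ range π.n, x (π.pt i) 0 * (n (π.pt (i + 1)) - n (π.pt i)))
      - (∑ i ∈ range π.n, (n (π.pt (i + 1)) - n (π.pt i)) * (z (π.pt (i + 1)) - z (π.pt i)))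
      + ∑ i ∈ range π.n, x (π.pt (i + 1)) 0
        * ((fundamental p (x (π.pt (i + 1))) - n (π.pt (i + 1)))
          - (fundamental p (x (π.pt i)) - n (π.pt i))) := by
  have htT := π.le
  have h1 := π.sum_sub fun s => p.γ₂ / 2 * x s 0 ^ 2 - fundamental p (x s) * x s 0
  have ht := h.position t ⟨le_rfl, htT⟩
  have hs := h.fundamental_start
  have h2 : (∑ i ∈ range π.n, x (π.pt i) 1 * (z (π.pt (i + 1)) - z (π.pt i)))
      + p.γ₂ / 2 * (∑ i ∈ range π.n,
        (z (π.pt (i + 1)) - z (π.pt i)) * (z (π.pt (i + 1)) - z (π.pt i)))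
      - ((∑ i ∈ range π.n, x (π.pt i) 0 * (n (π.pt (i + 1)) - n (π.pt i)))
      - (∑ i ∈ range π.n, (n (π.pt (i + 1)) - n (π.pt i)) * (z (π.pt (i + 1)) - z (π.pt i)))
      + ∑ i ∈ range π.n, x (π.pt (i + 1)) 0
        * ((fundamental p (x (π.pt (i + 1))) - n (π.pt (i + 1)))
          - (fundamental p (x (π.pt i)) - n (π.pt i))))
      = ∑ i ∈ range π.n, ((p.γ₂ / 2 * x (π.pt (i + 1)) 0 ^ 2
          - fundamental p (x (π.pt (i + 1))) * x (π.pt (i + 1)) 0)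
        - (p.γ₂ / 2 * x (π.pt i) 0 ^ 2 - fundamental p (x (π.pt i)) * x (π.pt i) 0)) := by
    rw [mul_sum, ← sum_add_distrib, ← sum_sub_distrib,
      ← sum_add_distrib, ← sum_sub_distrib]
    refine sum_congr rfl fun i hi => ?_
    have hi := Finset.mem_range.1 hi
    have e1 := h.position _ ⟨π.le_pt (i + 1), π.pt_le hi⟩
    have e0 := h.position _ ⟨π.le_pt i, π.pt_le hi.le⟩
    have d1 : z (π.pt (i + 1)) = x₀ 0 - x (π.pt (i + 1)) 0 := by rw [e1]; ring
    have d0 : z (π.pt i) = x₀ 0 - x (π.pt i) 0 := by rw [e0]; ring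
    have f0 : x (π.pt i) 1 = fundamental p (x (π.pt i)) - p.γ₂ * x (π.pt i) 0 := by
      unfold fundamental; ring
    rw [d1, d0, f0]
    ring
  rw [h1, hT, hs] at h2
  have hz : z t = x₀ 0 - x t 0 := by rw [ht]; ring
  rw [hz]
  unfold fundamental at h2 ⊢
  linear_combination h2

/-- Running cost and drift, as a random variable. -/
noncomputable def pathCost (P : Measure Ω) (p : Params) (e₀ : ℝ) (𝒳 : ℝ≥0 → Ω → Fin 3 → ℝ)
    (t T : ℝ≥0) (ω : Ω) : ℝ :=
  timeIntegral t T fun s => 𝒳 s ω 0 * driftY p e₀ (𝒳 s ω) (mean P 𝒳 s) + p.lam * 𝒳 s ω 0 ^ 2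

lemma tendsto_sum_drift (h : IsState P 𝓕 W p e₀ σ t T ξ Z 𝒳) {ω : Ω}
    (hω : IsStatePath p e₀ t T (ξ ω) (mean P 𝒳) (fun s => N s ω) (fun s => Z s ω)
      (fun s => 𝒳 s ω)) {π : ℕ → TimePartition t T} (hπ : MeshTendsto π) :
    Tendsto (fun k => ∑ i ∈ range (π k).n, 𝒳 ((π k).pt (i + 1)) ω 0
        * ((fundamental p (𝒳 ((π k).pt (i + 1)) ω) - N ((π k).pt (i + 1)) ω)
          - (fundamental p (𝒳 ((π k).pt i) ω) - N ((π k).pt i) ω))) atTop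
      (𝓝 (timeIntegral t T fun s => 𝒳 s ω 0 * driftY p e₀ (𝒳 s ω) (mean P 𝒳 s))) := by
  obtain ⟨K, hK⟩ := (h.cadlag ω 0).exists_bound
  have := tendsto_sum_right hπ hω.fundamental_primitive (f := fun r => 𝒳 r.toNNReal ω 0) (K := K)
    (fun r hr => hK _ (toNNReal_mem_Icc hr)) (fun r hr => by
      refine ((h.cadlag ω 0).1 _ (toNNReal_mem_Ico hr)).comp
        continuous_real_toNNReal.continuousWithinAt fun s hs => ?_
      exact Real.toNNReal_le_toNNReal hs)
  simp only [Real.toNNReal_coe] at this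
  exact this

lemma _root_.MeasureTheory.IsStronglyProgressive.stronglyMeasurable_onProd {U : ℝ≥0 → Ω → ℝ}
    (hU : IsStronglyProgressive 𝓕 U) : StronglyMeasurable (onProd U) := by
  refine stronglyMeasurable_of_tendsto atTop
    (f := fun (n : ℕ) (q : ℝ × Ω) => U (min q.1.toNNReal n) q.2) (fun n => ?_) ?_
  · have hm : Measurable fun q : ℝ × Ω =>
        ((⟨min q.1.toNNReal n, Set.mem_Iic.2 (min_le_right _ _)⟩, q.2) : Iic (n : ℝ≥0) × Ω) :=
      ((((measurable_real_toNNReal.comp measurable_fst).min measurable_const)).subtype_mk).prodMk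
        measurable_snd
    have hid : @Measurable _ _ _ (Subtype.instMeasurableSpace.prod (𝓕 n))
        (id : Iic (n : ℝ≥0) × Ω → Iic (n : ℝ≥0) × Ω) := by
      refine Measurable.of_le_map ?_
      rw [MeasurableSpace.map_id]
      exact sup_le_sup le_rfl (MeasurableSpace.comap_mono (𝓕.le n))
    exact (hU n).comp_measurable (hid.comp hm)
  · rw [tendsto_pi_nhds]
    intro q
    refine tendsto_const_nhds.congr' ?_
    filter_upwards [eventually_ge_atTop ⌈q.1.toNNReal⌉₊] with n hn
    rw [min_eq_left ((Nat.le_ceil _).trans (by exact_mod_cast hn))]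
    rfl

namespace IsControlledState

variable (h : IsControlledState P 𝓕 W p e₀ σ t T ξ N 𝒳)
include h

lemma integral_pathCost (htT : t ≤ T) : Integrable (pathCost P p e₀ 𝒳 t T) P ∧
    ∫ ω, pathCost P p e₀ 𝒳 t T ω ∂P = timeIntegral t T (runningCost P p e₀ 𝒳) := by
  have h1 := (h.dom 0).integrable_onProd_mul h.fund.drift_dom
  have h2 := ((h.dom 0).integrable_onProd_mul (h.dom 0)).const_mul p.lam
  have h3 := integral_timeIntegral htT (U := fun s ω =>
    𝒳 s ω 0 * driftY p e₀ (𝒳 s ω) (mean P 𝒳 s) + p.lam * 𝒳 s ω 0 ^ 2)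
    ((h1.add h2).congr (Eventually.of_forall fun q => by simp only [onProd, Pi.add_apply]; ring))
  refine ⟨h3.2.1, h3.2.2.2.trans ?_⟩
  rfl

lemma pathCost_eq (htT : t ≤ T) : ∀ᵐ ω ∂P, pathCost P p e₀ 𝒳 t T ω
    = (timeIntegral t T fun s => 𝒳 s ω 0 * driftY p e₀ (𝒳 s ω) (mean P 𝒳 s))
      + timeIntegral t T fun s => p.lam * 𝒳 s ω 0 ^ 2 := by
  have h1 := integral_timeIntegral htT ((h.dom 0).integrable_onProd_mul h.fund.drift_dom)
  have h2 := integral_timeIntegral htT (U := fun s ω => p.lam * 𝒳 s ω 0 ^ 2)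
    ((((h.dom 0).integrable_onProd_mul (h.dom 0)).const_mul p.lam).congr
      (Eventually.of_forall fun q => by simp only [onProd]; ring))
  filter_upwards [h1.1, h2.1] with ω e1 e2
  exact intervalIntegral.integral_add e1 e2

/-- The expected cost of a strategy that closes the position. -/
lemma cost_eq (hW : IsBrownianBasis P 𝓕 W) (htT : t ≤ T) (hσ : IsStronglyProgressive 𝓕 σ)
    (hξ2 : ∀ i, MemLp (fun ω => ξ ω i) 2 P) (hst : IsState P 𝓕 W p e₀ σ t T ξ Z 𝒳)
    (hpath : HasStatePaths P p e₀ t T ξ N Z 𝒳)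
    (hZa : ∀ s ≤ T, StronglyMeasurable[𝓕 s] (Z s)) (hZc : ∀ ω, IsCadlagOn (fun s => Z s ω) t T)
    (hT : ∀ᵐ ω ∂P, 𝒳 T ω 0 = 0) {c : ℝ} (hc : IsCost P W p σ t T ξ Z 𝒳 c) :
    c = (∫ ω, (p.γ₂ / 2 * ξ ω 0 ^ 2 + ξ ω 0 * ξ ω 1) ∂P)
      + timeIntegral t T (runningCost P p e₀ 𝒳) := by
  obtain ⟨I, Q, R, hI, hQ, hR, hint, rfl⟩ := hc
  have hπ := meshTendsto_uniform htT
  have hσm := hσ.stronglyMeasurable_onProd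
  have tI := ConvergesAlongPartitions.tendstoAESubseq hI hπ
  have tQ := hQ.tendstoAESubseq hπ
  have tR := hR.tendstoAESubseq hW hQ hZa hZc h.fund.ito hσm hπ
  have tD : TendstoAESubseq P (fun k ω => ∑ i ∈ range (TimePartition.uniform t T htT k).n,
      𝒳 ((TimePartition.uniform t T htT k).pt (i + 1)) ω 0
        * ((fundamental p (𝒳 ((TimePartition.uniform t T htT k).pt (i + 1)) ω)
            - N ((TimePartition.uniform t T htT k).pt (i + 1)) ω)
          - (fundamental p (𝒳 ((TimePartition.uniform t T htT k).pt i) ω)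
            - N ((TimePartition.uniform t T htT k).pt i) ω)))
      (fun ω => timeIntegral t T fun s => 𝒳 s ω 0 * driftY p e₀ (𝒳 s ω) (mean P 𝒳 s)) :=
    .of_ae (by filter_upwards [hpath] with ω hω using tendsto_sum_drift hst hω hπ)
  have hK0 : Integrable (fun ω => p.γ₂ / 2 * ξ ω 0 ^ 2 + ξ ω 0 * ξ ω 1) P :=
    ((hξ2 0).integrable_sq.const_mul _).add ((hξ2 0).integrable_mul_two (hξ2 1))
  obtain ⟨hC1, hC2⟩ := h.integral_pathCost htT
  set M : Ω → ℝ := fun ω => (I ω + p.γ₂ / 2 * Q ω + R ω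
      + timeIntegral t T (fun s => p.lam * (𝒳 s ω 0) ^ 2))
    - (p.γ₂ / 2 * ξ ω 0 ^ 2 + ξ ω 0 * ξ ω 1) - pathCost P p e₀ 𝒳 t T ω with hM
  have hMi : Integrable M P := (hint.sub hK0).sub hC1
  have hM0 : ∫ ω, M ω ∂P = 0 := by
    refine (h.dom 0).integral_limit_eq_zero hW h.fund.ito
      (π := fun k => TimePartition.uniform t T htT k) ?_ hMi
    refine (((tI.add (tQ.mul_left fun _ => p.γ₂ / 2)).add tR).sub tD).map ?_
    filter_upwards [hpath, hT, h.pathCost_eq htT] with ω h1 h2 h3 ns _ h4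
    have h5 := h4.add_const (p.γ₂ / 2 * Z t ω ^ 2 - (p.γ₂ / 2 * ξ ω 0 ^ 2 + ξ ω 0 * ξ ω 1))
    convert h5 using 1
    · funext k
      have := h1.sum_cost h2 (TimePartition.uniform t T htT (ns k))
      simp only [covSum]
      linear_combination -this
    · congr 1
      simp only [hM, h3]
      ring
  have hsplit : ∀ ω, I ω + p.γ₂ / 2 * Q ω + R ω
      + timeIntegral t T (fun s => p.lam * (𝒳 s ω 0) ^ 2)
      = M ω + ((p.γ₂ / 2 * ξ ω 0 ^ 2 + ξ ω 0 * ξ ω 1) + pathCost P p e₀ 𝒳 t T ω) := fun ω => by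
    simp only [hM]; ring
  simp only [hsplit]
  rw [integral_add hMi (hK0.fun_add hC1), hM0, integral_add hK0 hC1, hC2, zero_add]

end IsControlledState

variable {κ : Fin 5 → ℝ → ℝ} {v : ℝ≥0 → Ω → ℝ}

/-! ### The drift of the candidate -/

/-- `f` is continuously differentiable on `[0, T]` with derivative `f'`. -/
structure IsC1On (f f' : ℝ → ℝ) (T : ℝ) : Prop where
  deriv : ∀ s ∈ Icc 0 T, HasDerivWithinAt f (f' s) (Icc 0 T) s
  cont : ContinuousOn f' (Icc 0 T)

namespace IsC1On

variable {f f' g g' : ℝ → ℝ} {T : ℝ}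

lemma continuousOn (h : IsC1On f f' T) : ContinuousOn f (Icc 0 T) :=
  fun s hs => (h.deriv s hs).continuousWithinAt

lemma hasDerivAt (h : IsC1On f f' T) {s : ℝ} (hs : s ∈ Ioo 0 T) : HasDerivAt f (f' s) s :=
  (h.deriv s ⟨hs.1.le, hs.2.le⟩).hasDerivAt (Icc_mem_nhds hs.1 hs.2)

lemma isPrimitiveOn (h : IsC1On f f' T) (hT : 0 ≤ T) : IsPrimitiveOn f f' 0 T :=
  .of_hasDerivWithinAt hT h.deriv h.cont

lemma const (c : ℝ) : IsC1On (fun _ => c) (fun _ => 0) T :=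
  ⟨fun s _ => hasDerivWithinAt_const s _ c, continuousOn_const⟩

lemma const_mul (h : IsC1On f f' T) (c : ℝ) : IsC1On (fun s => c * f s) (fun s => c * f' s) T :=
  ⟨fun s hs => (h.deriv s hs).const_mul c, h.cont.const_mul c⟩

lemma add (h : IsC1On f f' T) (k : IsC1On g g' T) :
    IsC1On (fun s => f s + g s) (fun s => f' s + g' s) T :=
  ⟨fun s hs => (h.deriv s hs).add (k.deriv s hs), h.cont.add k.cont⟩

end IsC1On

/-- The derivatives of `IA₁, IA₂, IB₁, IB₂, ID` (with components counted from `0`). -/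
structure FeedbackRates (p : Params) (e₀ : ℝ) (A B : ℝ → Matrix (Fin 3) (Fin 3) ℝ)
    (D : ℝ → Fin 3 → ℝ) (T : ℝ) (κ : Fin 5 → ℝ → ℝ) : Prop where
  a₁ : IsC1On (fun s => IA p A s 1) (κ 0) T
  a₂ : IsC1On (fun s => IA p A s 2) (κ 1) T
  b₁ : IsC1On (fun s => IB p B s 1) (κ 2) T
  b₂ : IsC1On (fun s => IB p B s 2) (κ 3) T
  d : IsC1On (ID p e₀ D) (κ 4) T

lemma exists_feedbackRates (hA : SolvesA p T A) (hB : SolvesB p T B) (hD : SolvesD p e₀ T B D) :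
    ∃ κ, FeedbackRates p e₀ A B D T κ := by
  have a0 : ContinuousOn (fun r => A r 0 0) (Icc 0 (T : ℝ)) := fun s hs =>
    (hA.ode₁₁ s hs).continuousWithinAt
  have a1 : ContinuousOn (fun r => A r 0 2) (Icc 0 (T : ℝ)) := fun s hs =>
    (hA.ode₁₃ s hs).continuousWithinAt
  have b0 : ContinuousOn (fun r => B r 0 0) (Icc 0 (T : ℝ)) := fun s hs =>
    (hB.ode₁₁ s hs).continuousWithinAt
  have b1 : ContinuousOn (fun r => B r 0 2) (Icc 0 (T : ℝ)) := fun s hs =>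
    (hB.ode₁₃ s hs).continuousWithinAt
  have b2 : ContinuousOn (fun r => B r 2 2) (Icc 0 (T : ℝ)) := fun s hs =>
    (hB.ode₃₃ s hs).continuousWithinAt
  have d0 : ContinuousOn (fun r => D r 0) (Icc 0 (T : ℝ)) := fun s hs =>
    (hD.ode₁ s hs).continuousWithinAt
  have d2 : ContinuousOn (fun r => D r 2) (Icc 0 (T : ℝ)) := fun s hs =>
    (hD.ode₃ s hs).continuousWithinAt
  have A0 : IsC1On (fun r => A r 0 0) _ T := ⟨hA.ode₁₁, by fun_prop⟩
  have A1 : IsC1On (fun r => A r 0 2) _ T := ⟨hA.ode₁₃, by fun_prop⟩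
  have B0 : IsC1On (fun r => B r 0 0) _ T := ⟨hB.ode₁₁, by fun_prop⟩
  have B1 : IsC1On (fun r => B r 0 2) _ T := ⟨hB.ode₁₃, by fun_prop⟩
  have B2 : IsC1On (fun r => B r 2 2) _ T := ⟨hB.ode₃₃, by fun_prop⟩
  have D0 : IsC1On (fun r => D r 0) _ T := ⟨hD.ode₁, by fun_prop⟩
  have D2 : IsC1On (fun r => D r 2) _ T := ⟨hD.ode₃, by fun_prop⟩
  have c1 : ∃ k, IsC1On (fun s => IA p A s 1) k T := ⟨_, by
    convert (A0.const_mul (-(p.ρ / p.γ₂))).add (.const p.ρ) using 1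
    ext s; simp [IA]; ring⟩
  have c2 : ∃ k, IsC1On (fun s => IA p A s 2) k T := ⟨_, by
    convert (A1.const_mul (-p.ρ)).add (.const (p.γ₁ * (p.β - p.α) / 2)) using 1
    ext s; simp [IA]; ring⟩
  have c3 : ∃ k, IsC1On (fun s => IB p B s 1) k T := ⟨_, by
    convert ((B0.const_mul ((p.α * p.γ₁ - p.γ₂ * p.ρ) / p.γ₂ ^ 2)).add
      (B1.const_mul (p.α / p.γ₂))).add (.const (p.ρ - p.α * p.γ₁ / (2 * p.γ₂))) using 1
    ext s; simp [IB]; ring⟩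
  have c4 : ∃ k, IsC1On (fun s => IB p B s 2) k T := ⟨_, by
    convert ((B1.const_mul ((p.γ₁ * p.α - p.γ₂ * p.ρ) / p.γ₂)).add (B2.const_mul p.α)).add
      (.const (p.γ₁ * (p.β - p.α) / 2)) using 1
    ext s; simp [IB]; ring⟩
  have c5 : ∃ k, IsC1On (ID p e₀ D) k T := ⟨_, by
    convert ((D0.const_mul ((p.γ₁ * p.α - p.γ₂ * p.ρ) / (2 * p.γ₂))).add
      (D2.const_mul (p.α / 2))).add (.const (-(p.α * p.γ₁ / 2 * e₀))) using 1
    ext s; simp [ID]; ring⟩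
  obtain ⟨k1, c1⟩ := c1
  obtain ⟨k2, c2⟩ := c2
  obtain ⟨k3, c3⟩ := c3
  obtain ⟨k4, c4⟩ := c4
  obtain ⟨k5, c5⟩ := c5
  exact ⟨![k1, k2, k3, k4, k5], c1, c2, c3, c4, c5⟩

/-- The quantities on which the drift of the candidate depends linearly. -/
noncomputable def feedbackVec (p : Params) (x m : Fin 3 → ℝ) : Fin 7 → ℝ :=
  ![x 0, fundamental p x, x 2, 1, m 0, fundamental p m, m 2]

/-- The coefficients of the drift of the candidate. -/
noncomputable def feedbackCoef (p : Params) (e₀ : ℝ) (A B : ℝ → Matrix (Fin 3) (Fin 3) ℝ)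
    (κ : Fin 5 → ℝ → ℝ) : Fin 7 → ℝ → ℝ :=
  ![fun s => -(p.ρ * p.γ₂ / p.aTilde) * IA p A s 1,
    fun s => -(1 / p.aTilde) * (κ 0 s - p.ρ * IA p A s 1),
    fun s => -(1 / p.aTilde)
      * (κ 1 s - p.γ₁ * (p.β - p.α) * IA p A s 1 - (p.β - p.α) * IA p A s 2),
    fun s => -(1 / p.a) * (κ 4 s + p.α * p.γ₁ * e₀ * IB p B s 1 + p.α * e₀ * IB p B s 2),
    fun s => p.ρ * p.γ₂ / p.aTilde * IA p A s 1
      - 1 / p.a * ((p.ρ * p.γ₂ - p.α * p.γ₁) * IB p B s 1 - p.α * IB p B s 2),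
    fun s => 1 / p.aTilde * (κ 0 s - p.ρ * IA p A s 1) - 1 / p.a * (κ 2 s - p.ρ * IB p B s 1),
    fun s => 1 / p.aTilde
        * (κ 1 s - p.γ₁ * (p.β - p.α) * IA p A s 1 - (p.β - p.α) * IA p A s 2)
      - 1 / p.a * (κ 3 s - p.γ₁ * (p.β - p.α) * IB p B s 1 - (p.β - p.α) * IB p B s 2)]

/-- The drift of the candidate in terms of the derivatives of the feedback functions. -/
noncomputable def feedbackRate (p : Params) (e₀ : ℝ) (A B : ℝ → Matrix (Fin 3) (Fin 3) ℝ)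
    (κ : Fin 5 → ℝ → ℝ) (s : ℝ) (x m : Fin 3 → ℝ) : ℝ :=
  ∑ j, feedbackCoef p e₀ A B κ j s * feedbackVec p x m j

lemma feedbackRate_eq (s : ℝ) (x m : Fin 3 → ℝ) : feedbackRate p e₀ A B κ s x m
    = -(1 / p.aTilde) * (κ 0 s * (fundamental p x - fundamental p m) + κ 1 s * (x 2 - m 2)
        + IA p A s 1 * (driftY p e₀ x m - driftY p e₀ m m)
        + IA p A s 2 * (driftC p e₀ x m - driftC p e₀ m m))
      - 1 / p.a * (κ 2 s * fundamental p m + κ 3 s * m 2 + κ 4 s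
        + IB p B s 1 * driftY p e₀ m m + IB p B s 2 * driftC p e₀ m m) := by
  unfold feedbackRate feedbackVec feedbackCoef
  simp only [Fin.sum_univ_succ, Fin.isValue, Matrix.cons_val_zero, Matrix.cons_val_succ,
    Finset.univ_unique, Fin.default_eq_zero, Finset.sum_singleton]
  unfold driftY driftC fundamental
  ring

lemma candidateDrift_eq (hp : p.Standing) (hκ : FeedbackRates p e₀ A B D T κ) {s : ℝ}
    (hs : s ∈ Ioo 0 (T : ℝ)) (x m : Fin 3 → ℝ) :
    candidateDrift p e₀ A B D s x m = feedbackRate p e₀ A B κ s x m := by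
  have hA0 : ∀ s, IA p A s 0 = -p.aTilde + p.γ₂ * IA p A s 1 := fun s => by
    have := IA_dotProduct hp (A := A) s ![1, 0, 0]
    simp [dotProduct, Fin.sum_univ_three, fundamental] at this
    linarith
  have hB0 : ∀ s, IB p B s 0 = -p.a + p.γ₂ * IB p B s 1 := fun s => by
    have := IB_dotProduct hp (B := B) s ![1, 0, 0]
    simp [dotProduct, Fin.sum_univ_three, fundamental] at this
    linarith
  have dA : deriv (IA p A) s = ![p.γ₂ * κ 0 s, κ 0 s, κ 1 s] := by
    refine HasDerivAt.deriv (hasDerivAt_pi.2 fun i => ?_)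
    fin_cases i
    · have : (fun s => IA p A s 0) = fun s => -p.aTilde + p.γ₂ * IA p A s 1 := funext hA0
      simp only [Fin.zero_eta, this]
      exact ((hκ.a₁.hasDerivAt hs).const_mul p.γ₂).const_add _
    · exact hκ.a₁.hasDerivAt hs
    · exact hκ.a₂.hasDerivAt hs
  have dB : deriv (IB p B) s = ![p.γ₂ * κ 2 s, κ 2 s, κ 3 s] := by
    refine HasDerivAt.deriv (hasDerivAt_pi.2 fun i => ?_)
    fin_cases i
    · have : (fun s => IB p B s 0) = fun s => -p.a + p.γ₂ * IB p B s 1 := funext hB0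
      simp only [Fin.zero_eta, this]
      exact ((hκ.b₁.hasDerivAt hs).const_mul p.γ₂).const_add _
    · exact hκ.b₁.hasDerivAt hs
    · exact hκ.b₂.hasDerivAt hs
  rw [feedbackRate_eq, candidateDrift, dA, dB, (hκ.d.hasDerivAt hs).deriv]
  simp only [dotProduct, Fin.sum_univ_three, hA0, hB0, fundamental, driftY, driftC]
  simp [Matrix.mulVec, dotProduct, Fin.sum_univ_three, Params.H, Params.Hbar, Params.G]
  ring

lemma FeedbackRates.continuousOn_coef (hκ : FeedbackRates p e₀ A B D T κ) (j : Fin 7) :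
    ContinuousOn (feedbackCoef p e₀ A B κ j) (Icc 0 T) := by
  have h1 := hκ.a₁.continuousOn
  have h2 := hκ.a₂.continuousOn
  have h3 := hκ.b₁.continuousOn
  have h4 := hκ.b₂.continuousOn
  have k1 := hκ.a₁.cont
  have k2 := hκ.a₂.cont
  have k3 := hκ.b₁.cont
  have k4 := hκ.b₂.cont
  have k5 := hκ.d.cont
  fin_cases j <;> dsimp [feedbackCoef] <;> fun_prop

/-- Linear growth of the drift of the candidate. -/
lemma FeedbackRates.exists_bound (hκ : FeedbackRates p e₀ A B D T κ) : ∃ L, 0 ≤ L ∧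
    ∀ s ∈ Icc 0 (T : ℝ), ∀ x m : Fin 3 → ℝ, |feedbackRate p e₀ A B κ s x m|
      ≤ L * (|x 0| + |fundamental p x| + |x 2|)
        + L * (1 + |m 0| + |fundamental p m| + |m 2|) := by
  choose K hK using fun j => isCompact_Icc.exists_bound_of_continuousOn (hκ.continuousOn_coef j)
  refine ⟨∑ j, |K j|, sum_nonneg fun j _ => abs_nonneg _, fun s hs x m => ?_⟩
  calc |feedbackRate p e₀ A B κ s x m|
      ≤ ∑ j, |feedbackCoef p e₀ A B κ j s * feedbackVec p x m j| := abs_sum_le_sum_abs _ _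
    _ ≤ ∑ j, (∑ i, |K i|) * |feedbackVec p x m j| := by
        refine sum_le_sum fun j _ => ?_
        rw [abs_mul]
        refine mul_le_mul_of_nonneg_right (((hK j s hs).trans (le_abs_self _)).trans ?_)
          (abs_nonneg _)
        exact Finset.single_le_sum (f := fun i => |K i|) (fun i _ => abs_nonneg _)
          (Finset.mem_univ j)
    _ = _ := by
        rw [← mul_sum]
        unfold feedbackVec
        simp only [Fin.sum_univ_succ, Fin.isValue, Matrix.cons_val_zero, Matrix.cons_val_succ,
          Finset.univ_unique, Fin.default_eq_zero, Finset.sum_singleton, abs_one]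
        ring

/-! ### The state driven by the candidate -/

lemma intervalIntegrable_of_mem_Icc {f : ℝ → ℝ} {a b c d : ℝ}
    (h : IntervalIntegrable f volume a b) (hc : c ∈ Icc a b) (hd : d ∈ Icc a b) :
    IntervalIntegrable f volume c d :=
  h.mono_set (Set.uIcc_subset_uIcc (Set.Icc_subset_uIcc hc) (Set.Icc_subset_uIcc hd))

lemma IsItoPair.ae_forall_eq_mul_sub_integral (hW : IsBrownianBasis P 𝓕 W)
    {h N N' : ℝ≥0 → Ω → ℝ} (hx : IsItoPair P 𝓕 W T (h, N)) {g g' : ℝ → ℝ}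
    (hg : IsC1On g g' T) (hy : IsItoPair P 𝓕 W T (fun s ω => g s * h s ω, N'))
    (hNc : ∀ᵐ ω ∂P, ContinuousOn (fun s => N s ω) (Icc 0 T))
    (hNc' : ∀ᵐ ω ∂P, ContinuousOn (fun s => N' s ω) (Icc 0 T)) :
    ∀ᵐ ω ∂P, ∀ s ≤ T, N' s ω = g s * N s ω - ∫ r in (0 : ℝ)..s, N r.toNNReal ω * g' r := by
  obtain ⟨D, hD, hDd⟩ := TopologicalSpace.exists_countable_dense (Icc (0 : ℝ≥0) T)
  have h1 : ∀ᵐ ω ∂P, ∀ d ∈ D, N' d.1 ω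
      = g d.1 * N d.1 ω - ∫ r in (0 : ℝ)..d.1, N r.toNNReal ω * g' r := by
    rw [ae_ball_iff hD]
    exact fun d _ => hx.ae_eq_mul_sub_integral hW (hg.isPrimitiveOn T.coe_nonneg) hy hNc d.2.2
  have hm : Set.MapsTo ((↑) : ℝ≥0 → ℝ) (Icc 0 T) (Icc (0 : ℝ) T) :=
    fun s hs => ⟨s.coe_nonneg, by exact_mod_cast hs.2⟩
  filter_upwards [h1, hNc, hNc'] with ω h2 h3 h4 s hs
  have h3' : ContinuousOn (fun r : ℝ => N r.toNNReal ω) (Icc (0 : ℝ) T) :=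
    continuousOn_comp_toNNReal h3
  have h6 : ContinuousOn (fun u : ℝ => ∫ r in (0 : ℝ)..u, N r.toNNReal ω * g' r)
      (Icc (0 : ℝ) T) := by
    have := (IsPrimitiveOn.of_intervalIntegrable ((h3'.mul hg.cont).intervalIntegrable_of_Icc
      T.coe_nonneg) 0).continuousOn
    simpa using this
  have h7 : ContinuousOn (fun s : ℝ≥0 => g s * N s ω
      - ∫ r in (0 : ℝ)..s, N r.toNNReal ω * g' r) (Icc 0 T) :=
    ((hg.continuousOn.comp NNReal.continuous_coe.continuousOn hm).mul h3).sub
      (h6.comp NNReal.continuous_coe.continuousOn hm)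
  have h5 := Continuous.ext_on hDd (continuousOn_iff_continuous_domRestrict.1 h4)
    (continuousOn_iff_continuous_domRestrict.1 h7) (fun d hd => h2 d hd)
  exact congrFun h5 ⟨s, zero_le, hs⟩

/-- The drift of the part of finite variation of the position under the candidate. -/
noncomputable def coreRate (p : Params) (e₀ : ℝ) (A B : ℝ → Matrix (Fin 3) (Fin 3) ℝ)
    (κ : Fin 5 → ℝ → ℝ) (m : ℝ≥0 → Fin 3 → ℝ) (n : ℝ≥0 → ℝ) (x : ℝ≥0 → Fin 3 → ℝ) (r : ℝ) : ℝ :=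
  -(feedbackRate p e₀ A B κ r (x r.toNNReal) (m r.toNNReal) + κ 0 r / p.aTilde * n r.toNNReal)

/-- A path of the position under the candidate: before `T` it is the sum of a function `v` of
finite variation and of the martingale part `n` multiplied with the gain `IA₂ / ã`. -/
structure IsFeedbackPath (p : Params) (e₀ : ℝ) (A B : ℝ → Matrix (Fin 3) (Fin 3) ℝ)
    (κ : Fin 5 → ℝ → ℝ) (t T : ℝ≥0) (m : ℝ≥0 → Fin 3 → ℝ) (n v : ℝ≥0 → ℝ)
    (x : ℝ≥0 → Fin 3 → ℝ) : Prop where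
  cont : ContinuousOn n (Icc 0 T)
  core : IsPrimitiveOn (fun r : ℝ => v r.toNNReal) (coreRate p e₀ A B κ m n x) t T
  eq : ∀ s ∈ Ico t T, x s 0 = v s + IA p A s 1 / p.aTilde * n s
  terminal : x T 0 = 0

/-- Almost every path of `𝒳` is in feedback form. -/
abbrev HasFeedbackPaths (P : Measure Ω) (p : Params) (e₀ : ℝ)
    (A B : ℝ → Matrix (Fin 3) (Fin 3) ℝ) (κ : Fin 5 → ℝ → ℝ) (t T : ℝ≥0) (N v : ℝ≥0 → Ω → ℝ)
    (𝒳 : ℝ≥0 → Ω → Fin 3 → ℝ) : Prop :=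
  ∀ᵐ ω ∂P, IsFeedbackPath p e₀ A B κ t T (mean P 𝒳) (fun s => N s ω) (fun s => v s ω)
    (fun s => 𝒳 s ω)

lemma FeedbackRates.isC1On_gain (hκ : FeedbackRates p e₀ A B D T κ) :
    IsC1On (fun s => IA p A s 1 / p.aTilde) (fun s => κ 0 s / p.aTilde) T := by
  simpa only [div_eq_inv_mul] using hκ.a₁.const_mul p.aTilde⁻¹

lemma MemLp.onProd_continuous_mul {g : ℝ → ℝ} (hg : ContinuousOn g (Icc 0 (T : ℝ)))
    (hσ2 : MemLp (onProd σ) 2 (prodMeasure P T)) :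
    MemLp (onProd fun s ω => g s * σ s ω) 2 (prodMeasure P T) := by
  obtain ⟨K, hK⟩ := isCompact_Icc.exists_bound_of_continuousOn hg
  have hsub : Ioc (0 : ℝ) T ⊆ Icc 0 T := Set.Ioc_subset_Icc_self
  have hpos : ∀ᵐ q ∂(prodMeasure P T), q.1 ∈ Ioc (0 : ℝ) T :=
    Measure.quasiMeasurePreserving_fst.ae (ae_restrict_mem measurableSet_Ioc)
  have hm : AEStronglyMeasurable (fun q : ℝ × Ω => g q.1) (prodMeasure P T) :=
    ((hg.mono hsub).aestronglyMeasurable measurableSet_Ioc).comp_quasiMeasurePreserving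
      Measure.quasiMeasurePreserving_fst
  have he : onProd (fun s ω => g s * σ s ω) =ᵐ[prodMeasure P T] fun q => g q.1 * onProd σ q := by
    filter_upwards [hpos] with q hq
    simp only [onProd, Real.coe_toNNReal _ hq.1.le]
  refine MemLp.of_le_mul (c := K) hσ2 ((hm.mul hσ2.aestronglyMeasurable).congr he.symm) ?_
  filter_upwards [hpos, he] with q hq h
  rw [h, norm_mul]
  exact mul_le_mul_of_nonneg_right (hK _ (hsub hq)) (norm_nonneg _)

lemma FeedbackRates.intervalIntegrable_feedbackRate (htT : t ≤ T)
    (hκ : FeedbackRates p e₀ A B D T κ) {x m : ℝ≥0 → Fin 3 → ℝ}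
    (hx : ∀ i, IntervalIntegrable (fun r : ℝ => x r.toNNReal i) volume t T)
    (hm : ∀ i, IntervalIntegrable (fun r : ℝ => m r.toNNReal i) volume t T) :
    IntervalIntegrable (fun r : ℝ => feedbackRate p e₀ A B κ r (x r.toNNReal) (m r.toNNReal))
      volume t T := by
  have hle : (t : ℝ) ≤ T := by exact_mod_cast htT
  have hf : ∀ y : ℝ≥0 → Fin 3 → ℝ,
      (∀ i, IntervalIntegrable (fun r : ℝ => y r.toNNReal i) volume t T) →
      IntervalIntegrable (fun r : ℝ => fundamental p (y r.toNNReal)) volume t T :=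
    fun y hy => (hy 1).add ((hy 0).const_mul p.γ₂)
  have h7 : ∀ j, IntervalIntegrable
      (fun r : ℝ => feedbackVec p (x r.toNNReal) (m r.toNNReal) j) volume t T := by
    intro j
    fin_cases j
    exacts [hx 0, hf x hx, hx 2, intervalIntegrable_const, hm 0, hf m hm, hm 2]
  have h8 : IntervalIntegrable (∑ j, fun r : ℝ => feedbackCoef p e₀ A B κ j r
      * feedbackVec p (x r.toNNReal) (m r.toNNReal) j) volume t T := by
    refine IntervalIntegrable.sum _ fun j _ => (h7 j).continuousOn_mul ?_
    rw [Set.uIcc_of_le hle]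
    exact (hκ.continuousOn_coef j).mono (Set.Icc_subset_Icc_left t.coe_nonneg)
  convert h8 using 1
  ext r
  rw [Finset.sum_apply, feedbackRate]

lemma IsCandidate.exists_isFeedbackPath (hp : p.Standing) (hW : IsBrownianBasis P 𝓕 W)
    (htT : t < T) (hσ2 : MemLp (onProd σ) 2 (prodMeasure P T))
    (hκ : FeedbackRates p e₀ A B D T κ) (hZ : IsCandidate P 𝓕 W p e₀ σ A B D t T ξ Z 𝒳)
    (hN : IsItoIntegral P 𝓕 W T σ N) (hpath : HasStatePaths P p e₀ t T ξ N Z 𝒳) :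
    ∃ v : ℝ≥0 → Ω → ℝ, HasFeedbackPaths P p e₀ A B κ t T N v 𝒳 := by
  have hle : (t : ℝ) ≤ T := by exact_mod_cast htT.le
  have hg := hκ.isC1On_gain
  have hσg := MemLp.onProd_continuous_mul hg.continuousOn hσ2
  obtain ⟨N', hN', hdyn⟩ := hZ.dynamics
  have hfun : (fun (s : ℝ≥0) ω => (IA p A s ⬝ᵥ diffusion σ s ω) / p.aTilde)
      = fun (s : ℝ≥0) ω => IA p A s 1 / p.aTilde * σ s ω := by
    funext s ω
    simp [dotProduct, Fin.sum_univ_three, diffusion]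
    ring
  rw [hfun] at hN'
  have hparts := (hN.isItoPair hσ2).ae_forall_eq_mul_sub_integral hW hg (hN'.isItoPair hσg)
    hN.cont hN'.cont
  refine ⟨fun s ω => (𝒳 t ω 0 - IA p A t 1 / p.aTilde * N t ω)
    + ∫ r in (t : ℝ)..s, coreRate p e₀ A B κ (mean P 𝒳) (fun s => N s ω) (fun s => 𝒳 s ω) r, ?_⟩
  filter_upwards [hparts, hdyn, hpath, hN.cont, hZ.terminal_jump] with ω h1 h2 h3 h4 h5
  have hrate := hκ.intervalIntegrable_feedbackRate htT.le (x := fun s => 𝒳 s ω) (m := mean P 𝒳)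
    (fun i => (hZ.state.cadlag ω i).intervalIntegrable htT.le) hZ.state.integrable_mean
  have hnc : ContinuousOn (fun r : ℝ => N r.toNNReal ω) (Icc (0 : ℝ) T) :=
    continuousOn_comp_toNNReal h4
  have hng0 : IntervalIntegrable (fun r : ℝ => κ 0 r / p.aTilde * N r.toNNReal ω) volume 0 T :=
    (hg.cont.mul hnc).intervalIntegrable_of_Icc T.coe_nonneg
  have hng := intervalIntegrable_of_mem_Icc hng0 ⟨t.coe_nonneg, hle⟩
    ⟨T.coe_nonneg, le_rfl⟩
  refine ⟨h4, ?_, fun s hs => ?_, ?_⟩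
  · refine (IsPrimitiveOn.of_intervalIntegrable (u' := coreRate p e₀ A B κ (mean P 𝒳)
      (fun s => N s ω) (fun s => 𝒳 s ω)) (hrate.add hng).neg
      (𝒳 t ω 0 - IA p A t 1 / p.aTilde * N t ω)).congr hle (fun s hs => ?_) fun _ _ => rfl
    rw [Real.coe_toNNReal _ (t.coe_nonneg.trans hs.1)]
  · have hsT : (s : ℝ) ∈ Icc (t : ℝ) T :=
      ⟨by exact_mod_cast hs.1, by exact_mod_cast hs.2.le⟩
    have htt : (t : ℝ) ∈ Icc (t : ℝ) T := ⟨le_rfl, hle⟩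
    have e1 := h3.position s ⟨hs.1, hs.2.le⟩
    have e2 := h3.position t ⟨le_rfl, htT.le⟩
    have e3 := h2 s hs
    have e4 : timeIntegral t s (fun r => candidateDrift p e₀ A B D r (𝒳 r ω) (mean P 𝒳 r))
        = ∫ r in (t : ℝ)..s, feedbackRate p e₀ A B κ r (𝒳 r.toNNReal ω) (mean P 𝒳 r.toNNReal) := by
      refine intervalIntegral.integral_congr_ae (ae_of_all _ fun r hr => ?_)
      rw [Set.uIoc_of_le hsT.1] at hr
      have hr0 : 0 < r := t.coe_nonneg.trans_lt hr.1
      have hrT : r < T := hr.2.trans_lt (by exact_mod_cast hs.2)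
      simp only [Real.coe_toNNReal _ hr0.le, candidateDrift_eq hp hκ ⟨hr0, hrT⟩]
    have e5 : ∫ r in (t : ℝ)..s, coreRate p e₀ A B κ (mean P 𝒳) (fun s => N s ω)
          (fun s => 𝒳 s ω) r
        = -((∫ r in (t : ℝ)..s, feedbackRate p e₀ A B κ r (𝒳 r.toNNReal ω) (mean P 𝒳 r.toNNReal))
          + ∫ r in (t : ℝ)..s, κ 0 r / p.aTilde * N r.toNNReal ω) := by
      rw [← intervalIntegral.integral_add (intervalIntegrable_of_mem_Icc hrate htt hsT)
        (intervalIntegrable_of_mem_Icc hng htt hsT), ← intervalIntegral.integral_neg]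
      rfl
    have e6 : (∫ r in (0 : ℝ)..s, N r.toNNReal ω * (κ 0 r / p.aTilde))
        - (∫ r in (0 : ℝ)..t, N r.toNNReal ω * (κ 0 r / p.aTilde))
        = ∫ r in (t : ℝ)..s, κ 0 r / p.aTilde * N r.toNNReal ω := by
      have hng1 : IntervalIntegrable (fun r : ℝ => N r.toNNReal ω * (κ 0 r / p.aTilde))
          volume 0 T := by simpa only [mul_comm] using hng0
      rw [intervalIntegral.integral_interval_sub_left
        (intervalIntegrable_of_mem_Icc hng1 ⟨le_rfl, T.coe_nonneg⟩
          ⟨s.coe_nonneg, hsT.2⟩)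
        (intervalIntegrable_of_mem_Icc hng1 ⟨le_rfl, T.coe_nonneg⟩ ⟨t.coe_nonneg, hle⟩)]
      simp only [mul_comm]
    have e7 := h1 s hs.2.le
    have e8 := h1 t htT.le
    rw [e4] at e3
    rw [e5]
    linarith
  · have hne : (𝓝[<] T).NeBot := nhdsLT_neBot_of_exists_lt ⟨t, htT⟩
    obtain ⟨l, hl⟩ := (hZ.cadlag ω).2 T ⟨htT, le_rfl⟩
    obtain ⟨l', hl'⟩ := (hZ.state.cadlag ω 0).2 T ⟨htT, le_rfl⟩
    have hev : (fun s => 𝒳 s ω 0) =ᶠ[𝓝[<] T] fun s => ξ ω 0 - Z s ω := by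
      filter_upwards [Ico_mem_nhdsLT htT] with s hs
      exact h3.position s ⟨hs.1, hs.2.le⟩
    have hll : l' = ξ ω 0 - l := tendsto_nhds_unique (hl'.congr' hev) (hl.const_sub _)
    rw [leftLim_eq_of_tendsto hl, leftLim_eq_of_tendsto hl'] at h5
    have := h3.position T ⟨htT.le, le_rfl⟩
    linarith

/-- The mean of the position after the initial jump of the candidate. -/
noncomputable def initialMean (P : Measure Ω) (p : Params) (e₀ : ℝ)
    (B : ℝ → Matrix (Fin 3) (Fin 3) ℝ) (D : ℝ → Fin 3 → ℝ) (t : ℝ≥0) (ξ : Ω → Fin 3 → ℝ) : ℝ :=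
  (IB p B t 1 * (∫ ω, fundamental p (ξ ω) ∂P) + IB p B t 2 * (∫ ω, ξ ω 2 ∂P) + ID p e₀ D t) / p.a

lemma IsCandidate.initial_position (hp : p.Standing) (htT : t < T)
    (hξ2 : ∀ i, MemLp (fun ω => ξ ω i) 2 P) (hZ : IsCandidate P 𝓕 W p e₀ σ A B D t T ξ Z 𝒳)
    (hpath : HasStatePaths P p e₀ t T ξ N Z 𝒳) :
    ∀ᵐ ω ∂P, 𝒳 t ω 0 = initialMean P p e₀ B D t ξ
      + (IA p A t 1 * (fundamental p (ξ ω) - ∫ ω', fundamental p (ξ ω') ∂P)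
        + IA p A t 2 * (ξ ω 2 - ∫ ω', ξ ω' 2 ∂P)) / p.aTilde := by
  have hi := fun i => (hξ2 i).integrable one_le_two
  have hf : fundamental p (fun i => ∫ ω', ξ ω' i ∂P) = ∫ ω', fundamental p (ξ ω') ∂P := by
    unfold fundamental
    rw [integral_add (hi 1) ((hi 0).const_mul _), integral_const_mul]
  have h1 := hp.aTilde_pos.ne'
  have h2 : p.a ≠ 0 := hp.a_pos.ne'
  filter_upwards [hpath, hZ.initial_jump] with ω h3 h4
  rw [h3.position t ⟨le_rfl, htT.le⟩, h4, IA_dotProduct hp, IB_dotProduct hp, hf, initialMean]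
  have hfs : fundamental p (ξ ω - fun i => ∫ ω', ξ ω' i ∂P)
      = fundamental p (ξ ω) - ∫ ω', fundamental p (ξ ω') ∂P := by
    rw [← hf]
    simp only [fundamental, Pi.sub_apply]
    ring
  rw [hfs]
  simp only [Pi.sub_apply]
  field_simp
  ring

lemma IsCandidate.exists_state_bound (hp : p.Standing) (hW : IsBrownianBasis P 𝓕 W) (htT : t < T)
    (hσ2 : MemLp (onProd σ) 2 (prodMeasure P T)) (hξ2 : ∀ i, MemLp (fun ω => ξ ω i) 2 P)
    (hκ : FeedbackRates p e₀ A B D T κ) (hZ : IsCandidate P 𝓕 W p e₀ σ A B D t T ξ Z 𝒳)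
    (hN : IsItoIntegral P 𝓕 W T σ N) (hpath : HasStatePaths P p e₀ t T ξ N Z 𝒳)
    (hfb : HasFeedbackPaths P p e₀ A B κ t T N v 𝒳) :
    ∃ G : Ω → ℝ, MemLp G 2 P ∧ ∀ᵐ ω ∂P, ∀ s ∈ Icc t T, ∀ i, |𝒳 s ω i| ≤ G ω := by
  have hle : (t : ℝ) ≤ T := by exact_mod_cast htT.le
  have hg := hκ.isC1On_gain
  obtain ⟨L, hL, hLb⟩ := hκ.exists_bound
  obtain ⟨K, hK⟩ := isCompact_Icc.exists_bound_of_continuousOn hg.continuousOn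
  obtain ⟨K', hK'⟩ := isCompact_Icc.exists_bound_of_continuousOn hg.cont
  obtain ⟨G, hG, hGb⟩ := (hN.isItoPair hσ2).exists_memLp_bound hW hN.cont
  have h00 : (0 : ℝ) ∈ Icc (0 : ℝ) T := ⟨le_rfl, T.coe_nonneg⟩
  have hK0 : 0 ≤ K := (norm_nonneg _).trans (hK 0 h00)
  have hK0' : 0 ≤ K' := (norm_nonneg _).trans (hK' 0 h00)
  have hfξ : MemLp (fun ω => fundamental p (ξ ω)) 2 P := (hξ2 1).add ((hξ2 0).const_mul _)
  have hX0 : MemLp (fun ω => 𝒳 t ω 0) 2 P := by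
    have h1 := fun c : ℝ => hfξ.sub (memLp_const (p := 2) (μ := P) c)
    have h2 := fun c : ℝ => (hξ2 2).sub (memLp_const (p := 2) (μ := P) c)
    have h3 := fun c c' k k' l d : ℝ => (memLp_const (p := 2) (μ := P) l).add
      ((((h1 c).const_mul k).add ((h2 c').const_mul k')).const_mul d)
    refine MemLp.ae_eq ?_ (h3 (∫ ω', fundamental p (ξ ω') ∂P) (∫ ω', ξ ω' 2 ∂P) (IA p A t 1)
      (IA p A t 2) (initialMean P p e₀ B D t ξ) p.aTilde⁻¹)
    filter_upwards [hZ.initial_position hp htT hξ2 hpath] with ω hω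
    rw [hω, div_eq_inv_mul]
    rfl
  have hmi := hZ.state.integrable_mean
  refine exists_bound_of_isStatePath hp hW htT.le hσ2 hξ2 hN (hmi 0) hpath
    (G₀ := fun ω => |𝒳 t ω 0| + (2 * K + (T - t) * K') * G ω) (GT := fun _ => 0)
    (hX0.abs.add (hG.const_mul _)) (memLp_const _) hL
    (g₀ := fun r => L * (1 + |mean P 𝒳 r.toNNReal 0| + |fundamental p (mean P 𝒳 r.toNNReal)|
      + |mean P 𝒳 r.toNNReal 2|)) ?_ (fun r _ => by positivity) ?_ ?_
  · exact (((intervalIntegrable_const.add (hmi 0).abs).add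
      ((hmi 1).add ((hmi 0).const_mul _)).abs).add (hmi 2).abs).const_mul L
  · filter_upwards [hfb] with ω h
    simp [h.terminal]
  filter_upwards [hfb, hGb, hpath] with ω h hGω hpω
  have hG0 : 0 ≤ G ω := (abs_nonneg _).trans (hGω 0 zero_le)
  have hTt : (0 : ℝ) ≤ T - t := sub_nonneg.2 hle
  have hsub : Icc (t : ℝ) T ⊆ Icc 0 T := Set.Icc_subset_Icc_left t.coe_nonneg
  have hnc : ContinuousOn (fun r : ℝ => N r.toNNReal ω) (Icc (0 : ℝ) T) :=
    continuousOn_comp_toNNReal h.cont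
  have hNb : ∀ r ∈ Icc (t : ℝ) T, |N r.toNNReal ω| ≤ G ω := fun r hr =>
    hGω _ (Real.toNNReal_le_iff_le_coe.2 hr.2)
  have hX : ∀ r ∈ Ico (t : ℝ) T, 𝒳 r.toNNReal ω 0
      = v r.toNNReal ω + IA p A r 1 / p.aTilde * N r.toNNReal ω := fun r hr => by
    have := h.eq _ (toNNReal_mem_Ico hr)
    rwa [Real.coe_toNNReal _ (t.coe_nonneg.trans hr.1)] at this
  have hgN : ∀ r ∈ Icc (t : ℝ) T, |IA p A r 1 / p.aTilde * N r.toNNReal ω| ≤ K * G ω :=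
    fun r hr => by
      rw [abs_mul]
      exact mul_le_mul (hK r (hsub hr)) (hNb r hr) (abs_nonneg _) hK0
  refine ⟨by positivity, fun r => |v r.toNNReal ω + IA p A r 1 / p.aTilde * N r.toNNReal ω|,
    (h.core.continuousOn.add ((hg.continuousOn.mono hsub).mul (hnc.mono hsub))).abs,
    fun _ _ => abs_nonneg _, fun r hr => (congrArg abs (hX r hr)).le, fun s hs => ?_⟩
  have htt : (t : ℝ) ∈ Icc (t : ℝ) T := ⟨le_rfl, hle⟩
  have e1 := h.core.sub_eq htt hs
  have e2 := hX t ⟨le_rfl, by exact_mod_cast htT⟩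
  rw [Real.toNNReal_coe] at e1 e2
  have hfi : IntervalIntegrable (fun r : ℝ => L * (|v r.toNNReal ω
      + IA p A r 1 / p.aTilde * N r.toNNReal ω| + |fundamental p (𝒳 r.toNNReal ω)|
      + |𝒳 r.toNNReal ω 2|) + L * (1 + |mean P 𝒳 r.toNNReal 0|
      + |fundamental p (mean P 𝒳 r.toNNReal)| + |mean P 𝒳 r.toNNReal 2|)) volume t T := by
    have hxi := fun i => (hZ.state.cadlag ω i).intervalIntegrable htT.le
    refine (IntervalIntegrable.const_mul (((ContinuousOn.intervalIntegrable_of_Icc hle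
      (h.core.continuousOn.add ((hg.continuousOn.mono hsub).mul (hnc.mono hsub)))).abs.add
      ((hxi 1).add ((hxi 0).const_mul _)).abs).add (hxi 2).abs) L).add ?_
    exact (((intervalIntegrable_const.add (hmi 0).abs).add
      ((hmi 1).add ((hmi 0).const_mul _)).abs).add (hmi 2).abs).const_mul L
  have e3 : |∫ r in (t : ℝ)..s, coreRate p e₀ A B κ (mean P 𝒳) (fun s => N s ω)
      (fun s => 𝒳 s ω) r| ≤ ∫ r in (t : ℝ)..s, (L * (|v r.toNNReal ω
      + IA p A r 1 / p.aTilde * N r.toNNReal ω| + |fundamental p (𝒳 r.toNNReal ω)|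
      + |𝒳 r.toNNReal ω 2|) + L * (1 + |mean P 𝒳 r.toNNReal 0|
      + |fundamental p (mean P 𝒳 r.toNNReal)| + |mean P 𝒳 r.toNNReal 2|) + K' * G ω) := by
    rw [← Real.norm_eq_abs]
    refine intervalIntegral.norm_integral_le_of_norm_le hs.1 ?_
      ((intervalIntegrable_of_mem_Icc hfi htt hs).add intervalIntegrable_const)
    filter_upwards [Measure.ae_ne volume (T : ℝ)] with r hrT hr
    have hr' : r ∈ Icc (t : ℝ) T := ⟨hr.1.le, hr.2.trans hs.2⟩
    have e4 := hLb r (hsub hr') (𝒳 r.toNNReal ω) (mean P 𝒳 r.toNNReal)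
    rw [hX r ⟨hr'.1, lt_of_le_of_ne hr'.2 hrT⟩] at e4
    have e5 : |κ 0 r / p.aTilde * N r.toNNReal ω| ≤ K' * G ω := by
      rw [abs_mul]
      exact mul_le_mul (hK' r (hsub hr')) (hNb r hr') (abs_nonneg _) hK0'
    rw [coreRate, norm_neg]
    exact (abs_add_le _ _).trans (add_le_add e4 e5)
  rw [intervalIntegral.integral_add (intervalIntegrable_of_mem_Icc hfi htt hs)
    intervalIntegrable_const, intervalIntegral.integral_const, smul_eq_mul] at e3
  have e6 : (s - t) * (K' * G ω) ≤ (T - t) * (K' * G ω) :=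
    mul_le_mul_of_nonneg_right (sub_le_sub_right hs.2 _) (by positivity)
  have e7 := hgN s hs
  have e8 := hgN t htt
  rw [Real.toNNReal_coe] at e8
  have e9 : v s.toNNReal ω + IA p A s 1 / p.aTilde * N s.toNNReal ω
      = 𝒳 t ω 0 - IA p A t 1 / p.aTilde * N t ω + IA p A s 1 / p.aTilde * N s.toNNReal ω
        + ∫ r in (t : ℝ)..s, coreRate p e₀ A B κ (mean P 𝒳) (fun s => N s ω)
          (fun s => 𝒳 s ω) r := by linarith
  have e10 := abs_add_three (𝒳 t ω 0 - IA p A t 1 / p.aTilde * N t ω)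
    (IA p A s 1 / p.aTilde * N s.toNNReal ω) (∫ r in (t : ℝ)..s, coreRate p e₀ A B κ (mean P 𝒳)
      (fun s => N s ω) (fun s => 𝒳 s ω) r)
  have e11 := abs_sub (𝒳 t ω 0) (IA p A t 1 / p.aTilde * N t ω)
  simp only
  rw [e9]
  linarith

/-- The rate of change of `IA ⬝ᵥ 𝒳` under the candidate, where `m` is the mean of the state. -/
noncomputable def residualRate (p : Params) (e₀ : ℝ) (A B : ℝ → Matrix (Fin 3) (Fin 3) ℝ)
    (κ : Fin 5 → ℝ → ℝ) (s : ℝ) (m : Fin 3 → ℝ) : ℝ :=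
  κ 0 s * fundamental p m + κ 1 s * m 2 + IA p A s 1 * driftY p e₀ m m
    + IA p A s 2 * driftC p e₀ m m
    - p.aTilde / p.a * (κ 2 s * fundamental p m + κ 3 s * m 2 + κ 4 s
      + IB p B s 1 * driftY p e₀ m m + IB p B s 2 * driftC p e₀ m m)

lemma IsControlledState.residual_isPrimitiveOn (hp : p.Standing) (htT : t < T)
    (hκ : FeedbackRates p e₀ A B D T κ) (h : IsControlledState P 𝓕 W p e₀ σ t T ξ N 𝒳)
    (hfb : HasFeedbackPaths P p e₀ A B κ t T N v 𝒳) :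
    ∀ᵐ ω ∂P, IsPrimitiveOn (fun r : ℝ => -p.aTilde * v r.toNNReal ω
        + IA p A r 1 * (fundamental p (𝒳 r.toNNReal ω) - N r.toNNReal ω)
        + IA p A r 2 * 𝒳 r.toNNReal ω 2)
      (fun r : ℝ => residualRate p e₀ A B κ r (mean P 𝒳 r.toNNReal)) t T := by
  have hle : (t : ℝ) ≤ T := by exact_mod_cast htT.le
  have htm : (t : ℝ) ∈ Icc (0 : ℝ) T := ⟨t.coe_nonneg, hle⟩
  have hTm : (T : ℝ) ∈ Icc (0 : ℝ) T := ⟨T.coe_nonneg, le_rfl⟩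
  have h1 := hp.aTilde_pos.ne'
  have h2 : p.a ≠ 0 := hp.a_pos.ne'
  filter_upwards [hfb, h.fund.path, h.child.path] with ω h3 h4 h5
  refine (((h3.core.const_mul (-p.aTilde)).add
    (((hκ.a₁.isPrimitiveOn T.coe_nonneg).mono htm hTm).mul h4 hle)).add
    (((hκ.a₂.isPrimitiveOn T.coe_nonneg).mono htm hTm).mul h5 hle)).congr hle
    (fun s hs => ?_) (fun s hs => ?_)
  · simp
  · simp only [coreRate, feedbackRate_eq, residualRate, Prod.snd_zero, Pi.zero_apply, sub_zero]
    field_simp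
    ring

lemma IsControlledState.mean_fundamental (hW : IsBrownianBasis P 𝓕 W) (htT : t ≤ T)
    (h : IsControlledState P 𝓕 W p e₀ σ t T ξ N 𝒳) :
    IsPrimitiveOn (fun r : ℝ => fundamental p (mean P 𝒳 r.toNNReal))
      (fun r : ℝ => driftY p e₀ (mean P 𝒳 r.toNNReal) (mean P 𝒳 r.toNNReal)) t T :=
  (h.fund.expectation hW htT).congr (by exact_mod_cast htT)
    (fun _ hs => (h.integral_fundamental (toNNReal_mem_Icc hs)).symm)
    (fun _ hs => (h.integral_driftY (toNNReal_mem_Icc ⟨hs.1.le, hs.2.le⟩) _).symm)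

lemma IsControlledState.mean_child (hW : IsBrownianBasis P 𝓕 W) (htT : t ≤ T)
    (h : IsControlledState P 𝓕 W p e₀ σ t T ξ N 𝒳) :
    IsPrimitiveOn (fun r : ℝ => mean P 𝒳 r.toNNReal 2)
      (fun r : ℝ => driftC p e₀ (mean P 𝒳 r.toNNReal) (mean P 𝒳 r.toNNReal)) t T :=
  (h.child.expectation hW htT).congr (by exact_mod_cast htT) (fun _ _ => rfl)
    (fun _ hs => (h.integral_driftC (toNNReal_mem_Icc ⟨hs.1.le, hs.2.le⟩) _).symm)

/-- The feedback conditions hold along the candidate. -/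
lemma IsControlledState.feedback (hp : p.Standing) (hW : IsBrownianBasis P 𝓕 W) (htT : t < T)
    (hκ : FeedbackRates p e₀ A B D T κ) (h : IsControlledState P 𝓕 W p e₀ σ t T ξ N 𝒳)
    (hfb : HasFeedbackPaths P p e₀ A B κ t T N v 𝒳)
    (hst : ∀ᵐ ω ∂P, 𝒳 t ω 0 = initialMean P p e₀ B D t ξ
      + (IA p A t 1 * (fundamental p (ξ ω) - ∫ ω', fundamental p (ξ ω') ∂P)
        + IA p A t 2 * (ξ ω 2 - ∫ ω', ξ ω' 2 ∂P)) / p.aTilde) :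
    (∀ᵐ ω ∂P, ∀ s ∈ Ico t T, IA p A s ⬝ᵥ (𝒳 s ω - mean P 𝒳 s) = 0) ∧
    ∀ s ∈ Ico t T, IB p B s ⬝ᵥ mean P 𝒳 s + ID p e₀ D s = 0 := by
  have hle : (t : ℝ) ≤ T := by exact_mod_cast htT.le
  have htm : (t : ℝ) ∈ Icc (0 : ℝ) T := ⟨t.coe_nonneg, hle⟩
  have hTm : (T : ℝ) ∈ Icc (0 : ℝ) T := ⟨T.coe_nonneg, le_rfl⟩
  have htt : (t : ℝ) ∈ Icc (t : ℝ) T := ⟨le_rfl, hle⟩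
  have h1 := hp.aTilde_pos.ne'
  have h2 : p.a ≠ 0 := hp.a_pos.ne'
  have hres := h.residual_isPrimitiveOn hp htT hκ hfb
  set q : ℝ → ℝ := fun r => residualRate p e₀ A B κ r (mean P 𝒳 r.toNNReal) with hq
  set F := ∫ ω', fundamental p (ξ ω') ∂P with hF
  set C := ∫ ω', ξ ω' 2 ∂P with hC
  set k := -p.aTilde * initialMean P p e₀ B D t ξ + IA p A t 1 * F + IA p A t 2 * C with hk
  have key : ∀ᵐ ω ∂P, ∀ s ∈ Ico t T, IA p A s ⬝ᵥ 𝒳 s ω = k + ∫ r in (t : ℝ)..s, q r := by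
    filter_upwards [hres, hfb, hst, h.fund_start, h.child_start] with ω h3 h4 h5 h6 h7 s hs
    have e1 := h3.sub_eq htt (s := s) ⟨by exact_mod_cast hs.1, by exact_mod_cast hs.2.le⟩
    have e2 := h4.eq s hs
    have e3 := h4.eq t ⟨le_rfl, htT⟩
    simp only [Real.toNNReal_coe] at e1
    rw [← h6, ← h7] at h5
    rw [IA_dotProduct hp]
    have hg : ∀ x y : ℝ, p.aTilde * (x / p.aTilde * y) = x * y := fun x y => by field_simp
    have e4 : p.aTilde * 𝒳 s ω 0 = p.aTilde * v s ω + IA p A s 1 * N s ω := by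
      rw [e2, mul_add, hg]
    have e5 : p.aTilde * 𝒳 t ω 0 = p.aTilde * v t ω + IA p A t 1 * N t ω := by
      rw [e3, mul_add, hg]
    have e6 : p.aTilde * 𝒳 t ω 0 = p.aTilde * initialMean P p e₀ B D t ξ
        + (IA p A t 1 * (fundamental p (𝒳 t ω) - F) + IA p A t 2 * (𝒳 t ω 2 - C)) := by
      rw [h5]
      field_simp
    linarith
  have keym : ∀ s ∈ Ico t T, IA p A s ⬝ᵥ mean P 𝒳 s = k + ∫ r in (t : ℝ)..s, q r := by
    intro s hs
    have hsi := fun i => (h.dom i).integrable ⟨hs.1, hs.2.le⟩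
    have e1 := integral_sum_const_mul (IA p A s) (fun i ω => 𝒳 s ω i) hsi
    have e2 : ∫ ω, ∑ j, IA p A s j * 𝒳 s ω j ∂P = ∫ _ω, (k + ∫ r in (t : ℝ)..s, q r) ∂P :=
      integral_congr_ae (key.mono fun ω hω => hω s hs)
    rw [integral_const, probReal_univ, one_smul] at e2
    exact e1.symm.trans e2
  refine ⟨key.mono fun ω hω s hs => ?_, fun s hs => ?_⟩
  · rw [dotProduct_sub, hω s hs, keym s hs, sub_self]
  obtain ⟨ω, hω⟩ := hres.exists
  have hFp := h.mean_fundamental hW htT.le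
  have hCp := h.mean_child hW htT.le
  have hmono : ∀ {f f' : ℝ → ℝ}, IsC1On f f' T → IsPrimitiveOn f f' t T :=
    fun hf => (hf.isPrimitiveOn T.coe_nonneg).mono htm hTm
  have hM := (((((hmono hκ.a₁).mul hFp hle).add ((hmono hκ.a₂).mul hCp hle)).sub
    (.of_intervalIntegrable hω.integrable k)).const_mul (-(p.a / p.aTilde))).add
    ((((hmono hκ.b₁).mul hFp hle).add ((hmono hκ.b₂).mul hCp hle)).add (hmono hκ.d))
  have hM0 := (hM.congr hle (fun _ _ => rfl) (v' := fun _ => 0) (fun r hr => by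
    simp only [hq, residualRate]
    field_simp
    ring)).sub_eq htt (s := s) ⟨by exact_mod_cast hs.1, by exact_mod_cast hs.2.le⟩
  simp only [Real.toNNReal_coe, intervalIntegral.integral_zero, intervalIntegral.integral_same,
    add_zero] at hM0
  have e1 := keym s hs
  have hFt : fundamental p (mean P 𝒳 t) = F := by
    rw [← h.integral_fundamental ⟨le_rfl, htT.le⟩]
    exact integral_congr_ae h.fund_start
  have hCt : mean P 𝒳 t 2 = C := integral_congr_ae h.child_start
  rw [IA_dotProduct hp] at e1
  rw [IB_dotProduct hp]
  rw [hFt, hCt] at hM0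
  have e2 : p.a * initialMean P p e₀ B D t ξ = IB p B t 1 * F + IB p B t 2 * C + ID p e₀ D t := by
    rw [initialMean, ← hF, ← hC]
    field_simp
  have e3 : p.aTilde * mean P 𝒳 s 0 = IA p A s 1 * fundamental p (mean P 𝒳 s)
      + IA p A s 2 * mean P 𝒳 s 2 - (k + ∫ r in (t : ℝ)..s, q r) := by linarith
  rw [← e3, hk] at hM0
  field_simp at hM0
  refine mul_left_cancel₀ h1 ?_
  linear_combination hM0 - p.aTilde * e2

/-! ### Itô processes with a jump at the terminal time -/

/-- The indicator of the time `T`. -/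
noncomputable def atTime (T s : ℝ≥0) : ℝ := if s = T then 1 else 0

lemma atTime_mono {T s u : ℝ≥0} (hsu : s ≤ u) (hu : u ≤ T) : atTime T s ≤ atTime T u := by
  unfold atTime
  split_ifs with h1 h2
  · exact le_rfl
  · exact absurd (le_antisymm hu (h1 ▸ hsu)) h2
  · exact zero_le_one
  · exact le_rfl

lemma atTime_nonneg (T s : ℝ≥0) : 0 ≤ atTime T s := by
  unfold atTime
  split_ifs <;> simp

lemma atTime_le_one (T s : ℝ≥0) : atTime T s ≤ 1 := by
  unfold atTime
  split_ifs <;> simp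

lemma atTime_self (T : ℝ≥0) : atTime T T = 1 := if_pos rfl

lemma atTime_of_lt {T s : ℝ≥0} (h : s < T) : atTime T s = 0 := if_neg h.ne

variable {s : ℝ≥0}

lemma sum_atTime_mul_self (htT : t < T) (π : TimePartition t T) :
    ∑ i ∈ range π.n, (atTime T (π.pt (i + 1)) - atTime T (π.pt i))
      * (atTime T (π.pt (i + 1)) - atTime T (π.pt i)) = 1 := by
  rw [← sub_zero (1 : ℝ), ← atTime_self T, ← atTime_of_lt htT, ← π.sum_sub]
  refine sum_congr rfl fun i hi => ?_
  have := atTime_mono (π.mono (Nat.le_succ i)) (π.pt_le (Finset.mem_range.1 hi))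
  unfold atTime at *
  split_ifs at * <;> norm_num at *

lemma tendsto_sum_mul_atTime (hs : s ≤ T) {π : ℕ → TimePartition t s} {x : ℕ → ℕ → ℝ}
    (hx : ∀ ε : ℝ, 0 < ε → ∀ᶠ k in atTop, ∀ i < (π k).n, |x k i| < ε) :
    Tendsto (fun k => ∑ i ∈ range (π k).n,
      x k i * (atTime T ((π k).pt (i + 1)) - atTime T ((π k).pt i))) atTop (𝓝 0) := by
  refine Metric.tendsto_atTop.2 fun ε hε => ?_
  obtain ⟨k₀, hk₀⟩ := eventually_atTop.1 (hx (ε / 2) (half_pos hε))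
  refine ⟨k₀, fun k hk => ?_⟩
  rw [dist_zero_right, Real.norm_eq_abs]
  refine (abs_sum_mul_le_of_sum_abs_le (ε := ε / 2) (C := 1) (half_pos hε).le
    (fun i hi => (hk₀ k hk i hi).le) ?_).trans_lt (by linarith)
  rw [sum_congr rfl fun i hi => abs_of_nonneg (sub_nonneg.2 (atTime_mono
    ((π k).mono (Nat.le_succ i)) (((π k).pt_le (Finset.mem_range.1 hi)).trans hs))), (π k).sum_sub]
  linarith [atTime_le_one T s, atTime_nonneg T t]

lemma MeshTendsto.eventually_abs_sub_lt_of_continuousOn {π : ℕ → TimePartition t s}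
    (hπ : MeshTendsto π) {f : ℝ≥0 → ℝ} (hf : ContinuousOn f (Icc t s)) {ε : ℝ} (hε : 0 < ε) :
    ∀ᶠ k in atTop, ∀ i < (π k).n, |f ((π k).pt (i + 1)) - f ((π k).pt i)| < ε := by
  simpa only [Real.toNNReal_coe] using hπ.eventually_abs_sub_lt (continuousOn_comp_toNNReal hf) hε

lemma continuousOn_of_comp_toNNReal {f : ℝ≥0 → ℝ}
    (h : ContinuousOn (fun r : ℝ => f r.toNNReal) (Icc (t : ℝ) s)) :
    ContinuousOn f (Icc t s) := by
  have := h.comp NNReal.continuous_coe.continuousOn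
    (fun r (hr : r ∈ Icc t s) => ⟨by exact_mod_cast hr.1, by exact_mod_cast hr.2⟩)
  simpa [Function.comp_def] using this

/-- `X` is on `[t, T]` the sum of a process `w` of finite variation with continuous paths, the
Itô integral process `x.2`, and a jump `-J` at time `T`. -/
structure IsJumpDiffusion (P : Measure Ω) (𝓕 : Filtration ℝ≥0 mΩ) (W : ℝ≥0 → Ω → ℝ)
    (t T : ℝ≥0) (X : ℝ≥0 → Ω → ℝ) (x : ProcPair Ω) (w : ℝ≥0 → Ω → ℝ) (J : Ω → ℝ) : Prop where
  ito : IsItoPair P 𝓕 W T x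
  cont : ∀ᵐ ω ∂P, ContinuousOn (fun s => x.2 s ω) (Icc 0 T)
  path : ∀ᵐ ω ∂P, ∃ w', IsPrimitiveOn (fun r : ℝ => w r.toNNReal ω) w' t T
  eq : ∀ᵐ ω ∂P, ∀ s ∈ Icc t T, X s ω = w s ω + x.2 s ω - J ω * atTime T s

namespace IsJumpDiffusion

variable {X w : ℝ≥0 → Ω → ℝ} {J : Ω → ℝ}

lemma tendstoAESubseq_covSum (hW : IsBrownianBasis P 𝓕 W)
    (h : IsJumpDiffusion P 𝓕 W t T X x w J) (hy : IsItoPair P 𝓕 W T y)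
    (hyc : ∀ᵐ ω ∂P, ContinuousOn (fun s => y.2 s ω) (Icc 0 T)) {s : ℝ≥0}
    (hs : s ∈ Icc t T) {π : ℕ → TimePartition t s} (hπ : MeshTendsto π) :
    TendstoAESubseq P (fun k => covSum X y.2 (π k))
      (fun ω => ∫ r in (t : ℝ)..s, x.1 r.toNNReal ω * y.1 r.toNNReal ω) := by
  have hst : Icc t s ⊆ Icc 0 T := Set.Icc_subset_Icc zero_le hs.2
  have h1 := h.ito.tendstoAESubseq_sum hW hy hs.2 hπ (g := fun _ => 1) continuousOn_const
  have h2 : TendstoAESubseq P (fun k ω => (∑ i ∈ range (π k).n,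
        (y.2 ((π k).pt (i + 1)) ω - y.2 ((π k).pt i) ω)
          * (w ((π k).pt (i + 1)) ω - w ((π k).pt i) ω))
      - J ω * ∑ i ∈ range (π k).n, (y.2 ((π k).pt (i + 1)) ω - y.2 ((π k).pt i) ω)
          * (atTime T ((π k).pt (i + 1)) - atTime T ((π k).pt i))) fun _ => 0 := by
    refine .of_ae ?_
    filter_upwards [hyc, h.path] with ω hω ⟨w', hw⟩
    have hsm := fun (ε : ℝ) (hε : 0 < ε) =>
      hπ.eventually_abs_sub_lt_of_continuousOn (hω.mono hst) hε
    have e1 := tendsto_sum_mul_sub_zero (hw.mono ⟨le_rfl, by exact_mod_cast hs.1.trans hs.2⟩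
      ⟨by exact_mod_cast hs.1, by exact_mod_cast hs.2⟩) hsm
    simp only [Real.toNNReal_coe] at e1
    simpa using e1.sub ((tendsto_sum_mul_atTime hs.2 hsm).const_mul (J ω))
  refine (h1.add h2).congr ?_ (ae_of_all _ fun ω => by simp)
  filter_upwards [h.eq] with ω hω k
  rw [covSum, mul_sum, ← sum_sub_distrib, ← sum_add_distrib]
  refine sum_congr rfl fun i hi => ?_
  have hi' := Finset.mem_range.1 hi
  rw [hω _ ⟨(π k).le_pt _, ((π k).pt_le hi').trans hs.2⟩,
    hω _ ⟨(π k).le_pt _, ((π k).pt_le hi'.le).trans hs.2⟩]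
  ring

lemma tendstoAESubseq_covSum_self (hW : IsBrownianBasis P 𝓕 W) (htT : t < T)
    (h : IsJumpDiffusion P 𝓕 W t T X x w J) {π : ℕ → TimePartition t T} (hπ : MeshTendsto π) :
    TendstoAESubseq P (fun k => covSum X X (π k))
      (fun ω => (∫ r in (t : ℝ)..T, x.1 r.toNNReal ω * x.1 r.toNNReal ω) + J ω ^ 2) := by
  have hst : Icc t T ⊆ Icc 0 T := Set.Icc_subset_Icc zero_le le_rfl
  have h1 := h.ito.tendstoAESubseq_sum hW h.ito le_rfl hπ (g := fun _ => 1) continuousOn_const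
  have h2 : TendstoAESubseq P (fun k ω => (∑ i ∈ range (π k).n,
        ((w ((π k).pt (i + 1)) ω + 2 * x.2 ((π k).pt (i + 1)) ω)
          - (w ((π k).pt i) ω + 2 * x.2 ((π k).pt i) ω))
          * (w ((π k).pt (i + 1)) ω - w ((π k).pt i) ω))
      - 2 * J ω * ∑ i ∈ range (π k).n,
        ((w ((π k).pt (i + 1)) ω + x.2 ((π k).pt (i + 1)) ω)
          - (w ((π k).pt i) ω + x.2 ((π k).pt i) ω))
          * (atTime T ((π k).pt (i + 1)) - atTime T ((π k).pt i))) fun _ => 0 := by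
    refine .of_ae ?_
    filter_upwards [h.cont, h.path] with ω hω ⟨w', hw⟩
    have hwc : ContinuousOn (fun s => w s ω) (Icc t T) :=
      continuousOn_of_comp_toNNReal hw.continuousOn
    have hxc := hω.mono hst
    have e1 := tendsto_sum_mul_sub_zero hw fun (ε : ℝ) (hε : 0 < ε) =>
      hπ.eventually_abs_sub_lt_of_continuousOn (hwc.add (hxc.const_mul 2)) hε
    simp only [Real.toNNReal_coe] at e1
    have e2 := (tendsto_sum_mul_atTime le_rfl fun (ε : ℝ) (hε : 0 < ε) =>
      hπ.eventually_abs_sub_lt_of_continuousOn (hwc.add hxc) hε).const_mul (2 * J ω)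
    simpa using e1.sub e2
  refine ((h1.add h2).add (.of_ae (f := fun k ω => J ω ^ 2 * ∑ i ∈ range (π k).n,
    (atTime T ((π k).pt (i + 1)) - atTime T ((π k).pt i))
      * (atTime T ((π k).pt (i + 1)) - atTime T ((π k).pt i))) (F := fun ω => J ω ^ 2)
    (ae_of_all _ fun ω => by simp [sum_atTime_mul_self htT]))).congr ?_ (ae_of_all _ fun ω => by simp)
  filter_upwards [h.eq] with ω hω k
  simp only [covSum, mul_sum]
  rw [← sum_sub_distrib, ← sum_add_distrib, ← sum_add_distrib]
  refine sum_congr rfl fun i hi => ?_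
  have hi' := Finset.mem_range.1 hi
  rw [hω _ ⟨(π k).le_pt (i + 1), (π k).pt_le hi'⟩, hω _ ⟨(π k).le_pt i, (π k).pt_le hi'.le⟩]
  ring

end IsJumpDiffusion

/-- The Brownian motion as an Itô integral process. -/
lemma exists_isItoPair_brownian (hW : IsBrownianBasis P 𝓕 W) (T : ℝ≥0) :
    ∃ y : ProcPair Ω, IsItoPair P 𝓕 W T y ∧
      (∀ᵐ ω ∂P, ContinuousOn (fun s => y.2 s ω) (Icc 0 T)) ∧
      (∀ s ∈ Ioc 0 T, ∀ ω, y.1 s ω = 1) ∧ ∀ s ≤ T, ∀ ω, y.2 s ω = W s ω - W 0 ω := by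
  have h1 : ∀ s ≤ T, ∀ ω, (elemBlock W 0 T fun _ => 1).2 s ω = W s ω - W 0 ω := fun s hs ω => by
    simp [elemBlock, hs]
  refine ⟨elemBlock W 0 T fun _ => 1, .of_mem hW (elemBlock_mem zero_le
    stronglyMeasurable_const ⟨1, fun _ => by simp⟩), ?_, fun s hs ω => ?_, h1⟩
  · filter_upwards [hW.brownian.cont] with ω hω
    exact (hω.continuousOn.sub continuousOn_const).congr fun s hs => h1 s hs.2 ω
  · simp [elemBlock, hs.1, hs.2]

/-! ### Existence of the quadratic variation and of the cost of the candidate -/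

lemma exists_stieltjes_withDensity {φ : ℝ → ℝ} (hφ : Integrable φ) (h0 : ∀ r, 0 ≤ φ r) :
    ∃ f : StieltjesFunction ℝ, (∀ x y, f y - f x = ∫ r in x..y, φ r) ∧
      f.measure = volume.withDensity fun r => ((φ r).toNNReal : ℝ≥0∞) := by
  have hsub : ∀ x y, (∫ r in (0 : ℝ)..y, φ r) - (∫ r in (0 : ℝ)..x, φ r) = ∫ r in x..y, φ r :=
    fun x y => intervalIntegral.integral_interval_sub_left hφ.intervalIntegrable
      hφ.intervalIntegrable
  let f : StieltjesFunction ℝ := ⟨fun x => ∫ r in (0 : ℝ)..x, φ r, fun x y hxy => by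
    rw [← sub_nonneg]
    simp only [hsub]
    exact intervalIntegral.integral_nonneg_of_forall hxy h0, fun x =>
    (intervalIntegral.continuous_primitive (fun _ _ => hφ.intervalIntegrable)
      0).continuousAt.continuousWithinAt⟩
  refine ⟨f, hsub, Measure.ext_of_Ioc _ _ fun x y hxy => ?_⟩
  have h1 : f y - f x = ∫ r in x..y, φ r := hsub x y
  rw [StieltjesFunction.measure_Ioc, h1, withDensity_apply _ measurableSet_Ioc,
    intervalIntegral.integral_of_le hxy.le]
  exact ofReal_integral_eq_lintegral_ofReal hφ.integrableOn (ae_of_all _ h0)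

lemma isStieltjesIntegral_of_density (htT : t ≤ T) {h φ v : ℝ≥0 → ℝ}
    (hφ : IntervalIntegrable (fun r : ℝ => φ r.toNNReal) volume t T)
    (hh : AEStronglyMeasurable (fun r : ℝ => h r.toNNReal) (volume.restrict (Ioc (t : ℝ) T)))
    (hi : IntervalIntegrable (fun r : ℝ => h r.toNNReal * φ r.toNNReal) volume t T)
    (hv : ∀ s ∈ Icc t T, v s = timeIntegral t s φ) :
    IsStieltjesIntegral t T h v (timeIntegral t T fun s => h s * φ s) := by
  have hle : (t : ℝ) ≤ T := by exact_mod_cast htT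
  set I := Ioc (t : ℝ) T with hI
  have hφI : IntegrableOn (fun r : ℝ => φ r.toNNReal) I :=
    (intervalIntegrable_iff_integrableOn_Ioc_of_le hle).1 hφ
  have hiI : IntegrableOn (fun r : ℝ => h r.toNNReal * φ r.toNNReal) I :=
    (intervalIntegrable_iff_integrableOn_Ioc_of_le hle).1 hi
  have main : ∀ ψ : ℝ → ℝ, IntegrableOn ψ I → (∀ r, 0 ≤ ψ r) →
      (∀ r, ψ r ≤ |φ r.toNNReal|) → ∃ f : StieltjesFunction ℝ,
      (∀ s ∈ Icc t T, f s - f t = ∫ r in (t : ℝ)..s, ψ r) ∧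
      IntegrableOn (fun r : ℝ => h r.toNNReal) I f.measure ∧
      IntegrableOn (fun r : ℝ => h r.toNNReal * ψ r) I ∧
      ∫ r in I, h r.toNNReal ∂f.measure = ∫ r in I, h r.toNNReal * ψ r := by
    intro ψ hψ hψ0 hψφ
    have hind : ∀ r, 0 ≤ I.indicator ψ r := fun r => Set.indicator_nonneg (fun r _ => hψ0 r) r
    have hint : Integrable (I.indicator ψ) := hψ.integrable_indicator measurableSet_Ioc
    obtain ⟨f, hf, hfm⟩ := exists_stieltjes_withDensity hint hind
    have hfI : f.measure.restrict I
        = (volume.restrict I).withDensity fun r => ((I.indicator ψ r).toNNReal : ℝ≥0∞) := by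
      rw [hfm, restrict_withDensity measurableSet_Ioc]
    have hae : (fun r => (I.indicator ψ r).toNNReal • h r.toNNReal)
        =ᵐ[volume.restrict I] fun r => h r.toNNReal * ψ r := by
      filter_upwards [ae_restrict_mem measurableSet_Ioc] with r hr
      rw [NNReal.smul_def, Real.coe_toNNReal _ (hind r), Set.indicator_of_mem hr, smul_eq_mul,
        mul_comm]
    have hm : AEMeasurable (fun r => (I.indicator ψ r).toNNReal) (volume.restrict I) :=
      hint.aemeasurable.real_toNNReal.restrict
    have hhψ : IntegrableOn (fun r : ℝ => h r.toNNReal * ψ r) I := by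
      refine Integrable.mono' hiI.abs (hh.mul hψ.aestronglyMeasurable) (ae_of_all _ fun r => ?_)
      rw [norm_mul, abs_mul]
      refine mul_le_mul_of_nonneg_left ?_ (abs_nonneg _)
      rw [Real.norm_of_nonneg (hψ0 r)]
      exact hψφ r
    refine ⟨f, fun s hs => ?_, ?_, hhψ, ?_⟩
    · rw [hf]
      refine intervalIntegral.integral_congr_ae (ae_of_all _ fun r hr => ?_)
      rw [Set.uIoc_of_le (by exact_mod_cast hs.1)] at hr
      exact Set.indicator_of_mem (show r ∈ I from ⟨hr.1, hr.2.trans (by exact_mod_cast hs.2)⟩) _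
    · rw [IntegrableOn, hfI, integrable_withDensity_iff_integrable_smul₀ hm, integrable_congr hae]
      exact hhψ
    · rw [hfI, integral_withDensity_eq_integral_smul₀ hm, integral_congr_ae hae]
  have hsplit : ∀ x : ℝ, max x 0 - max (-x) 0 = x := fun x => max_zero_sub_max_neg_zero_eq_self x
  obtain ⟨f, hf1, hf2, hf3, hf4⟩ := main (fun r => max (φ r.toNNReal) 0) hφI.pos_part
    (fun r => le_max_right _ _) (fun r => max_le (le_abs_self _) (abs_nonneg _))
  obtain ⟨g, hg1, hg2, hg3, hg4⟩ := main (fun r => max (-φ r.toNNReal) 0) hφI.neg_part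
    (fun r => le_max_right _ _) (fun r => max_le (neg_le_abs _) (abs_nonneg _))
  refine ⟨f, g, fun s hs => ?_, hf2, hg2, ?_⟩
  · have hs1 : (t : ℝ) ≤ s := by exact_mod_cast hs.1
    have hsub : Ioc (t : ℝ) s ⊆ I := Set.Ioc_subset_Ioc_right (by exact_mod_cast hs.2)
    rw [hf1 s hs, hg1 s hs, hv s hs, hv t ⟨le_rfl, htT⟩, timeIntegral, timeIntegral,
      intervalIntegral.integral_same, sub_zero, ← intervalIntegral.integral_sub]
    · simp only [hsplit]
    · exact (intervalIntegrable_iff_integrableOn_Ioc_of_le hs1).2 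
        (IntegrableOn.mono_set (show IntegrableOn _ I volume from hφI.pos_part) hsub)
    · exact (intervalIntegrable_iff_integrableOn_Ioc_of_le hs1).2 
        (IntegrableOn.mono_set (show IntegrableOn _ I volume from hφI.neg_part) hsub)
  · rw [hf4, hg4, ← integral_sub hf3 hg3, timeIntegral, intervalIntegral.integral_of_le hle]
    simp only [← mul_sub, hsplit]
    rfl

/-- The integrand of the martingale part of the position under the candidate. -/
noncomputable def gainIntegrand (p : Params) (A : ℝ → Matrix (Fin 3) (Fin 3) ℝ)
    (σ : ℝ≥0 → Ω → ℝ) (s : ℝ≥0) (ω : Ω) : ℝ := IA p A s 1 / p.aTilde * σ s ω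

lemma IsCandidate.exists_isJumpDiffusion (hW : IsBrownianBasis P 𝓕 W) (htT : t < T)
    (hσ2 : MemLp (onProd σ) 2 (prodMeasure P T)) (hκ : FeedbackRates p e₀ A B D T κ)
    (hZ : IsCandidate P 𝓕 W p e₀ σ A B D t T ξ Z 𝒳) (hN : IsItoIntegral P 𝓕 W T σ N)
    (hfb : HasFeedbackPaths P p e₀ A B κ t T N v 𝒳) :
    ∃ N' w, IsJumpDiffusion P 𝓕 W t T (fun s ω => 𝒳 s ω 0) (gainIntegrand p A σ, N') w
      (fun ω => v T ω + IA p A T 1 / p.aTilde * N T ω) := by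
  have hle : (t : ℝ) ≤ T := by exact_mod_cast htT.le
  have hg := hκ.isC1On_gain
  obtain ⟨N', hN', -⟩ := hZ.dynamics
  have hfun : (fun (s : ℝ≥0) ω => (IA p A s ⬝ᵥ diffusion σ s ω) / p.aTilde)
      = gainIntegrand p A σ := by
    funext s ω
    simp [dotProduct, Fin.sum_univ_three, diffusion, gainIntegrand]
    ring
  rw [hfun] at hN'
  have hpair := hN'.isItoPair (MemLp.onProd_continuous_mul hg.continuousOn hσ2)
  have hparts := (hN.isItoPair hσ2).ae_forall_eq_mul_sub_integral hW hg hpair hN.cont hN'.cont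
  refine ⟨N', fun s ω => v s ω + IA p A s 1 / p.aTilde * N s ω - N' s ω, hpair, hN'.cont, ?_, ?_⟩
  · filter_upwards [hfb, hparts] with ω h1 h2
    have h3 : ContinuousOn (fun r : ℝ => N r.toNNReal ω) (Icc (0 : ℝ) T) :=
      continuousOn_comp_toNNReal h1.cont
    refine ⟨_, (h1.core.add ((IsPrimitiveOn.of_intervalIntegrable
      ((h3.mul hg.cont).intervalIntegrable_of_Icc T.coe_nonneg) 0).mono ⟨t.coe_nonneg, hle⟩
      ⟨T.coe_nonneg, le_rfl⟩)).congr hle (fun s hs => ?_) fun _ _ => rfl⟩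
    rw [h2 _ (Real.toNNReal_le_iff_le_coe.2 hs.2), Real.coe_toNNReal _ (t.coe_nonneg.trans hs.1)]
    simp only [Pi.mul_apply]
    ring
  · filter_upwards [hfb] with ω h1 s hs
    rcases hs.2.eq_or_lt with rfl | hlt
    · rw [h1.terminal, atTime_self]
      ring
    · rw [h1.eq s ⟨hs.1, hlt⟩, atTime_of_lt hlt]
      ring

lemma isCovariation_of_tendsto {s : ℝ≥0} (hs : s ∈ Icc t T) {U : ℝ≥0 → Ω → ℝ} {L : Ω → ℝ}
    (hZ : ∀ s ≤ T, StronglyMeasurable[𝓕 s] (Z s)) (hU : ∀ s ≤ T, StronglyMeasurable[𝓕 s] (U s))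
    {u : Ω → ℝ} (hu : StronglyMeasurable u) (h : ∀ π : ℕ → TimePartition t s, MeshTendsto π →
      TendstoAESubseq P (fun k => covSum Z U (π k)) L) :
    IsCovariation P t s Z (fun _ => 0) U u (fun ω => Z t ω * (U t ω - u ω) + L ω) := by
  have htT := hs.1.trans hs.2
  refine convergesAlongPartitions_of_seq (fun π => ?_) fun π hπ => ?_
  · exact ((((hZ t htT).mono (𝓕.le t)).sub stronglyMeasurable_const).mul
      (((hU t htT).mono (𝓕.le t)).sub hu)).aestronglyMeasurable.add
      (stronglyMeasurable_covSum hZ hU hs.2 π).aestronglyMeasurable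
  · refine ((TendstoAESubseq.of_ae (f := fun _ ω => Z t ω * (U t ω - u ω))
      (F := fun ω => Z t ω * (U t ω - u ω)) (ae_of_all _ fun _ => tendsto_const_nhds)).add
      (h π hπ)).congr (ae_of_all _ fun ω k => ?_) (ae_of_all _ fun _ => rfl)
    simp only [sub_zero, covSum]

lemma ae_covSum_eq_neg {X U : ℝ≥0 → Ω → ℝ} {s : ℝ≥0}
    (hs : s ≤ T) (hpos : ∀ᵐ ω ∂P, ∀ s ∈ Icc t T, X s ω = ξ ω 0 - Z s ω) :
    ∀ᵐ ω ∂P, ∀ π : TimePartition t s, covSum Z U π ω = -covSum X U π ω := by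
  filter_upwards [hpos] with ω hω π
  rw [covSum, covSum, ← Finset.sum_neg_distrib]
  refine sum_congr rfl fun i hi => ?_
  have hi' := Finset.mem_range.1 hi
  rw [hω _ ⟨π.le_pt (i + 1), (π.pt_le hi').trans hs⟩, hω _ ⟨π.le_pt i, (π.pt_le hi'.le).trans hs⟩]
  ring

variable {X w : ℝ≥0 → Ω → ℝ} {J : Ω → ℝ}

lemma IsJumpDiffusion.isQuadVar (hW : IsBrownianBasis P 𝓕 W) (htT : t < T)
    (h : IsJumpDiffusion P 𝓕 W t T X x w J) (hZ : ∀ s ≤ T, StronglyMeasurable[𝓕 s] (Z s))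
    (hpos : ∀ᵐ ω ∂P, ∀ s ∈ Icc t T, X s ω = ξ ω 0 - Z s ω) :
    IsQuadVar P t T Z fun ω => Z t ω * (Z t ω - 0) + (cellInt x.1 x.1 t T ω + J ω ^ 2) := by
  refine isCovariation_of_tendsto ⟨htT.le, le_rfl⟩ hZ hZ stronglyMeasurable_const fun π hπ => ?_
  refine (h.tendstoAESubseq_covSum_self hW htT hπ).congr ?_ (ae_of_all _ fun _ => rfl)
  filter_upwards [hpos] with ω hω k
  refine sum_congr rfl fun i hi => ?_
  have hi' := Finset.mem_range.1 hi
  rw [hω _ ⟨(π k).le_pt (i + 1), (π k).pt_le hi'⟩, hω _ ⟨(π k).le_pt i, (π k).pt_le hi'.le⟩]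
  ring

lemma IsJumpDiffusion.isCovariationIntegral (hW : IsBrownianBasis P 𝓕 W) (htT : t < T)
    (h : IsJumpDiffusion P 𝓕 W t T X x w J) (hZ : ∀ s ≤ T, StronglyMeasurable[𝓕 s] (Z s))
    (hpos : ∀ᵐ ω ∂P, ∀ s ∈ Icc t T, X s ω = ξ ω 0 - Z s ω)
    (hσ : IsStronglyProgressive 𝓕 σ) (hN : IsItoPair P 𝓕 W T (σ, N)) :
    IsCovariationIntegral P t T σ Z W fun ω => timeIntegral t T fun s => σ s ω * -x.1 s ω := by
  have hle : (t : ℝ) ≤ T := by exact_mod_cast htT.le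
  obtain ⟨y, hy, hyc, hy1, hy2⟩ := exists_isItoPair_brownian hW T
  refine ⟨fun s ω => Z t ω * (W t ω - W t ω) + timeIntegral t s fun s => -x.1 s ω,
    fun s hs => ?_, ?_⟩
  · refine isCovariation_of_tendsto hs hZ (fun s _ => hW.adapted s)
      ((hW.adapted t).mono (𝓕.le t)) fun π hπ => ?_
    refine ((h.tendstoAESubseq_covSum hW hy hyc hs hπ).mul_left fun _ => -1).congr ?_
      (ae_of_all _ fun ω => ?_)
    · filter_upwards [ae_covSum_eq_neg (U := W) hs.2 hpos] with ω hω k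
      rw [hω, neg_one_mul, neg_inj]
      refine sum_congr rfl fun i hi => ?_
      have hi' := Finset.mem_range.1 hi
      rw [hy2 _ (((π k).pt_le hi').trans hs.2), hy2 _ (((π k).pt_le hi'.le).trans hs.2)]
      ring
    · rw [timeIntegral, neg_one_mul, ← intervalIntegral.integral_neg]
      refine intervalIntegral.integral_congr_ae (ae_of_all _ fun r hr => ?_)
      rw [Set.uIoc_of_le (by exact_mod_cast hs.1)] at hr
      rw [hy1 _ ⟨Real.toNNReal_pos.2 (t.coe_nonneg.trans_lt hr.1),
        (Real.toNNReal_le_iff_le_coe.2 hr.2).trans hs.2⟩, mul_one]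
  · filter_upwards [h.ito.ae_intervalIntegrable hy, hN.ae_intervalIntegrable h.ito] with ω h1 h2
    have h3 := intervalIntegrable_sub_interval h1 htT.le le_rfl
    have h4 := intervalIntegrable_sub_interval h2 htT.le le_rfl
    refine isStieltjesIntegral_of_density htT.le ?_ ?_ ?_ fun s hs => by ring
    · refine h3.neg.congr fun r hr => ?_
      rw [Set.uIoc_of_le hle] at hr
      simp [hy1 _ ⟨Real.toNNReal_pos.2 (t.coe_nonneg.trans_lt hr.1),
        Real.toNNReal_le_iff_le_coe.2 hr.2⟩]
    · exact (hσ.stronglyMeasurable_onProd.comp_measurable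
        measurable_prodMk_right).aestronglyMeasurable
    · exact h4.neg.congr fun r _ => by simp

lemma abs_le_of_forall_Ico {f : ℝ → ℝ} {a b K : ℝ} (hab : a < b)
    (hf : ContinuousOn f (Icc a b)) (h : ∀ r ∈ Ico a b, |f r| ≤ K) :
    ∀ r ∈ Icc a b, |f r| ≤ K := by
  intro r hr
  rw [← closure_Ico hab.ne] at hr hf
  exact le_on_closure h hf.abs continuousOn_const hr

lemma exists_core_bound (htT : t < T) (hκ : FeedbackRates p e₀ A B D T κ)
    (hfb : HasFeedbackPaths P p e₀ A B κ t T N v 𝒳)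
    (hb : ∃ G : Ω → ℝ, MemLp G 2 P ∧ ∀ᵐ ω ∂P, ∀ s ∈ Icc t T, ∀ i, |𝒳 s ω i| ≤ G ω)
    (hNb : ∃ G : Ω → ℝ, MemLp G 2 P ∧ ∀ᵐ ω ∂P, ∀ s ≤ T, |N s ω| ≤ G ω) :
    ∃ H : Ω → ℝ, MemLp H 2 P ∧ ∀ᵐ ω ∂P, 0 ≤ H ω ∧ ∀ r ∈ Icc (t : ℝ) T,
      |N r.toNNReal ω| ≤ H ω ∧ |v r.toNNReal ω| ≤ H ω ∧
      |v r.toNNReal ω + IA p A r 1 / p.aTilde * N r.toNNReal ω| ≤ H ω ∧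
      |coreRate p e₀ A B κ (mean P 𝒳) (fun s => N s ω) (fun s => 𝒳 s ω) r| ≤ H ω := by
  have hlt : (t : ℝ) < T := by exact_mod_cast htT
  have hg := hκ.isC1On_gain
  obtain ⟨L, hL, hLb⟩ := hκ.exists_bound
  obtain ⟨K, hK⟩ := isCompact_Icc.exists_bound_of_continuousOn hg.continuousOn
  obtain ⟨K', hK'⟩ := isCompact_Icc.exists_bound_of_continuousOn hg.cont
  obtain ⟨GX, hGX, hX⟩ := hb
  obtain ⟨GN, hGN, hN⟩ := hNb
  have h00 : (0 : ℝ) ∈ Icc (0 : ℝ) T := ⟨le_rfl, T.coe_nonneg⟩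
  have hK0 : 0 ≤ K := (norm_nonneg _).trans (hK 0 h00)
  have hK0' : 0 ≤ K' := (norm_nonneg _).trans (hK' 0 h00)
  have hm : ∀ s ∈ Icc t T, ∀ i, |mean P 𝒳 s i| ≤ ∫ ω, GX ω ∂P := fun s hs i =>
    norm_integral_le_of_norm_le (f := fun ω => 𝒳 s ω i) (hGX.integrable one_le_two)
      (hX.mono fun ω hω => hω s hs i)
  set e := ∫ ω, GX ω ∂P with he
  have hfb' : ∀ (y : Fin 3 → ℝ) (G : ℝ), (∀ i, |y i| ≤ G) →
      |fundamental p y| ≤ (1 + |p.γ₂|) * G := fun y G hy => by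
    have h1 := abs_add_le (y 1) (p.γ₂ * y 0)
    rw [abs_mul] at h1
    have h2 := mul_le_mul_of_nonneg_left (hy 0) (abs_nonneg p.γ₂)
    unfold fundamental
    linarith [hy 1]
  refine ⟨fun ω => (1 + L * (3 + |p.γ₂|)) * GX ω + (1 + K + K') * GN ω
    + L * (1 + (3 + |p.γ₂|) * e), ((hGX.const_mul _).add (hGN.const_mul _)).add (memLp_const _), ?_⟩
  filter_upwards [hfb, hX, hN] with ω h h1 h2
  have hGX0 : 0 ≤ GX ω := (abs_nonneg _).trans (h1 t ⟨le_rfl, htT.le⟩ 0)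
  have hGN0 : 0 ≤ GN ω := (abs_nonneg _).trans (h2 0 zero_le)
  have he0 : 0 ≤ e := (abs_nonneg _).trans (hm t ⟨le_rfl, htT.le⟩ 0)
  have hsub : Icc (t : ℝ) T ⊆ Icc 0 T := Set.Icc_subset_Icc_left t.coe_nonneg
  have hnc : ContinuousOn (fun r : ℝ => N r.toNNReal ω) (Icc (0 : ℝ) T) :=
    continuousOn_comp_toNNReal h.cont
  have hNr : ∀ r ∈ Icc (t : ℝ) T, |N r.toNNReal ω| ≤ GN ω := fun r hr =>
    h2 _ (Real.toNNReal_le_iff_le_coe.2 hr.2)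
  have hXc := abs_le_of_forall_Ico hlt (h.core.continuousOn.add
    ((hg.continuousOn.mono hsub).mul (hnc.mono hsub))) (K := GX ω) fun r hr => by
      have h3 := h.eq _ (toNNReal_mem_Ico hr)
      rw [Real.coe_toNNReal _ (t.coe_nonneg.trans hr.1)] at h3
      change |v r.toNNReal ω + IA p A r 1 / p.aTilde * N r.toNNReal ω| ≤ GX ω
      rw [← h3]
      exact h1 _ (toNNReal_mem_Icc ⟨hr.1, hr.2.le⟩) 0
  have p1 : 0 ≤ L * (3 + |p.γ₂|) * GX ω := by positivity
  have p2 : 0 ≤ K * GN ω := by positivity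
  have p3 : 0 ≤ K' * GN ω := by positivity
  have p4 : 0 ≤ L * (1 + (3 + |p.γ₂|) * e) := by positivity
  refine ⟨by linarith, fun r hr => ?_⟩
  have hr' := toNNReal_mem_Icc hr
  have hgN : |IA p A r 1 / p.aTilde * N r.toNNReal ω| ≤ K * GN ω := by
    rw [abs_mul]
    exact mul_le_mul (hK r (hsub hr)) (hNr r hr) (abs_nonneg _) hK0
  have hgN' : |κ 0 r / p.aTilde * N r.toNNReal ω| ≤ K' * GN ω := by
    rw [abs_mul]
    exact mul_le_mul (hK' r (hsub hr)) (hNr r hr) (abs_nonneg _) hK0'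
  have q1 := hNr r hr
  have q2 : |v r.toNNReal ω + IA p A r 1 / p.aTilde * N r.toNNReal ω| ≤ GX ω := hXc r hr
  have q3 := abs_sub (v r.toNNReal ω + IA p A r 1 / p.aTilde * N r.toNNReal ω)
    (IA p A r 1 / p.aTilde * N r.toNNReal ω)
  rw [add_sub_cancel_right] at q3
  refine ⟨by linarith, by linarith, by linarith, ?_⟩
  rw [coreRate, abs_neg]
  refine (abs_add_le _ _).trans ?_
  have q4 := hLb r (hsub hr) (𝒳 r.toNNReal ω) (mean P 𝒳 r.toNNReal)
  have q5 : L * (|𝒳 r.toNNReal ω 0| + |fundamental p (𝒳 r.toNNReal ω)| + |𝒳 r.toNNReal ω 2|)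
      ≤ L * ((3 + |p.γ₂|) * GX ω) := by
    refine mul_le_mul_of_nonneg_left ?_ hL
    linarith [h1 _ hr' 0, h1 _ hr' 2, hfb' _ _ (h1 _ hr')]
  have q6 : L * (1 + |mean P 𝒳 r.toNNReal 0| + |fundamental p (mean P 𝒳 r.toNNReal)|
      + |mean P 𝒳 r.toNNReal 2|) ≤ L * (1 + (3 + |p.γ₂|) * e) := by
    refine mul_le_mul_of_nonneg_left ?_ hL
    linarith [hm _ hr' 0, hm _ hr' 2, hfb' _ _ (hm _ hr')]
  linarith

lemma exists_integral_position (hW : IsBrownianBasis P 𝓕 W) (htT : t < T)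
    (hκ : FeedbackRates p e₀ A B D T κ) (hN : IsItoPair P 𝓕 W T (σ, N)) {N' : ℝ≥0 → Ω → ℝ}
    (hx : IsItoPair P 𝓕 W T (gainIntegrand p A σ, N'))
    (hXa : ∀ s ∈ Icc t T, StronglyMeasurable[𝓕 s] (fun ω => 𝒳 s ω 0))
    (hfb : HasFeedbackPaths P p e₀ A B κ t T N v 𝒳)
    (hH : ∃ H : Ω → ℝ, MemLp H 2 P ∧ ∀ᵐ ω ∂P, 0 ≤ H ω ∧ ∀ r ∈ Icc (t : ℝ) T,
      |N r.toNNReal ω| ≤ H ω ∧ |v r.toNNReal ω| ≤ H ω ∧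
      |v r.toNNReal ω + IA p A r 1 / p.aTilde * N r.toNNReal ω| ≤ H ω ∧
      |coreRate p e₀ A B κ (mean P 𝒳) (fun s => N s ω) (fun s => 𝒳 s ω) r| ≤ H ω) :
    ∃ M : Ω → ℝ, Integrable M P ∧ ∀ π : ℕ → TimePartition t T, MeshTendsto π →
      TendstoAESubseq P (fun k ω => ∑ i ∈ range (π k).n,
        𝒳 ((π k).pt i) ω 0 * (N ((π k).pt (i + 1)) ω - N ((π k).pt i) ω)) M := by
  have hle : (t : ℝ) ≤ T := by exact_mod_cast htT.le
  have hsub : Icc (t : ℝ) T ⊆ Icc 0 T := Set.Icc_subset_Icc_left t.coe_nonneg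
  have hg := hκ.isC1On_gain
  have hgp := (hg.isPrimitiveOn T.coe_nonneg).mono (c := t) (d := T) ⟨t.coe_nonneg, hle⟩
    ⟨T.coe_nonneg, le_rfl⟩
  set g : ℝ → ℝ := fun s => IA p A s 1 / p.aTilde with hgd
  set S : Ω → ℝ := cellInt (gainIntegrand p A σ) σ t T with hS
  set a : Ω → ℝ := fun ω => v T ω * N T ω - v t ω * N t ω - ∫ r in (t : ℝ)..T,
    N r.toNNReal ω * coreRate p e₀ A B κ (mean P 𝒳) (fun s => N s ω) (fun s => 𝒳 s ω) r with ha
  set b : Ω → ℝ := fun ω => g T * N T ω ^ 2 - g t * N t ω ^ 2 - ∫ r in (t : ℝ)..T,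
    N r.toNNReal ω ^ 2 * (κ 0 r / p.aTilde) with hb
  have key : ∀ π : ℕ → TimePartition t T, MeshTendsto π →
      TendstoAESubseq P (fun k ω => ∑ i ∈ range (π k).n,
        𝒳 ((π k).pt i) ω 0 * (N ((π k).pt (i + 1)) ω - N ((π k).pt i) ω))
        fun ω => a ω + 1 / 2 * (b ω - S ω) := by
    intro π hπ
    have h1 := (hN.tendstoAESubseq_sum hW hN le_rfl hπ (hg.continuousOn.mono hsub)).mul_left
      fun _ => -(1 / 2)
    refine ((TendstoAESubseq.of_ae (f := fun k ω => (∑ i ∈ range (π k).n,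
      v ((π k).pt i) ω * (N ((π k).pt (i + 1)) ω - N ((π k).pt i) ω))
      + 1 / 2 * ∑ i ∈ range (π k).n, g ((π k).pt i)
        * (N ((π k).pt (i + 1)) ω ^ 2 - N ((π k).pt i) ω ^ 2))
      (F := fun ω => a ω + 1 / 2 * b ω) ?_).add h1).congr ?_ (ae_of_all _ fun ω => ?_)
    · filter_upwards [hfb] with ω h
      have hnc := (continuousOn_comp_toNNReal h.cont).mono hsub
      have e1 := tendsto_sum_primitive_mul_sub hπ h.core hnc
      have e2 := tendsto_sum_primitive_mul_sub hπ hgp (hnc.pow 2)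
      simp only [Real.toNNReal_coe, Pi.pow_apply] at e1 e2
      exact e1.add (e2.const_mul (1 / 2))
    · filter_upwards [hfb] with ω h k
      rw [mul_sum, mul_sum, ← sum_add_distrib, ← sum_add_distrib]
      refine sum_congr rfl fun i hi => ?_
      have hi' := Finset.mem_range.1 hi
      rcases ((π k).pt_le hi'.le).eq_or_lt with h0 | h0
      · have h2 : (π k).pt (i + 1) = (π k).pt i :=
          le_antisymm (((π k).pt_le hi').trans h0.ge) ((π k).mono (Nat.le_succ i))
        rw [h2]
        ring
      · rw [h.eq _ ⟨(π k).le_pt i, h0⟩]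
        ring
    · have : S ω = ∫ r in (t : ℝ)..T, g r * (σ r.toNNReal ω * σ r.toNNReal ω) := by
        refine intervalIntegral.integral_congr_ae (ae_of_all _ fun r hr => ?_)
        rw [Set.uIoc_of_le hle] at hr
        simp only [gainIntegrand, Real.coe_toNNReal _ (t.coe_nonneg.trans hr.1.le), hgd]
        ring
      rw [this]
      ring
  refine ⟨_, ?_, key⟩
  have hSi : Integrable S P := hx.integrable_cellInt hN htT.le le_rfl
  have hM := (key _ (meshTendsto_uniform htT.le)).aestronglyMeasurable fun k => by
    refine (Finset.stronglyMeasurable_fun_sum _ fun i hi => ?_).aestronglyMeasurable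
    have hi' := Finset.mem_range.1 hi
    set π := TimePartition.uniform t T htT.le k
    exact ((hXa _ ⟨π.le_pt i, π.pt_le hi'.le⟩).mono (𝓕.le _)).mul
      (((hN.adapted _ (π.pt_le hi')).mono (𝓕.le _)).sub
        ((hN.adapted _ (π.pt_le hi'.le)).mono (𝓕.le _)))
  obtain ⟨H, hH2, hHb⟩ := hH
  obtain ⟨K, hK⟩ := isCompact_Icc.exists_bound_of_continuousOn hg.continuousOn
  obtain ⟨K', hK'⟩ := isCompact_Icc.exists_bound_of_continuousOn hg.cont
  have hab : Integrable (fun ω => a ω + 1 / 2 * b ω) P := by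
    refine Integrable.mono' (hH2.integrable_sq.const_mul (2 + (T - t) + (K + K' * (T - t) / 2)))
      ((hM.add (hSi.aestronglyMeasurable.const_mul (1 / 2))).congr (ae_of_all _ fun ω => ?_)) ?_
    · simp only [Pi.add_apply]
      ring
    filter_upwards [hHb] with ω ⟨h0, h⟩
    have hTt : |(T : ℝ) - t| = T - t := abs_of_nonneg (sub_nonneg.2 hle)
    have ht := h t ⟨le_rfl, hle⟩
    have hT := h T ⟨hle, le_rfl⟩
    rw [Real.toNNReal_coe] at ht hT
    have hsq : ∀ r ∈ Icc (t : ℝ) T, |N r.toNNReal ω ^ 2| ≤ H ω ^ 2 := fun r hr => by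
      rw [abs_pow]
      exact pow_le_pow_left₀ (abs_nonneg _) (h r hr).1 2
    have mul2 : ∀ {x y : ℝ}, |x| ≤ H ω → |y| ≤ H ω → |x * y| ≤ H ω ^ 2 := fun hx hy => by
      rw [abs_mul, sq]
      exact mul_le_mul hx hy (abs_nonneg _) h0
    have i1 := intervalIntegral.norm_integral_le_of_norm_le_const (a := (t : ℝ)) (b := T)
      (C := H ω ^ 2) (f := fun r => N r.toNNReal ω * coreRate p e₀ A B κ (mean P 𝒳)
        (fun s => N s ω) (fun s => 𝒳 s ω) r) fun r hr => by
        rw [Set.uIoc_of_le hle] at hr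
        have := h r ⟨hr.1.le, hr.2⟩
        exact mul2 this.1 this.2.2.2
    have mulg : ∀ {x y C : ℝ}, |y| ≤ C → |x| ≤ H ω ^ 2 → |y * x| ≤ C * H ω ^ 2 := fun hy hx => by
      rw [abs_mul]
      exact mul_le_mul hy hx (abs_nonneg _) ((abs_nonneg _).trans hy)
    have i2 := intervalIntegral.norm_integral_le_of_norm_le_const (a := (t : ℝ)) (b := T)
      (C := K' * H ω ^ 2) (f := fun r => N r.toNNReal ω ^ 2 * (κ 0 r / p.aTilde)) fun r hr => by
        rw [Set.uIoc_of_le hle] at hr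
        rw [mul_comm]
        exact mulg (hK' r (hsub ⟨hr.1.le, hr.2⟩)) (hsq r ⟨hr.1.le, hr.2⟩)
    rw [hTt] at i1 i2
    have j1 := mul2 hT.2.1 hT.1
    have j2 := mul2 ht.2.1 ht.1
    have j3 := mulg (hK T ⟨T.coe_nonneg, le_rfl⟩) (Real.toNNReal_coe (r := T) ▸ hsq T ⟨hle, le_rfl⟩)
    have j4 := mulg (hK t ⟨t.coe_nonneg, hle⟩) (Real.toNNReal_coe (r := t) ▸ hsq t ⟨le_rfl, hle⟩)
    simp only [ha, hb, Real.norm_eq_abs, abs_le] at *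
    constructor <;> linarith [i1.1, i1.2, i2.1, i2.2, j1.1, j1.2, j2.1, j2.2, j3.1, j3.2, j4.1, j4.2]
  refine (hab.sub (hSi.const_mul (1 / 2))).congr (ae_of_all _ fun ω => ?_)
  simp only [Pi.sub_apply]
  ring

lemma boundedVariationOn_of_abs_sub_le {f φ : ℝ≥0 → ℝ} {T : ℝ≥0}
    (h : ∀ s u, s ≤ u → u ≤ T → |f u - f s| ≤ φ u - φ s) :
    BoundedVariationOn f (Icc 0 T) := by
  have hm : MonotoneOn φ (Icc 0 T) := fun s _ u hu hsu =>
    sub_nonneg.1 ((abs_nonneg _).trans (h s u hsu hu.2))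
  have h1 := (hm.eVariationOn_eq (a := 0) (b := T) ⟨le_rfl, zero_le⟩ ⟨zero_le, le_rfl⟩).le
  rw [Set.inter_self] at h1
  refine ne_top_of_le_ne_top ENNReal.ofReal_ne_top (le_trans (iSup_le fun q => ?_) h1)
  refine le_trans (sum_le_sum fun i _ => ?_) (eVariationOn.sum_le (n := q.1) q.2.2.1 q.2.2.2)
  rw [edist_dist, edist_dist, Real.dist_eq, Real.dist_eq]
  exact ENNReal.ofReal_le_ofReal ((h _ _ (q.2.2.1 (Nat.le_succ i)) (q.2.2.2 _).2).trans
    (le_abs_self _))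

lemma IsCadlagOn.sub_continuous {f m : ℝ≥0 → ℝ} (hf : IsCadlagOn f t T)
    (hm : Continuous m) : IsCadlagOn (fun s => f s - m s) t T := by
  refine ⟨fun s hs => (hf.1 s hs).sub hm.continuousWithinAt, fun s hs => ?_⟩
  obtain ⟨l, hl⟩ := hf.2 s hs
  exact ⟨l - m s, hl.sub (hm.tendsto s |>.mono_left nhdsWithin_le_nhds)⟩

lemma IsCadlagOn.of_eq_zero {f : ℝ≥0 → ℝ} (hf : IsCadlagOn f t T)
    (h : ∀ s < t, f s = 0) : IsCadlagOn f 0 T := by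
  refine ⟨fun s hs => ?_, fun s hs => ?_⟩
  · rcases lt_or_ge s t with hst | hst
    · refine ContinuousAt.continuousWithinAt ((continuousAt_const (y := (0 : ℝ))).congr ?_)
      filter_upwards [Iio_mem_nhds hst] with u hu using (h u hu).symm
    · exact hf.1 s ⟨hst, hs.2⟩
  · rcases le_or_gt s t with hst | hst
    · refine ⟨0, tendsto_const_nhds.congr' ?_⟩
      filter_upwards [self_mem_nhdsWithin] with u hu using (h u (lt_of_lt_of_le hu hst)).symm
    · exact hf.2 s ⟨hst, hs.2⟩

lemma IsItoPair.martingale_min (hW : IsBrownianBasis P 𝓕 W) (hx : IsItoPair P 𝓕 W T x)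
    {c : ℝ≥0} (hc : c ≤ T) : Martingale (fun s ω => x.2 (min s c) ω) 𝓕 P := by
  have hT : ∀ s : ℝ≥0, min s c ≤ T := fun s => (min_le_right _ _).trans hc
  have hi : ∀ s : ℝ≥0, Integrable (x.2 (min s c)) P := fun s =>
    (hx.memLp_eval hW (hT s)).integrable one_le_two
  have ha : ∀ s : ℝ≥0, StronglyMeasurable[𝓕 s] (x.2 (min s c)) := fun s =>
    (hx.adapted _ (hT s)).mono (𝓕.mono (min_le_left _ _))
  refine ⟨ha, fun s u hsu => (ae_eq_condExp_of_forall_setIntegral_eq (𝓕.le s) (hi u)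
    (fun F _ _ => (hi s).integrableOn) (fun F hF _ => ?_) (ha s).aestronglyMeasurable).symm⟩
  rcases le_total s c with h | h
  · rw [min_eq_left h]
    have h0 := hx.zeroMean hW (le_min hsu h) (hT u) F hF
    have hs := hi s
    rw [min_eq_left h] at hs
    rw [integral_sub (hi u).integrableOn hs.integrableOn] at h0
    linarith
  · rw [min_eq_right h, min_eq_right (h.trans hsu)]

lemma IsJumpDiffusion.isSemimartingaleOn (hW : IsBrownianBasis P 𝓕 W) (htT : t < T)
    (h : IsJumpDiffusion P 𝓕 W t T X x w J) (hZ0 : ∀ s < t, ∀ ω, Z s ω = 0)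
    (hZ : ∀ s ≤ T, StronglyMeasurable[𝓕 s] (Z s)) (hZc : ∀ ω, IsCadlagOn (fun s => Z s ω) t T)
    (hpos : ∀ᵐ ω ∂P, ∀ s ∈ Icc t T, X s ω = ξ ω 0 - Z s ω) :
    IsSemimartingaleOn P 𝓕 T Z := by
  have hle : (t : ℝ) ≤ T := by exact_mod_cast htT.le
  have hM := (h.ito.martingale_min hW htT.le).sub (h.ito.martingale_min hW le_rfl)
  set M : ℝ≥0 → Ω → ℝ := (fun s ω => x.2 (min s t) ω) - fun s ω => x.2 (min s T) ω with hMd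
  have hMc : ∀ᵐ ω ∂P, Continuous fun s => M s ω := by
    filter_upwards [h.cont] with ω hω
    have : ∀ c ≤ T, Continuous fun s : ℝ≥0 => x.2 (min s c) ω := fun c hc =>
      hω.comp_continuous (continuous_id.min continuous_const) fun s =>
        ⟨zero_le, (min_le_right _ _).trans hc⟩
    exact (this t htT.le).sub (this T le_rfl)
  refine ⟨M, fun s ω => Z s ω - M s ω, Locally.of_prop hM, ?_,
    fun s hs => (hZ s hs).sub (hM.1 s), ?_, ?_, ae_of_all _ fun ω s _ => by ring⟩
  · filter_upwards [hMc] with ω hω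
    exact ⟨fun s _ => hω.continuousWithinAt,
      fun s _ => ⟨_, (hω.tendsto s).mono_left nhdsWithin_le_nhds⟩⟩
  · filter_upwards [hMc] with ω hω
    exact ((hZc ω).of_eq_zero fun s hs => hZ0 s hs ω).sub_continuous hω
  filter_upwards [h.path, h.eq, hpos] with ω ⟨w', hw⟩ h1 h2
  set c := ξ ω 0 - w t ω - x.2 t ω with hc
  set e : ℝ≥0 → ℝ := fun s => if t ≤ s then 1 else 0 with he
  have hem : ∀ s u, s ≤ u → e s ≤ e u := fun s u hsu => by
    simp only [he]
    split_ifs with h3 h4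
    · exact le_rfl
    · exact absurd (h3.trans hsu) h4
    · exact zero_le_one
    · exact le_rfl
  have hV : ∀ s ≤ T, Z s ω - M s ω
      = c * e s - (w (max s t) ω - w t ω) + J ω * atTime T s := fun s hs => by
    simp only [hMd, he, Pi.sub_apply]
    rcases lt_or_ge s t with hst | hst
    · rw [hZ0 s hst, min_eq_left hst.le, min_eq_left hs, if_neg hst.not_ge, max_eq_right hst.le,
        atTime_of_lt (hst.trans htT)]
      ring
    · have e1 := h1 s ⟨hst, hs⟩
      have e2 := h2 s ⟨hst, hs⟩
      rw [min_eq_right hst, min_eq_left hs, if_pos hst, max_eq_left hst]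
      linarith
  refine boundedVariationOn_of_abs_sub_le (φ := fun s => |c| * e s
    + (∫ r in (t : ℝ)..(max s t : ℝ≥0), |w' r|) + |J ω| * atTime T s) fun s u hsu hu => ?_
  have hmem : ∀ s ≤ T, ((max s t : ℝ≥0) : ℝ) ∈ Icc (t : ℝ) T := fun s hs =>
    ⟨by exact_mod_cast le_max_right s t, by exact_mod_cast max_le hs htT.le⟩
  have ht : (t : ℝ) ∈ Icc (t : ℝ) T := ⟨le_rfl, hle⟩
  have hms := hmem s (hsu.trans hu)
  have hmu := hmem u hu
  have hw1 : |w (max u t) ω - w (max s t) ω| ≤ (∫ r in (t : ℝ)..(max u t : ℝ≥0), |w' r|)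
      - ∫ r in (t : ℝ)..(max s t : ℝ≥0), |w' r| := by
    have := hw.sub_eq hms hmu
    simp only [Real.toNNReal_coe] at this
    rw [this, intervalIntegral.integral_interval_sub_left
      (intervalIntegrable_of_mem_Icc hw.integrable.abs ht hmu)
      (intervalIntegrable_of_mem_Icc hw.integrable.abs ht hms)]
    exact intervalIntegral.abs_integral_le_integral_abs
      (by exact_mod_cast max_le_max_right t hsu)
  have a1 : |c * (e u - e s)| = |c| * (e u - e s) := by
    rw [abs_mul, abs_of_nonneg (sub_nonneg.2 (hem s u hsu))]
  have a2 : |J ω * (atTime T u - atTime T s)| = |J ω| * (atTime T u - atTime T s) := by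
    rw [abs_mul, abs_of_nonneg (sub_nonneg.2 (atTime_mono hsu hu))]
  have a3 := abs_add_three (c * (e u - e s)) (-(w (max u t) ω - w (max s t) ω))
    (J ω * (atTime T u - atTime T s))
  rw [abs_neg, a1, a2] at a3
  rw [hV s (hsu.trans hu), hV u hu, show c * e u - (w (max u t) ω - w t ω) + J ω * atTime T u
    - (c * e s - (w (max s t) ω - w t ω) + J ω * atTime T s) = c * (e u - e s)
    + -(w (max u t) ω - w (max s t) ω) + J ω * (atTime T u - atTime T s) by ring]
  linarith

lemma IsJumpDiffusion.isAdmissible (hW : IsBrownianBasis P 𝓕 W) (htT : t < T)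
    (h : IsJumpDiffusion P 𝓕 W t T X x w J) (hZ0 : ∀ s < t, ∀ ω, Z s ω = 0)
    (hZ : ∀ s ≤ T, StronglyMeasurable[𝓕 s] (Z s)) (hZc : ∀ ω, IsCadlagOn (fun s => Z s ω) t T)
    (hpos : ∀ᵐ ω ∂P, ∀ s ∈ Icc t T, X s ω = ξ ω 0 - Z s ω) (hξ2 : MemLp (fun ω => ξ ω 0) 2 P)
    (hb : ∃ G : Ω → ℝ, MemLp G 2 P ∧ ∀ᵐ ω ∂P, ∀ s ∈ Icc t T, |X s ω| ≤ G ω)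
    (hJ : ∃ H : Ω → ℝ, MemLp H 2 P ∧ ∀ᵐ ω ∂P, |J ω| ≤ H ω) : IsAdmissible P 𝓕 t T Z := by
  obtain ⟨G, hG, hGb⟩ := hb
  obtain ⟨H, hH, hHb⟩ := hJ
  have hG' : MemLp (fun ω => |ξ ω 0| + G ω) 2 P := hξ2.abs.add hG
  have hZb : ∀ᵐ ω ∂P, ∀ s ∈ Icc t T, |Z s ω| ≤ |ξ ω 0| + G ω := by
    filter_upwards [hpos, hGb] with ω h1 h2 s hs
    rw [show Z s ω = ξ ω 0 - X s ω by linarith [h1 s hs]]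
    exact (abs_sub _ _).trans (add_le_add le_rfl (h2 s hs))
  have hZt : MemLp (Z t) 2 P := hG'.of_le
    (((hZ t htT.le).mono (𝓕.le t)).aestronglyMeasurable) (hZb.mono fun ω hω =>
      (hω t ⟨le_rfl, htT.le⟩).trans (le_abs_self _))
  refine ⟨hZ0, hZ, hZc, h.isSemimartingaleOn hW htT hZ0 hZ hZc hpos,
    ⟨_, h.isQuadVar hW htT hZ hpos, ?_⟩, ?_⟩
  · have hC : Integrable (cellInt x.1 x.1 t T) P := h.ito.integrable_cellInt h.ito htT.le le_rfl
    have hm := ((h.isQuadVar hW htT hZ hpos).tendstoAESubseq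
      (meshTendsto_uniform htT.le)).aestronglyMeasurable fun k =>
        (stronglyMeasurable_covSum hZ hZ le_rfl _).aestronglyMeasurable
    have hJ2 : Integrable (fun ω => J ω ^ 2) P := by
      refine Integrable.mono' hH.integrable_sq ((hm.sub hC.aestronglyMeasurable).congr
        (ae_of_all _ fun ω => ?_)) (hHb.mono fun ω hω => ?_)
      · simp only [Pi.sub_apply]
        ring
      · rw [Real.norm_of_nonneg (sq_nonneg _), ← sq_abs]
        exact pow_le_pow_left₀ (abs_nonneg _) hω 2
    simp only [sub_zero]
    exact (hZt.integrable_mul_two hZt).add (hC.add hJ2)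
  · refine lt_of_le_of_lt (lintegral_mono_ae (hZb.mono fun ω hω => ?_))
      (hG'.integrable_sq.lintegral_lt_top)
    refine iSup₂_le fun s hs => ENNReal.ofReal_le_ofReal ?_
    rw [← sq_abs]
    exact pow_le_pow_left₀ (abs_nonneg _) (hω s hs) 2

/-- The cost of a strategy whose state is of the form of `IsJumpDiffusion`. -/
lemma IsJumpDiffusion.exists_isCost (hW : IsBrownianBasis P 𝓕 W) (htT : t < T)
    (hσ : IsStronglyProgressive 𝓕 σ) (hξ : ∀ i, StronglyMeasurable[𝓕 t] (fun ω => ξ ω i))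
    (hξ2 : ∀ i, MemLp (fun ω => ξ ω i) 2 P) (hst : IsState P 𝓕 W p e₀ σ t T ξ Z 𝒳)
    (hcs : IsControlledState P 𝓕 W p e₀ σ t T ξ N 𝒳)
    (hNc : ∀ᵐ ω ∂P, ContinuousOn (fun s => N s ω) (Icc 0 T))
    (hpath : HasStatePaths P p e₀ t T ξ N Z 𝒳)
    (h : IsJumpDiffusion P 𝓕 W t T (fun s ω => 𝒳 s ω 0) x w J)
    (hZ : ∀ s ≤ T, StronglyMeasurable[𝓕 s] (Z s)) (hT : ∀ᵐ ω ∂P, 𝒳 T ω 0 = 0)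
    (hM : ∃ M : Ω → ℝ, Integrable M P ∧ ∀ π : ℕ → TimePartition t T, MeshTendsto π →
      TendstoAESubseq P (fun k ω => ∑ i ∈ range (π k).n,
        𝒳 ((π k).pt i) ω 0 * (N ((π k).pt (i + 1)) ω - N ((π k).pt i) ω)) M) :
    ∃ c, IsCost P W p σ t T ξ Z 𝒳 c := by
  obtain ⟨M, hMi, hM⟩ := hM
  have hpos : ∀ᵐ ω ∂P, ∀ s ∈ Icc t T, 𝒳 s ω 0 = ξ ω 0 - Z s ω :=
    hpath.mono fun ω hω => hω.position
  have hQ := h.isQuadVar hW htT hZ hpos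
  have hR := h.isCovariationIntegral hW htT hZ hpos hσ hcs.fund.ito
  set Q : Ω → ℝ := fun ω => Z t ω * (Z t ω - 0) + (cellInt x.1 x.1 t T ω + J ω ^ 2)
  set dr : Ω → ℝ := fun ω =>
    timeIntegral t T fun s => 𝒳 s ω 0 * driftY p e₀ (𝒳 s ω) (mean P 𝒳 s)
  set K₀ : Ω → ℝ := fun ω => p.γ₂ / 2 * ξ ω 0 ^ 2 + ξ ω 0 * ξ ω 1 with hK₀
  have hK₀i : Integrable K₀ P :=
    ((hξ2 0).integrable_sq.const_mul _).add ((hξ2 0).integrable_mul_two (hξ2 1))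
  obtain ⟨hC, -⟩ := hcs.integral_pathCost htT.le
  have htot : (fun ω => K₀ ω + M ω + pathCost P p e₀ 𝒳 t T ω) =ᵐ[P] fun ω =>
      (K₀ ω + M ω + cellInt x.1 σ t T ω + dr ω - p.γ₂ / 2 * Q ω) + p.γ₂ / 2 * Q ω
        + (timeIntegral t T fun s => σ s ω * -x.1 s ω)
        + timeIntegral t T fun s => p.lam * (𝒳 s ω 0) ^ 2 := by
    filter_upwards [hcs.pathCost_eq htT.le] with ω hω
    have : (timeIntegral t T fun s => σ s ω * -x.1 s ω) = -cellInt x.1 σ t T ω := by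
      rw [cellInt, timeIntegral, ← intervalIntegral.integral_neg]
      exact intervalIntegral.integral_congr fun r _ => by ring
    rw [hω, this]
    ring
  refine ⟨_, _, Q, _, convergesAlongPartitions_of_seq (fun π => ?_) fun π hπ => ?_, hQ, hR,
    ((hK₀i.add hMi).add hC).congr htot, rfl⟩
  · have hY : ∀ s ∈ Icc t T, StronglyMeasurable (fun ω => 𝒳 s ω 1) := fun s hs =>
      (hst.adapted s hs 1).mono (𝓕.le s)
    have hZm : ∀ s ≤ T, StronglyMeasurable (Z s) := fun s hs => (hZ s hs).mono (𝓕.le s)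
    refine (((((hξ 1).mono (𝓕.le t)).mul (hZm t htT.le))).add
      (Finset.stronglyMeasurable_fun_sum _ fun i hi => ?_)).aestronglyMeasurable
    have hi' := Finset.mem_range.1 hi
    exact (hY _ ⟨π.le_pt i, π.pt_le hi'.le⟩).mul ((hZm _ (π.pt_le hi')).sub
      (hZm _ (π.pt_le hi'.le)))
  · have tX := h.tendstoAESubseq_covSum hW hcs.fund.ito hNc ⟨htT.le, le_rfl⟩ hπ
    have tD : TendstoAESubseq P (fun k ω => ∑ i ∈ range (π k).n,
        𝒳 ((π k).pt (i + 1)) ω 0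
          * ((fundamental p (𝒳 ((π k).pt (i + 1)) ω) - N ((π k).pt (i + 1)) ω)
            - (fundamental p (𝒳 ((π k).pt i) ω) - N ((π k).pt i) ω))) dr :=
      .of_ae (by filter_upwards [hpath] with ω hω using tendsto_sum_drift hst hω hπ)
    have tQ := (hQ.tendstoAESubseq hπ).mul_left fun _ => p.γ₂ / 2
    refine ((((hM π hπ).add tX).add tD).sub tQ).map ?_
    filter_upwards [hpath, hT, ae_covSum_eq_neg (U := N) le_rfl hpos] with ω h1 h2 h3 ns _ h4
    have h5 := h4.const_add (K₀ ω - p.γ₂ / 2 * Z t ω ^ 2)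
    convert h5 using 1
    · funext k
      have e1 := h1.sum_cost h2 (π (ns k))
      have e2 := h3 (π (ns k))
      have e3 : ∑ i ∈ range (π (ns k)).n,
          (N ((π (ns k)).pt (i + 1)) ω - N ((π (ns k)).pt i) ω)
            * (Z ((π (ns k)).pt (i + 1)) ω - Z ((π (ns k)).pt i) ω)
          = -covSum (fun s ω => 𝒳 s ω 0) N (π (ns k)) ω := by
        rw [← e2, covSum]
        exact sum_congr rfl fun i _ => mul_comm _ _
      rw [e3] at e1
      rw [covSum] at e1 ⊢
      simp only [covSum, hK₀]
      linear_combination e1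
    · congr 1
      simp only [cellInt]
      ring

end Liquidation

theorem theorem4p2 {Ω : Type*} {mΩ : MeasurableSpace Ω} (P : Measure Ω) [IsProbabilityMeasure P]
    (𝓕 : Filtration ℝ≥0 mΩ) (W : ℝ≥0 → Ω → ℝ) (hW : IsBrownianBasis P 𝓕 W)
    (p : Params) (hp : p.Standing)
    (t T : ℝ≥0) (htT : t < T)
    (x₀ : Ω → ℝ) (hx₀ : MemLp x₀ 2 P)
    (σ : ℝ≥0 → Ω → ℝ) (hσ : IsStronglyProgressive 𝓕 σ)
    (hσ2 : MemLp (onProd σ) 2 (prodMeasure P T))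
    (A B : ℝ → Matrix (Fin 3) (Fin 3) ℝ) (D : ℝ → Fin 3 → ℝ)
    (hA : SolvesA p T A) (hB : SolvesB p T B) (hD : SolvesD p (∫ ω, x₀ ω ∂P) T B D)
    (ξ : Ω → Fin 3 → ℝ) (hξ : ∀ i, StronglyMeasurable[𝓕 t] (fun ω => ξ ω i))
    (hξ2 : ∀ i, MemLp (fun ω => ξ ω i) 2 P)
    (Z : ℝ≥0 → Ω → ℝ) (𝒳 : ℝ≥0 → Ω → Fin 3 → ℝ)
    (hZ : IsCandidate P 𝓕 W p (∫ ω, x₀ ω ∂P) σ A B D t T ξ Z 𝒳) :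
    (∀ᵐ ω ∂P, ∀ s ∈ Set.Ico t T, IA p A s ⬝ᵥ (𝒳 s ω - mean P 𝒳 s) = 0) ∧
    (∀ s ∈ Set.Ico t T, IB p B s ⬝ᵥ mean P 𝒳 s + ID p (∫ ω, x₀ ω ∂P) D s = 0) ∧
    (∀ᵐ ω ∂P, timeIntegral t T (fun s => (IA p A s ⬝ᵥ (𝒳 s ω - mean P 𝒳 s)) ^ 2) = 0) ∧
    timeIntegral t T (fun s => (IB p B s ⬝ᵥ mean P 𝒳 s + ID p (∫ ω, x₀ ω ∂P) D s) ^ 2) = 0 ∧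
    IsAdmissible P 𝓕 t T Z ∧
    (∀ᵐ ω ∂P, 𝒳 T ω 0 = 0) ∧
    ∃ c : ℝ, IsCost P W p σ t T ξ Z 𝒳 c ∧
      IsLeast (attainableCosts P 𝓕 W p (∫ ω, x₀ ω ∂P) σ t T ξ) c := by
  have hle := htT.le
  obtain ⟨κ, hκ⟩ := exists_feedbackRates hA hB hD
  obtain ⟨N, hN, hpath⟩ := hZ.state.exists_isStatePath hW hle
  obtain ⟨v, hfb⟩ := hZ.exists_isFeedbackPath hp hW htT hσ2 hκ hN hpath
  have hb := hZ.exists_state_bound hp hW htT hσ2 hξ2 hκ hN hpath hfb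
  have hcs := isControlledState_of_bound hW hle hσ2 hN hZ.state hpath hb
  obtain ⟨hIA, hIB⟩ := hcs.feedback hp hW htT hκ hfb (hZ.initial_position hp htT hξ2 hpath)
  have hT : ∀ᵐ ω ∂P, 𝒳 T ω 0 = 0 := hfb.mono fun ω h => h.terminal
  obtain ⟨N', w, hjd⟩ := hZ.exists_isJumpDiffusion hW htT hσ2 hκ hN hfb
  obtain ⟨H, hHm, hH⟩ :=
    exists_core_bound htT hκ hfb hb ((hN.isItoPair hσ2).exists_memLp_bound hW hN.cont)
  have hadm : IsAdmissible P 𝓕 t T Z :=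
    hjd.isAdmissible hW htT hZ.start hZ.adapted hZ.cadlag (hpath.mono fun ω h => h.position)
      (hξ2 0) (hb.imp fun G hG => ⟨hG.1, hG.2.mono fun ω h s hs => h s hs 0⟩)
      ⟨H, hHm, hH.mono fun ω h => by
        simpa only [Real.toNNReal_coe] using (h.2 T ⟨by exact_mod_cast hle, le_rfl⟩).2.2.1⟩
  have hM := exists_integral_position hW htT hκ (hN.isItoPair hσ2) hjd.ito
    (fun s hs => hZ.state.adapted s hs 0) hfb ⟨H, hHm, hH⟩
  obtain ⟨c, hc⟩ :=
    hjd.exists_isCost hW htT hσ hξ hξ2 hZ.state hcs hN.cont hpath hZ.adapted hT hM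
  refine ⟨hIA, hIB, hIA.mono fun ω h => timeIntegral_eq_zero hle fun s hs => by simp [h s hs],
    timeIntegral_eq_zero hle fun s hs => by simp [hIB s hs], hadm, hT, c, hc,
    ⟨Z, 𝒳, hadm, hZ.state, hT, hc⟩, ?_⟩
  rintro c' ⟨Z', 𝒳', hadm', hst', hT', hc'⟩
  obtain ⟨M, hMi, hpath'⟩ := hst'.exists_isStatePath hW hle
  have hcs' := isControlledState_of_bound hW hle hσ2 hMi hst' hpath'
    (hadm'.exists_state_bound hp hW hle hσ2 hξ2 hst')
  have h0 : ∀ s ∈ Set.Ico t T, IsControlledState.deviation P p (∫ ω, x₀ ω ∂P) A B D 𝒳 s = 0 := by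
    intro s hs
    have h1 : ∫ ω, (IA p A s ⬝ᵥ (𝒳 s ω - mean P 𝒳 s)) ^ 2 ∂P = 0 :=
      integral_eq_zero_of_ae (hIA.mono fun ω h => by simp [h s hs])
    rw [IsControlledState.deviation, h1, hIB s hs]
    ring
  rw [hcs.cost_eq hW hle hσ hξ2 hZ.state hpath hZ.adapted hZ.cadlag hT hc,
    hcs'.cost_eq hW hle hσ hξ2 hst' hpath' hadm'.adapted hadm'.cadlag hT' hc',
    hcs.eq_valueAt hp hW hle hA hB hD h0]
  exact add_le_add_right (hcs'.valueAt_le hp hW hle hA hB hD) _
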